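/- All manifolds, Lie groups, Lie algebras and maps are complex analytic, finite dimensional, Hausdorff and second countable; structure groups of principal bundles act on the right. A \emph{complex Lie subgroup} of $G$ is a complex Lie group with an injective holomorphic immersive group morphism to $G$; it need not be closed. Let $H$ be a complex Lie subgroup of a complex Lie group $G$, with Lie algebras $\mathfrak h\subset\mathfrak g$. A \emph{Cartan geometry modelled on $(G,H)$} on a complex manifold $M$ is a holomorphic principal $H$-bundle $\pi:E\to M$ with a holomorphic $1$-form $\omega\in\Omega^1(E)\otimes\mathfrak g$ such that (1) $r_h^*\omega=\mathrm{Ad}_h^{-1}\omega$ for all $h\in H$; (2) $\omega_e:T_eE\to\mathfrak g$ is a linear isomorphism for all $e\in E$; (3) for $A\in\mathfrak h$ the vector field $\vec A$ on $E$ with $\omega(\vec A)=A$ generates the action of $t\mapsto \exp(tA)$ on $E$. It is a \emph{$G/H$-geometry} if moreover $H\subset G$ is closed. It is \emph{flat} if $d\omega+\frac12[\omega,\omega]=0$. If $H\subset H'$ are complex Lie subgroups of $G$ (with $H$ closed in $G$) and $E'\to M'$ is a Cartan geometry modelled on $(G,H')$, its \emph{lift} is the $G/H$-geometry $E'\to E'/H$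 with the same Cartan connection. An isomorphism of such geometries is an $H$-equivariant biholomorphism of total spaces matching the Cartan connections. A \emph{rational curve} in $M$ is a nonconstant holomorphic map $\mathbb P^1\to M$. \textbf{Theorem.} Let $H\subset G$ be a closed complex Lie subgroup of a complex Lie group, $M$ a connected complex manifold and $E\to M$ a $G/H$-geometry with connected total space $E$. Suppose that $M$ contains a rational curve. Then there is a complex Lie subalgebra $\mathfrak h'\subset\mathfrak g$ with $\mathfrak h\subsetneq\mathfrak h'$ such that there is a complex Lie subgroup $H'\subset G$ (not necessarily closed) containing $H$ with Lie algebra $\mathfrak h'$, and for every such $H'$: \begin{enumerate} \item $M$ is covered by open sets $U$ for each of which there is a holomorphic Cartan geometry $E'\to M'$ modelled on $(G,H')$ (hence on $(G,\mathfrak h')$) on a connected complex manifold $M'$, so that the restriction of $E\to M$ to $U$ is isomorphic to the restriction to some open subset of $E'/H$ of the lift $E'\to E'/H$; \item there is a holomorphic foliation of $M$ by connected, injectively immersed complex submanifolds of positive dimension $k$, such that on every leaf $L$ the $G/H$-geometry restricts to a flat Cartan geometry modelled on $(H',H)$: the form $\omega$ pulls back to the pullback bundle $E|_L\to L$ as an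 $\mathfrak h'$-valued form, which is the Cartan connection of a flat Cartan geometry on $L$ modelled on $(H',H)$. \end{enumerate} -/

import Mathlib

open scoped Manifold ContDiff

universe u

noncomputable section

/-! ## Complex manifolds and complex Lie groups -/

/-- The model space `ℂⁿ`. -/
abbrev Cn (n : ℕ) : Type := EuclideanSpace ℂ (Fin n)

/-- The model with corners of (boundaryless) complex `n`-manifolds. -/
abbrev cI (n : ℕ) : ModelWithCorners ℂ (Cn n) (Cn n) := modelWithCornersSelf ℂ (Cn n)

/-- A complex manifold of dimension `n`: holomorphic (complex analytic) transition maps, Hausdorff,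
second countable.  (Over `ℂ`, the regularity `ω` means holomorphic.) -/
class ComplexManifold (n : ℕ) (M : Type u) [TopologicalSpace M] [ChartedSpace (Cn n) M] : Prop
    extends IsManifold (cI n) ω M, T2Space M, SecondCountableTopology M

/-- A complex Lie group of dimension `d`. -/
class ComplexLieGroup (d : ℕ) (G : Type u) [Group G] [TopologicalSpace G] [ChartedSpace (Cn d) G] :
    Prop extends LieGroup (cI d) ω G, T2Space G, SecondCountableTopology G

instance ComplexLieGroup.complexManifold {d : ℕ} {G : Type u} [Group G] [TopologicalSpace G]
    [ChartedSpace (Cn d) G] [ComplexLieGroup d G] : ComplexManifold d G where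

/-- Regularity bookkeeping: it makes Mathlib's Lie algebra structure on `T₁G` available. -/
instance ComplexLieGroup.lieGroup_minSmoothness {d : ℕ} {G : Type u} [Group G] [TopologicalSpace G]
    [ChartedSpace (Cn d) G] [ComplexLieGroup d G] : LieGroup (cI d) (minSmoothness ℂ 3) G :=
  LieGroup.of_le (n := ω) le_top

/-- The Lie algebra of a complex Lie group: the tangent space at `1`, with the bracket of
left-invariant vector fields. -/
abbrev LieAlg (d : ℕ) (G : Type u) [Group G] [TopologicalSpace G] [ChartedSpace (Cn d) G] : Type :=
  GroupLieAlgebra (cI d) G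

/-- The identity map, from the Lie algebra `T₁G` to its underlying normed space `ℂᵈ`: it serves to
speak of holomorphic functions with values in the Lie algebra. -/
def LieAlg.coord {d : ℕ} {G : Type u} [Group G] [TopologicalSpace G] [ChartedSpace (Cn d) G]
    (A : LieAlg d G) : Cn d := A

/-- The adjoint representation `Ad g : 𝔤 → 𝔤`, the derivative at `1` of `x ↦ g x g⁻¹`. -/
def Ad (d : ℕ) {G : Type u} [Group G] [TopologicalSpace G] [ChartedSpace (Cn d) G] (g : G) :
    LieAlg d G →L[ℂ] LieAlg d G :=
  (mfderiv (cI d) (cI d) (fun x : G => g * x * g⁻¹) 1 : Cn d →L[ℂ] Cn d)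

/-- The derivative at `1` of a group morphism, as a map of Lie algebras. -/
def lieMap (d e : ℕ) {G H : Type u} [Group G] [TopologicalSpace G] [ChartedSpace (Cn d) G]
    [Group H] [TopologicalSpace H] [ChartedSpace (Cn e) H] (f : H →* G) :
    LieAlg e H →L[ℂ] LieAlg d G :=
  (mfderiv (cI e) (cI d) f 1 : Cn e →L[ℂ] Cn d)

/-- A complex Lie subgroup of `G`, not necessarily closed: a complex Lie group with an injective
holomorphic immersive group morphism to `G`. -/
structure ComplexLieSubgroup (d : ℕ) (G : Type u) [Group G] [TopologicalSpace G]
    [ChartedSpace (Cn d) G] where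
  dim : ℕ
  carrier : Type u
  [group : Group carrier]
  [topologicalSpace : TopologicalSpace carrier]
  [chartedSpace : ChartedSpace (Cn dim) carrier]
  [complexLieGroup : ComplexLieGroup dim carrier]
  incl : carrier →* G
  injective : Function.Injective incl
  holomorphic : ContMDiff (cI dim) (cI d) ω incl
  immersion : Function.Injective (lieMap d dim incl)

attribute [instance] ComplexLieSubgroup.group ComplexLieSubgroup.topologicalSpace
  ComplexLieSubgroup.chartedSpace ComplexLieSubgroup.complexLieGroup

/-- The Lie algebra of a complex Lie subgroup, as a subspace of the Lie algebra of `G`. -/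
def ComplexLieSubgroup.lieAlgebra {d : ℕ} {G : Type u} [Group G] [TopologicalSpace G]
    [ChartedSpace (Cn d) G] (H : ComplexLieSubgroup d G) : Submodule ℂ (LieAlg d G) :=
  LinearMap.range (lieMap d H.dim H.incl).toLinearMap

/-- A complex Lie subgroup `H' ⊆ G` (not necessarily closed) with Lie algebra `𝔥'`, which
contains the complex Lie subgroup `H`. -/
structure LieOvergroup {d : ℕ} {G : Type u} [Group G] [TopologicalSpace G]
    [ChartedSpace (Cn d) G] [ComplexLieGroup d G] (H : ComplexLieSubgroup d G)
    (𝔥' : LieSubalgebra ℂ (LieAlg d G)) extends ComplexLieSubgroup d G where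
  /-- the inclusion of `H` into `H'` -/
  sub : H.carrier →* carrier
  sub_holomorphic : ContMDiff (cI H.dim) (cI dim) ω sub
  incl_comp_sub : incl.comp sub = H.incl
  lieAlgebra_eq : toComplexLieSubgroup.lieAlgebra = 𝔥'.toSubmodule

/-! ## Rational curves -/

/-- The point `[z : 1]` of the projective line. -/
def projPt₀ (z : ℂ) : Projectivization ℂ (Fin 2 → ℂ) :=
  Projectivization.mk ℂ ![z, 1] (fun h => one_ne_zero (congrFun h 1))

/-- The point `[1 : z]` of the projective line. -/
def projPt₁ (z : ℂ) : Projectivization ℂ (Fin 2 → ℂ) :=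
  Projectivization.mk ℂ ![1, z] (fun h => one_ne_zero (congrFun h 0))

/-- A rational curve in a complex manifold: a nonconstant map `ℙ¹ → M` which is holomorphic
(in both standard affine coordinates of `ℙ¹`). -/
structure IsRationalCurve {n : ℕ} {M : Type u} [TopologicalSpace M] [ChartedSpace (Cn n) M]
    (f : Projectivization ℂ (Fin 2 → ℂ) → M) : Prop where
  holomorphic₀ : ContMDiff (modelWithCornersSelf ℂ ℂ) (cI n) ω (fun z => f (projPt₀ z))
  holomorphic₁ : ContMDiff (modelWithCornersSelf ℂ ℂ) (cI n) ω (fun z => f (projPt₁ z))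
  nonconstant : ∃ p q, f p ≠ f q

/-! ## Cartan geometries -/

/-- A holomorphic Cartan geometry on `M` for a complex Lie group `G` and a complex Lie group `H`
mapped to `G` by `ι` (the inclusion of a Lie subgroup): a holomorphic principal right `H`-bundle
`E → M` with a holomorphic `𝔤`-valued 1-form `form` (the Cartan connection) on `E`.  The total
space has the same dimension as `G`, since `form` is a pointwise isomorphism. -/
structure CartanGeometry (d e : ℕ) {G H : Type u}
    [Group G] [TopologicalSpace G] [ChartedSpace (Cn d) G]
    [Group H] [TopologicalSpace H] [ChartedSpace (Cn e) H] (ι : H →* G)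
    (n : ℕ) (M : Type u) [TopologicalSpace M] [ChartedSpace (Cn n) M] where
  E : Type u
  [topologicalSpace : TopologicalSpace E]
  [chartedSpace : ChartedSpace (Cn d) E]
  [complexManifold : ComplexManifold d E]
  /-- the bundle projection -/
  proj : E → M
  /-- the right action of the structure group -/
  act : E → H → E
  act_one : ∀ x, act x 1 = x
  act_mul : ∀ x h k, act x (h * k) = act (act x h) k
  act_holomorphic :
    ContMDiff ((cI d).prod (cI e)) (cI d) ω (fun p : E × H => act p.1 p.2)
  /-- `E → M` is locally isomorphic to a product bundle `U × H → U` -/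
  locally_trivial : ∀ m : M, ∃ (U : Set M) (ψ : OpenPartialHomeomorph (M × H) E),
    IsOpen U ∧ m ∈ U ∧ ψ.source = U ×ˢ Set.univ ∧ ψ.target = proj ⁻¹' U ∧
    ContMDiffOn ((cI n).prod (cI e)) (cI d) ω ψ ψ.source ∧
    ContMDiffOn (cI d) ((cI n).prod (cI e)) ω ψ.symm ψ.target ∧
    ∀ x ∈ U, ∀ h k : H, proj (ψ (x, h)) = x ∧ ψ (x, h * k) = act (ψ (x, h)) k
  /-- the Cartan connection, a linear isomorphism on each tangent space -/
  form : ∀ x : E, TangentSpace (cI d) x ≃L[ℂ] LieAlg d G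
  form_holomorphic : ContMDiff (cI d).tangent (modelWithCornersSelf ℂ (Cn d)) ω
    (fun v : TangentBundle (cI d) E => LieAlg.coord (form v.proj v.snd))
  /-- `r_h^* form = Ad(h)⁻¹ form` -/
  form_equivariant : ∀ (h : H) (x : E) (v : TangentSpace (cI d) x),
    form (act x h) (mfderiv (cI d) (cI d) (fun y => act y h) x v) = Ad d (ι h)⁻¹ (form x v)
  /-- for `X ∈ 𝔥`, the vector field on which `form` is constant, equal to `X`, generates the action
  of the one-parameter group of `X` -/
  form_vertical : ∀ (x : E) (X : LieAlg e H),
    form (act x 1) (mfderiv (cI e) (cI d) (fun h => act x h) 1 X) = lieMap d e ι X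

attribute [instance] CartanGeometry.topologicalSpace CartanGeometry.chartedSpace
  CartanGeometry.complexManifold

namespace CartanGeometry

variable {d e : ℕ} {G H : Type u}
    [Group G] [TopologicalSpace G] [ChartedSpace (Cn d) G]
    [Group H] [TopologicalSpace H] [ChartedSpace (Cn e) H] {ι : H →* G}
    {n : ℕ} {M : Type u} [TopologicalSpace M] [ChartedSpace (Cn n) M]

/-- The vector field on `E` on which the Cartan connection is constant, equal to `A`. -/
def constField (C : CartanGeometry d e ι n M) (A : LieAlg d G) (x : C.E) : TangentSpace (cI d) x :=
  (C.form x).symm A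

/-- The exterior derivative of the Cartan connection, on vector fields:
`dω (X, Y) = X (ω Y) - Y (ω X) - ω [X, Y]`. -/
def dForm (C : CartanGeometry d e ι n M) (X Y : ∀ x : C.E, TangentSpace (cI d) x) (x : C.E) :
    LieAlg d G :=
  let XωY : LieAlg d G := mfderiv (cI d) (cI d) (fun y => LieAlg.coord (C.form y (Y y))) x (X x)
  let YωX : LieAlg d G := mfderiv (cI d) (cI d) (fun y => LieAlg.coord (C.form y (X y))) x (Y x)
  XωY - YωX - C.form x (VectorField.mlieBracket (cI d) X Y x)

/-- The curvature function of a Cartan geometry: the 2-form `dω + ½ [ω, ω]`, evaluated on the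
vector fields on which `ω` is constant, equal to `A` and `B`
(recall that `½ [ω, ω] (X, Y) = [ω X, ω Y]`). -/
def curvature (C : CartanGeometry d e ι n M) (x : C.E) (A B : LieAlg d G) : LieAlg d G :=
  C.dForm (C.constField A) (C.constField B) x
    + ⁅C.form x (C.constField A x), C.form x (C.constField B x)⁆

/-- A Cartan geometry is flat if its curvature vanishes. -/
def Flat (C : CartanGeometry d e ι n M) : Prop :=
  ∀ (x : C.E) (A B : LieAlg d G), C.curvature x A B = 0

/-- `C` is a geometry on `M` with structure group `H`; `C'` is a geometry on `M'` with a bigger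
structure group `H'`, and `j : H → H'` is the inclusion.  The lift of `C'` is the geometry
`C'.E → C'.E / H` with the same total space and the same Cartan connection, where `H` acts through
`j`.  The restriction of `C` to the open set `U` is isomorphic to the restriction of this lift to
some open subset of `C'.E / H`: there is a biholomorphic `H`-equivariant map from the part of `C.E`
above `U` to an (automatically `H`-invariant) open subset of `C'.E`, which identifies the Cartan
connections. -/
def RestrictionIsoToLift {e' n' : ℕ} {H' M' : Type u}
    [Group H'] [TopologicalSpace H'] [ChartedSpace (Cn e') H'] {ι' : H' →* G}
    [TopologicalSpace M'] [ChartedSpace (Cn n') M']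
    (C : CartanGeometry d e ι n M) (U : Set M) (C' : CartanGeometry d e' ι' n' M') (j : H →* H') : Prop :=
  ∃ F : OpenPartialHomeomorph C.E C'.E,
    F.source = C.proj ⁻¹' U ∧
    ContMDiffOn (cI d) (cI d) ω F F.source ∧
    ContMDiffOn (cI d) (cI d) ω F.symm F.target ∧
    (∀ x ∈ F.source, ∀ h : H, F (C.act x h) = C'.act (F x) (j h)) ∧
    (∀ x ∈ F.source, ∀ v : TangentSpace (cI d) x,
      C'.form (F x) (mfderiv (cI d) (cI d) F x v) = C.form x v)

/-- The geometry `C` on `M`, with structure group `H`, restricts along the immersed submanifold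
`i : L → M` to the geometry `D`, with the same structure group `H` and with values in the Lie
algebra of the subgroup `κ : G' → G`: there is an `H`-equivariant holomorphic bundle map `Φ` over
`i` (so that `D.E` is the pullback bundle of `C.E` along `i`), which pulls the Cartan connection of
`C` back to that of `D`. -/
def RestrictsAlong {d' k : ℕ} {G' L : Type u}
    [Group G'] [TopologicalSpace G'] [ChartedSpace (Cn d') G'] {j : H →* G'}
    [TopologicalSpace L] [ChartedSpace (Cn k) L]
    (C : CartanGeometry d e ι n M) (i : L → M) (D : CartanGeometry d' e j k L) (κ : G' →* G) : Prop :=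
  ∃ Φ : D.E → C.E,
    ContMDiff (cI d') (cI d) ω Φ ∧
    (∀ x, C.proj (Φ x) = i (D.proj x)) ∧
    (∀ x h, Φ (D.act x h) = C.act (Φ x) h) ∧
    (∀ x, ∀ v : TangentSpace (cI d') x,
      C.form (Φ x) (mfderiv (cI d') (cI d) Φ x v) = lieMap d d' κ (D.form x v))

end CartanGeometry

/-! ## Holomorphic foliations -/

/-- A holomorphic foliation of `M` with leaves of dimension `k`: a partition of `M` into connected
injectively immersed complex submanifolds (the leaves), such that around each point there is a
holomorphic chart to a product `B × T ⊆ ℂᵏ × ℂ^q`, `B` connected, each of whose plaques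
`B × {y}` is an open piece of a leaf. -/
structure HolomorphicFoliation (n : ℕ) (M : Type u) [TopologicalSpace M] [ChartedSpace (Cn n) M]
    (k : ℕ) where
  Index : Type u
  Leaf : Index → Type u
  [topologicalSpace : ∀ a, TopologicalSpace (Leaf a)]
  [chartedSpace : ∀ a, ChartedSpace (Cn k) (Leaf a)]
  [complexManifold : ∀ a, ComplexManifold k (Leaf a)]
  [connectedSpace : ∀ a, ConnectedSpace (Leaf a)]
  incl : ∀ a, Leaf a → M
  incl_holomorphic : ∀ a, ContMDiff (cI k) (cI n) ω (incl a)
  incl_injective : ∀ a, Function.Injective (incl a)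
  incl_immersion : ∀ a (p : Leaf a), Function.Injective (mfderiv (cI k) (cI n) (incl a) p)
  partition : ∀ m : M, ∃! a, m ∈ Set.range (incl a)
  foliated_chart : ∀ m : M, ∃ (q : ℕ) (φ : OpenPartialHomeomorph M (Cn k × Cn q))
    (B : Set (Cn k)) (T : Set (Cn q)),
    m ∈ φ.source ∧ φ.target = B ×ˢ T ∧ IsConnected B ∧
    ContMDiffOn (cI n) (modelWithCornersSelf ℂ (Cn k × Cn q)) ω φ φ.source ∧
    ContMDiffOn (modelWithCornersSelf ℂ (Cn k × Cn q)) (cI n) ω φ.symm φ.target ∧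
    ∀ y ∈ T, ∃ a, φ.symm '' (B ×ˢ {y}) ⊆ Set.range (incl a) ∧
      IsOpen (incl a ⁻¹' (φ.symm '' (B ×ˢ {y})))

attribute [instance] HolomorphicFoliation.topologicalSpace HolomorphicFoliation.chartedSpace
  HolomorphicFoliation.complexManifold HolomorphicFoliation.connectedSpace

end

/-! Write Â for the vector field on E with ω(Â) = A, and `tors` for the function ω([Â, B̂]). The
curvature on constant fields is K(A, B) = [A, B] − `tors`(A, B). It is H-equivariant, and it is
semibasic: K(A, ·) = 0 for A in 𝔥.

The rational curve enters through the adjoint tractor bundle E ×_H 𝔤 with its tractor connection,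
whose parallel frames p along a lift s of a curve solve p' = −ad(ω(s')) p. Over ℙ¹ a connection is
flat for reasons of dimension, and ℙ¹ is simply connected, so there is a global parallel frame. In
that frame, an equivariant tensor which is semibasic in one argument, contracted there with the
velocity of the curve, becomes a vector-valued holomorphic 1-form on ℙ¹, and so vanishes
(`exists_tensors_vanish`). This applies to K, and also to all its iterated derivatives along
constant fields, since these are again such tensors (`IsTensor.tensorDeriv`). At a point of E above
a place where the curve is immersed, let A be the value of ω on the velocity of a lift; then A is
not in 𝔥, and all Taylor coefficients of K(A, ·) vanish there. As E is connected, K(A, ·) = 0 on all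
of E (`exists_tors_eq`).

Let 𝔥' be the set of all A with K(A, ·) = 0 everywhere (`flatSubalgebra`). It is a subalgebra by the
Jacobi identity for vector fields (`tors_bracket`), it contains 𝔥 because K is semibasic, strictly
because of the vector A just found, and it is Ad(H)-stable by equivariance. Hence H together with
the integral subgroup of 𝔥' generates an overgroup with Lie algebra 𝔥' (`exists_lieOvergroup`).

The rest works for any such H'. In the directions of 𝔥' the brackets of constant fields are those of
𝔤, so in coordinates which are exponential along 𝔥' the pullback of ω solves, along each ray, a
linear differential equation with constant coefficients (`pull_eq_exp`). It is therefore determined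
by its restriction η to a transversal slice. This has two consequences. The distribution ω⁻¹(𝔥') is
integrable; being H-invariant and containing the vertical directions, it descends to a foliation of
M, and ω restricted above a leaf is 𝔥'-valued and flat (`exists_foliation`). Moreover the product of
the slice with H', with connection Ad(g)⁻¹η plus the Maurer-Cartan form, solves the same equation
with the same initial value, which yields a germ of isomorphism. It extends H-equivariantly, and is
injective above a small open subset of M because H carries the topology induced from G
(`exists_restrictionIsoToLift`). -/

noncomputable section

open Set Filter Topology

set_option linter.unusedSectionVars false

/-! ### Superposition operators on spaces of continuous functions -/

section Nemytskii

variable {K : Type*} [TopologicalSpace K] [CompactSpace K]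
  {V W : Type*} [NormedAddCommGroup V] [NormedSpace ℂ V] [NormedAddCommGroup W] [NormedSpace ℂ W]

/-- A continuous multilinear map, applied pointwise to continuous functions. -/
def ContinuousMultilinearMap.pointwise (K : Type*) [TopologicalSpace K] [CompactSpace K] {n : ℕ}
    (p : ContinuousMultilinearMap ℂ (fun _ : Fin n => V) W) :
    ContinuousMultilinearMap ℂ (fun _ : Fin n => C(K, V)) C(K, W) :=
  MultilinearMap.mkContinuous
    { toFun := fun γ => ⟨fun t => p fun i => γ i t, by fun_prop⟩
      map_update_add' := by
        intro _ γ i a b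
        ext t
        have h : ∀ c : C(K, V), (fun j => Function.update γ i c j t)
            = Function.update (fun j => γ j t) i (c t) := by
          intro c; ext j
          by_cases hj : j = i
          · subst hj; simp
          · simp [hj]
        simp only [ContinuousMap.coe_mk, ContinuousMap.add_apply, h]
        rw [← p.map_update_add]
      map_update_smul' := by
        intro _ γ i z a
        ext t
        have h : ∀ c : C(K, V), (fun j => Function.update γ i c j t)
            = Function.update (fun j => γ j t) i (c t) := by
          intro c; ext j
          by_cases hj : j = i
          · subst hj; simp
          · simp [hj]
        simp only [ContinuousMap.coe_mk, ContinuousMap.smul_apply, h]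
        rw [← p.map_update_smul] }
    ‖p‖ (by
      intro γ
      rw [ContinuousMap.norm_le _ (by positivity)]
      intro t
      refine (p.le_opNorm _).trans ?_
      gcongr with i
      exact (γ i).norm_coe_le_norm t)

lemma ContinuousMultilinearMap.norm_pointwise_le {n : ℕ}
    (p : ContinuousMultilinearMap ℂ (fun _ : Fin n => V) W) : ‖p.pointwise K‖ ≤ ‖p‖ :=
  MultilinearMap.mkContinuous_norm_le _ (norm_nonneg _) _

/-- Composition with an analytic map is analytic on spaces of continuous functions, near a
constant function. -/
theorem exists_analyticAt_comp_continuousMap [CompleteSpace W] {f : V → W} {x₀ : V}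
    (hf : AnalyticAt ℂ f x₀) :
    ∃ N : C(K, V) → C(K, W), AnalyticAt ℂ N (ContinuousMap.const K x₀) ∧
      ∃ r > 0, ∀ γ : C(K, V), (∀ t, ‖γ t - x₀‖ < r) → ∀ t, N γ t = f (γ t) := by
  obtain ⟨p, r, hp⟩ := hf
  let P : FormalMultilinearSeries ℂ C(K, V) C(K, W) := fun n => (p n).pointwise K
  -- Pointwise application does not increase the norms of the coefficients, so the lifted series
  -- converges at least where the original one does.
  have hrad : p.radius ≤ P.radius := by
    refine ENNReal.le_of_forall_nnreal_lt fun s hs => ?_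
    refine P.le_radius_of_summable_norm ?_
    refine Summable.of_nonneg_of_le (fun n => by positivity) (fun n => ?_) (p.summable_norm_mul_pow hs)
    gcongr
    exact ContinuousMultilinearMap.norm_pointwise_le _
  have hpos : 0 < P.radius := hp.r_pos.trans_le (hp.r_le.trans hrad)
  have hP := P.hasFPowerSeriesOnBall hpos
  refine ⟨fun γ => P.sum (γ - ContinuousMap.const K x₀), ?_, ?_⟩
  · have h1 : AnalyticAt ℂ P.sum (ContinuousMap.const K x₀ - ContinuousMap.const K x₀) := by
      rw [sub_self]; exact hP.analyticAt
    exact AnalyticAt.fun_comp h1 (by fun_prop)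
  · obtain ⟨s, hs0, hs⟩ := ENNReal.lt_iff_exists_nnreal_btwn.1 hp.r_pos
    refine ⟨s, by exact_mod_cast hs0, fun γ hγ t => ?_⟩
    have hs0' : (0 : ℝ) < s := by exact_mod_cast hs0
    have hγn : ‖γ - ContinuousMap.const K x₀‖ < s := by
      rw [ContinuousMap.norm_lt_iff _ hs0']
      intro t; simpa using hγ t
    have hmem : γ - ContinuousMap.const K x₀ ∈ Metric.eball (0 : C(K, V)) P.radius := by
      rw [Metric.mem_eball, edist_zero_right]
      refine lt_of_lt_of_le ?_ (hs.le.trans (hp.r_le.trans hrad))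
      rw [enorm_lt_coe]
      exact_mod_cast hγn
    have h1 := hP.hasSum hmem
    rw [zero_add] at h1
    -- Evaluation at t is continuous and linear, so it turns the series in C(K, W) into the power
    -- series of f at γ t.
    have h2 := h1.mapL (ContinuousMap.evalCLM ℂ t)
    have hmem' : γ t - x₀ ∈ Metric.eball (0 : V) r := by
      rw [Metric.mem_eball, edist_zero_right]
      refine lt_trans ?_ hs
      rw [enorm_lt_coe]
      exact_mod_cast hγ t
    have h3 := hp.hasSum hmem'
    rw [add_sub_cancel] at h3
    exact h2.unique h3

end Nemytskii

/-! ### Analytic dependence of integral curves on their data -/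

section Exponential

variable {V' V : Type*} [NormedAddCommGroup V'] [NormedSpace ℂ V']
  [NormedAddCommGroup V] [NormedSpace ℂ V] [CompleteSpace V]

/-- The primitive, vanishing at `0`, of a continuous function on the unit interval. -/
def unitPrimitive (V : Type*) [NormedAddCommGroup V] [NormedSpace ℂ V] [CompleteSpace V] :
    C(unitInterval, V) →L[ℂ] C(unitInterval, V) :=
  LinearMap.mkContinuous
    { toFun := fun γ => ⟨fun t => ∫ s in (0 : ℝ)..t, γ (projIcc 0 1 zero_le_one s), by
        have : Continuous fun t : ℝ => ∫ s in (0 : ℝ)..t, γ (projIcc 0 1 zero_le_one s) :=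
          intervalIntegral.continuous_primitive
            (fun a b => (γ.continuous.comp continuous_projIcc).intervalIntegrable a b) 0
        exact this.comp continuous_subtype_val⟩
      map_add' := by
        intro γ δ
        ext t
        exact intervalIntegral.integral_add
          ((γ.continuous.comp continuous_projIcc).intervalIntegrable _ _)
          ((δ.continuous.comp continuous_projIcc).intervalIntegrable _ _)
      map_smul' := by
        intro c γ
        ext t
        exact intervalIntegral.integral_smul c _ }
    1 (by
      intro γ
      rw [ContinuousMap.norm_le _ (by positivity)]
      intro t
      have h := intervalIntegral.norm_integral_le_of_norm_le_const (a := (0 : ℝ)) (b := t)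
        (f := fun s => γ (projIcc 0 1 zero_le_one s)) (C := ‖γ‖)
        (fun s _ => γ.norm_coe_le_norm _)
      refine h.trans ?_
      rw [sub_zero, abs_of_nonneg t.2.1, one_mul]
      exact mul_le_of_le_one_right (norm_nonneg _) t.2.2)

lemma unitPrimitive_apply (γ : C(unitInterval, V)) (t : unitInterval) :
    unitPrimitive V γ t = ∫ s in (0 : ℝ)..t, γ (projIcc 0 1 zero_le_one s) := rfl

/-- The pairing of a constant with a continuous function. -/
def constPair (K V' V : Type*) [TopologicalSpace K] [CompactSpace K]
    [NormedAddCommGroup V'] [NormedSpace ℂ V'] [NormedAddCommGroup V] [NormedSpace ℂ V] :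
    (V' × C(K, V)) →L[ℂ] C(K, V' × V) :=
  LinearMap.mkContinuous
    { toFun := fun p => ⟨fun t => (p.1, p.2 t), by fun_prop⟩
      map_add' := by intro p q; ext t <;> rfl
      map_smul' := by intro c p; ext t <;> rfl }
    1 (by
      intro p
      rw [ContinuousMap.norm_le _ (by positivity), one_mul]
      intro t
      exact max_le (le_max_left _ _) ((p.2.norm_coe_le_norm t).trans (le_max_right _ _)))

omit [CompleteSpace V] in
lemma constPair_apply {K : Type*} [TopologicalSpace K] [CompactSpace K] (p : V' × C(K, V)) (t : K) :
    constPair K V' V p t = (p.1, p.2 t) := rfl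

/-- Constant functions. -/
def constMap (K V : Type*) [TopologicalSpace K] [CompactSpace K]
    [NormedAddCommGroup V] [NormedSpace ℂ V] : V →L[ℂ] C(K, V) :=
  LinearMap.mkContinuous
    { toFun := fun v => ContinuousMap.const K v
      map_add' := by intro p q; ext t; rfl
      map_smul' := by intro c p; ext t; rfl }
    1 (by
      intro p
      rw [ContinuousMap.norm_le _ (by positivity), one_mul]
      intro t
      exact le_rfl)

omit [CompleteSpace V] in
lemma constMap_apply {K : Type*} [TopologicalSpace K] [CompactSpace K] (v : V) (t : K) :
    constMap K V v t = v := rfl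

/-- The integral equation for the curves `γ' = X(γ) A`, `γ(0) = x`, has a unique solution near a
constant curve, depending analytically on `A` near `0` and on `x`. -/
theorem exists_analytic_solution [CompleteSpace V'] {X : V → V' →L[ℂ] V} {x₀ : V}
    (hX : AnalyticAt ℂ X x₀) :
    ∃ Γ : V' × V → C(unitInterval, V), AnalyticAt ℂ Γ (0, x₀) ∧
      Γ (0, x₀) = ContinuousMap.const _ x₀ ∧ ∃ ε > 0,
      (∀ᶠ p in 𝓝 ((0, x₀) : V' × V), ∀ t : unitInterval,
        Γ p t = p.2 + ∫ s in (0 : ℝ)..t, X (Γ p (projIcc 0 1 zero_le_one s)) p.1) ∧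
      (∀ p : V' × V, ‖p - (0, x₀)‖ < ε → ∀ γ : C(unitInterval, V), (∀ t, ‖γ t - x₀‖ < ε) →
        (∀ t : unitInterval,
          γ t = p.2 + ∫ s in (0 : ℝ)..t, X (γ (projIcc 0 1 zero_le_one s)) p.1) → γ = Γ p) := by
  let I := unitInterval
  have hF : AnalyticAt ℂ (fun q : V' × V => X q.2 q.1) (0, x₀) := by
    have h1 : AnalyticAt ℂ (fun q : V' × V => X q.2) (0, x₀) := hX.fun_comp analyticAt_snd
    exact (h1.contDiffAt.clm_apply (n := ω) contDiffAt_fst).analyticAt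
  obtain ⟨N, hN, r, hr, hNX⟩ := exists_analyticAt_comp_continuousMap (K := I) hF
  let c₀ : C(I, V) := constMap I V x₀
  have hpair : constPair I V' V (0, c₀) = ContinuousMap.const I (0, x₀) := rfl
  -- The second component vanishes exactly on solutions of the integral equation, as long as N
  -- computes the field. Carrying the parameters in the first component lets the inverse function
  -- theorem serve as an implicit function theorem.
  let Λ : (V' × V) × C(I, V) → (V' × V) × C(I, V) := fun z =>
    (z.1, z.2 - constMap I V z.1.2 - unitPrimitive V (N (constPair I V' V (z.1.1, z.2))))
  have hNP : AnalyticAt ℂ (fun z : (V' × V) × C(I, V) => N (constPair I V' V (z.1.1, z.2)))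
      ((0, x₀), c₀) := by
    have : AnalyticAt ℂ (fun z : (V' × V) × C(I, V) => constPair I V' V (z.1.1, z.2))
      ((0, x₀), c₀) := ((constPair I V' V).comp
        (((ContinuousLinearMap.fst ℂ V' V).comp (ContinuousLinearMap.fst ℂ _ C(I, V))).prod
          (ContinuousLinearMap.snd ℂ _ C(I, V)))).analyticAt _
    exact AnalyticAt.fun_comp (by simpa only [hpair] using hN) this
  have hΛ : AnalyticAt ℂ Λ ((0, x₀), c₀) := by
    refine AnalyticAt.prod analyticAt_fst ?_
    refine AnalyticAt.sub (((ContinuousLinearMap.snd ℂ (V' × V) C(I, V)) - (constMap I V).comp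
      ((ContinuousLinearMap.snd ℂ V' V).comp (ContinuousLinearMap.fst ℂ _ C(I, V)))).analyticAt _) ?_
    exact (ContinuousLinearMap.analyticAt _ _).fun_comp hNP
  let L := fderiv ℂ N (ContinuousMap.const I (0, x₀))
  have hL : HasFDerivAt N L (ContinuousMap.const I (0, x₀)) := hN.differentiableAt.hasFDerivAt
  -- The field X(·) A vanishes identically for A = 0, so at the base point the integral term has no
  -- derivative in γ. The derivative of Λ is then unipotent triangular, hence invertible, without
  -- any smallness of the time interval.
  have hL0 : ∀ γ, L (constPair I V' V (0, γ)) = 0 := by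
    have h1 : HasFDerivAt (fun γ : C(I, V) => N (constPair I V' V (0, γ)))
        (L.comp ((constPair I V' V).comp (ContinuousLinearMap.inr ℂ V' C(I, V)))) c₀ := by
      have h2 : HasFDerivAt (fun γ : C(I, V) => constPair I V' V (0, γ))
        ((constPair I V' V).comp (ContinuousLinearMap.inr ℂ V' C(I, V))) c₀ :=
        ((constPair I V' V).comp (ContinuousLinearMap.inr ℂ V' C(I, V))).hasFDerivAt
      exact HasFDerivAt.comp c₀ (by rw [hpair]; exact hL) h2
    have h3 : (fun γ : C(I, V) => N (constPair I V' V (0, γ))) =ᶠ[𝓝 c₀] fun _ => 0 := by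
      filter_upwards [Metric.ball_mem_nhds c₀ hr] with γ hγ
      ext t
      rw [hNX]
      · simp [constPair_apply]
      · intro t
        rw [constPair_apply, Prod.mk_sub_mk, sub_self, Prod.norm_mk, norm_zero,
          max_eq_right (norm_nonneg _)]
        rw [Metric.mem_ball, dist_eq_norm] at hγ
        exact ((γ - c₀).norm_coe_le_norm t).trans_lt hγ
    have h4 := (h1.congr_of_eventuallyEq h3.symm).unique (hasFDerivAt_const _ _)
    intro γ
    exact DFunLike.congr_fun h4 γ
  let S : (V' × V) →L[ℂ] C(I, V) := (constMap I V).comp (ContinuousLinearMap.snd ℂ V' V) +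
    (unitPrimitive V).comp (L.comp ((constPair I V' V).comp
      ((ContinuousLinearMap.inl ℂ V' C(I, V)).comp (ContinuousLinearMap.fst ℂ V' V))))
  let fs := ContinuousLinearMap.fst ℂ (V' × V) C(I, V)
  let sn := ContinuousLinearMap.snd ℂ (V' × V) C(I, V)
  let e : ((V' × V) × C(I, V)) ≃L[ℂ] ((V' × V) × C(I, V)) :=
    ContinuousLinearEquiv.equivOfInverse (fs.prod (sn - S.comp fs)) (fs.prod (sn + S.comp fs))
      (fun z => by ext <;> simp [fs, sn]) (fun z => by ext <;> simp [fs, sn])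
  have hΛ' : HasFDerivAt Λ (e : ((V' × V) × C(I, V)) →L[ℂ] ((V' × V) × C(I, V)))
      ((0, x₀), c₀) := by
    have hp : HasFDerivAt (fun z : (V' × V) × C(I, V) => constPair I V' V (z.1.1, z.2))
        ((constPair I V' V).comp (((ContinuousLinearMap.fst ℂ V' V).comp fs).prod sn))
        ((0, x₀), c₀) :=
      ((constPair I V' V).comp (((ContinuousLinearMap.fst ℂ V' V).comp fs).prod sn)).hasFDerivAt
    have hn := (unitPrimitive V).hasFDerivAt.comp ((0, x₀), c₀)
      (HasFDerivAt.comp ((0, x₀), c₀) (by rw [hpair]; exact hL) hp)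
    have hc : HasFDerivAt (fun z : (V' × V) × C(I, V) => z.2 - constMap I V z.1.2)
        (sn - (constMap I V).comp ((ContinuousLinearMap.snd ℂ V' V).comp fs)) ((0, x₀), c₀) :=
      (sn - (constMap I V).comp ((ContinuousLinearMap.snd ℂ V' V).comp fs)).hasFDerivAt
    have hall := (fs.hasFDerivAt (x := ((0, x₀), c₀))).prodMk (hc.sub hn)
    refine hall.congr_fderiv ?_
    refine ContinuousLinearMap.ext fun z => ?_
    have hz : constPair I V' V (z.1.1, z.2)
        = constPair I V' V (z.1.1, 0) + constPair I V' V (0, z.2) := by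
      rw [← map_add]; simp
    have hz' : L (constPair I V' V (z.1.1, z.2)) = L (constPair I V' V (z.1.1, 0)) := by
      rw [hz, map_add, hL0, add_zero]
    refine Prod.ext rfl ?_
    change z.2 - constMap I V z.1.2 - unitPrimitive V (L (constPair I V' V (z.1.1, z.2))) =
      z.2 - (constMap I V z.1.2 + unitPrimitive V (L (constPair I V' V (z.1.1, 0))))
    rw [hz', sub_sub]
  have hΛc : ContDiffAt ℂ ω Λ ((0, x₀), c₀) := hΛ.contDiffAt
  let Ψ := hΛc.toOpenPartialHomeomorph Λ hΛ' (by simp)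
  have hmem : ((0, x₀), c₀) ∈ Ψ.source := hΛc.mem_toOpenPartialHomeomorph_source hΛ' (by simp)
  have hΛ0 : Λ ((0, x₀), c₀) = ((0, x₀), 0) := by
    refine Prod.ext rfl ?_
    have : N (constPair I V' V (0, c₀)) = 0 := by
      ext t
      rw [hNX]
      · simp [constPair_apply]
      · intro t
        simpa [constPair_apply, c₀, constMap_apply] using hr
    change c₀ - constMap I V x₀ - unitPrimitive V (N (constPair I V' V (0, c₀))) = 0
    rw [this]; simp [c₀]
  have hsymm : AnalyticAt ℂ Ψ.symm ((0, x₀), 0) := by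
    have h := hΛc.to_localInverse hΛ' (by simp)
    rw [hΛ0] at h
    exact h.analyticAt
  have hΨ0 : Ψ.symm ((0, x₀), 0) = ((0, x₀), c₀) := by
    rw [← hΛ0]; exact Ψ.left_inv hmem
  have htarget : ∀ᶠ p in 𝓝 ((0, x₀) : V' × V), (p, (0 : C(I, V))) ∈ Ψ.target := by
    have : ContinuousAt (fun p : V' × V => (p, (0 : C(I, V)))) (0, x₀) := by fun_prop
    refine this.eventually_mem (Ψ.open_target.mem_nhds ?_)
    rw [← hΛ0]; exact Ψ.map_source hmem
  have hΓ : AnalyticAt ℂ (fun p : V' × V => (Ψ.symm (p, 0)).2) (0, x₀) :=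
    analyticAt_snd.fun_comp (AnalyticAt.fun_comp (f := fun p : V' × V => (p, (0 : C(I, V)))) hsymm
      (by fun_prop))
  have hNval : ∀ (A : V') (γ : C(I, V)), ‖A‖ < r → (∀ t, ‖γ t - x₀‖ < r) → ∀ t,
      N (constPair I V' V (A, γ)) t = X (γ t) A := by
    intro A γ hA hγ t
    rw [hNX]
    · rfl
    · intro t
      rw [constPair_apply, Prod.mk_sub_mk, sub_zero, Prod.norm_mk]
      exact max_lt hA (hγ t)
  refine ⟨_, hΓ, by rw [hΨ0]; rfl, ?_⟩
  obtain ⟨ε, hε, hεs⟩ := Metric.mem_nhds_iff.1 (Ψ.open_source.mem_nhds hmem)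
  -- Pointwise strict bounds give only a weak bound on the supremum norm, hence the half. The bound
  -- r keeps the curve where N agrees with the field.
  refine ⟨min (ε / 2) r, by positivity, ?_, ?_⟩
  · have h1 : ∀ᶠ p in 𝓝 ((0, x₀) : V' × V), ‖(Ψ.symm (p, 0)).2 - c₀‖ < r := by
      have := hΓ.continuousAt.sub (continuousAt_const (y := c₀))
      refine this.norm.eventually_lt_const ?_
      simpa [hΨ0] using hr
    have h2 : ∀ᶠ p in 𝓝 ((0, x₀) : V' × V), ‖p.1‖ < r :=
      (continuousAt_fst (p := ((0, x₀) : V' × V))).norm.eventually_lt_const (by simpa using hr)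
    filter_upwards [htarget, h1, h2] with p hp hp1 hp2 t
    have h := Ψ.right_inv hp
    have hfst : (Ψ.symm (p, 0)).1 = p := congrArg Prod.fst h
    have hsnd := congrArg Prod.snd h
    change (Ψ.symm (p, 0)).2 - constMap I V (Ψ.symm (p, 0)).1.2 - unitPrimitive V
      (N (constPair I V' V ((Ψ.symm (p, 0)).1.1, (Ψ.symm (p, 0)).2))) = 0 at hsnd
    rw [hfst, sub_sub, sub_eq_zero] at hsnd
    have h3 := DFunLike.congr_fun hsnd t
    rw [ContinuousMap.add_apply, unitPrimitive_apply, constMap_apply] at h3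
    rw [h3]
    congr 1
    refine intervalIntegral.integral_congr fun s _ => ?_
    exact hNval _ _ hp2 (fun t => (((Ψ.symm (p, 0)).2 - c₀).norm_coe_le_norm t).trans_lt hp1) _
  · intro p hp γ hγ heq
    have hp1 : ‖p.1‖ < r := by
      have : ‖p.1 - 0‖ ≤ ‖p - (0, x₀)‖ := le_max_left _ _
      rw [sub_zero] at this
      exact this.trans_lt (hp.trans_le (min_le_right _ _))
    have hsrc : (p, γ) ∈ Ψ.source := by
      apply hεs
      rw [Metric.mem_ball, dist_eq_norm, Prod.mk_sub_mk, Prod.norm_mk]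
      refine max_lt (hp.trans_le ((min_le_left _ _).trans (by linarith))) ?_
      refine lt_of_le_of_lt (b := ε / 2) ?_ (by linarith)
      rw [ContinuousMap.norm_le _ (by positivity)]
      intro t
      exact (hγ t).le.trans (min_le_left _ _)
    have hval : Λ (p, γ) = (p, 0) := by
      refine Prod.ext rfl ?_
      change γ - constMap I V p.2 - unitPrimitive V (N (constPair I V' V (p.1, γ))) = 0
      ext t
      simp only [ContinuousMap.sub_apply, unitPrimitive_apply, ContinuousMap.zero_apply]
      rw [sub_sub, sub_eq_zero, heq t]
      congr 1
      refine intervalIntegral.integral_congr fun s _ => ?_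
      exact (hNval _ _ hp1 (fun t => (hγ t).trans_le (min_le_right _ _)) _).symm
    have := Ψ.left_inv hsrc
    change Ψ.symm (Λ (p, γ)) = _ at this
    rw [hval] at this
    rw [this]

/-- The exponential map of a linear family of vector fields: `t ↦ Φ (t A, x)` is the integral
curve through `x` of the field `X · A`. -/
theorem exists_exponential [CompleteSpace V'] {X : V → V' →L[ℂ] V} {x₀ : V}
    (hX : AnalyticAt ℂ X x₀) :
    ∃ Φ : V' × V → V, AnalyticAt ℂ Φ (0, x₀) ∧ (∀ᶠ x in 𝓝 x₀, Φ (0, x) = x) ∧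
      ∀ᶠ p in 𝓝 ((0, x₀) : V' × V), fderiv ℂ Φ p (p.1, 0) = X (Φ p) p.1 := by
  obtain ⟨Γ, hΓ, hΓ0, ε, hε, hsol, huniq⟩ := exists_analytic_solution hX
  let Φ : V' × V → V := fun p => Γ p 1
  have hev : ∀ t : unitInterval, AnalyticAt ℂ (fun p => Γ p t) (0, x₀) := fun t =>
    ((ContinuousMap.evalCLM ℂ t : C(unitInterval, V) →L[ℂ] V).analyticAt _).fun_comp hΓ
  have hclose : ∀ᶠ p in 𝓝 ((0, x₀) : V' × V), ∀ t, ‖Γ p t - x₀‖ < ε := by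
    have h1 : ∀ᶠ p in 𝓝 ((0, x₀) : V' × V), ‖Γ p - ContinuousMap.const _ x₀‖ < ε := by
      have := hΓ.continuousAt.sub (continuousAt_const (y := ContinuousMap.const _ x₀))
      refine this.norm.eventually_lt_const ?_
      simpa [hΓ0] using hε
    filter_upwards [h1] with p hp t
    exact ((Γ p - ContinuousMap.const _ x₀).norm_coe_le_norm t).trans_lt hp
  refine ⟨Φ, hev 1, ?_, ?_⟩
  · have : ContinuousAt (fun x : V => ((0, x) : V' × V)) x₀ := by fun_prop
    filter_upwards [this.eventually hsol] with x hx
    simpa using hx 1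
  · have hball : ∀ᶠ p in 𝓝 ((0, x₀) : V' × V), ‖p - (0, x₀)‖ < ε := by
      filter_upwards [Metric.ball_mem_nhds _ hε] with p hp
      rwa [Metric.mem_ball, dist_eq_norm] at hp
    have hXc : ∀ᶠ p in 𝓝 ((0, x₀) : V' × V), ∀ t, ContinuousAt X (Γ p t) := by
      obtain ⟨δ, hδ, h1⟩ := Metric.eventually_nhds_iff_ball.1 hX.eventually_analyticAt
      have h2 : ∀ᶠ p in 𝓝 ((0, x₀) : V' × V), ‖Γ p - ContinuousMap.const _ x₀‖ < δ := by
        have := hΓ.continuousAt.sub (continuousAt_const (y := ContinuousMap.const _ x₀))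
        refine this.norm.eventually_lt_const ?_
        simpa [hΓ0] using hδ
      filter_upwards [h2] with p hp t
      refine (h1 _ ?_).continuousAt
      rw [Metric.mem_ball, dist_eq_norm]
      exact ((Γ p - ContinuousMap.const _ x₀).norm_coe_le_norm t).trans_lt hp
    filter_upwards [hsol, hclose, hball, hXc, (hev 1).eventually_analyticAt] with p hs hc hb hXp hd
    obtain ⟨A, x⟩ := p
    -- the rescaled solution
    have key : ∀ t : unitInterval, Γ (A, x) t = Φ ((t : ℂ) • A, x) := by
      intro t
      let γ : C(unitInterval, V) := ⟨fun s => Γ (A, x) (t * s), by fun_prop⟩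
      -- Slowing time by the factor t turns the solution for A into a solution for t • A; uniqueness
      -- near the constant curve identifies them.
      have hγ : γ = Γ ((t : ℂ) • A, x) := by
        refine huniq _ ?_ γ (fun s => hc _) ?_
        · refine lt_of_le_of_lt ?_ hb
          rw [Prod.mk_sub_mk, Prod.mk_sub_mk, Prod.norm_mk, Prod.norm_mk, sub_zero, sub_zero]
          refine max_le_max ?_ le_rfl
          rw [norm_smul, Complex.norm_real, Real.norm_of_nonneg t.2.1]
          exact mul_le_of_le_one_left (norm_nonneg _) t.2.2
        · intro s
          have h1 := hs (t * s)
          change Γ (A, x) (t * s) = _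
          rw [h1]
          congr 1
          have h2 := intervalIntegral.smul_integral_comp_mul_left
            (f := fun r => X (Γ (A, x) (projIcc 0 1 zero_le_one r)) A) (a := 0) (b := (s : ℝ))
            (c := (t : ℝ))
          rw [mul_zero] at h2
          rw [Set.Icc.coe_mul, ← h2, ← intervalIntegral.integral_smul]
          refine intervalIntegral.integral_congr fun r hr => ?_
          rw [uIcc_of_le s.2.1] at hr
          have hr1 : r ∈ Icc (0 : ℝ) 1 := ⟨hr.1, hr.2.trans s.2.2⟩
          have hr2 : (t : ℝ) * r ∈ Icc (0 : ℝ) 1 := unitInterval.mul_mem t.2 hr1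
          change (t : ℝ) • X (Γ (A, x) (projIcc 0 1 zero_le_one (t * r))) A =
            X (Γ (A, x) (t * projIcc 0 1 zero_le_one r)) ((t : ℂ) • A)
          rw [projIcc_of_mem _ hr2, projIcc_of_mem _ hr1, map_smul]
          rfl
      rw [show Φ ((t : ℂ) • A, x) = Γ ((t : ℂ) • A, x) 1 from rfl, ← hγ]
      simp [γ]
    have hcont : Continuous (fun s : ℝ => X (Γ (A, x) (projIcc 0 1 zero_le_one s)) A) := by
      refine continuous_iff_continuousAt.2 fun s => ?_
      have h1 : ContinuousAt (fun s : ℝ => Γ (A, x) (projIcc 0 1 zero_le_one s)) s :=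
        ((Γ (A, x)).continuous.comp continuous_projIcc).continuousAt
      exact (ContinuousAt.comp (g := X) (f := fun s : ℝ => Γ (A, x) (projIcc 0 1 zero_le_one s))
        (hXp _) h1).clm_apply continuousAt_const
    have hd1 : HasDerivAt (fun s : ℝ => x + ∫ r in (0 : ℝ)..s,
        X (Γ (A, x) (projIcc 0 1 zero_le_one r)) A) (X (Φ (A, x)) A) 1 := by
      have h := (intervalIntegral.integral_hasDerivAt_right (a := 0) (b := 1)
        (hcont.intervalIntegrable _ _) (hcont.stronglyMeasurableAtFilter _ _)
        hcont.continuousAt).const_add x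
      rw [projIcc_right] at h
      exact h
    have hd2 : HasDerivAt (fun s : ℝ => Φ ((s : ℂ) • A, x)) (fderiv ℂ Φ (A, x) (A, 0)) 1 := by
      have h1 : HasDerivAt (fun s : ℝ => ((s : ℂ) • A, x)) (A, (0 : V)) 1 := by
        have h2 : HasDerivAt (fun s : ℝ => (s : ℂ)) 1 1 := Complex.ofRealCLM.hasDerivAt
        have h3 := (h2.smul_const A).prodMk (hasDerivAt_const (1 : ℝ) x)
        simpa using h3
      have h4 : HasFDerivAt Φ (fderiv ℂ Φ (A, x)) (((1 : ℝ) : ℂ) • A, x) := by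
        rw [Complex.ofReal_one, one_smul]
        exact hd.differentiableAt.hasFDerivAt
      exact (h4.restrictScalars ℝ).comp_hasDerivAt (1 : ℝ) h1
    -- The integral equation is known on [0, 1] only, so the two derivatives at the endpoint 1 are
    -- compared within the interval.
    have huniqd : UniqueDiffWithinAt ℝ (Icc (0 : ℝ) 1) 1 :=
      uniqueDiffOn_Icc zero_lt_one 1 (right_mem_Icc.2 zero_le_one)
    refine huniqd.eq_deriv _ ?_ hd1.hasDerivWithinAt
    refine hd2.hasDerivWithinAt.congr (fun s hs' => ?_) ?_
    · have h1 := hs ⟨s, hs'⟩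
      rw [key] at h1
      exact h1.symm
    · have h1 := hs 1
      rw [key] at h1
      exact h1.symm

end Exponential

/-! ### Manifold derivatives as linear maps of model spaces, and charts -/

section ModelDerivative

variable {E₁ H₁ M₁ E₂ H₂ M₂ E₃ H₃ M₃ : Type*}
  [NormedAddCommGroup E₁] [NormedSpace ℂ E₁] [TopologicalSpace H₁] [TopologicalSpace M₁]
  [ChartedSpace H₁ M₁]
  [NormedAddCommGroup E₂] [NormedSpace ℂ E₂] [TopologicalSpace H₂] [TopologicalSpace M₂]
  [ChartedSpace H₂ M₂]
  [NormedAddCommGroup E₃] [NormedSpace ℂ E₃] [TopologicalSpace H₃] [TopologicalSpace M₃]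
  [ChartedSpace H₃ M₃]
  {I₁ : ModelWithCorners ℂ E₁ H₁} {I₂ : ModelWithCorners ℂ E₂ H₂} {I₃ : ModelWithCorners ℂ E₃ H₃}

/-- The manifold derivative, as a linear map of the model spaces. -/
def mder (I₁ : ModelWithCorners ℂ E₁ H₁) (I₂ : ModelWithCorners ℂ E₂ H₂) (f : M₁ → M₂) (x : M₁) :
    E₁ →L[ℂ] E₂ :=
  mfderiv I₁ I₂ f x

lemma mder_comp {g : M₂ → M₃} {f : M₁ → M₂} {x : M₁} (hg : ContMDiffAt I₂ I₃ ω g (f x))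
    (hf : ContMDiffAt I₁ I₂ ω f x) :
    mder I₁ I₃ (fun y => g (f y)) x = (mder I₂ I₃ g (f x)).comp (mder I₁ I₂ f x) :=
  mfderiv_comp x (hg.mdifferentiableAt (by simp)) (hf.mdifferentiableAt (by simp))

lemma mder_comp_apply {g : M₂ → M₃} {f : M₁ → M₂} {x : M₁} (hg : ContMDiffAt I₂ I₃ ω g (f x))
    (hf : ContMDiffAt I₁ I₂ ω f x) (v : E₁) :
    mder I₁ I₃ (fun y => g (f y)) x v = mder I₂ I₃ g (f x) (mder I₁ I₂ f x v) := by
  rw [mder_comp hg hf]; rfl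

lemma mder_congr {f g : M₁ → M₂} {x : M₁} (h : f =ᶠ[𝓝 x] g) :
    mder I₁ I₂ f x = mder I₁ I₂ g x :=
  h.mfderiv_eq

lemma ContMDiffAt.eventually_nhds [IsManifold I₁ ω M₁] [IsManifold I₂ ω M₂] {f : M₁ → M₂} {x : M₁}
    (hf : ContMDiffAt I₁ I₂ ω f x) : ∀ᶠ y in 𝓝 x, ContMDiffAt I₁ I₂ ω f y :=
  (contMDiffAt_iff_contMDiffAt_nhds (by simp)).1 hf

lemma mder_const (x : M₁) (c : M₂) : mder I₁ I₂ (fun _ => c) x = 0 := mfderiv_const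

lemma mder_id (x : M₁) : mder I₁ I₁ (fun y => y) x = ContinuousLinearMap.id ℂ E₁ :=
  mfderiv_id

lemma mder_eq_fderiv (f : E₁ → E₂) (x : E₁) : mder 𝓘(ℂ, E₁) 𝓘(ℂ, E₂) f x = fderiv ℂ f x :=
  mfderiv_eq_fderiv

end ModelDerivative

section Charts

variable {E₁ : Type*} [NormedAddCommGroup E₁] [NormedSpace ℂ E₁]
  {n : ℕ} {M : Type*} [TopologicalSpace M] [ChartedSpace (Cn n) M]
  [IsManifold (cI n) ω M]

lemma contMDiffAt_chartAt {x y : M} (h : y ∈ (chartAt (Cn n) x).source) :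
    ContMDiffAt (cI n) (cI n) ω (chartAt (Cn n) x) y :=
  contMDiffAt_of_mem_maximalAtlas (IsManifold.chart_mem_maximalAtlas x) h

lemma contMDiffAt_chartAt_symm {x : M} {y : Cn n} (h : y ∈ (chartAt (Cn n) x).target) :
    ContMDiffAt (cI n) (cI n) ω (chartAt (Cn n) x).symm y :=
  contMDiffAt_symm_of_mem_maximalAtlas (IsManifold.chart_mem_maximalAtlas x) h

lemma mder_chartAt_comp_symm {x y : M} (h : y ∈ (chartAt (Cn n) x).source) :
    (mder (cI n) (cI n) (chartAt (Cn n) x).symm (chartAt (Cn n) x y)).comp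
      (mder (cI n) (cI n) (chartAt (Cn n) x) y) = ContinuousLinearMap.id ℂ _ := by
  rw [← mder_comp (contMDiffAt_chartAt_symm ((chartAt (Cn n) x).map_source h))
    (contMDiffAt_chartAt h), ← mder_id (I₁ := cI n) y]
  refine mder_congr ?_
  filter_upwards [(chartAt (Cn n) x).open_source.mem_nhds h] with z hz
  exact (chartAt (Cn n) x).left_inv hz

/-- The tangent space at x is by definition identified with the model space through the preferred
chart at x itself. -/
lemma mder_chartAt_self (x : M) :
    mder (cI n) (cI n) (chartAt (Cn n) x) x = ContinuousLinearMap.id ℂ _ := by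
  exact mfderiv_extChartAt_self (I := cI n) (x := x)

lemma mder_chartAt_symm_self (x : M) :
    mder (cI n) (cI n) (chartAt (Cn n) x).symm (chartAt (Cn n) x x)
      = ContinuousLinearMap.id ℂ _ := by
  have h := mder_chartAt_comp_symm (mem_chart_source (Cn n) x)
  rwa [mder_chartAt_self, ContinuousLinearMap.comp_id] at h

lemma mder_eq_chartAt_symm_comp_fderiv {Z : Type*} [NormedAddCommGroup Z] [NormedSpace ℂ Z]
    {f : Z → M} {z : Z} (hf : ContMDiffAt 𝓘(ℂ, Z) (cI n) ω f z) {x : M}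
    (hx : f z ∈ (chartAt (Cn n) x).source) :
    mder 𝓘(ℂ, Z) (cI n) f z = (mder (cI n) (cI n) (chartAt (Cn n) x).symm (chartAt (Cn n) x (f z))).comp
      (fderiv ℂ (fun y => chartAt (Cn n) x (f y)) z) := by
  rw [← mder_eq_fderiv, mder_comp (contMDiffAt_chartAt hx) hf, ← ContinuousLinearMap.comp_assoc,
    mder_chartAt_comp_symm hx, ContinuousLinearMap.id_comp]

lemma ContMDiffAt.contDiffAt_chartAt {Z : Type*} [NormedAddCommGroup Z] [NormedSpace ℂ Z]
    {f : Z → M} {z : Z} (hf : ContMDiffAt 𝓘(ℂ, Z) (cI n) ω f z) {x : M}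
    (hx : f z ∈ (chartAt (Cn n) x).source) :
    ContDiffAt ℂ ω (fun y => chartAt (Cn n) x (f y)) z :=
  contMDiffAt_iff_contDiffAt.1 ((contMDiffAt_chartAt hx).comp z hf)

end Charts

/-! ### Coframes and their structure equation -/

section Pullback

variable {Z V W : Type*} [NormedAddCommGroup Z] [NormedSpace ℂ Z]
  [NormedAddCommGroup V] [NormedSpace ℂ V] [NormedAddCommGroup W] [NormedSpace ℂ W]

/-- Pullback commutes with the exterior derivative, for a vector-valued 1-form. -/
lemma fderiv_pullback_sub_swap {p : Z → V} {w : V → V →L[ℂ] W} {z : Z}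
    (hp : ContDiffAt ℂ ω p z) (hw : ContDiffAt ℂ ω w (p z)) (u v : Z) :
    fderiv ℂ (fun y => w (p y) (fderiv ℂ p y v)) z u
      - fderiv ℂ (fun y => w (p y) (fderiv ℂ p y u)) z v =
    fderiv ℂ w (p z) (fderiv ℂ p z u) (fderiv ℂ p z v)
      - fderiv ℂ w (p z) (fderiv ℂ p z v) (fderiv ℂ p z u) := by
  have hp1 : DifferentiableAt ℂ (fderiv ℂ p) z :=
    (hp.fderiv_right (m := 1) le_top).differentiableAt (by simp)
  have hpd := hp.differentiableAt (by simp)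
  have hwd := hw.differentiableAt (by simp)
  have key : ∀ a b : Z, fderiv ℂ (fun y => w (p y) (fderiv ℂ p y a)) z b =
      fderiv ℂ w (p z) (fderiv ℂ p z b) (fderiv ℂ p z a)
        + w (p z) (fderiv ℂ (fderiv ℂ p) z b a) := by
    intro a b
    have h1 : HasFDerivAt (fun y => w (p y)) ((fderiv ℂ w (p z)).comp (fderiv ℂ p z)) z :=
      hwd.hasFDerivAt.comp z hpd.hasFDerivAt
    have h2 : HasFDerivAt (fun y => fderiv ℂ p y a) ((fderiv ℂ (fderiv ℂ p) z).flip a) z := by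
      simpa using hp1.hasFDerivAt.clm_apply (hasFDerivAt_const a z)
    rw [(h1.clm_apply h2).fderiv]
    simp [add_comm]
  have hsymm : fderiv ℂ (fderiv ℂ p) z u v = fderiv ℂ (fderiv ℂ p) z v u :=
    (hp.isSymmSndFDerivAt (by simp)).eq u v
  rw [key, key, hsymm]
  abel

end Pullback

/-- A holomorphic coframe on a complex manifold, in the form of a 1-form with values in `ℂᵈ` which
is an isomorphism on each tangent space. -/
structure Coframe (d : ℕ) (E : Type*) [TopologicalSpace E] [ChartedSpace (Cn d) E] where
  form : E → Cn d ≃L[ℂ] Cn d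
  holo : ∀ x₀ : E, ContDiffAt ℂ ω (fun x : Cn d =>
    (form ((chartAt (Cn d) x₀).symm x) : Cn d →L[ℂ] Cn d).comp
      (mder (cI d) (cI d) (chartAt (Cn d) x₀).symm x)) (chartAt (Cn d) x₀ x₀)

namespace Coframe

variable {d : ℕ} {E : Type*} [TopologicalSpace E] [ChartedSpace (Cn d) E]

/-- The expression of a coframe in a chart. -/
def loc (C : Coframe d E) (x₀ : E) (x : Cn d) : Cn d →L[ℂ] Cn d :=
  (C.form ((chartAt (Cn d) x₀).symm x) : Cn d →L[ℂ] Cn d).comp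
      (mder (cI d) (cI d) (chartAt (Cn d) x₀).symm x)

/-- The vector field on which the coframe is constant. -/
def field (C : Coframe d E) (A : Cn d) (x : E) : Cn d := (C.form x).symm A

/-- The bracket of the vector fields on which the coframe is constant, equal to `A` and `B`. -/
def tors (C : Coframe d E) (x : E) (A B : Cn d) : Cn d :=
  fderiv ℂ (C.loc x) (chartAt (Cn d) x x) (C.field B x) (C.field A x)
    - fderiv ℂ (C.loc x) (chartAt (Cn d) x x) (C.field A x) (C.field B x)

/-- The pullback of a coframe to a normed space. -/
def pull (C : Coframe d E) {Z : Type*} [NormedAddCommGroup Z] [NormedSpace ℂ Z] (f : Z → E) (z : Z) :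
    Z →L[ℂ] Cn d :=
  (C.form (f z) : Cn d →L[ℂ] Cn d).comp (mder 𝓘(ℂ, Z) (cI d) f z)

variable [IsManifold (cI d) ω E] (C : Coframe d E)
  {Z : Type*} [NormedAddCommGroup Z] [NormedSpace ℂ Z]

lemma loc_self (x : E) : C.loc x (chartAt (Cn d) x x) = C.form x := by
  rw [loc, mder_chartAt_symm_self, ContinuousLinearMap.comp_id,
    (chartAt (Cn d) x).left_inv (mem_chart_source _ x)]

lemma pull_eq {f : Z → E} {z : Z} (hf : ContMDiffAt 𝓘(ℂ, Z) (cI d) ω f z) {x : E}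
    (hx : f z ∈ (chartAt (Cn d) x).source) :
    C.pull f z = (C.loc x (chartAt (Cn d) x (f z))).comp
      (fderiv ℂ (fun y => chartAt (Cn d) x (f y)) z) := by
  rw [pull, mder_eq_chartAt_symm_comp_fderiv hf hx, loc, (chartAt (Cn d) x).left_inv hx,
    ContinuousLinearMap.comp_assoc]

lemma eventually_pull_eq {f : Z → E} {z : Z} (hf : ContMDiffAt 𝓘(ℂ, Z) (cI d) ω f z) {x : E}
    (hx : f z ∈ (chartAt (Cn d) x).source) :
    ∀ᶠ y in 𝓝 z, C.pull f y = (C.loc x (chartAt (Cn d) x (f y))).comp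
      (fderiv ℂ (fun y => chartAt (Cn d) x (f y)) y) := by
  filter_upwards [hf.eventually_nhds,
    hf.continuousAt.eventually_mem ((chartAt (Cn d) x).open_source.mem_nhds hx)] with y h1 h2
  exact C.pull_eq h1 h2

omit [IsManifold (cI d) ω E] in
lemma pull_congr {f g : Z → E} {z : Z} (h : f =ᶠ[𝓝 z] g) : C.pull f z = C.pull g z := by
  rw [pull, pull, mder_congr h, h.eq_of_nhds]

omit [IsManifold (cI d) ω E] in
lemma pull_comp {Y : Type*} [NormedAddCommGroup Y] [NormedSpace ℂ Y] {f : Z → E} {g : Y → Z} {y : Y}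
    (hf : ContMDiffAt 𝓘(ℂ, Z) (cI d) ω f (g y)) (hg : ContDiffAt ℂ ω g y) :
    C.pull (fun y => f (g y)) y = (C.pull f (g y)).comp (fderiv ℂ g y) := by
  rw [pull, mder_comp hf hg.contMDiffAt, pull, mder_eq_fderiv, ContinuousLinearMap.comp_assoc]

lemma contDiffAt_pull {f : Z → E} {z : Z} (hf : ContMDiffAt 𝓘(ℂ, Z) (cI d) ω f z) :
    ContDiffAt ℂ ω (C.pull f) z := by
  have hx := mem_chart_source (Cn d) (f z)
  have hp := hf.contDiffAt_chartAt hx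
  refine ContDiffAt.congr_of_eventuallyEq ?_ (C.eventually_pull_eq hf hx)
  exact ((C.holo (f z)).comp z hp).clm_comp (hp.fderiv_right le_top)

/-- The structure equation. -/
theorem structure_equation {f : Z → E} {z : Z} (hf : ContMDiffAt 𝓘(ℂ, Z) (cI d) ω f z) (u v : Z) :
    fderiv ℂ (fun y => C.pull f y v) z u - fderiv ℂ (fun y => C.pull f y u) z v =
      - C.tors (f z) (C.pull f z u) (C.pull f z v) := by
  have hx := mem_chart_source (Cn d) (f z)
  have hp := hf.contDiffAt_chartAt hx
  have hev := C.eventually_pull_eq hf hx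
  have h := fderiv_pullback_sub_swap hp (C.holo (f z)) u v
  have key : ∀ v, (fun y => C.pull f y v) =ᶠ[𝓝 z] fun y => C.loc (f z) (chartAt (Cn d) (f z) (f y))
      (fderiv ℂ (fun y => chartAt (Cn d) (f z) (f y)) y v) := fun v => by
    filter_upwards [hev] with y hy
    rw [hy]; rfl
  have hfield : ∀ v, C.field (C.pull f z v) (f z)
      = fderiv ℂ (fun y => chartAt (Cn d) (f z) (f y)) z v := fun v => by
    rw [(key v).eq_of_nhds, loc_self, field]
    exact (C.form (f z)).symm_apply_apply _
  rw [(key v).fderiv_eq, (key u).fderiv_eq, tors, hfield, hfield, neg_sub]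
  exact h

/-- Coframes related by a holomorphic map have related brackets. -/
theorem tors_of_related {d' : ℕ} {E' : Type*} [TopologicalSpace E'] [ChartedSpace (Cn d') E']
    [IsManifold (cI d') ω E'] (C' : Coframe d' E') (f : E → E') (l : Cn d →L[ℂ] Cn d') {x : E}
    (hf : ContMDiffAt (cI d) (cI d') ω f x)
    (h : ∀ᶠ y in 𝓝 x, ∀ v, C'.form (f y) (mder (cI d) (cI d') f y v) = l (C.form y v)) (A B : Cn d) :
    l (C.tors x A B) = C'.tors (f x) (l A) (l B) := by
  let c := chartAt (Cn d) x
  have hx : x ∈ c.source := mem_chart_source _ x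
  have hcs : ContMDiffAt (cI d) (cI d) ω c.symm (c x) := contMDiffAt_chartAt_symm (c.map_source hx)
  have hcx : c.symm (c x) = x := c.left_inv hx
  have hfx : ContMDiffAt (cI d) (cI d') ω f (c.symm (c x)) := by rwa [hcx]
  have hfc : ContMDiffAt (cI d) (cI d') ω (fun z => f (c.symm z)) (c x) := hfx.comp (c x) hcs
  have hrel : ∀ᶠ z in 𝓝 (c x), ∀ v, C'.pull (fun z => f (c.symm z)) z v = l (C.pull c.symm z v) := by
    have h1 := hcs.continuousAt.eventually (by rw [hcx]; exact h)
    have h2 := hcs.continuousAt.eventually (hfx.eventually_nhds)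
    filter_upwards [h1, h2, hcs.eventually_nhds] with z h1 h2 h3 v
    have := h1 (mder (cI d) (cI d) c.symm z v)
    rw [← mder_comp_apply h2 h3] at this
    exact this
  have hpull : ∀ v, C.pull c.symm (c x) v = C.form x v := fun v => by
    change C.form (c.symm (c x)) (mder (cI d) (cI d) c.symm (c x) v) = _
    rw [hcx, mder_chartAt_symm_self]; rfl
  let u := (C.form x).symm A
  let v := (C.form x).symm B
  have hu : C.pull c.symm (c x) u = A := by rw [hpull]; exact (C.form x).apply_symm_apply A
  have hv : C.pull c.symm (c x) v = B := by rw [hpull]; exact (C.form x).apply_symm_apply B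
  -- Both brackets are read off from the structure equations of the pullbacks to the chart, where l
  -- commutes with differentiation.
  have e1 := C.structure_equation hcs u v
  have e2 := C'.structure_equation hfc u v
  have hd : ∀ a b, fderiv ℂ (fun y => C'.pull (fun z => f (c.symm z)) y a) (c x) b =
      l (fderiv ℂ (fun y => C.pull c.symm y a) (c x) b) := by
    intro a b
    have h1 : (fun y => C'.pull (fun z => f (c.symm z)) y a) =ᶠ[𝓝 (c x)]
        fun y => l (C.pull c.symm y a) := by
      filter_upwards [hrel] with z hz using hz a
    rw [h1.fderiv_eq]
    have h2 : DifferentiableAt ℂ (fun y => C.pull c.symm y a) (c x) :=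
      ((C.contDiffAt_pull hcs).clm_apply contDiffAt_const).differentiableAt (by simp)
    have h3 := (l.hasFDerivAt.comp (c x) h2.hasFDerivAt).fderiv
    exact DFunLike.congr_fun h3 b
  rw [hd, hd, ← map_sub, e1, hrel.self_of_nhds, hrel.self_of_nhds, hu, hv, hcx, map_neg, neg_inj]
    at e2
  exact e2

/-- The bracket of a coframe in terms of Lie brackets of vector fields. -/
theorem form_mlieBracket (x : E) (A B : Cn d) :
    C.form x (VectorField.mlieBracket (cI d) (fun y => (C.field A y : TangentSpace (cI d) y))
      (fun y => (C.field B y : TangentSpace (cI d) y)) x) = C.tors x A B := by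
  let c := chartAt (Cn d) x
  have hx : x ∈ c.source := mem_chart_source _ x
  -- The coordinate expression of the constant field A, near x.
  let Y : Cn d → Cn d → Cn d := fun A y => (C.loc x y).inverse A
  have hinv : ∀ᶠ y in 𝓝 (c x), (C.loc x y).IsInvertible := by
    have h1 : (C.loc x (c x)).IsInvertible := by
      rw [loc_self]; exact ⟨C.form x, rfl⟩
    have h2 := (C.holo x).continuousAt
    exact h2.eventually_mem (ContinuousLinearEquiv.isOpen.mem_nhds h1)
  have hloc : DifferentiableAt ℂ (C.loc x) (c x) := (C.holo x).differentiableAt (by simp)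
  have hY : ∀ A, DifferentiableAt ℂ (Y A) (c x) := by
    intro A
    have h1 : ContDiffAt ℂ ω (fun y => (C.loc x y).inverse) (c x) := by
      obtain ⟨e, he⟩ := hinv.self_of_nhds
      have h2 : ContDiffAt ℂ ω ContinuousLinearMap.inverse (C.loc x (c x)) := by
        rw [← he]; exact contDiffAt_map_inverse e
      exact h2.comp (c x) (C.holo x)
    exact (h1.clm_apply contDiffAt_const).differentiableAt (by simp)
  have hYx : ∀ A, Y A (c x) = C.field A x := by
    intro A
    change (C.loc x (c x)).inverse A = _
    rw [loc_self, ContinuousLinearMap.inverse_equiv]; rfl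
  have hfield : ∀ A, (fun y => VectorField.mpullbackWithin 𝓘(ℂ, Cn d) (cI d) (extChartAt (cI d) x).symm
      (fun y => (C.field A y : TangentSpace (cI d) y)) (range (cI d)) y : Cn d → Cn d) =ᶠ[𝓝 (c x)] Y A := by
    intro A
    filter_upwards [c.open_target.mem_nhds (c.map_source hx), hinv] with y hy hi
    have h1 : mder (cI d) (cI d) c.symm y = (mfderivWithin 𝓘(ℂ, Cn d) (cI d) (extChartAt (cI d) x).symm
        (range (cI d)) y : Cn d →L[ℂ] Cn d) := by
      have : range (cI d) = univ := by simp
      rw [this, mfderivWithin_univ]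
      rfl
    change (mfderivWithin 𝓘(ℂ, Cn d) (cI d) (extChartAt (cI d) x).symm
        (range (cI d)) y : Cn d →L[ℂ] Cn d).inverse ((C.form (c.symm y)).symm A) = (C.loc x y).inverse A
    rw [← h1]
    change _ = ((C.form (c.symm y) : Cn d →L[ℂ] Cn d).comp (mder (cI d) (cI d) c.symm y)).inverse A
    rw [ContinuousLinearMap.inverse_equiv_comp]
    rfl
  have hbr : (VectorField.mlieBracket (cI d) (fun y => (C.field A y : TangentSpace (cI d) y))
      (fun y => (C.field B y : TangentSpace (cI d) y)) x : Cn d)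
      = VectorField.lieBracket ℂ (Y A) (Y B) (c x) := by
    let P : Cn d → Cn d → Cn d := fun A y =>
      VectorField.mpullbackWithin 𝓘(ℂ, Cn d) (cI d) (extChartAt (cI d) x).symm
        (fun y => (C.field A y : TangentSpace (cI d) y)) (range (cI d)) y
    have h1 : (VectorField.mlieBracket (cI d) (fun y => (C.field A y : TangentSpace (cI d) y))
        (fun y => (C.field B y : TangentSpace (cI d) y)) x : Cn d) =
      (mder (cI d) (cI d) c x).inverse (VectorField.lieBracketWithin ℂ (P A) (P B)
        ((extChartAt (cI d) x).symm ⁻¹' univ ∩ range (cI d)) (c x)) := rfl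
    have h2 : ((extChartAt (cI d) x).symm ⁻¹' univ ∩ range (cI d)) = univ := by simp
    have h3 := Filter.EventuallyEq.lieBracket_vectorField_eq (𝕜 := ℂ) (E := Cn d) (hfield A) (hfield B)
    refine h1.trans ?_
    rw [mder_chartAt_self, ContinuousLinearMap.inverse_id, h2, VectorField.lieBracketWithin_univ]
    exact h3
  -- Differentiating the identity loc(Y A) = A trades derivatives of the fields for derivatives of
  -- the form, which is how the Lie bracket becomes the antisymmetrized derivative in `tors`.
  have hD : ∀ A u, C.form x (fderiv ℂ (Y A) (c x) u) = - fderiv ℂ (C.loc x) (c x) u (C.field A x) := by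
    intro A u
    have h1 : (fun y => C.loc x y (Y A y)) =ᶠ[𝓝 (c x)] fun _ => A := by
      filter_upwards [hinv] with y hy
      exact DFunLike.congr_fun hy.self_comp_inverse A
    have h2 := (hloc.hasFDerivAt.clm_apply (hY A).hasFDerivAt).fderiv
    rw [h1.fderiv_eq] at h2
    have h3 := DFunLike.congr_fun h2 u
    simp only [fderiv_fun_const, Pi.zero_apply, zero_apply,
      add_apply, ContinuousLinearMap.comp_apply,
      ContinuousLinearMap.flip_apply, hYx] at h3
    change 0 = C.loc x (c x) _ + _ at h3
    rw [loc_self] at h3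
    exact eq_neg_of_add_eq_zero_left h3.symm
  calc C.form x (VectorField.mlieBracket (cI d) (fun y => (C.field A y : TangentSpace (cI d) y))
      (fun y => (C.field B y : TangentSpace (cI d) y)) x)
      = C.form x (VectorField.lieBracket ℂ (Y A) (Y B) (c x)) := congrArg _ hbr
    _ = _ := by
      rw [VectorField.lieBracket, map_sub, hD, hD, hYx, hYx, tors]
      abel

end Coframe

/-! ### The inverse function theorem on manifolds -/

section InverseFunction

variable {E₁ M₁ E₂ M₂ : Type*}
  [NormedAddCommGroup E₁] [NormedSpace ℂ E₁] [CompleteSpace E₁] [TopologicalSpace M₁]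
  [ChartedSpace E₁ M₁] [IsManifold 𝓘(ℂ, E₁) ω M₁]
  [NormedAddCommGroup E₂] [NormedSpace ℂ E₂] [TopologicalSpace M₂]
  [ChartedSpace E₂ M₂] [IsManifold 𝓘(ℂ, E₂) ω M₂]

/-- The inverse function theorem for holomorphic maps of manifolds. -/
theorem exists_openPartialHomeomorph_of_mder {f : M₁ → M₂} {x : M₁}
    (hf : ContMDiffAt 𝓘(ℂ, E₁) 𝓘(ℂ, E₂) ω f x) (f' : E₁ ≃L[ℂ] E₂)
    (hf' : mder 𝓘(ℂ, E₁) 𝓘(ℂ, E₂) f x = f') :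
    ∃ e : OpenPartialHomeomorph M₁ M₂, x ∈ e.source ∧ EqOn e f e.source ∧
      (∀ y ∈ e.source, ContMDiffAt 𝓘(ℂ, E₁) 𝓘(ℂ, E₂) ω f y) ∧
      ContMDiffOn 𝓘(ℂ, E₁) 𝓘(ℂ, E₂) ω e e.source ∧
      ContMDiffOn 𝓘(ℂ, E₂) 𝓘(ℂ, E₁) ω e.symm e.target := by
  let c₁ := chartAt E₁ x
  let c₂ := chartAt E₂ (f x)
  have hx₁ : x ∈ c₁.source := mem_chart_source _ x
  have hx₂ : f x ∈ c₂.source := mem_chart_source _ _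
  have hc₁ : ∀ y ∈ c₁.source, ContMDiffAt 𝓘(ℂ, E₁) 𝓘(ℂ, E₁) ω c₁ y := fun y hy =>
    contMDiffAt_of_mem_maximalAtlas (IsManifold.chart_mem_maximalAtlas x) hy
  have hc₁' : ∀ y ∈ c₁.target, ContMDiffAt 𝓘(ℂ, E₁) 𝓘(ℂ, E₁) ω c₁.symm y := fun y hy =>
    contMDiffAt_symm_of_mem_maximalAtlas (IsManifold.chart_mem_maximalAtlas x) hy
  have hc₂ : ∀ y ∈ c₂.source, ContMDiffAt 𝓘(ℂ, E₂) 𝓘(ℂ, E₂) ω c₂ y := fun y hy =>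
    contMDiffAt_of_mem_maximalAtlas (IsManifold.chart_mem_maximalAtlas (f x)) hy
  have hc₂' : ∀ y ∈ c₂.target, ContMDiffAt 𝓘(ℂ, E₂) 𝓘(ℂ, E₂) ω c₂.symm y := fun y hy =>
    contMDiffAt_symm_of_mem_maximalAtlas (IsManifold.chart_mem_maximalAtlas (f x)) hy
  have hfx : ContMDiffAt 𝓘(ℂ, E₁) 𝓘(ℂ, E₂) ω f (c₁.symm (c₁ x)) := by rwa [c₁.left_inv hx₁]
  have hfc : ContMDiffAt 𝓘(ℂ, E₁) 𝓘(ℂ, E₂) ω (fun y => f (c₁.symm y)) (c₁ x) :=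
    hfx.comp (c₁ x) (hc₁' _ (c₁.map_source hx₁))
  let g : E₁ → E₂ := fun y => c₂ (f (c₁.symm y))
  have hgx : g (c₁ x) = c₂ (f x) := by simp only [g]; rw [c₁.left_inv hx₁]
  have hgm : ContMDiffAt 𝓘(ℂ, E₁) 𝓘(ℂ, E₂) ω g (c₁ x) :=
    ContMDiffAt.comp (c₁ x) (g := c₂) (f := fun y => f (c₁.symm y))
      (hc₂ _ (by rw [c₁.left_inv hx₁]; exact hx₂)) hfc
  have hg : ContDiffAt ℂ ω g (c₁ x) := contMDiffAt_iff_contDiffAt.1 hgm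
  have hid₁ : mder 𝓘(ℂ, E₁) 𝓘(ℂ, E₁) c₁ x = ContinuousLinearMap.id ℂ _ :=
    mfderiv_extChartAt_self (I := 𝓘(ℂ, E₁)) (x := x)
  have hid₂ : mder 𝓘(ℂ, E₂) 𝓘(ℂ, E₂) c₂ (f x) = ContinuousLinearMap.id ℂ _ :=
    mfderiv_extChartAt_self (I := 𝓘(ℂ, E₂)) (x := f x)
  have hid₁' : mder 𝓘(ℂ, E₁) 𝓘(ℂ, E₁) c₁.symm (c₁ x) = ContinuousLinearMap.id ℂ _ := by
    have h1 := mder_comp (I₁ := 𝓘(ℂ, E₁)) (x := x) (hc₁' _ (c₁.map_source hx₁)) (hc₁ x hx₁)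
    rw [hid₁, ContinuousLinearMap.comp_id] at h1
    rw [← h1, ← mder_id (I₁ := 𝓘(ℂ, E₁)) x]
    refine mder_congr ?_
    filter_upwards [c₁.open_source.mem_nhds hx₁] with z hz
    exact c₁.left_inv hz
  have hg' : HasFDerivAt g (f' : E₁ →L[ℂ] E₂) (c₁ x) := by
    have h1 : fderiv ℂ g (c₁ x) = f' := by
      rw [← mder_eq_fderiv, mder_comp (f := fun y => f (c₁.symm y)) (g := c₂)
        (hc₂ _ (by rw [c₁.left_inv hx₁]; exact hx₂)) hfc, mder_comp hfx
        (hc₁' _ (c₁.map_source hx₁)), hid₁', c₁.left_inv hx₁, hid₂, hf']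
      rfl
    rw [← h1]
    exact (hg.differentiableAt (by simp)).hasFDerivAt
  let Φ := hg.toOpenPartialHomeomorph g hg' (by simp)
  have hΦx : c₁ x ∈ Φ.source := hg.mem_toOpenPartialHomeomorph_source hg' (by simp)
  have hsymm : ContDiffAt ℂ ω Φ.symm (c₂ (f x)) := by
    have h := hg.to_localInverse hg' (by simp)
    rw [hgx] at h
    exact h
  have hΦs : Φ.symm (c₂ (f x)) = c₁ x := by rw [← hgx]; exact Φ.left_inv hΦx
  let e₀ := (c₁.trans Φ).trans c₂.symm
  have he₀ : ∀ y, e₀ y = c₂.symm (c₂ (f (c₁.symm (c₁ y)))) := fun y => rfl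
  -- The inverse function theorem gives holomorphy of the inverse at one point; this spreads to a
  -- neighbourhood, to which the domain is now restricted.
  have hS : ∀ᶠ y in 𝓝 x, f y ∈ c₂.source ∧ y ∈ c₁.source ∧
      ContMDiffAt 𝓘(ℂ, E₁) 𝓘(ℂ, E₂) ω f y ∧ ContDiffAt ℂ ω Φ.symm (c₂ (f y)) := by
    refine (hf.continuousAt.eventually_mem (c₂.open_source.mem_nhds hx₂)).and
      (Eventually.and (c₁.open_source.mem_nhds hx₁) (hf.eventually_nhds.and ?_))
    have h1 : ContinuousAt (fun y => c₂ (f y)) x := (hc₂ _ hx₂).continuousAt.comp hf.continuousAt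
    exact h1.eventually (hsymm.eventually (by simp))
  obtain ⟨S, hS, hSo, hxS⟩ := _root_.eventually_nhds_iff.1 hS
  let e := e₀.restrOpen S hSo
  have hsrc : ∀ y ∈ e.source, y ∈ c₁.source ∧ c₁ y ∈ Φ.source ∧ y ∈ S := by
    intro y hy
    have h1 : y ∈ e₀.source ∩ S := hy
    simp only [e₀, OpenPartialHomeomorph.trans_source] at h1
    exact ⟨h1.1.1.1, h1.1.1.2, h1.2⟩
  have heq : EqOn e f e.source := by
    intro y hy
    obtain ⟨h1, h2, h3⟩ := hsrc y hy
    change c₂.symm (c₂ (f (c₁.symm (c₁ y)))) = f y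
    rw [c₁.left_inv h1, c₂.left_inv (hS y h3).1]
  refine ⟨e, ?_, heq, fun y hy => (hS y (hsrc y hy).2.2).2.2.1, ?_, ?_⟩
  · refine ⟨?_, hxS⟩
    simp only [e₀, OpenPartialHomeomorph.trans_source]
    refine ⟨⟨hx₁, hΦx⟩, ?_⟩
    change c₂ (f (c₁.symm (c₁ x))) ∈ c₂.target
    rw [c₁.left_inv hx₁]
    exact c₂.map_source hx₂
  · intro y hy
    exact ((hS y (hsrc y hy).2.2).2.2.1.contMDiffWithinAt).congr (fun z hz => heq hz) (heq hy)
  · intro y hy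
    have hy' := e.map_target hy
    obtain ⟨h1, h2, h3⟩ := hsrc _ hy'
    have h4 : f (e.symm y) = y := by rw [← heq hy']; exact e.right_inv hy
    obtain ⟨h5, -, -, h6⟩ := hS _ h3
    rw [h4] at h5 h6
    have h7 : e.symm y ∈ e.source := hy'
    have h8 : Φ.symm (c₂ y) ∈ c₁.target := by
      have : Φ (c₁ (e.symm y)) = c₂ y := by
        change c₂ (f (c₁.symm (c₁ (e.symm y)))) = c₂ y
        rw [c₁.left_inv h1, h4]
      rw [← this, Φ.left_inv h2]
      exact c₁.map_source h1
    have h9 : ContMDiffAt 𝓘(ℂ, E₂) 𝓘(ℂ, E₁) ω (fun z => Φ.symm (c₂ z)) y :=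
      ContMDiffAt.comp y (g := Φ.symm) (f := c₂) h6.contMDiffAt (hc₂ y h5)
    exact (ContMDiffAt.comp y (g := c₁.symm) (hc₁' _ h8) h9).contMDiffWithinAt

end InverseFunction

/-! ### Exponential maps of coframes and the equation for their derivative -/

namespace Coframe

variable {d : ℕ} {E : Type*} [TopologicalSpace E] [ChartedSpace (Cn d) E] [IsManifold (cI d) ω E]
  (C : Coframe d E) {Z : Type*} [NormedAddCommGroup Z] [NormedSpace ℂ Z]

lemma eventually_loc_isInvertible (x : E) :
    ∀ᶠ y in 𝓝 (chartAt (Cn d) x x), (C.loc x y).IsInvertible := by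
  have h1 : (C.loc x (chartAt (Cn d) x x)).IsInvertible := by
    rw [loc_self]; exact ⟨C.form x, rfl⟩
  exact (C.holo x).continuousAt.eventually_mem (ContinuousLinearEquiv.isOpen.mem_nhds h1)

lemma contDiffAt_loc_inverse (x : E) :
    ContDiffAt ℂ ω (fun y => (C.loc x y).inverse) (chartAt (Cn d) x x) := by
  obtain ⟨e, he⟩ := (C.eventually_loc_isInvertible x).self_of_nhds
  have h2 : ContDiffAt ℂ ω ContinuousLinearMap.inverse (C.loc x (chartAt (Cn d) x x)) := by
    rw [← he]; exact contDiffAt_map_inverse e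
  exact h2.comp _ (C.holo x)

/-- The exponential map of a coframe: the integral curves of the constant fields. -/
theorem exists_exp (x₀ : E) :
    ∃ Φ : Cn d × Cn d → E, ContMDiffAt 𝓘(ℂ, Cn d × Cn d) (cI d) ω Φ (0, chartAt (Cn d) x₀ x₀) ∧
      (∀ᶠ x in 𝓝 (chartAt (Cn d) x₀ x₀), Φ (0, x) = (chartAt (Cn d) x₀).symm x) ∧
      ∀ᶠ p in 𝓝 ((0, chartAt (Cn d) x₀ x₀) : Cn d × Cn d), C.pull Φ p (p.1, 0) = p.1 := by
  let c := chartAt (Cn d) x₀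
  have hx : x₀ ∈ c.source := mem_chart_source _ x₀
  obtain ⟨φ, hφ, hφ0, hφ1⟩ := exists_exponential (C.contDiffAt_loc_inverse x₀).analyticAt
  have hφx : φ (0, c x₀) = c x₀ := hφ0.self_of_nhds
  have hct : φ (0, c x₀) ∈ c.target := by rw [hφx]; exact c.map_source hx
  have hΦ : ContMDiffAt 𝓘(ℂ, Cn d × Cn d) (cI d) ω (fun p => c.symm (φ p)) (0, c x₀) :=
    ContMDiffAt.comp (g := c.symm) (f := φ) _ (contMDiffAt_chartAt_symm hct)
      hφ.contDiffAt.contMDiffAt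
  refine ⟨fun p => c.symm (φ p), hΦ, ?_, ?_⟩
  · filter_upwards [hφ0] with x h
    rw [h]
  · have hΦs : c.symm (φ (0, c x₀)) ∈ (chartAt (Cn d) x₀).source := c.map_target hct
    filter_upwards [hφ1, C.eventually_pull_eq hΦ hΦs,
      (hφ.continuousAt.eventually_mem (c.open_target.mem_nhds hct)).eventually_nhds,
      hφ.continuousAt.eventually (hφx ▸ C.eventually_loc_isInvertible x₀)] with p h1 h2 h3 h4
    rw [h2]
    have h5 : (fun y => c (c.symm (φ y))) =ᶠ[𝓝 p] φ := by
      filter_upwards [h3] with y hy using c.right_inv hy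
    change C.loc x₀ (c (c.symm (φ p))) (fderiv ℂ (fun y => c (c.symm (φ y))) p (p.1, 0)) = _
    rw [h5.fderiv_eq, h5.eq_of_nhds, h1]
    exact DFunLike.congr_fun h4.self_comp_inverse p.1

end Coframe

section LinearODE

variable {V : Type*} [NormedAddCommGroup V] [NormedSpace ℂ V] [CompleteSpace V]

/-- Solutions of a linear differential equation with constant coefficients. -/
lemma eq_exp_of_hasDerivAt {M : V →L[ℂ] V} {z : ℝ → V}
    (hz : ∀ t ∈ Icc (0 : ℝ) 1, HasDerivAt z (M (z t)) t) : z 1 = NormedSpace.exp M (z 0) := by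
  have he : ∀ t : ℝ, HasDerivAt (fun t : ℝ => NormedSpace.exp (t • M) (z 0))
      (M (NormedSpace.exp (t • M) (z 0))) t := by
    intro t
    have h1 := hasDerivAt_exp_smul_const' (𝕂 := ℝ) M t
    have h2 : HasFDerivAt (fun L : V →L[ℂ] V => L (z 0))
      ((ContinuousLinearMap.apply ℂ V (z 0)).restrictScalars ℝ) (NormedSpace.exp (t • M)) :=
      ((ContinuousLinearMap.apply ℂ V (z 0)).restrictScalars ℝ).hasFDerivAt
    exact h2.comp_hasDerivAt t h1
  have h := ODE_solution_unique_of_mem_Icc_right (v := fun _ => M) (s := fun _ => univ)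
    (K := ‖M‖₊) (f := z) (g := fun t : ℝ => NormedSpace.exp (t • M) (z 0)) (a := 0) (b := 1)
    (fun t _ => M.lipschitz.lipschitzOnWith) (fun t ht => (hz t ht).continuousAt.continuousWithinAt)
    (fun t ht => (hz t (Ico_subset_Icc_self ht)).hasDerivWithinAt) (fun _ _ => mem_univ _)
    (fun t _ => (he t).continuousAt.continuousWithinAt)
    (fun t _ => (he t).hasDerivWithinAt) (fun _ _ => mem_univ _) (by simp)
  simpa using h (right_mem_Icc.2 zero_le_one)

/-- The exponential of an operator preserves the closed invariant subspaces. -/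
lemma exp_mem_of_invariant [FiniteDimensional ℂ V] {M : V →L[ℂ] V} {S : Submodule ℂ V}
    (h : ∀ v ∈ S, M v ∈ S) {v : V} (hv : v ∈ S) : NormedSpace.exp M v ∈ S := by
  have h1 : ∀ n : ℕ, (M ^ n) v ∈ S := by
    intro n
    induction n with
    | zero => simpa using hv
    | succ n ih =>
      rw [pow_succ']
      exact h _ ih
  have h2 := (NormedSpace.exp_series_hasSum_exp' (𝕂 := ℂ) M).mapL (ContinuousLinearMap.apply ℂ V v)
  refine S.closed_of_finiteDimensional.mem_of_tendsto h2 (Eventually.of_forall fun s => ?_)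
  refine S.sum_mem fun n _ => ?_
  exact S.smul_mem _ (h1 n)

end LinearODE

/-- The operator `(B, y) ↦ (0, B - [A, y])` which governs the exponential map. -/
def expGen {V : Type*} [NormedAddCommGroup V] [NormedSpace ℂ V] (br : V →L[ℂ] V →L[ℂ] V) (A : V) :
    (V × V) →L[ℂ] (V × V) :=
  (0 : (V × V) →L[ℂ] V).prod (ContinuousLinearMap.fst ℂ V V - (br A).comp (ContinuousLinearMap.snd ℂ V V))

namespace Coframe

variable {d : ℕ} {E : Type*} [TopologicalSpace E] [ChartedSpace (Cn d) E] [IsManifold (cI d) ω E]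
  (C : Coframe d E) {V Z : Type*} [NormedAddCommGroup V] [NormedSpace ℂ V]
  [NormedAddCommGroup Z] [NormedSpace ℂ Z]

/-- The derivative of a map which is exponential in its first variable. -/
theorem pull_eq_exp {Θ : V × Z → E} {z₀ : Z} (hΘ : ContMDiffAt 𝓘(ℂ, V × Z) (cI d) ω Θ (0, z₀))
    (l : V →L[ℂ] Cn d) (hl : ∀ᶠ p in 𝓝 ((0, z₀) : V × Z), C.pull Θ p (p.1, 0) = l p.1)
    (br : Cn d →L[ℂ] Cn d →L[ℂ] Cn d) (hbr : ∀ (y : E) (a : V) (B : Cn d), C.tors y (l a) B = br (l a) B) :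
    ∀ᶠ p in 𝓝 ((0, z₀) : V × Z), ∀ (b : V) (v : Z),
      C.pull Θ p (b, v) = (NormedSpace.exp (expGen br (l p.1)) (l b, C.pull Θ (0, p.2) (0, v))).2 := by
  obtain ⟨r, hr, hball⟩ := Metric.eventually_nhds_iff_ball.1 (hΘ.eventually_nhds.and hl)
  have hsmooth : ∀ p ∈ Metric.ball ((0, z₀) : V × Z) r, ContMDiffAt 𝓘(ℂ, V × Z) (cI d) ω Θ p :=
    fun p hp => (hball p hp).1
  have hmemball : ∀ (a : V) (z : Z), (a, z) ∈ Metric.ball ((0, z₀) : V × Z) r ↔ ‖a‖ < r ∧ ‖z - z₀‖ < r := by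
    intro a z
    rw [Metric.mem_ball, dist_eq_norm, Prod.mk_sub_mk, sub_zero, Prod.norm_mk, max_lt_iff]
  -- homogeneity
  have hom1 : ∀ (t : ℂ) (a : V) (z : Z), t ≠ 0 → (t • a, z) ∈ Metric.ball ((0, z₀) : V × Z) r →
      C.pull Θ (t • a, z) (a, 0) = l a := by
    intro t a z ht hm
    have h1 := (hball _ hm).2
    change C.pull Θ (t • a, z) (t • a, 0) = l (t • a) at h1
    have h2 : ((t • a, 0) : V × Z) = t • (a, 0) := by simp
    rw [h2, map_smul, map_smul] at h1
    exact smul_right_injective _ ht h1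
  have hom : ∀ (t : ℂ) (a : V) (z : Z), (t • a, z) ∈ Metric.ball ((0, z₀) : V × Z) r →
      C.pull Θ (t • a, z) (a, 0) = l a := by
    intro t a z hm
    -- At t = 0 the hypothesis on radial vectors is void; the value there is recovered by continuity
    -- from t ≠ 0.
    by_cases ht : t = 0
    · subst ht
      rw [zero_smul] at hm ⊢
      have hc : ContinuousAt (fun s : ℂ => ((s • a, z) : V × Z)) 0 := by fun_prop
      have hm' : (((0 : ℂ) • a, z) : V × Z) ∈ Metric.ball ((0, z₀) : V × Z) r := by rwa [zero_smul]
      have h1 : ContinuousAt (fun s : ℂ => C.pull Θ (s • a, z) (a, 0)) 0 :=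
        (ContinuousAt.comp (g := C.pull Θ) (f := fun s : ℂ => ((s • a, z) : V × Z)) (C.contDiffAt_pull (hsmooth _ hm')).continuousAt hc).clm_apply
          continuousAt_const
      have h2 : Tendsto (fun s : ℂ => C.pull Θ (s • a, z) (a, 0)) (𝓝[≠] 0) (𝓝 (l a)) := by
        refine tendsto_const_nhds.congr' ?_
        filter_upwards [self_mem_nhdsWithin, nhdsWithin_le_nhds
          (hc.eventually_mem (Metric.isOpen_ball.mem_nhds hm'))] with s hs hs'
        exact (hom1 s a z hs hs').symm
      have h3 := tendsto_nhds_unique (h1.tendsto.mono_left nhdsWithin_le_nhds) h2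
      rwa [zero_smul] at h3
    · exact hom1 t a z ht hm
  filter_upwards [Metric.ball_mem_nhds _ hr] with p hp b v
  obtain ⟨a, z⟩ := p
  have hp' := (hmemball a z).1 hp
  -- The coframe evaluated on the variation field of a family of rays, an analogue of a Jacobi
  -- field; it satisfies y' = b − [a, y].
  let y : ℝ → Cn d := fun t => C.pull Θ ((t : ℂ) • a, z) ((t : ℂ) • b, v)
  have hy : ∀ t ∈ Icc (0 : ℝ) 1, HasDerivAt y (l b - br (l a) (y t)) t := by
    intro t ht
    -- The family of rays: the first variable is time, along which the coframe is constant by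
    -- homogeneity; the second is the variation. The structure equation in these two variables is
    -- the differential equation for y.
    let g : ℂ × ℂ → V × Z := fun q => (q.1 • (a + q.2 • b), z + q.2 • v)
    have hg : ∀ q, ContDiffAt ℂ ω g q := fun q => by
      apply ContDiff.contDiffAt
      fun_prop
    have hg0 : g (t, 0) = ((t : ℂ) • a, z) := by simp [g]
    have hgm : g (t, 0) ∈ Metric.ball ((0, z₀) : V × Z) r := by
      rw [hg0, hmemball]
      refine ⟨?_, hp'.2⟩
      rw [norm_smul, Complex.norm_real, Real.norm_of_nonneg ht.1]
      exact (mul_le_of_le_one_left (norm_nonneg _) ht.2).trans_lt hp'.1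
    have hΨ : ContMDiffAt 𝓘(ℂ, ℂ × ℂ) (cI d) ω (fun q => Θ (g q)) (t, 0) :=
      ContMDiffAt.comp (g := Θ) (f := g) _ (hsmooth _ hgm) (hg _).contMDiffAt
    have hgd : ∀ q w, fderiv ℂ g q w = (q.1 • w.2 • b + w.1 • (a + q.2 • b), w.2 • v) := by
      intro q w
      have h1 : HasFDerivAt (fun q : ℂ × ℂ => q.1) (ContinuousLinearMap.fst ℂ ℂ ℂ) q := hasFDerivAt_fst
      have h2 : HasFDerivAt (fun q : ℂ × ℂ => q.2) (ContinuousLinearMap.snd ℂ ℂ ℂ) q := hasFDerivAt_snd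
      have h3 := (h1.fun_smul ((h2.smul_const b).const_add a)).prodMk ((h2.smul_const v).const_add z)
      rw [HasFDerivAt.fderiv (f := g) h3]
      simp
    have hgd1 : ∀ q, fderiv ℂ g q (1, 0) = (a + q.2 • b, 0) := fun q => by simp [hgd]
    have hgd2 : ∀ q, fderiv ℂ g q (0, 1) = (q.1 • b, v) := fun q => by simp [hgd]
    have hev : ∀ᶠ q in 𝓝 ((t, 0) : ℂ × ℂ), g q ∈ Metric.ball ((0, z₀) : V × Z) r :=
      (hg _).continuousAt.eventually_mem (Metric.isOpen_ball.mem_nhds hgm)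
    have hpull : ∀ᶠ q in 𝓝 ((t, 0) : ℂ × ℂ),
        C.pull (fun q => Θ (g q)) q = (C.pull Θ (g q)).comp (fderiv ℂ g q) := by
      filter_upwards [hev] with q hq
      exact C.pull_comp (hsmooth _ hq) (hg q)
    have hy1 : (fun q => C.pull (fun q => Θ (g q)) q (1, 0)) =ᶠ[𝓝 ((t, 0) : ℂ × ℂ)]
        fun q => l (a + q.2 • b) := by
      filter_upwards [hpull, hev] with q hq hq'
      rw [hq, ContinuousLinearMap.comp_apply, hgd1]
      exact hom _ _ _ hq'
    have hy2 : (fun q => C.pull (fun q => Θ (g q)) q (0, 1)) =ᶠ[𝓝 ((t, 0) : ℂ × ℂ)]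
        fun q => C.pull Θ (g q) (q.1 • b, v) := by
      filter_upwards [hpull] with q hq
      rw [hq, ContinuousLinearMap.comp_apply, hgd2]
    have hs := C.structure_equation hΨ (1, 0) (0, 1)
    have hl' : fderiv ℂ (fun q : ℂ × ℂ => l (a + q.2 • b)) (t, 0) (0, 1) = l b := by
      have h2 : HasFDerivAt (fun q : ℂ × ℂ => q.2) (ContinuousLinearMap.snd ℂ ℂ ℂ) (t, 0) := hasFDerivAt_snd
      have h3 := l.hasFDerivAt.comp ((t, 0) : ℂ × ℂ) ((h2.smul_const b).const_add a)
      rw [HasFDerivAt.fderiv (f := fun q : ℂ × ℂ => l (a + q.2 • b)) h3]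
      simp
    rw [hy1.fderiv_eq, hl', hy1.eq_of_nhds, hy2.eq_of_nhds, hbr, hg0] at hs
    have hd : DifferentiableAt ℂ (fun q => C.pull (fun q => Θ (g q)) q (0, 1)) (t, 0) :=
      ((C.contDiffAt_pull hΨ).clm_apply contDiffAt_const).differentiableAt (by simp)
    have hcurve : HasDerivAt (fun s : ℝ => ((s : ℂ), (0 : ℂ))) (1, 0) t :=
      (show HasDerivAt (fun s : ℝ => (s : ℂ)) 1 t from Complex.ofRealCLM.hasDerivAt).prodMk
        (hasDerivAt_const _ _)
    have hfin := HasFDerivAt.comp_hasDerivAt (f := fun s : ℝ => ((s : ℂ), (0 : ℂ))) t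
      (hd.hasFDerivAt.restrictScalars ℝ) hcurve
    have hval : fderiv ℂ (fun q => C.pull (fun q => Θ (g q)) q (0, 1)) (t, 0) (1, 0)
        = l b - br (l a) (y t) := by
      rw [sub_eq_iff_eq_add] at hs
      rw [hs]
      simp [y, sub_eq_neg_add]
    have hfin' : HasDerivAt (fun s : ℝ => C.pull (fun q => Θ (g q)) ((s : ℂ), 0) (0, 1))
        (l b - br (l a) (y t)) t := by
      rw [← hval]; exact hfin
    refine hfin'.congr_of_eventuallyEq ?_
    filter_upwards [hcurve.continuousAt.eventually hy2] with s hs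
    refine Eq.trans ?_ hs.symm
    simp [y, g]
  -- Adjoining the constant l b makes the inhomogeneous equation for y a homogeneous linear one.
  have hz := eq_exp_of_hasDerivAt (M := expGen br (l a)) (z := fun t => (l b, y t)) (fun t ht => by
    simpa [expGen] using (hasDerivAt_const t (l b)).prodMk (hy t ht))
  have := congrArg Prod.snd hz
  simpa [y] using this

end Coframe

/-! ### Maurer-Cartan forms and the adjoint representation -/

section MaurerCartan

variable {d : ℕ} {G : Type u} [Group G] [TopologicalSpace G] [ChartedSpace (Cn d) G]
  [ComplexLieGroup d G]

lemma contMDiffAt_mul_left' (g x : G) : ContMDiffAt (cI d) (cI d) ω (fun y => g * y) x :=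
  (contMDiff_mul_left (I := cI d) (n := ω) (a := g)).contMDiffAt

lemma contMDiffAt_mul_right' (g x : G) : ContMDiffAt (cI d) (cI d) ω (fun y => y * g) x :=
  (contMDiff_mul_right (I := cI d) (n := ω) (a := g)).contMDiffAt

lemma contMDiffAt_conj (g x : G) : ContMDiffAt (cI d) (cI d) ω (fun y => g * y * g⁻¹) x :=
  (contMDiffAt_mul_right' g⁻¹ (g * x)).comp x (contMDiffAt_mul_left' g x)

lemma mder_mul_left_comp (g h x : G) :
    (mder (cI d) (cI d) (fun y => g * y) (h * x)).comp (mder (cI d) (cI d) (fun y => h * y) x)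
      = mder (cI d) (cI d) (fun y => g * h * y) x := by
  rw [← mder_comp (contMDiffAt_mul_left' g _) (contMDiffAt_mul_left' h x)]
  simp only [mul_assoc]

omit [ComplexLieGroup d G] in
lemma mder_one_mul (x : G) :
    mder (cI d) (cI d) (fun y => (1 : G) * y) x = ContinuousLinearMap.id ℂ _ := by
  simp only [one_mul]; exact mder_id x

/-- The value at `g` of the Maurer-Cartan form. -/
def mcForm (d : ℕ) {G : Type u} [Group G] [TopologicalSpace G] [ChartedSpace (Cn d) G]
    [ComplexLieGroup d G] (g : G) : Cn d ≃L[ℂ] Cn d :=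
  ContinuousLinearEquiv.equivOfInverse (mder (cI d) (cI d) (fun y => g⁻¹ * y) g)
    (mder (cI d) (cI d) (fun y => g * y) 1)
    (fun v => by
      have h := mder_mul_left_comp (d := d) g g⁻¹ g
      rw [inv_mul_cancel, mul_inv_cancel, mder_one_mul] at h
      exact DFunLike.congr_fun h v)
    (fun v => by
      have h := mder_mul_left_comp (d := d) g⁻¹ g 1
      rw [mul_one, inv_mul_cancel, mder_one_mul] at h
      exact DFunLike.congr_fun h v)

lemma mcForm_apply (g : G) (v : Cn d) :
    mcForm d g v = mder (cI d) (cI d) (fun y => g⁻¹ * y) g v := rfl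

/-- The Maurer-Cartan form of a complex Lie group. -/
def mc (d : ℕ) (G : Type u) [Group G] [TopologicalSpace G] [ChartedSpace (Cn d) G]
    [ComplexLieGroup d G] : Coframe d G where
  form := mcForm d
  holo := by
    intro x₀
    let c := chartAt (Cn d) x₀
    let c₁ := chartAt (Cn d) (1 : G)
    -- The Maurer-Cartan form is the derivative of (x, y) ↦ x⁻¹y in y, taken on the diagonal. There
    -- the product is 1, where the chart at 1 has derivative the identity, so holomorphy of the form
    -- follows from that of this one function.
    let h : Cn d × Cn d → Cn d := fun p => c₁ ((c.symm p.1)⁻¹ * c.symm p.2)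
    have hct : c x₀ ∈ c.target := c.map_source (mem_chart_source _ _)
    have hF : ∀ p : Cn d × Cn d, p.1 ∈ c.target → p.2 ∈ c.target →
        ContMDiffAt 𝓘(ℂ, Cn d × Cn d) (cI d) ω (fun p : Cn d × Cn d => (c.symm p.1)⁻¹ * c.symm p.2) p := by
      intro p h1 h2
      have e1 : ContMDiffAt 𝓘(ℂ, Cn d × Cn d) (cI d) ω (fun p : Cn d × Cn d => c.symm p.1) p :=
        ContMDiffAt.comp (g := c.symm) p (contMDiffAt_chartAt_symm h1) contDiffAt_fst.contMDiffAt
      have e2 : ContMDiffAt 𝓘(ℂ, Cn d × Cn d) (cI d) ω (fun p : Cn d × Cn d => c.symm p.2) p :=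
        ContMDiffAt.comp (g := c.symm) p (contMDiffAt_chartAt_symm h2) contDiffAt_snd.contMDiffAt
      exact e1.inv.mul e2
    have hh : ∀ x ∈ c.target, ContDiffAt ℂ ω h (x, x) := by
      intro x hx
      refine (hF (x, x) hx hx).contDiffAt_chartAt (x := (1 : G)) ?_
      simp
    have hd : ContDiffAt ℂ ω (fun x : Cn d => (fderiv ℂ h (x, x)).comp (ContinuousLinearMap.inr ℂ (Cn d) (Cn d)))
        (c x₀) := by
      have h1 : ContDiffAt ℂ ω (fun x : Cn d => fderiv ℂ h (x, x)) (c x₀) :=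
        ContDiffAt.comp (g := fderiv ℂ h) (f := fun x : Cn d => (x, x)) (c x₀)
          ((hh _ hct).fderiv_right le_top) (contDiffAt_id.prodMk contDiffAt_id)
      exact h1.clm_comp contDiffAt_const
    refine hd.congr_of_eventuallyEq ?_
    filter_upwards [c.open_target.mem_nhds hct] with x hx
    have hg : ContMDiffAt (cI d) (cI d) ω (fun y => (c.symm x)⁻¹ * c.symm y) x :=
      (contMDiffAt_mul_left' _ _).comp x (contMDiffAt_chartAt_symm hx)
    have h1 : (mcForm d (c.symm x) : Cn d →L[ℂ] Cn d).comp (mder (cI d) (cI d) c.symm x)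
        = mder (cI d) (cI d) (fun y => (c.symm x)⁻¹ * c.symm y) x :=
      (mder_comp (contMDiffAt_mul_left' _ _) (contMDiffAt_chartAt_symm hx)).symm
    have h2 : mder (cI d) (cI d) (fun y => (c.symm x)⁻¹ * c.symm y) x
        = fderiv ℂ (fun y => h (x, y)) x := by
      have h3 := mder_eq_chartAt_symm_comp_fderiv hg (x := (1 : G))
        (by simp)
      rw [h3, inv_mul_cancel, mder_chartAt_symm_self, ContinuousLinearMap.id_comp]
    refine h1.trans (h2.trans ?_)
    have h4 : HasFDerivAt (fun y : Cn d => (x, y)) (ContinuousLinearMap.inr ℂ (Cn d) (Cn d)) x :=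
      hasFDerivAt_prodMk_right x x
    exact (((hh x hx).differentiableAt (by simp)).hasFDerivAt.comp x h4).fderiv

/-- The Lie bracket of a complex Lie group, as a continuous bilinear map. -/
def lieBr (d : ℕ) (G : Type u) [Group G] [TopologicalSpace G] [ChartedSpace (Cn d) G]
    [ComplexLieGroup d G] : Cn d →L[ℂ] Cn d →L[ℂ] Cn d :=
  LinearMap.toContinuousLinearMap
    { toFun := fun A => LinearMap.toContinuousLinearMap
        { toFun := fun B => (show LieAlg d G from ⁅(show LieAlg d G from A), (show LieAlg d G from B)⁆)
          map_add' := lie_add (L := LieAlg d G) (M := LieAlg d G) A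
          map_smul' := fun c => lie_smul (R := ℂ) (L := LieAlg d G) (M := LieAlg d G) c A }
      map_add' := fun x y => by
        ext1 B
        exact add_lie (L := LieAlg d G) (M := LieAlg d G) x y B
      map_smul' := fun c x => by
        ext1 B
        exact smul_lie (R := ℂ) (L := LieAlg d G) (M := LieAlg d G) c x B }

/-- The structure equation of a Lie group. -/
theorem tors_mc (g : G) (A B : Cn d) : (mc d G).tors g A B = lieBr d G A B := by
  rw [← Coframe.form_mlieBracket]
  have h := congrFun (mulInvariantVector_mlieBracket (I := cI d) (G := G) A B) g
  have h1 : (VectorField.mlieBracket (cI d) (fun y => ((mc d G).field A y : TangentSpace (cI d) y))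
      (fun y => ((mc d G).field B y : TangentSpace (cI d) y)) g : Cn d)
      = (mcForm d g).symm (lieBr d G A B) := h.symm
  rw [h1]
  exact (mcForm d g).apply_symm_apply _

end MaurerCartan

section AdjointRepresentation

variable {d : ℕ} {G : Type u} [Group G] [TopologicalSpace G] [ChartedSpace (Cn d) G]
  {E₁ H₁ M₁ : Type*} [NormedAddCommGroup E₁] [NormedSpace ℂ E₁] [TopologicalSpace H₁]
  [TopologicalSpace M₁] [ChartedSpace H₁ M₁] {I₁ : ModelWithCorners ℂ E₁ H₁}
  {Z : Type*} [NormedAddCommGroup Z] [NormedSpace ℂ Z]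

/-- The adjoint representation, on the underlying vector space of the Lie algebra. -/
def adm (d : ℕ) {G : Type u} [Group G] [TopologicalSpace G] [ChartedSpace (Cn d) G] (g : G) :
    Cn d →L[ℂ] Cn d :=
  mder (cI d) (cI d) (fun x : G => g * x * g⁻¹) 1

variable [ComplexLieGroup d G]

lemma mc_conj (g x : G) (v : Cn d) :
    mcForm d (g * x * g⁻¹) (mder (cI d) (cI d) (fun y => g * y * g⁻¹) x v) = adm d g (mcForm d x v) := by
  have h1 : mder (cI d) (cI d) (fun y : G => (g * x * g⁻¹)⁻¹ * (g * y * g⁻¹)) x v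
      = mcForm d (g * x * g⁻¹) (mder (cI d) (cI d) (fun y => g * y * g⁻¹) x v) :=
    mder_comp_apply (contMDiffAt_mul_left' _ _) (contMDiffAt_conj g x) v
  have h2 : mder (cI d) (cI d) (fun y : G => g * (x⁻¹ * y) * g⁻¹) x v = adm d g (mcForm d x v) := by
    have h3 := mder_comp_apply (I₁ := cI d) (I₂ := cI d) (I₃ := cI d) (g := fun y : G => g * y * g⁻¹)
      (f := fun y => x⁻¹ * y) (x := x) (contMDiffAt_conj g _) (contMDiffAt_mul_left' x⁻¹ x) v
    rw [h3, inv_mul_cancel]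
    rfl
  rw [← h1, ← h2]
  congr 2
  funext y
  group

omit [ComplexLieGroup d G] in
lemma adm_one : adm d (1 : G) = ContinuousLinearMap.id ℂ _ := by
  simp only [adm, one_mul, inv_one, mul_one]
  exact mder_id _

lemma adm_mul (g h : G) : adm d (g * h) = (adm d g).comp (adm d h) := by
  have h3 := mder_comp (I₁ := cI d) (I₂ := cI d) (I₃ := cI d) (g := fun y : G => g * y * g⁻¹)
      (f := fun y => h * y * h⁻¹) (x := 1) (contMDiffAt_conj g _) (contMDiffAt_conj h 1)
  rw [mul_one, mul_inv_cancel] at h3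
  rw [adm, adm, adm, ← h3]
  congr 1
  funext y
  group

lemma adm_inv_apply_adm (g : G) (v : Cn d) : adm d g⁻¹ (adm d g v) = v := by
  rw [← ContinuousLinearMap.comp_apply, ← adm_mul, inv_mul_cancel, adm_one]; rfl

lemma adm_apply_adm_inv (g : G) (v : Cn d) : adm d g (adm d g⁻¹ v) = v := by
  rw [← ContinuousLinearMap.comp_apply, ← adm_mul, mul_inv_cancel, adm_one]; rfl

/-- Conjugation by g relates the Maurer-Cartan coframe to itself through Ad g, and related coframes
have related brackets. -/
lemma adm_lieBr (g : G) (A B : Cn d) :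
    adm d g (lieBr d G A B) = lieBr d G (adm d g A) (adm d g B) := by
  have h := (mc d G).tors_of_related (mc d G) (fun y => g * y * g⁻¹) (adm d g) (x := 1)
    (contMDiffAt_conj g 1) (Eventually.of_forall fun y v => mc_conj g y v) A B
  rwa [tors_mc, tors_mc] at h

/-- The product rule for the Maurer-Cartan form. -/
lemma mc_mul {f k : M₁ → G} {x : M₁} (hf : ContMDiffAt I₁ (cI d) ω f x)
    (hk : ContMDiffAt I₁ (cI d) ω k x) (v : E₁) :
    mcForm d (f x * k x) (mder I₁ (cI d) (fun y => f y * k y) x v)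
      = adm d (k x)⁻¹ (mcForm d (f x) (mder I₁ (cI d) f x v)) + mcForm d (k x) (mder I₁ (cI d) k x v) := by
  have hmul : ContMDiff ((cI d).prod (cI d)) (cI d) ω (fun p : G × G => p.1 * p.2) :=
    contMDiff_mul (cI d) ω
  have hpair : ContMDiffAt I₁ ((cI d).prod (cI d)) ω (fun y => (f y, k y)) x := hf.prodMk hk
  have h1 : mder I₁ (cI d) (fun y => f y * k y) x v
      = mder ((cI d).prod (cI d)) (cI d) (fun p : G × G => p.1 * p.2) (f x, k x)
        (mder I₁ ((cI d).prod (cI d)) (fun y => (f y, k y)) x v) :=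
    mder_comp_apply (g := fun p : G × G => p.1 * p.2) hmul.contMDiffAt hpair v
  have h2 : mder I₁ ((cI d).prod (cI d)) (fun y => (f y, k y)) x v
      = (mder I₁ (cI d) f x v, mder I₁ (cI d) k x v) := by
    have := mfderiv_prodMk (hf.mdifferentiableAt (by simp)) (hk.mdifferentiableAt (by simp))
    exact DFunLike.congr_fun this v
  have h3 : ∀ a b : Cn d, mder ((cI d).prod (cI d)) (cI d) (fun p : G × G => p.1 * p.2) (f x, k x) (a, b)
      = mder (cI d) (cI d) (fun z => z * k x) (f x) a + mder (cI d) (cI d) (fun z => f x * z) (k x) b :=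
    fun a b => mfderiv_prod_eq_add_apply (p := (f x, k x)) (v := (a, b))
      (hmul.mdifferentiableAt (by simp))
  rw [h1, h2, h3, map_add]
  congr 1
  · rw [mcForm_apply, mcForm_apply, adm]
    rw [← mder_comp_apply (g := fun y => (f x * k x)⁻¹ * y) (f := fun z => z * k x)
      (contMDiffAt_mul_left' _ _) (contMDiffAt_mul_right' _ _)]
    have h4 := mder_comp_apply (I₁ := cI d) (I₂ := cI d) (I₃ := cI d)
      (g := fun y : G => (k x)⁻¹ * y * (k x)⁻¹⁻¹) (f := fun y => (f x)⁻¹ * y) (x := f x)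
      (contMDiffAt_conj _ _) (contMDiffAt_mul_left' _ _) (mder I₁ (cI d) f x v)
    rw [inv_mul_cancel] at h4
    rw [← h4]
    congr 2
    funext y
    group
  · rw [mcForm_apply, mcForm_apply, ← ContinuousLinearMap.comp_apply, mder_mul_left_comp]
    congr 2
    funext y
    group

lemma pull_mc_mul {f k : Z → G} {z : Z} (hf : ContMDiffAt 𝓘(ℂ, Z) (cI d) ω f z)
    (hk : ContMDiffAt 𝓘(ℂ, Z) (cI d) ω k z) (v : Z) :
    (mc d G).pull (fun y => f y * k y) z v
      = adm d (k z)⁻¹ ((mc d G).pull f z v) + (mc d G).pull k z v :=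
  mc_mul hf hk v

/-- Through each point there is a curve with any given velocity. -/
lemma Coframe.exists_curve {E : Type*} [TopologicalSpace E] [ChartedSpace (Cn d) E]
    [IsManifold (cI d) ω E] (C : Coframe d E) (x : E) (A : Cn d) :
    ∃ γ : ℂ → E, ContMDiffAt 𝓘(ℂ, ℂ) (cI d) ω γ 0 ∧ γ 0 = x ∧ C.pull γ 0 1 = A := by
  let c := chartAt (Cn d) x
  have hx := mem_chart_source (Cn d) x
  let a := (C.form x).symm A
  let p : ℂ → Cn d := fun s => c x + s • a
  have hp0 : p 0 = c x := by simp [p]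
  have hp : ContDiffAt ℂ ω p 0 := ContDiff.contDiffAt (by fun_prop)
  have hcs : ContMDiffAt (cI d) (cI d) ω c.symm (p 0) := by
    rw [hp0]; exact contMDiffAt_chartAt_symm (c.map_source hx)
  refine ⟨fun s => c.symm (p s), ContMDiffAt.comp (g := c.symm) (f := p) _ hcs hp.contMDiffAt, ?_, ?_⟩
  · change c.symm (p 0) = x
    rw [hp0]; exact c.left_inv hx
  · have hd : fderiv ℂ p 0 1 = a := by
      have h1 : HasFDerivAt p ((ContinuousLinearMap.id ℂ ℂ).smulRight a) 0 :=
        ((hasFDerivAt_id (0 : ℂ)).smul_const a).const_add (c x)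
      rw [h1.fderiv]; simp
    rw [C.pull_comp hcs hp, ContinuousLinearMap.comp_apply, hd, hp0]
    change C.form (c.symm (c x)) (mder (cI d) (cI d) c.symm (c x) a) = A
    rw [mder_chartAt_symm_self, c.left_inv hx]
    exact (C.form x).apply_symm_apply A

/-- The logarithmic derivative of the adjoint representation. -/
theorem hasFDerivAt_adm_inv {g : Z → G} {z : Z} (hg : ContMDiffAt 𝓘(ℂ, Z) (cI d) ω g z) (y : Cn d) :
    ContDiffAt ℂ ω (fun z => adm d (g z)⁻¹ y) z ∧
    ∀ v, fderiv ℂ (fun z => adm d (g z)⁻¹ y) z v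
      = - lieBr d G ((mc d G).pull g z v) (adm d (g z)⁻¹ y) := by
  obtain ⟨γ, hγ, hγ0, hγ1⟩ := (mc d G).exists_curve 1 y
  -- As γ has velocity y at 1, the Maurer-Cartan form of this product on the second variable is
  -- Ad(g)⁻¹ y at s = 0. Its derivative in z is then given by the structure equation, since the
  -- component along z does not depend on s.
  let Ψ : Z × ℂ → G := fun p => γ p.2 * g p.1
  have hfst : ∀ᶠ p in 𝓝 ((z, 0) : Z × ℂ), ContMDiffAt 𝓘(ℂ, Z × ℂ) (cI d) ω (fun p : Z × ℂ => g p.1) p := by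
    have h1 : ContinuousAt (fun p : Z × ℂ => p.1) (z, 0) := continuousAt_fst
    filter_upwards [h1.eventually hg.eventually_nhds] with p hp
    exact ContMDiffAt.comp (g := g) p hp contDiffAt_fst.contMDiffAt
  have hsnd : ∀ᶠ p in 𝓝 ((z, 0) : Z × ℂ), ContMDiffAt 𝓘(ℂ, Z × ℂ) (cI d) ω (fun p : Z × ℂ => γ p.2) p := by
    have h1 : ContinuousAt (fun p : Z × ℂ => p.2) (z, 0) := continuousAt_snd
    filter_upwards [h1.eventually hγ.eventually_nhds] with p hp
    exact ContMDiffAt.comp (g := γ) p hp contDiffAt_snd.contMDiffAt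
  have hpull : ∀ᶠ p in 𝓝 ((z, 0) : Z × ℂ), ∀ w : Z × ℂ, (mc d G).pull Ψ p w
      = adm d (g p.1)⁻¹ ((mc d G).pull γ p.2 w.2) + (mc d G).pull g p.1 w.1 := by
    have h1 : ContinuousAt (fun p : Z × ℂ => p.1) (z, 0) := continuousAt_fst
    have h2 : ContinuousAt (fun p : Z × ℂ => p.2) (z, 0) := continuousAt_snd
    filter_upwards [hfst, hsnd, h1.eventually hg.eventually_nhds, h2.eventually hγ.eventually_nhds]
      with p h1 h2 h3 h4 w
    have h5 : (mc d G).pull (fun p : Z × ℂ => g p.1) p w = (mc d G).pull g p.1 w.1 := by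
      rw [(mc d G).pull_comp (g := fun p : Z × ℂ => p.1) h3 contDiffAt_fst, fderiv_fst]; rfl
    have h6 : (mc d G).pull (fun p : Z × ℂ => γ p.2) p w = (mc d G).pull γ p.2 w.2 := by
      rw [(mc d G).pull_comp (g := fun p : Z × ℂ => p.2) h4 contDiffAt_snd, fderiv_snd]; rfl
    rw [← h5, ← h6]
    exact pull_mc_mul h2 h1 w
  have hΨ : ContMDiffAt 𝓘(ℂ, Z × ℂ) (cI d) ω Ψ (z, 0) := hsnd.self_of_nhds.mul hfst.self_of_nhds
  have hin : ContDiffAt ℂ ω (fun z' : Z => (z', (0 : ℂ))) z := contDiffAt_id.prodMk contDiffAt_const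
  have heq : (fun z' => (mc d G).pull Ψ (z', 0) (0, 1)) =ᶠ[𝓝 z] fun z' => adm d (g z')⁻¹ y := by
    filter_upwards [hin.continuousAt.eventually hpull] with z' hz'
    have := hz' (0, 1)
    simp only [map_zero, add_zero, hγ1] at this
    exact this
  have hc : ContDiffAt ℂ ω (fun p => (mc d G).pull Ψ p (0, 1)) (z, 0) :=
    ((mc d G).contDiffAt_pull hΨ).clm_apply contDiffAt_const
  have hc' : ContDiffAt ℂ ω (fun z' => (mc d G).pull Ψ (z', 0) (0, 1)) z :=
    ContDiffAt.comp (g := fun p => (mc d G).pull Ψ p (0, 1)) (f := fun z' : Z => (z', (0 : ℂ))) z hc hin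
  refine ⟨hc'.congr_of_eventuallyEq heq.symm, fun v => ?_⟩
  have hs := (mc d G).structure_equation hΨ (v, 0) (0, 1)
  have e1 : fderiv ℂ (fun p => (mc d G).pull Ψ p (v, 0)) (z, 0) (0, 1) = 0 := by
    have h1 : (fun p => (mc d G).pull Ψ p (v, 0)) =ᶠ[𝓝 (z, 0)] fun p => (mc d G).pull g p.1 v := by
      filter_upwards [hpull] with p hp
      rw [hp]; simp
    have h2 : DifferentiableAt ℂ (fun z' => (mc d G).pull g z' v) z :=
      (((mc d G).contDiffAt_pull hg).clm_apply contDiffAt_const).differentiableAt (by simp)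
    have h3 := HasFDerivAt.comp ((z, 0) : Z × ℂ) (g := fun z' => (mc d G).pull g z' v)
      (f := fun p : Z × ℂ => p.1) h2.hasFDerivAt hasFDerivAt_fst
    rw [h1.fderiv_eq]
    rw [HasFDerivAt.fderiv (f := fun p : Z × ℂ => (mc d G).pull g p.1 v) h3]
    simp
  have e2 : fderiv ℂ (fun p => (mc d G).pull Ψ p (0, 1)) (z, 0) (v, 0)
      = fderiv ℂ (fun z => adm d (g z)⁻¹ y) z v := by
    rw [← heq.fderiv_eq]
    have h3 := HasFDerivAt.comp z (f := fun z' : Z => (z', (0 : ℂ)))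
      (hc.differentiableAt (by simp)).hasFDerivAt (hasFDerivAt_prodMk_left z 0)
    rw [HasFDerivAt.fderiv (f := fun z' => (mc d G).pull Ψ (z', 0) (0, 1)) h3]
    simp
  rw [e1, e2, sub_zero, tors_mc, hpull.self_of_nhds, hpull.self_of_nhds] at hs
  rw [hs]
  simp [hγ1]

end AdjointRepresentation

section Morphisms

variable {d e : ℕ} {G H : Type u} [Group G] [TopologicalSpace G] [ChartedSpace (Cn d) G]
  [ComplexLieGroup d G] [Group H] [TopologicalSpace H] [ChartedSpace (Cn e) H] [ComplexLieGroup e H]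
  {ι : H →* G}

/-- The derivative at `1` of a group morphism, on the underlying vector spaces. -/
def lmap (d e : ℕ) {G H : Type u} [Group G] [TopologicalSpace G] [ChartedSpace (Cn d) G]
    [Group H] [TopologicalSpace H] [ChartedSpace (Cn e) H] (ι : H →* G) : Cn e →L[ℂ] Cn d :=
  mder (cI e) (cI d) ι 1

lemma mc_hom (hι : ContMDiff (cI e) (cI d) ω ι) (h : H) (v : Cn e) :
    mcForm d (ι h) (mder (cI e) (cI d) ι h v) = lmap d e ι (mcForm e h v) := by
  have h1 := mder_comp_apply (I₁ := cI e) (I₂ := cI d) (I₃ := cI d) (g := fun y : G => (ι h)⁻¹ * y)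
    (f := ι) (x := h) (contMDiffAt_mul_left' _ _) hι.contMDiffAt v
  have h2 := mder_comp_apply (I₁ := cI e) (I₂ := cI e) (I₃ := cI d) (g := ι)
    (f := fun y => h⁻¹ * y) (x := h) hι.contMDiffAt (contMDiffAt_mul_left' _ _) v
  rw [inv_mul_cancel] at h2
  rw [mcForm_apply, mcForm_apply, lmap, ← h1, ← h2]
  simp only [map_mul, map_inv]

lemma pull_mc_hom (hι : ContMDiff (cI e) (cI d) ω ι) {Z : Type*} [NormedAddCommGroup Z]
    [NormedSpace ℂ Z] {k : Z → H} {z : Z} (hk : ContMDiffAt 𝓘(ℂ, Z) (cI e) ω k z) (v : Z) :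
    (mc d G).pull (fun z => ι (k z)) z v = lmap d e ι ((mc e H).pull k z v) := by
  change mcForm d (ι (k z)) (mder _ _ (fun z => ι (k z)) z v) = _
  rw [mder_comp_apply hι.contMDiffAt hk, mc_hom hι]
  rfl

lemma lmap_lieBr (hι : ContMDiff (cI e) (cI d) ω ι) (A B : Cn e) :
    lmap d e ι (lieBr e H A B) = lieBr d G (lmap d e ι A) (lmap d e ι B) := by
  have h := (mc e H).tors_of_related (mc d G) ι (lmap d e ι) (x := 1) hι.contMDiffAt
    (Eventually.of_forall fun y v => mc_hom hι y v) A B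
  rwa [tors_mc, tors_mc] at h

lemma lmap_adm (hι : ContMDiff (cI e) (cI d) ω ι) (h : H) (A : Cn e) :
    lmap d e ι (adm e h A) = adm d (ι h) (lmap d e ι A) := by
  have h1 := mder_comp_apply (I₁ := cI e) (I₂ := cI d) (I₃ := cI d) (g := fun y : G => ι h * y * (ι h)⁻¹)
    (f := ι) (x := 1) (contMDiffAt_conj _ _) hι.contMDiffAt A
  have h2 := mder_comp_apply (I₁ := cI e) (I₂ := cI e) (I₃ := cI d) (g := ι)
    (f := fun y => h * y * h⁻¹) (x := 1) hι.contMDiffAt (contMDiffAt_conj _ _) A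
  rw [map_one] at h1
  rw [mul_one, mul_inv_cancel] at h2
  rw [adm, adm, lmap, ← h1, ← h2]
  simp only [map_mul, map_inv]

end Morphisms

/-! ### The Cartan connection as a coframe; the curvature is semibasic -/

namespace CartanGeometry

variable {d e : ℕ} {G H : Type u} [Group G] [TopologicalSpace G] [ChartedSpace (Cn d) G]
  [Group H] [TopologicalSpace H] [ChartedSpace (Cn e) H]
  {ι : H →* G} {n : ℕ} {M : Type u} [TopologicalSpace M] [ChartedSpace (Cn n) M]

/-- The Cartan connection, on the underlying vector spaces. -/
def frm (C : CartanGeometry d e ι n M) (x : C.E) : Cn d ≃L[ℂ] Cn d := C.form x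

/-- The Cartan connection as a coframe on the total space. -/
def coframe (C : CartanGeometry d e ι n M) : Coframe d C.E where
  form := C.frm
  holo := by
    intro x₀
    let c := chartAt (Cn d) x₀
    have hct : c x₀ ∈ c.target := c.map_source (mem_chart_source _ _)
    have hcs : ContMDiffOn (cI d) (cI d) ω c.symm c.target := fun y hy =>
      (contMDiffAt_chartAt_symm hy).contMDiffWithinAt
    have hon : ContDiffOn ℂ ω (fun x : Cn d => (C.frm (c.symm x) : Cn d →L[ℂ] Cn d).comp
        (mder (cI d) (cI d) c.symm x)) c.target := by
      rw [contDiffOn_clm_apply]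
      intro v
      have h1 : ContMDiff (cI d) (cI d).tangent ω
          (fun x : Cn d => (⟨x, v⟩ : TangentBundle (cI d) (Cn d))) :=
        contMDiff_vectorSpace_iff_contDiff.2 (contDiff_const (c := v))
      have h2 := hcs.contMDiffOn_tangentMapWithin (m := ω) le_rfl c.open_target.uniqueMDiffOn
      have h3 : ContMDiffOn (cI d) (cI d).tangent ω (fun x : Cn d =>
          tangentMapWithin (cI d) (cI d) c.symm c.target (⟨x, v⟩ : TangentBundle (cI d) (Cn d))) c.target :=
        h2.comp h1.contMDiffOn (fun x hx => hx)
      have h4 := C.form_holomorphic.comp_contMDiffOn h3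
      refine (contMDiffOn_iff_contDiffOn.1 h4).congr fun x hx => ?_
      have h5 : mder (cI d) (cI d) c.symm x = mfderivWithin (cI d) (cI d) c.symm c.target x :=
        (mfderivWithin_of_isOpen c.open_target hx).symm
      change C.form (c.symm x) (mder (cI d) (cI d) c.symm x v) = _
      rw [h5]
      rfl
    exact hon.contDiffAt (c.open_target.mem_nhds hct)

/-- The curvature is the difference of the brackets of the model and of the coframe. -/
lemma curvature_eq [ComplexLieGroup d G] (C : CartanGeometry d e ι n M) (x : C.E) (A B : Cn d) :
    C.curvature x A B = lieBr d G A B - C.coframe.tors x A B := by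
  have h1 : ∀ A : Cn d, (fun y => C.frm y ((C.frm y).symm A)) = fun _ => A := fun A =>
    funext fun y => (C.frm y).apply_symm_apply A
  have h2 : C.curvature x A B = (mder (cI d) (cI d) (fun y => C.frm y ((C.frm y).symm B)) x
      ((C.frm x).symm A) - mder (cI d) (cI d) (fun y => C.frm y ((C.frm y).symm A)) x
      ((C.frm x).symm B) - C.coframe.tors x A B)
      + lieBr d G (C.frm x ((C.frm x).symm A)) (C.frm x ((C.frm x).symm B)) := by
    rw [← Coframe.form_mlieBracket]
    rfl
  rw [h2, h1, h1, mder_const, mder_const, ContinuousLinearEquiv.apply_symm_apply,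
    ContinuousLinearEquiv.apply_symm_apply]
  simp only [zero_apply]
  abel

end CartanGeometry

namespace CartanGeometry

variable {d e : ℕ} {G H : Type u} [Group G] [TopologicalSpace G] [ChartedSpace (Cn d) G]
  [Group H] [TopologicalSpace H] [ChartedSpace (Cn e) H]
  {ι : H →* G} {n : ℕ} {M : Type u} [TopologicalSpace M] [ChartedSpace (Cn n) M]
  (C : CartanGeometry d e ι n M)

lemma proj_act (x : C.E) (h : H) : C.proj (C.act x h) = C.proj x := by
  obtain ⟨U, ψ, hU, hm, hs, ht, -, -, hψ⟩ := C.locally_trivial (C.proj x)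
  have hx : x ∈ ψ.target := by rw [ht]; exact hm
  obtain ⟨p, hp, rfl⟩ := ψ.surjOn hx
  obtain ⟨u, k⟩ := p
  rw [hs] at hp
  rw [← (hψ u hp.1 k h).2, (hψ u hp.1 _ 1).1, (hψ u hp.1 _ 1).1]

/-- A local section through a given point, and the trivialization which it defines. -/
structure LocalSection (x : C.E) where
  U : Set M
  isOpen : IsOpen U
  mem : C.proj x ∈ U
  s : M → C.E
  k : C.E → H
  s_holomorphic : ContMDiffOn (cI n) (cI d) ω s U
  k_holomorphic : ContMDiffOn (cI d) (cI e) ω k (C.proj ⁻¹' U)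
  proj_s : ∀ u ∈ U, C.proj (s u) = u
  s_proj : s (C.proj x) = x
  k_s : ∀ u ∈ U, k (s u) = 1
  k_act : ∀ y, C.proj y ∈ U → ∀ h, k (C.act y h) = k y * h
  act_s_k : ∀ y, C.proj y ∈ U → C.act (s (C.proj y)) (k y) = y
  proj_holomorphic : ContMDiffOn (cI d) (cI n) ω C.proj (C.proj ⁻¹' U)
  isOpen_preimage : IsOpen (C.proj ⁻¹' U)

variable [ComplexLieGroup e H]

lemma nonempty_localSection (x : C.E) : Nonempty (C.LocalSection x) := by
  obtain ⟨U, ψ, hU, hm, hs, ht, h1, h2, hψ⟩ := C.locally_trivial (C.proj x)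
  have hx : x ∈ ψ.target := by rw [ht]; exact hm
  obtain ⟨p, hp, rfl⟩ := ψ.surjOn hx
  obtain ⟨u₀, h₀⟩ := p
  have hu₀ : u₀ ∈ U := by rw [hs] at hp; exact hp.1
  have hsrc : ∀ u ∈ U, ∀ h, (u, h) ∈ ψ.source := fun u hu h => by rw [hs]; exact ⟨hu, mem_univ _⟩
  have hp0 : C.proj (ψ (u₀, h₀)) = u₀ := (hψ u₀ hu₀ h₀ 1).1
  have hy : ∀ y, C.proj y ∈ U → y ∈ ψ.target := fun y hy => by rw [ht]; exact hy
  have hsymm : ∀ y, C.proj y ∈ U → (ψ.symm y).1 = C.proj y := by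
    intro y hyU
    have hmem := ψ.map_target (hy y hyU)
    have e1 := ψ.right_inv (hy y hyU)
    rw [hs] at hmem
    have e2 := (hψ (ψ.symm y).1 hmem.1 (ψ.symm y).2 1).1
    rw [← e2]
    exact congrArg C.proj e1
  have hopen : IsOpen (C.proj ⁻¹' U) := by rw [← ht]; exact ψ.open_target
  exact ⟨{
    U := U
    isOpen := hU
    mem := hm
    s := fun u => ψ (u, h₀)
    k := fun y => h₀⁻¹ * (ψ.symm y).2
    s_holomorphic := by
      have h3 : ContMDiffOn (cI n) ((cI n).prod (cI e)) ω (fun u : M => (u, h₀)) U :=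
        (contMDiff_id.prodMk contMDiff_const).contMDiffOn
      exact h1.comp h3 (fun u hu => hsrc u hu h₀)
    k_holomorphic := by
      have h3 : ContMDiffOn (cI d) (cI e) ω (fun y => (ψ.symm y).2) (C.proj ⁻¹' U) := by
        rw [← ht]
        exact contMDiff_snd.comp_contMDiffOn h2
      exact (contMDiff_mul_left (I := cI e) (n := ω) (a := h₀⁻¹)).comp_contMDiffOn h3
    proj_s := fun u hu => (hψ u hu h₀ 1).1
    s_proj := by rw [hp0]
    k_s := fun u hu => by
      rw [ψ.left_inv (hsrc u hu h₀)]; simp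
    k_act := fun y hyU h => by
      obtain ⟨p, hp, rfl⟩ := ψ.surjOn (hy y hyU)
      obtain ⟨u, k⟩ := p
      have hu : u ∈ U := by rw [hs] at hp; exact hp.1
      rw [← (hψ u hu k h).2, ψ.left_inv (hsrc u hu _), ψ.left_inv (hsrc u hu _), mul_assoc]
    act_s_k := fun y hyU => by
      rw [← (hψ _ hyU h₀ _).2, mul_inv_cancel_left, ← hsymm y hyU]
      exact ψ.right_inv (hy y hyU)
    proj_holomorphic := by
      have h3 : ContMDiffOn (cI d) (cI n) ω (fun y => (ψ.symm y).1) (C.proj ⁻¹' U) := by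
        rw [← ht]
        exact contMDiff_fst.comp_contMDiffOn h2
      exact h3.congr fun y hyU => (hsymm y hyU).symm
    isOpen_preimage := hopen }⟩

/-- A chosen local section through a point. -/
def localSection (x : C.E) : C.LocalSection x := (C.nonempty_localSection x).some

lemma proj_holomorphic : ContMDiff (cI d) (cI n) ω C.proj := fun x =>
  (C.localSection x).proj_holomorphic.contMDiffAt
    ((C.localSection x).isOpen_preimage.mem_nhds (C.localSection x).mem)

omit [ComplexLieGroup e H] in
lemma proj_surjective : Function.Surjective C.proj := fun m => by
  obtain ⟨U, ψ, hU, hm, hs, ht, h1, h2, hψ⟩ := C.locally_trivial m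
  exact ⟨ψ (m, 1), (hψ m hm 1 1).1⟩

lemma act_injective (x : C.E) : Function.Injective (C.act x) := fun h k hhk => by
  have h1 := congrArg (C.localSection x).k hhk
  rw [(C.localSection x).k_act x (C.localSection x).mem,
    (C.localSection x).k_act x (C.localSection x).mem] at h1
  exact mul_left_cancel h1

lemma exists_act_eq {x y : C.E} (h : C.proj x = C.proj y) : ∃ k, C.act x k = y := by
  have h1 := (C.localSection x).act_s_k y (h ▸ (C.localSection x).mem)
  rw [← h, (C.localSection x).s_proj] at h1
  exact ⟨_, h1⟩

omit [ComplexLieGroup e H] in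
lemma act_right_holomorphic (x : C.E) : ContMDiff (cI e) (cI d) ω (fun h => C.act x h) :=
  C.act_holomorphic.comp (contMDiff_const.prodMk contMDiff_id)

omit [ComplexLieGroup e H] in
lemma act_left_holomorphic (h : H) : ContMDiff (cI d) (cI d) ω (fun x => C.act x h) :=
  C.act_holomorphic.comp (contMDiff_id.prodMk contMDiff_const)

omit [ComplexLieGroup e H] in
lemma frm_act (h : H) (x : C.E) (v : Cn d) :
    C.frm (C.act x h) (mder (cI d) (cI d) (fun y => C.act y h) x v) = adm d (ι h)⁻¹ (C.frm x v) :=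
  C.form_equivariant h x v

/-- The axiom concerns the unit of H only; moving the base point to x·h and translating by h⁻¹ on
the left in H reduces the general case to it. -/
lemma frm_vertical (x : C.E) (h : H) (v : Cn e) :
    C.frm (C.act x h) (mder (cI e) (cI d) (fun k => C.act x k) h v) = lmap d e ι (mcForm e h v) := by
  have h1 : C.frm (C.act (C.act x h) 1)
      (mder (cI e) (cI d) (fun k => C.act (C.act x h) k) 1 (mcForm e h v)) = lmap d e ι (mcForm e h v) :=
    C.form_vertical (C.act x h) (mcForm e h v)
  rw [C.act_one] at h1
  have h2 := mder_comp_apply (I₁ := cI e) (I₂ := cI e) (I₃ := cI d) (g := fun k => C.act (C.act x h) k)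
    (f := fun y => h⁻¹ * y) (x := h) (C.act_right_holomorphic _).contMDiffAt
    (contMDiffAt_mul_left' _ _) v
  simp only [← C.act_mul, mul_inv_cancel_left, inv_mul_cancel] at h2
  rw [h2]
  refine Eq.trans ?_ h1
  simp only [C.act_mul]
  rfl

variable {E₁ H₁ M₁ : Type*} [NormedAddCommGroup E₁] [NormedSpace ℂ E₁] [TopologicalSpace H₁]
  [TopologicalSpace M₁] [ChartedSpace H₁ M₁] {I₁ : ModelWithCorners ℂ E₁ H₁}
  {Z : Type*} [NormedAddCommGroup Z] [NormedSpace ℂ Z]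

/-- The product rule for the Cartan connection. -/
lemma frm_act_mul {s : M₁ → C.E} {k : M₁ → H} {x : M₁} (hs : ContMDiffAt I₁ (cI d) ω s x)
    (hk : ContMDiffAt I₁ (cI e) ω k x) (v : E₁) :
    C.frm (C.act (s x) (k x)) (mder I₁ (cI d) (fun y => C.act (s y) (k y)) x v)
      = adm d (ι (k x))⁻¹ (C.frm (s x) (mder I₁ (cI d) s x v))
        + lmap d e ι (mcForm e (k x) (mder I₁ (cI e) k x v)) := by
  have hpair : ContMDiffAt I₁ ((cI d).prod (cI e)) ω (fun y => (s y, k y)) x := hs.prodMk hk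
  have h1 : mder I₁ (cI d) (fun y => C.act (s y) (k y)) x v
      = mder ((cI d).prod (cI e)) (cI d) (fun p : C.E × H => C.act p.1 p.2) (s x, k x)
        (mder I₁ ((cI d).prod (cI e)) (fun y => (s y, k y)) x v) :=
    mder_comp_apply (g := fun p : C.E × H => C.act p.1 p.2) C.act_holomorphic.contMDiffAt hpair v
  have h2 : mder I₁ ((cI d).prod (cI e)) (fun y => (s y, k y)) x v
      = (mder I₁ (cI d) s x v, mder I₁ (cI e) k x v) := by
    have := mfderiv_prodMk (hs.mdifferentiableAt (by simp)) (hk.mdifferentiableAt (by simp))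
    exact DFunLike.congr_fun this v
  have h3 : ∀ (a : Cn d) (b : Cn e),
      mder ((cI d).prod (cI e)) (cI d) (fun p : C.E × H => C.act p.1 p.2) (s x, k x) (a, b)
      = mder (cI d) (cI d) (fun z => C.act z (k x)) (s x) a
        + mder (cI e) (cI d) (fun z => C.act (s x) z) (k x) b :=
    fun a b => mfderiv_prod_eq_add_apply (p := (s x, k x)) (v := (a, b))
      (C.act_holomorphic.mdifferentiableAt (by simp))
  rw [h1, h2, h3, map_add, frm_act, frm_vertical]

lemma pull_act {s : Z → C.E} {k : Z → H} {z : Z} (hs : ContMDiffAt 𝓘(ℂ, Z) (cI d) ω s z)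
    (hk : ContMDiffAt 𝓘(ℂ, Z) (cI e) ω k z) (v : Z) :
    C.coframe.pull (fun y => C.act (s y) (k y)) z v
      = adm d (ι (k z))⁻¹ (C.coframe.pull s z v) + lmap d e ι ((mc e H).pull k z v) :=
  C.frm_act_mul hs hk v

/-- The vertical vectors are those on which the Cartan connection takes values in `𝔥`. -/
lemma mder_proj_eq_zero_iff (x : C.E) (v : Cn d) :
    mder (cI d) (cI n) C.proj x v = 0 ↔ ∃ X, C.frm x v = lmap d e ι X := by
  let S := C.localSection x
  have hnhds : C.proj ⁻¹' S.U ∈ 𝓝 x := S.isOpen_preimage.mem_nhds S.mem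
  constructor
  · intro hv
    have hs : ContMDiffAt (cI n) (cI d) ω S.s (C.proj x) :=
      S.s_holomorphic.contMDiffAt (S.isOpen.mem_nhds S.mem)
    have hsp : ContMDiffAt (cI d) (cI d) ω (fun y => S.s (C.proj y)) x :=
      hs.comp x C.proj_holomorphic.contMDiffAt
    have hk : ContMDiffAt (cI d) (cI e) ω S.k x := S.k_holomorphic.contMDiffAt hnhds
    -- The identity of E is y ↦ s(π y)·k(y). On a vector killed by dπ, the product rule leaves only
    -- the contribution of k, which lies in 𝔥.
    have h1 := C.frm_act_mul hsp hk v
    have h2 : (fun y => C.act (S.s (C.proj y)) (S.k y)) =ᶠ[𝓝 x] fun y => y := by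
      filter_upwards [hnhds] with y hy using S.act_s_k y hy
    rw [mder_congr h2, h2.eq_of_nhds, mder_id, mder_comp_apply hs C.proj_holomorphic.contMDiffAt, hv,
      map_zero, map_zero, map_zero, zero_add] at h1
    exact ⟨_, h1⟩
  · rintro ⟨X, hX⟩
    have h1 := C.frm_vertical x 1 ((mcForm e (1 : H)).symm X)
    rw [C.act_one, ContinuousLinearEquiv.apply_symm_apply, ← hX] at h1
    have h2 := (C.frm x).injective h1
    have h3 := mder_comp_apply (I₁ := cI e) (I₂ := cI d) (I₃ := cI n) (g := C.proj)
      (f := fun k => C.act x k) (x := 1) C.proj_holomorphic.contMDiffAt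
      (C.act_right_holomorphic _).contMDiffAt ((mcForm e (1 : H)).symm X)
    simp only [C.proj_act, C.act_one] at h3
    rw [h2, mder_const] at h3
    exact h3.symm

-- Right translation by h relates the coframe to itself through Ad(h)⁻¹. Together with `adm_lieBr`
-- this makes the curvature equivariant.
omit [ComplexLieGroup e H] in
lemma tors_act (h : H) (x : C.E) (A B : Cn d) :
    C.coframe.tors (C.act x h) (adm d (ι h)⁻¹ A) (adm d (ι h)⁻¹ B)
      = adm d (ι h)⁻¹ (C.coframe.tors x A B) :=
  (C.coframe.tors_of_related C.coframe (fun y => C.act y h) (adm d (ι h)⁻¹) (x := x)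
    (C.act_left_holomorphic h).contMDiffAt (Eventually.of_forall fun y v => C.frm_act h y v) A B).symm

variable [ComplexLieGroup d G]

/-- The curvature is semibasic. -/
theorem tors_vertical (hι : ContMDiff (cI e) (cI d) ω ι) (x : C.E) (X : Cn e) (B : Cn d) :
    C.coframe.tors x (lmap d e ι X) B = lieBr d G (lmap d e ι X) B := by
  obtain ⟨γ, hγ, hγ0, hγ1⟩ := C.coframe.exists_curve x B
  obtain ⟨k, hk, hk0, hk1⟩ := (mc e H).exists_curve 1 X
  -- A surface through x, vertical with velocity X in the first variable, with velocity B in the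
  -- second. At the origin of its structure equation, the only surviving derivative is that of
  -- Ad(k)⁻¹B, which is −[X, B].
  let Ψ : ℂ × ℂ → C.E := fun p => C.act (γ p.2) (k p.1)
  have hpull : ∀ᶠ p in 𝓝 ((0, 0) : ℂ × ℂ), ContMDiffAt 𝓘(ℂ, ℂ × ℂ) (cI d) ω Ψ p ∧
      ∀ w : ℂ × ℂ, C.coframe.pull Ψ p w
      = adm d (ι (k p.1))⁻¹ (C.coframe.pull γ p.2 w.2) + lmap d e ι ((mc e H).pull k p.1 w.1) := by
    have h1 : ContinuousAt (fun p : ℂ × ℂ => p.1) (0, 0) := continuousAt_fst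
    have h2 : ContinuousAt (fun p : ℂ × ℂ => p.2) (0, 0) := continuousAt_snd
    filter_upwards [h1.eventually hk.eventually_nhds, h2.eventually hγ.eventually_nhds]
      with p h3 h4
    have h7 : ContMDiffAt 𝓘(ℂ, ℂ × ℂ) (cI e) ω (fun p : ℂ × ℂ => k p.1) p :=
      ContMDiffAt.comp (g := k) p h3 contDiffAt_fst.contMDiffAt
    have h8 : ContMDiffAt 𝓘(ℂ, ℂ × ℂ) (cI d) ω (fun p : ℂ × ℂ => γ p.2) p :=
      ContMDiffAt.comp (g := γ) p h4 contDiffAt_snd.contMDiffAt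
    refine ⟨C.act_holomorphic.contMDiffAt.comp p (h8.prodMk h7), fun w => ?_⟩
    have h5 : (mc e H).pull (fun p : ℂ × ℂ => k p.1) p w = (mc e H).pull k p.1 w.1 := by
      rw [(mc e H).pull_comp (g := fun p : ℂ × ℂ => p.1) h3 contDiffAt_fst, fderiv_fst]; rfl
    have h6 : C.coframe.pull (fun p : ℂ × ℂ => γ p.2) p w = C.coframe.pull γ p.2 w.2 := by
      rw [C.coframe.pull_comp (g := fun p : ℂ × ℂ => p.2) h4 contDiffAt_snd, fderiv_snd]; rfl
    rw [← h5, ← h6]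
    exact C.pull_act h8 h7 w
  have hΨ := hpull.self_of_nhds.1
  have hs := C.coframe.structure_equation hΨ (1, 0) (0, 1)
  have hdiff : ∀ w, DifferentiableAt ℂ (fun p => C.coframe.pull Ψ p w) (0, 0) := fun w =>
    ((C.coframe.contDiffAt_pull hΨ).clm_apply contDiffAt_const).differentiableAt (by simp)
  have hιk : ContMDiffAt 𝓘(ℂ, ℂ) (cI d) ω (fun z => ι (k z)) 0 := hι.contMDiffAt.comp 0 hk
  have e1 : fderiv ℂ (fun p => C.coframe.pull Ψ p (1, 0)) (0, 0) (0, 1) = 0 := by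
    have h3 := HasFDerivAt.comp (0 : ℂ) (f := fun z' : ℂ => ((0 : ℂ), z'))
      (hdiff (1, 0)).hasFDerivAt (hasFDerivAt_prodMk_right 0 0)
    have h4 : (fun z' : ℂ => C.coframe.pull Ψ (0, z') (1, 0)) =ᶠ[𝓝 0] fun _ => lmap d e ι X := by
      have hin : ContinuousAt (fun z' : ℂ => ((0 : ℂ), z')) 0 := by fun_prop
      filter_upwards [hin.eventually hpull] with z hz
      rw [hz.2]; simp [hk1]
    have h5 := h3.fderiv.symm.trans (h4.fderiv_eq)
    simpa using DFunLike.congr_fun h5 1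
  have e2 : fderiv ℂ (fun p => C.coframe.pull Ψ p (0, 1)) (0, 0) (1, 0)
      = - lieBr d G (lmap d e ι X) B := by
    have h3 := HasFDerivAt.comp (0 : ℂ) (f := fun z' : ℂ => (z', (0 : ℂ)))
      (hdiff (0, 1)).hasFDerivAt (hasFDerivAt_prodMk_left 0 0)
    have h4 : (fun z' : ℂ => C.coframe.pull Ψ (z', 0) (0, 1)) =ᶠ[𝓝 0] fun z => adm d (ι (k z))⁻¹ B := by
      have hin : ContinuousAt (fun z' : ℂ => (z', (0 : ℂ))) 0 := by fun_prop
      filter_upwards [hin.eventually hpull] with z hz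
      rw [hz.2]; simp [hγ1]
    have h5 := h3.fderiv.symm.trans (h4.fderiv_eq)
    have h6 := (hasFDerivAt_adm_inv hιk B).2 1
    rw [pull_mc_hom hι hk, hk1, hk0, map_one ι, inv_one, adm_one] at h6
    have h7 := DFunLike.congr_fun h5 1
    rw [h6] at h7
    simpa using h7
  rw [e1, e2, hpull.self_of_nhds.2, hpull.self_of_nhds.2] at hs
  simp only [hγ1, hk1, hk0, hγ0, map_zero, map_one, inv_one, adm_one, sub_zero, zero_add, add_zero,
    neg_inj, ContinuousLinearMap.id_apply, Ψ, C.act_one] at hs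
  exact hs.symm

end CartanGeometry

/-! ### Local systems and linear differential equations on complex domains -/

section LocalSystems

/-- A local system of torsors on a simply connected space has a global section. -/
theorem exists_section_of_locally_constant {A : Type*} [TopologicalSpace A] [SimplyConnectedSpace A]
    [LocallyPathConnectedSpace A] {Γ : Type*} [Group Γ] (U : A → Set A) (hU : ∀ i, IsOpen (U i))
    (hmem : ∀ i, i ∈ U i) (p : A → A → Γ)
    (hp : ∀ i j, ∀ x ∈ U i ∩ U j, ∀ᶠ y in 𝓝 x, (p j y)⁻¹ * p i y = (p j x)⁻¹ * p i x) :
    ∃ a : A → Γ, ∀ i, ∀ x ∈ U i, ∀ᶠ y in 𝓝 x, (p i y)⁻¹ * a y = (p i x)⁻¹ * a x := by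
  let _ : TopologicalSpace Γ := ⊥
  have : DiscreteTopology Γ := ⟨rfl⟩
  -- With Γ discrete, locally constant transition functions define a covering space. A global
  -- section is a lift of the identity, which exists because the base is simply connected.
  let Z : FiberBundleCore A A Γ :=
    { baseSet := U
      isOpen_baseSet := hU
      indexAt := id
      mem_baseSet_at := hmem
      coordChange := fun i j x v => (p j x)⁻¹ * p i x * v
      coordChange_self := fun i x _ v => by simp
      continuousOn_coordChange := fun i j => by
        rintro ⟨x, v⟩ ⟨hx, -⟩
        refine ContinuousAt.continuousWithinAt ?_
        have h0 : ContinuousAt (Prod.fst : A × Γ → A) (x, v) := continuousAt_fst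
        have h1 : ∀ᶠ q in 𝓝 (x, v), (p j q.1)⁻¹ * p i q.1 = (p j x)⁻¹ * p i x :=
          h0.eventually (hp i j x hx)
        have h2 : ContinuousAt (fun q : A × Γ => (p j x)⁻¹ * p i x * q.2) (x, v) :=
          (continuous_of_discreteTopology (f := fun g : Γ => (p j x)⁻¹ * p i x * g)).continuousAt.comp
            continuousAt_snd
        refine h2.congr ?_
        filter_upwards [h1] with q hq
        rw [hq]
      coordChange_comp := fun i j k x _ v => by group }
  have hcov : IsCoveringMap (Bundle.TotalSpace.proj : Bundle.TotalSpace Γ Z.Fiber → A) :=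
    IsFiberBundle.isCoveringMap fun x => ⟨Z.localTrivAt x, Z.mem_localTrivAt_baseSet x⟩
  obtain ⟨x₀⟩ : Nonempty A := inferInstance
  obtain ⟨F, ⟨-, hF⟩, -⟩ := hcov.existsUnique_continuousMap_lifts (ContinuousMap.id A) x₀ ⟨x₀, (1 : Γ)⟩ rfl
  have hF' : ∀ x, (F x).1 = x := fun x => congrFun hF x
  let v : A → Γ := fun x => (F x).2
  refine ⟨fun x => p (F x).1 x * v x, fun i x hx => ?_⟩
  have h1 : ContinuousAt (fun y => (Z.localTriv i (F y)).2) x := by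
    have h2 : ContinuousAt (Z.localTriv i) (F x) := by
      refine (Z.localTriv i).continuousAt ?_
      rw [Z.mem_localTriv_source]
      rw [hF' x]; exact hx
    exact continuousAt_snd.comp (h2.comp F.continuous.continuousAt)
  have h3 := h1.eventually_mem (isOpen_discrete {(Z.localTriv i (F x)).2} |>.mem_nhds rfl)
  filter_upwards [h3] with y hy
  have h4 : ∀ y, (Z.localTriv i (F y)).2 = (p i y)⁻¹ * (p (F y).1 y * v y) := fun y => by
    rw [Z.localTriv_apply]
    change (p i (F y).1)⁻¹ * p (F y).1 (F y).1 * v y = _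
    rw [hF' y, mul_assoc]
  rw [← h4, ← h4]
  exact hy

end LocalSystems

section LinearEquations

variable {V : Type*} [NormedAddCommGroup V] [NormedSpace ℂ V]

/-- Exponential maps are characterized on radial vectors, at the price of a factor t; it is divided
out away from 0, and continuity settles t = 0. -/
lemma eventuallyEq_of_smul_eq {f g : ℂ → V} (hf : ContinuousAt f 0) (hg : ContinuousAt g 0)
    (h : ∀ᶠ t in 𝓝 (0 : ℂ), t • f t = t • g t) : f =ᶠ[𝓝 0] g := by
  refine (hf.eventuallyEq_nhds_iff_eventuallyEq_nhdsNE hg).1 ?_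
  filter_upwards [h.filter_mono nhdsWithin_le_nhds, self_mem_nhdsWithin] with t ht ht'
  exact smul_right_injective V ht' ht

/-- The exponential of a coframe-like family gives integral curves. -/
lemma eventually_deriv_of_smul [CompleteSpace V] {Φ : ℂ → V} {X : ℂ → V} (hΦ : AnalyticAt ℂ Φ 0) (hX : ContinuousAt X 0)
    (h : ∀ᶠ t in 𝓝 (0 : ℂ), t • deriv Φ t = t • X t) : ∀ᶠ t in 𝓝 (0 : ℂ), HasDerivAt Φ (X t) t := by
  filter_upwards [eventuallyEq_of_smul_eq hΦ.deriv.continuousAt hX h, hΦ.eventually_analyticAt] with t h1 h2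
  rw [← h1]
  exact h2.differentiableAt.hasDerivAt

/-- Linear holomorphic differential equations have local fundamental solutions. -/
theorem exists_fundamental_solution [CompleteSpace V] {L : ℂ → V →L[ℂ] V} {z₀ : ℂ}
    (hL : AnalyticAt ℂ L z₀) :
    ∃ P : ℂ → V →L[ℂ] V, AnalyticAt ℂ P z₀ ∧ P z₀ = ContinuousLinearMap.id ℂ V ∧
      ∀ᶠ z in 𝓝 z₀, HasDerivAt P ((L z).comp (P z)) z := by
  let W := ℂ × (V →L[ℂ] V)
  let x₀ : W := (z₀, ContinuousLinearMap.id ℂ V)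
  -- Time is adjoined as a coordinate of velocity 1, which makes the equation autonomous, so that
  -- the exponential of a vector field solves it.
  let Y : W → W := fun x => (1, (L x.1).comp x.2)
  have hY : AnalyticAt ℂ Y x₀ := by
    have h1 : AnalyticAt ℂ (fun x : W => L x.1) x₀ := AnalyticAt.comp (g := L) (f := Prod.fst) hL analyticAt_fst
    have h2 : AnalyticAt ℂ (fun x : W => (L x.1).comp x.2) x₀ :=
      (h1.contDiffAt.clm_comp (analyticAt_snd (𝕜 := ℂ)).contDiffAt (n := ω)).analyticAt
    exact analyticAt_const.prod h2
  let X : W → ℂ →L[ℂ] W := fun x => ContinuousLinearMap.smulRight (1 : ℂ →L[ℂ] ℂ) (Y x)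
  have hX : AnalyticAt ℂ X x₀ := by
    have h1 : ContDiffAt ℂ ω X x₀ := contDiffAt_const.smulRight hY.contDiffAt
    exact h1.analyticAt
  obtain ⟨Φ, hΦ, hΦ0, hΦ1⟩ := exists_exponential hX
  let u : ℂ → W := fun t => Φ (t, x₀)
  have hu : AnalyticAt ℂ u 0 := hΦ.comp (f := fun t : ℂ => (t, x₀)) (analyticAt_id.prod analyticAt_const)
  have hu0 : u 0 = x₀ := hΦ0.self_of_nhds
  have hYu : ContinuousAt (fun t => Y (u t)) 0 := by
    refine ContinuousAt.comp (g := Y) ?_ hu.continuousAt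
    rw [hu0]; exact hY.continuousAt
  have hin : ContinuousAt (fun t : ℂ => (t, x₀)) 0 := by fun_prop
  have hder : ∀ᶠ t in 𝓝 (0 : ℂ), HasDerivAt u (Y (u t)) t := by
    refine eventually_deriv_of_smul hu hYu ?_
    filter_upwards [hin.eventually hΦ1, hin.eventually hΦ.eventually_analyticAt] with t h1 h2
    have h3 : HasDerivAt u (fderiv ℂ Φ (t, x₀) (1, 0)) t :=
      h2.differentiableAt.hasFDerivAt.comp_hasDerivAt t ((hasDerivAt_id t).prodMk (hasDerivAt_const t x₀))
    rw [h3.deriv, ← map_smul]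
    simpa [X] using h1
  have hfst : ∀ᶠ t in 𝓝 (0 : ℂ), (u t).1 = z₀ + t := by
    obtain ⟨r, hr, hball⟩ := Metric.eventually_nhds_iff_ball.1 hder
    filter_upwards [Metric.ball_mem_nhds (0 : ℂ) hr] with t ht
    have h1 : ∀ t ∈ Metric.ball (0 : ℂ) r, HasDerivAt (fun t => (u t).1 - t) 0 t := fun t ht => by
      have h2 : HasDerivAt (fun t => (u t).1) 1 t :=
        (ContinuousLinearMap.fst ℂ ℂ (V →L[ℂ] V)).hasFDerivAt.comp_hasDerivAt t (hball t ht)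
      simpa using h2.fun_sub (hasDerivAt_id' t)
    have h2 := (convex_ball (0 : ℂ) r).is_const_of_fderivWithin_eq_zero (𝕜 := ℂ)
      (f := fun t => (u t).1 - t) (fun t ht => (h1 t ht).differentiableAt.differentiableWithinAt)
      (fun t ht => by
        rw [fderivWithin_of_isOpen Metric.isOpen_ball ht]
        ext; simp [(h1 t ht).deriv]) ht (Metric.mem_ball_self hr)
    have h3 : (u t).1 - t = (u 0).1 - 0 := h2
    rw [hu0] at h3
    linear_combination h3
  have hsub : ContinuousAt (fun z => z - z₀) z₀ := by fun_prop
  have hz : Tendsto (fun z => z - z₀) (𝓝 z₀) (𝓝 0) := by simpa using hsub.tendsto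
  refine ⟨fun z => (u (z - z₀)).2, ?_, ?_, ?_⟩
  · have h1 : AnalyticAt ℂ u (z₀ - z₀) := by simpa using hu
    exact analyticAt_snd.comp (h1.comp (f := fun z => z - z₀) (analyticAt_id.sub analyticAt_const))
  · simp [hu0, x₀]
  · filter_upwards [hz.eventually hder, hz.eventually hfst] with z h1 h2
    have h3 : HasDerivAt (fun z => (u (z - z₀)).2) (Y (u (z - z₀))).2 z := by
      have h4 : HasDerivAt (fun z => u (z - z₀)) (Y (u (z - z₀))) z := by
        have h5 := HasDerivAt.scomp (h := fun z => z - z₀) z h1 ((hasDerivAt_id' z).sub_const z₀)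
        rw [one_smul] at h5
        exact h5
      exact (ContinuousLinearMap.snd ℂ ℂ (V →L[ℂ] V)).hasFDerivAt.comp_hasDerivAt z h4
    have h5 : (u (z - z₀)).1 = z := by rw [h2]; ring
    change HasDerivAt _ ((L (u (z - z₀)).1).comp _) z at h3
    rwa [h5] at h3

end LinearEquations

/-! ### Lifts of curves and parallel frames of the adjoint tractor bundle -/

namespace CartanGeometry

variable {d e : ℕ} {G H : Type u} [Group G] [TopologicalSpace G] [ChartedSpace (Cn d) G]
  [ComplexLieGroup d G]
  [Group H] [TopologicalSpace H] [ChartedSpace (Cn e) H] [ComplexLieGroup e H]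
  {ι : H →* G} {n : ℕ} {M : Type u} [TopologicalSpace M] [ChartedSpace (Cn n) M]
  (C : CartanGeometry d e ι n M)

/-- Holomorphic lifts of a map to the total space. -/
def IsLiftAt {Z : Type*} [NormedAddCommGroup Z] [NormedSpace ℂ Z] (f : Z → M) (s : Z → C.E) (z : Z) : Prop :=
  ContMDiffAt 𝓘(ℂ, Z) (cI d) ω s z ∧ ∀ᶠ w in 𝓝 z, C.proj (s w) = f w

section Lifts

variable {C} {Z : Type*} [NormedAddCommGroup Z] [NormedSpace ℂ Z] {f : Z → M} {s t : Z → C.E} {z : Z}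

lemma IsLiftAt.eventually (h : C.IsLiftAt f s z) : ∀ᶠ w in 𝓝 z, C.IsLiftAt f s w := by
  filter_upwards [h.1.eventually_nhds, h.2.eventually_nhds] with w h1 h2 using ⟨h1, h2⟩

lemma exists_isLiftAt (hf : ContMDiffAt 𝓘(ℂ, Z) (cI n) ω f z) {x : C.E} (hx : C.proj x = f z) :
    ∃ s, C.IsLiftAt f s z ∧ s z = x := by
  let S := C.localSection x
  have hS := S.isOpen.mem_nhds S.mem
  refine ⟨fun w => S.s (f w), ⟨?_, ?_⟩, ?_⟩
  · refine ContMDiffAt.comp (g := S.s) z ?_ hf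
    rw [← hx]
    exact S.s_holomorphic.contMDiffAt hS
  · rw [hx] at hS
    filter_upwards [hf.continuousAt.eventually_mem hS] with w hw using S.proj_s _ hw
  · change S.s (f z) = x
    rw [← hx, S.s_proj]

/-- Two lifts differ by a holomorphic map to the structure group. -/
lemma IsLiftAt.exists_act_eq (hs : C.IsLiftAt f s z) (ht : C.IsLiftAt f t z) :
    ∃ k : Z → H, ContMDiffAt 𝓘(ℂ, Z) (cI e) ω k z ∧ ∀ᶠ w in 𝓝 z, t w = C.act (s w) (k w) := by
  let S := C.localSection (s z)
  have hS := S.isOpen_preimage.mem_nhds S.mem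
  have hz : C.proj (t z) = C.proj (s z) := by rw [hs.2.self_of_nhds, ht.2.self_of_nhds]
  have hS' : C.proj ⁻¹' S.U ∈ 𝓝 (t z) := S.isOpen_preimage.mem_nhds (by rw [mem_preimage, hz]; exact S.mem)
  have h1 : ContMDiffAt 𝓘(ℂ, Z) (cI e) ω (fun w => S.k (s w)) z :=
    ContMDiffAt.comp (g := S.k) z (S.k_holomorphic.contMDiffAt hS) hs.1
  have h2 : ContMDiffAt 𝓘(ℂ, Z) (cI e) ω (fun w => S.k (t w)) z :=
    ContMDiffAt.comp (g := S.k) z (S.k_holomorphic.contMDiffAt hS') ht.1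
  refine ⟨fun w => (S.k (s w))⁻¹ * S.k (t w), (h1.inv).mul h2, ?_⟩
  filter_upwards [hs.2, ht.2, hs.1.continuousAt.eventually_mem hS, ht.1.continuousAt.eventually_mem hS']
    with w e1 e2 m1 m2
  have e3 := S.act_s_k _ m1
  have e4 := S.act_s_k _ m2
  rw [e1] at e3
  rw [e2] at e4
  rw [← e4, ← e3, S.k_act _ (by rwa [S.proj_s _ (e1 ▸ m1), ← e1]), S.k_s _ (e1 ▸ m1),
    S.k_act _ (by rwa [S.proj_s _ (e1 ▸ m1), ← e1]), S.k_s _ (e1 ▸ m1), ← C.act_mul]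
  simp

end Lifts

end CartanGeometry

/-- Endomorphisms of the underlying vector space of the Lie algebra. -/
abbrev GLn (d : ℕ) : Type := (Cn d →L[ℂ] Cn d)ˣ

/-- Two solutions of one linear equation p' = X p differ by a constant factor on the right: the two
contributions of X cancel. -/
lemma hasDerivAt_units_inv_mul {R : Type*} [NormedRing R] [NormedAlgebra ℂ R] [CompleteSpace R]
    {p q : ℂ → Rˣ} {X : R} {w : ℂ} (hp : HasDerivAt (fun w => (p w : R)) (X * p w) w)
    (hq : HasDerivAt (fun w => (q w : R)) (X * q w) w) :
    HasDerivAt (fun w => (((p w)⁻¹ * q w : Rˣ) : R)) 0 w := by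
  have h3 := (hasFDerivAt_ringInverse (𝕜 := ℂ) (p w)).comp_hasDerivAt w hp
  have h4 := h3.mul hq
  have h5 : (fun w => (((p w)⁻¹ * q w : Rˣ) : R)) =
      (Ring.inverse ∘ fun w => (p w : R)) * fun w => (q w : R) := by
    funext w
    simp
  rw [h5]
  refine h4.congr_deriv ?_
  simp [mul_assoc]

section AdjointUnits

variable {d : ℕ} {G : Type u} [Group G] [TopologicalSpace G] [ChartedSpace (Cn d) G]
  [ComplexLieGroup d G] {Z : Type*} [NormedAddCommGroup Z] [NormedSpace ℂ Z]

/-- The adjoint representation as a group morphism. -/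
def admU (d : ℕ) (G : Type u) [Group G] [TopologicalSpace G] [ChartedSpace (Cn d) G]
    [ComplexLieGroup d G] : G →* GLn d :=
  MonoidHom.toHomUnits
    { toFun := fun g => adm d g
      map_one' := adm_one
      map_mul' := fun g h => adm_mul g h }

lemma admU_coe (g : G) : (admU d G g : Cn d →L[ℂ] Cn d) = adm d g := rfl

lemma contDiffAt_adm_inv {g : Z → G} {z : Z} (hg : ContMDiffAt 𝓘(ℂ, Z) (cI d) ω g z) :
    ContDiffAt ℂ ω (fun z => adm d (g z)⁻¹) z := by
  obtain ⟨U, hU, hopen, hz⟩ := eventually_nhds_iff.1 hg.eventually_nhds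
  exact (contDiffOn_clm_apply.2 fun y w hw =>
    (hasFDerivAt_adm_inv (hU w hw) y).1.contDiffWithinAt).contDiffAt (hopen.mem_nhds hz)

lemma hasDerivAt_adm_inv {g : ℂ → G} {z : ℂ} (hg : ContMDiffAt 𝓘(ℂ, ℂ) (cI d) ω g z) :
    HasDerivAt (fun z => adm d (g z)⁻¹) (lieBr d G (-(mc d G).pull g z 1) * adm d (g z)⁻¹) z := by
  have h1 := ((contDiffAt_adm_inv hg).differentiableAt (by simp)).hasFDerivAt.hasDerivAt
  refine h1.congr_deriv ?_
  ext1 y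
  have h2 := h1.clm_apply (hasDerivAt_const z y)
  have h3 := (((hasFDerivAt_adm_inv hg y).1.differentiableAt (by simp)).hasFDerivAt.hasDerivAt).unique h2
  rw [(hasFDerivAt_adm_inv hg y).2] at h3
  simpa using h3.symm

end AdjointUnits

namespace CartanGeometry

variable {d e : ℕ} {G H : Type u} [Group G] [TopologicalSpace G] [ChartedSpace (Cn d) G]
  [ComplexLieGroup d G]
  [Group H] [TopologicalSpace H] [ChartedSpace (Cn e) H] [ComplexLieGroup e H]
  {ι : H →* G} {n : ℕ} {M : Type u} [TopologicalSpace M] [ChartedSpace (Cn n) M]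
  (C : CartanGeometry d e ι n M)

/-- The position of a point in its fibre, relative to a chosen point of each fibre. -/
def fibreCoord (x : C.E) : H :=
  (C.exists_act_eq (x := Function.surjInv C.proj_surjective (C.proj x)) (y := x)
    (Function.surjInv_eq C.proj_surjective _)).choose

lemma act_fibreCoord (x : C.E) :
    C.act (Function.surjInv C.proj_surjective (C.proj x)) (C.fibreCoord x) = x :=
  (C.exists_act_eq (x := Function.surjInv C.proj_surjective (C.proj x)) (y := x)
    (Function.surjInv_eq C.proj_surjective _)).choose_spec

lemma fibreCoord_act (x : C.E) (h : H) : C.fibreCoord (C.act x h) = C.fibreCoord x * h := by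
  refine C.act_injective (Function.surjInv C.proj_surjective (C.proj x)) ?_
  rw [C.act_mul, C.act_fibreCoord]
  conv_lhs => rw [← C.proj_act x h, C.act_fibreCoord]

/-- A frame of the adjoint bundle at a point of the base, seen from a point of the total space. -/
def frameAt (a : GLn d) (x : C.E) : GLn d := (admU d G (ι (C.fibreCoord x)))⁻¹ * a

/-- A frame of the tractor fibre over a point of the base is an equivariant function on the fibre of
E above it; a single matrix encodes it relative to the chosen point of the fibre. -/
lemma frameAt_act (a : GLn d) (x : C.E) (h : H) :
    C.frameAt a (C.act x h) = (admU d G (ι h))⁻¹ * C.frameAt a x := by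
  simp only [frameAt, fibreCoord_act, map_mul, mul_inv_rev, mul_assoc]

lemma frameAt_mul (a b : GLn d) (x : C.E) : C.frameAt (a * b) x = C.frameAt a x * b := by
  simp only [frameAt, mul_assoc]

/-- The chosen points of the fibres need not vary continuously. They cancel in quotients of frames,
so that transition functions between frame fields are meaningful all the same. -/
lemma frameAt_inv_mul (a b : GLn d) (x : C.E) : (C.frameAt a x)⁻¹ * C.frameAt b x = a⁻¹ * b := by
  simp only [frameAt]; group

/-- The tractor equation for a frame field, along a lift of a curve. -/
def IsParallel (a : ℂ → GLn d) (s : ℂ → C.E) (w : ℂ) : Prop :=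
  HasDerivAt (fun w => (C.frameAt (a w) (s w) : Cn d →L[ℂ] Cn d))
    (lieBr d G (-C.coframe.pull s w 1) * (C.frameAt (a w) (s w) : Cn d →L[ℂ] Cn d)) w

/-- A frame field along a curve in the base is flat if it is parallel for the tractor connection. -/
def IsFlatAt (f : ℂ → M) (a : ℂ → GLn d) (z : ℂ) : Prop :=
  ∃ s, C.IsLiftAt f s z ∧ ∀ᶠ w in 𝓝 z, C.IsParallel a s w

variable {C} {f : ℂ → M} {a b : ℂ → GLn d} {z : ℂ} {s t : ℂ → C.E}

lemma IsParallel.congr {w : ℂ} (h : C.IsParallel a s w) (hab : a =ᶠ[𝓝 w] b) (hst : s =ᶠ[𝓝 w] t) :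
    C.IsParallel b t w := by
  unfold IsParallel at h ⊢
  rw [← C.coframe.pull_congr hst, ← hab.eq_of_nhds, ← hst.eq_of_nhds]
  refine h.congr_of_eventuallyEq ?_
  filter_upwards [hab, hst] with w h1 h2
  rw [h1, h2]

lemma IsFlatAt.eventually (h : C.IsFlatAt f a z) : ∀ᶠ w in 𝓝 z, C.IsFlatAt f a w := by
  obtain ⟨s, h1, h2⟩ := h
  filter_upwards [h1.eventually, h2.eventually_nhds] with w h3 h4 using ⟨s, h3, h4⟩

lemma IsFlatAt.congr (h : C.IsFlatAt f a z) (hab : a =ᶠ[𝓝 z] b) : C.IsFlatAt f b z := by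
  obtain ⟨s, h1, h2⟩ := h
  refine ⟨s, h1, ?_⟩
  filter_upwards [h2, hab.eventuallyEq_nhds] with w h3 h4 using h3.congr h4 (EventuallyEq.refl _ _)

lemma IsFlatAt.mul_const (h : C.IsFlatAt f a z) (c : GLn d) : C.IsFlatAt f (fun w => a w * c) z := by
  obtain ⟨s, h1, h2⟩ := h
  refine ⟨s, h1, ?_⟩
  filter_upwards [h2] with w h3
  have h4 := HasDerivAt.mul_const h3 (c : Cn d →L[ℂ] Cn d)
  simp only [IsParallel, frameAt_mul, Units.val_mul]
  refine h4.congr_deriv ?_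
  rw [mul_assoc]

/-- Gauge invariance: replacing s by s·k multiplies the frame by Ad(k)⁻¹, whose logarithmic
derivative matches the extra term which k contributes to the pullback of the connection. -/
lemma isParallel_act {k : ℂ → H} {w : ℂ} (hι : ContMDiff (cI e) (cI d) ω ι)
    (hs : ContMDiffAt 𝓘(ℂ, ℂ) (cI d) ω s w) (hk : ContMDiffAt 𝓘(ℂ, ℂ) (cI e) ω k w)
    (h : C.IsParallel a s w) : C.IsParallel a (fun w => C.act (s w) (k w)) w := by
  have hιk : ContMDiffAt 𝓘(ℂ, ℂ) (cI d) ω (fun w => ι (k w)) w := hι.contMDiffAt.comp w hk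
  have h1 := HasDerivAt.mul (hasDerivAt_adm_inv hιk) h
  have h0 : ∀ w, (C.frameAt (a w) (C.act (s w) (k w)) : Cn d →L[ℂ] Cn d)
      = adm d (ι (k w))⁻¹ * (C.frameAt (a w) (s w) : Cn d →L[ℂ] Cn d) := fun w => by
    rw [frameAt_act, ← map_inv, Units.val_mul, admU_coe]
  unfold IsParallel
  simp only [h0]
  refine h1.congr_deriv ?_
  have h2 : ∀ B : Cn d, lieBr d G (adm d (ι (k w))⁻¹ B) * adm d (ι (k w))⁻¹
      = adm d (ι (k w))⁻¹ * lieBr d G B := fun B => by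
    ext1 y
    exact (adm_lieBr _ _ _).symm
  rw [C.pull_act hs hk, neg_add, ← map_neg (adm d (ι (k w))⁻¹), map_add, pull_mc_hom hι hk, add_mul,
    ← mul_assoc, ← mul_assoc, h2, ← mul_assoc]
  exact add_comm _ _

lemma IsFlatAt.isParallel (hι : ContMDiff (cI e) (cI d) ω ι) (h : C.IsFlatAt f a z)
    (ht : C.IsLiftAt f t z) : ∀ᶠ w in 𝓝 z, C.IsParallel a t w := by
  obtain ⟨s, h1, h2⟩ := h
  obtain ⟨k, hk, hst⟩ := h1.exists_act_eq ht
  filter_upwards [h1.1.eventually_nhds, hk.eventually_nhds, h2, hst.eventually_nhds] with w a1 a2 a3 a4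
  refine (isParallel_act hι a1 a2 a3).congr (EventuallyEq.refl _ _) ?_
  filter_upwards [a4] with w hw using hw.symm

lemma eventually_eq_of_deriv_eq_zero {V : Type*} [NormedAddCommGroup V] [NormedSpace ℂ V] {F : ℂ → V}
    {z : ℂ} (h : ∀ᶠ w in 𝓝 z, HasDerivAt F 0 w) : ∀ᶠ w in 𝓝 z, F w = F z := by
  obtain ⟨r, hr, hball⟩ := Metric.eventually_nhds_iff_ball.1 h
  filter_upwards [Metric.ball_mem_nhds z hr] with w hw
  refine (convex_ball z r).is_const_of_fderivWithin_eq_zero (𝕜 := ℂ)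
    (fun t ht => (hball t ht).differentiableAt.differentiableWithinAt) (fun t ht => ?_) hw
    (Metric.mem_ball_self hr)
  rw [fderivWithin_of_isOpen Metric.isOpen_ball ht]
  ext
  simp [(hball t ht).deriv]

/-- By gauge invariance both frame fields solve the same linear equation along a common lift. So
flat frame fields form a local system of torsors under GL(𝔤). -/
lemma IsFlatAt.eventually_inv_mul_eq (hι : ContMDiff (cI e) (cI d) ω ι) (ha : C.IsFlatAt f a z)
    (hb : C.IsFlatAt f b z) : ∀ᶠ w in 𝓝 z, (a w)⁻¹ * b w = (a z)⁻¹ * b z := by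
  obtain ⟨s, hs, has⟩ := ha
  have hbs := hb.isParallel hι hs
  have key : ∀ᶠ w in 𝓝 z, HasDerivAt (fun w => (((a w)⁻¹ * b w : GLn d) : Cn d →L[ℂ] Cn d)) 0 w := by
    filter_upwards [has, hbs] with w h1 h2
    have h3 := hasDerivAt_units_inv_mul (R := Cn d →L[ℂ] Cn d) h1 h2
    simpa only [frameAt_inv_mul] using h3
  filter_upwards [eventually_eq_of_deriv_eq_zero key] with w hw using Units.ext hw

lemma exists_isFlatAt (hf : ContMDiffAt 𝓘(ℂ, ℂ) (cI n) ω f z) : ∃ a, C.IsFlatAt f a z := by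
  obtain ⟨x, hx⟩ := C.proj_surjective (f z)
  obtain ⟨s, hs, hsx⟩ := exists_isLiftAt hf hx
  have hL : AnalyticAt ℂ (fun w => lieBr d G (-C.coframe.pull s w 1)) z :=
    ((lieBr d G).contDiff.contDiffAt.comp z
      ((C.coframe.contDiffAt_pull hs.1).clm_apply contDiffAt_const).neg).analyticAt
  obtain ⟨P, hP, hPz, hP'⟩ := exists_fundamental_solution hL
  have hunit : ∀ᶠ w in 𝓝 z, IsUnit (P w) := by
    refine hP.continuousAt.eventually_mem (Units.isOpen.mem_nhds ?_)
    rw [hPz]; exact isUnit_one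
  classical
  let p : ℂ → GLn d := fun w => if h : IsUnit (P w) then h.unit else 1
  have hp : ∀ᶠ w in 𝓝 z, (p w : Cn d →L[ℂ] Cn d) = P w := by
    filter_upwards [hunit] with w hw
    simp [p, hw]
  -- The first factor undoes the fibre coordinate of s w, so that the frame seen from s w is the
  -- fundamental solution p w.
  refine ⟨fun w => admU d G (ι (C.fibreCoord (s w))) * p w, s, hs, ?_⟩
  have h1 : ∀ w, C.frameAt (admU d G (ι (C.fibreCoord (s w))) * p w) (s w) = p w := fun w => by
    simp [frameAt]
  filter_upwards [hp.eventually_nhds, hP'] with w h2 h3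
  simp only [IsParallel, h1]
  rw [h2.self_of_nhds]
  refine HasDerivAt.congr_of_eventuallyEq ?_ h2
  exact h3

/-- Every holomorphic curve parametrized by `ℂ` carries a flat frame field. -/
theorem exists_forall_isFlatAt (hι : ContMDiff (cI e) (cI d) ω ι) (hf : ContMDiff 𝓘(ℂ, ℂ) (cI n) ω f) :
    ∃ a, ∀ z, C.IsFlatAt f a z := by
  choose p hp using fun z => exists_isFlatAt (C := C) (hf.contMDiffAt (x := z))
  have hU : ∀ z, ∃ U : Set ℂ, (∀ w ∈ U, C.IsFlatAt f (p z) w) ∧ IsOpen U ∧ z ∈ U := fun z =>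
    eventually_nhds_iff.1 (hp z).eventually
  choose U hflat hopen hmem using hU
  -- Local flat frame fields glue because ℂ is simply connected.
  obtain ⟨a, ha⟩ := exists_section_of_locally_constant U hopen hmem p
    (fun i j x hx => (hflat j x hx.2).eventually_inv_mul_eq hι (hflat i x hx.1))
  refine ⟨a, fun z => ?_⟩
  refine ((hp z).mul_const ((p z z)⁻¹ * a z)).congr ?_
  filter_upwards [ha z z (hmem z)] with w hw
  rw [← hw, mul_inv_cancel_left]

end CartanGeometry

/-! ### Rational curves in affine coordinates -/

section Constancy

variable {n : ℕ} {M : Type u} [TopologicalSpace M] [ChartedSpace (Cn n) M] [IsManifold (cI n) ω M]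

/-- A holomorphic map on `ℂ` with vanishing derivative is constant. -/
lemma eq_of_mder_eq_zero {f : ℂ → M} (hf : ContMDiff 𝓘(ℂ, ℂ) (cI n) ω f)
    (h : ∀ z, mder 𝓘(ℂ, ℂ) (cI n) f z = 0) (z w : ℂ) : f z = f w := by
  have h1 : IsLocallyConstant f := by
    rw [IsLocallyConstant.iff_eventually_eq]
    intro z
    let c := chartAt (Cn n) (f z)
    have hz : f z ∈ c.source := mem_chart_source _ _
    have hs := hf.continuous.continuousAt.eventually_mem (c.open_source.mem_nhds hz)
    have h2 : ∀ᶠ w in 𝓝 z, HasDerivAt (fun w => c (f w)) 0 w := by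
      filter_upwards [hs] with w hw
      have h3 : fderiv ℂ (fun w => c (f w)) w = 0 := by
        rw [← mder_eq_fderiv, mder_comp (contMDiffAt_chartAt hw) hf.contMDiffAt, h,
          ContinuousLinearMap.comp_zero]
      have h4 := (hf.contMDiffAt.contDiffAt_chartAt hw).differentiableAt (by simp)
      have h5 := h4.hasFDerivAt.hasDerivAt
      rw [h3] at h5
      simpa using h5
    filter_upwards [CartanGeometry.eventually_eq_of_deriv_eq_zero h2, hs] with w h3 h4
    exact c.injOn h4 hz h3
  exact h1.apply_eq_of_preconnectedSpace z w

lemma projPt₁_eq {z : ℂ} (hz : z ≠ 0) : projPt₁ z = projPt₀ z⁻¹ := by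
  rw [projPt₀, projPt₁, Projectivization.mk_eq_mk_iff']
  refine ⟨z, ?_⟩
  ext i
  fin_cases i <;> simp [hz]

lemma eq_projPt (p : Projectivization ℂ (Fin 2 → ℂ)) : (∃ z, p = projPt₀ z) ∨ p = projPt₁ 0 := by
  induction p using Projectivization.ind with
  | h v hv =>
    by_cases h1 : v 1 = 0
    · right
      rw [projPt₁, Projectivization.mk_eq_mk_iff']
      refine ⟨v 0, ?_⟩
      ext i
      fin_cases i <;> simp [h1]
    · left
      refine ⟨v 0 / v 1, ?_⟩
      rw [projPt₀, Projectivization.mk_eq_mk_iff']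
      refine ⟨v 1, ?_⟩
      ext i
      fin_cases i <;> simp [h1, mul_div_cancel₀]

/-- The derivative of a rational curve does not vanish identically. -/
lemma IsRationalCurve.exists_mder_ne_zero [T2Space M] {f : Projectivization ℂ (Fin 2 → ℂ) → M}
    (hf : IsRationalCurve (n := n) f) :
    ∃ z, mder 𝓘(ℂ, ℂ) (cI n) (fun z => f (projPt₀ z)) z ≠ 0 := by
  by_contra! hcon
  have h0 := eq_of_mder_eq_zero hf.holomorphic₀ hcon
  -- The only point outside the affine chart is a limit of points of the chart, on which f is
  -- constant.
  have h1 : f (projPt₁ 0) = f (projPt₀ 0) := by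
    have h2 : Tendsto (fun z => f (projPt₁ z)) (𝓝[≠] 0) (𝓝 (f (projPt₁ 0))) :=
      hf.holomorphic₁.continuous.continuousAt.tendsto.mono_left nhdsWithin_le_nhds
    have h3 : Tendsto (fun z => f (projPt₁ z)) (𝓝[≠] 0) (𝓝 (f (projPt₀ 0))) := by
      refine tendsto_const_nhds.congr' ?_
      filter_upwards [self_mem_nhdsWithin] with z hz
      rw [projPt₁_eq hz]
      exact h0 _ _
    exact tendsto_nhds_unique h2 h3
  have h4 : ∀ p, f p = f (projPt₀ 0) := fun p => by
    rcases eq_projPt p with ⟨z, rfl⟩ | rfl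
    · exact h0 _ _
    · exact h1
  obtain ⟨p, q, hpq⟩ := hf.nonconstant
  exact hpq ((h4 p).trans (h4 q).symm)

end Constancy

/-! ### Equivariant tensors vanish on the velocity of a rational curve -/

namespace CartanGeometry

variable {d e : ℕ} {G H : Type u} [Group G] [TopologicalSpace G] [ChartedSpace (Cn d) G]
  [ComplexLieGroup d G]
  [Group H] [TopologicalSpace H] [ChartedSpace (Cn e) H] [ComplexLieGroup e H]
  {ι : H →* G} {n : ℕ} {M : Type u} [TopologicalSpace M] [ChartedSpace (Cn n) M]
  (C : CartanGeometry d e ι n M)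

/-- A holomorphic equivariant family of bilinear maps, semibasic in the first argument, depending
on a point of the total space and on a vector of the model. -/
structure IsTensor (Q : C.E → Cn d → Cn d →L[ℂ] Cn d →L[ℂ] Cn d) : Prop where
  holo : ContMDiff ((cI d).prod 𝓘(ℂ, Cn d)) 𝓘(ℂ, Cn d →L[ℂ] Cn d →L[ℂ] Cn d) ω
    (fun p : C.E × Cn d => Q p.1 p.2)
  equivariant : ∀ h x A B y, Q (C.act x h) (adm d (ι h)⁻¹ B) (adm d (ι h)⁻¹ A) (adm d (ι h)⁻¹ y)
    = adm d (ι h)⁻¹ (Q x B A y)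
  vertical : ∀ x B X, Q x B (lmap d e ι X) = 0

/-- A tensor along a curve, contracted with the velocity and expressed in a frame field. -/
def transported (Q : C.E → Cn d → Cn d →L[ℂ] Cn d →L[ℂ] Cn d) (a : ℂ → GLn d) (b y : Cn d) (s : ℂ → C.E)
    (z : ℂ) : Cn d :=
  (((C.frameAt (a z) (s z))⁻¹ : GLn d) : Cn d →L[ℂ] Cn d)
    (Q (s z) ((C.frameAt (a z) (s z) : Cn d →L[ℂ] Cn d) b) (C.coframe.pull s z 1)
      ((C.frameAt (a z) (s z) : Cn d →L[ℂ] Cn d) y))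

variable {C} {Q : C.E → Cn d → Cn d →L[ℂ] Cn d →L[ℂ] Cn d} {f : ℂ → M} {a : ℂ → GLn d} {b y : Cn d}
  {z : ℂ} {s t : ℂ → C.E}

/-- Another lift changes the frame by Ad(k)⁻¹, which equivariance absorbs, and the velocity moreover
by a vertical term, which the semibasic argument kills. The transported tensor is thus attached to
the curve in the base. -/
lemma IsTensor.transported_eq (hQ : C.IsTensor Q) (hs : C.IsLiftAt f s z) (ht : C.IsLiftAt f t z) :
    C.transported Q a b y t z = C.transported Q a b y s z := by
  obtain ⟨k, hk, hst⟩ := hs.exists_act_eq ht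
  have h1 : C.coframe.pull t z 1 = adm d (ι (k z))⁻¹ (C.coframe.pull s z 1)
      + lmap d e ι ((mc e H).pull k z 1) := by
    rw [C.coframe.pull_congr hst, C.pull_act hs.1 hk]
  have h2 : ∀ v, (C.frameAt (a z) (C.act (s z) (k z)) : Cn d →L[ℂ] Cn d) v
      = adm d (ι (k z))⁻¹ ((C.frameAt (a z) (s z) : Cn d →L[ℂ] Cn d) v) := fun v => by
    rw [frameAt_act, ← map_inv]; rfl
  have h3 : ∀ v, (((C.frameAt (a z) (C.act (s z) (k z)))⁻¹ : GLn d) : Cn d →L[ℂ] Cn d)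
      (adm d (ι (k z))⁻¹ v) = (((C.frameAt (a z) (s z))⁻¹ : GLn d) : Cn d →L[ℂ] Cn d) v := fun v => by
    rw [frameAt_act, ← map_inv, ← admU_coe, mul_inv_rev, Units.val_mul]
    change (((C.frameAt (a z) (s z))⁻¹ : GLn d) : Cn d →L[ℂ] Cn d)
      (((((admU d G) (ι (k z))⁻¹)⁻¹ * (admU d G) (ι (k z))⁻¹ : GLn d) : Cn d →L[ℂ] Cn d) v) = _
    rw [inv_mul_cancel]
    rfl
  unfold transported
  rw [h1, hst.self_of_nhds, map_add, hQ.vertical, add_zero, h2, h2, hQ.equivariant, h3]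

lemma IsTensor.differentiableAt_transported (hQ : C.IsTensor Q) (hs : C.IsLiftAt f s z)
    (ha : ∀ᶠ w in 𝓝 z, C.IsParallel a s w) : DifferentiableAt ℂ (C.transported Q a b y s) z := by
  have hP : AnalyticAt ℂ (fun w => (C.frameAt (a w) (s w) : Cn d →L[ℂ] Cn d)) z := by
    rw [Complex.analyticAt_iff_eventually_differentiableAt]
    filter_upwards [ha] with w hw using hw.differentiableAt
  have hPv : ∀ v, ContDiffAt ℂ ω (fun w => (C.frameAt (a w) (s w) : Cn d →L[ℂ] Cn d) v) z := fun v =>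
    hP.contDiffAt.clm_apply contDiffAt_const
  have hPi : ContDiffAt ℂ ω
      (fun w => (((C.frameAt (a w) (s w))⁻¹ : GLn d) : Cn d →L[ℂ] Cn d)) z := by
    have h1 : (fun w => (((C.frameAt (a w) (s w))⁻¹ : GLn d) : Cn d →L[ℂ] Cn d))
        = fun w => Ring.inverse (C.frameAt (a w) (s w) : Cn d →L[ℂ] Cn d) := by
      funext w; simp
    rw [h1]
    exact (contDiffAt_ringInverse ℂ (C.frameAt (a z) (s z))).comp z hP.contDiffAt
  have hQs : ContDiffAt ℂ ω
      (fun w => Q (s w) ((C.frameAt (a w) (s w) : Cn d →L[ℂ] Cn d) b)) z := by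
    rw [← contMDiffAt_iff_contDiffAt]
    exact ContMDiffAt.comp (g := fun p : C.E × Cn d => Q p.1 p.2)
      (f := fun w => (s w, (C.frameAt (a w) (s w) : Cn d →L[ℂ] Cn d) b)) z hQ.holo.contMDiffAt
      (hs.1.prodMk (hPv b).contMDiffAt)
  have hp : ContDiffAt ℂ ω (fun w => C.coframe.pull s w 1) z :=
    (C.coframe.contDiffAt_pull hs.1).clm_apply contDiffAt_const
  exact (hPi.clm_apply ((hQs.clm_apply hp).clm_apply (hPv y))).differentiableAt (by simp)

/-- The velocity occurs once and linearly, so the transported tensor changes under reparametrization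
like the coefficient of a 1-form. -/
lemma transported_comp {φ : ℂ → ℂ} (hφ : ContDiffAt ℂ ω φ z)
    (hs : ContMDiffAt 𝓘(ℂ, ℂ) (cI d) ω s (φ z)) :
    C.transported Q (fun w => a (φ w)) b y (fun w => s (φ w)) z
      = deriv φ z • C.transported Q a b y s (φ z) := by
  unfold transported
  have h1 : C.coframe.pull (fun w => s (φ w)) z 1 = deriv φ z • C.coframe.pull s (φ z) 1 := by
    rw [C.coframe.pull_comp hs hφ, ← map_smul, ContinuousLinearMap.comp_apply]
    congr 1
    rw [smul_eq_mul, mul_one]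
    rfl
  rw [h1, map_smul, smul_apply, map_smul]

lemma IsLiftAt.comp {φ : ℂ → ℂ} (hφ : ContDiffAt ℂ ω φ z) (hs : C.IsLiftAt f s (φ z)) :
    C.IsLiftAt (fun w => f (φ w)) (fun w => s (φ w)) z :=
  ⟨ContMDiffAt.comp z hs.1 hφ.contMDiffAt, hφ.continuousAt.eventually hs.2⟩

lemma IsParallel.comp {φ : ℂ → ℂ} (hφ : ContDiffAt ℂ ω φ z)
    (hs : ContMDiffAt 𝓘(ℂ, ℂ) (cI d) ω s (φ z)) (h : C.IsParallel a s (φ z)) :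
    C.IsParallel (fun w => a (φ w)) (fun w => s (φ w)) z := by
  have h2 := HasDerivAt.scomp z h (hφ.differentiableAt (by simp)).hasDerivAt
  have h1 : C.coframe.pull (fun w => s (φ w)) z 1 = deriv φ z • C.coframe.pull s (φ z) 1 := by
    rw [C.coframe.pull_comp hs hφ, ← map_smul, ContinuousLinearMap.comp_apply]
    congr 1
    rw [smul_eq_mul, mul_one]
    rfl
  unfold IsParallel
  rw [h1, ← smul_neg, map_smul, smul_mul_assoc]
  exact h2

lemma IsFlatAt.comp {φ : ℂ → ℂ} (hφ : ContDiffAt ℂ ω φ z) (h : C.IsFlatAt f a (φ z)) :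
    C.IsFlatAt (fun w => f (φ w)) (fun w => a (φ w)) z := by
  obtain ⟨s, hs, hp⟩ := h
  refine ⟨_, hs.comp hφ, ?_⟩
  filter_upwards [hφ.continuousAt.eventually hp, hφ.continuousAt.eventually hs.1.eventually_nhds,
    hφ.eventually (by simp)] with w h1 h2 h3
  exact h1.comp h3 h2

lemma IsFlatAt.congr_left {f' : ℂ → M} (h : C.IsFlatAt f a z) (hf : f =ᶠ[𝓝 z] f') : C.IsFlatAt f' a z := by
  obtain ⟨s, hs, hp⟩ := h
  refine ⟨s, ⟨hs.1, ?_⟩, hp⟩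
  filter_upwards [hs.2, hf] with w h1 h2 using h1.trans h2

/-- Tensors vanish on the velocity of a rational curve. -/
theorem exists_tensors_vanish [IsManifold (cI n) ω M] [T2Space M] (hι : ContMDiff (cI e) (cI d) ω ι)
    {f : Projectivization ℂ (Fin 2 → ℂ) → M} (hf : IsRationalCurve (n := n) f) :
    ∃ (x : C.E) (A : Cn d), (¬ ∃ X, A = lmap d e ι X) ∧
      ∀ Q, C.IsTensor Q → ∀ B y, Q x B A y = 0 := by
  let f₀ : ℂ → M := fun z => f (projPt₀ z)
  let f₁ : ℂ → M := fun z => f (projPt₁ z)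
  have hf₁ : ∀ w, w ≠ 0 → f₁ w = f₀ w⁻¹ := fun w hw => congrArg f (projPt₁_eq hw)
  obtain ⟨a₀, ha₀⟩ := exists_forall_isFlatAt (C := C) hι hf.holomorphic₀
  -- Each affine chart has its own flat frame field. On the overlap their quotient is locally
  -- constant, hence constant because ℂ ∖ {0} is connected, and correcting the second field by this
  -- constant makes the two agree.
  obtain ⟨a₁, ha₁⟩ : ∃ a₁ : ℂ → GLn d, (∀ z, C.IsFlatAt f₁ a₁ z) ∧ ∀ w, w ≠ 0 → a₁ w = a₀ w⁻¹ := by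
    obtain ⟨a, ha⟩ := exists_forall_isFlatAt (C := C) hι hf.holomorphic₁
    have hloc : ∀ w : ℂ, w ≠ 0 → ∀ᶠ v in 𝓝 w, (a v)⁻¹ * a₀ v⁻¹ = (a w)⁻¹ * a₀ w⁻¹ := fun w hw => by
      have h1 : C.IsFlatAt f₁ (fun v => a₀ v⁻¹) w := by
        refine ((ha₀ w⁻¹).comp (φ := fun v => v⁻¹) (contDiffAt_inv ℂ hw)).congr_left ?_
        filter_upwards [isOpen_ne.mem_nhds hw] with v hv using (hf₁ v hv).symm
      exact (ha w).eventually_inv_mul_eq hι h1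
    have hconst : ∀ w : ℂ, w ≠ 0 → (a w)⁻¹ * a₀ w⁻¹ = (a 1)⁻¹ * a₀ 1⁻¹ := by
      let _ : TopologicalSpace (GLn d) := ⊥
      have : DiscreteTopology (GLn d) := ⟨rfl⟩
      have hconn : IsPreconnected ({0}ᶜ : Set ℂ) :=
        (isConnected_compl_singleton_of_one_lt_rank (by simp) 0).isPreconnected
      intro w hw
      refine hconn.constant (f := fun w => (a w)⁻¹ * a₀ w⁻¹) (fun w hw => ?_) hw one_ne_zero
      refine ContinuousAt.continuousWithinAt ?_
      exact continuousAt_const.congr (EventuallyEq.symm (hloc w hw))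
    refine ⟨fun w => a w * ((a 1)⁻¹ * a₀ 1⁻¹), fun z => (ha z).mul_const _, fun w hw => ?_⟩
    simp only [← hconst w hw, mul_inv_cancel_left]
  have hlift₀ : ∀ z, ∃ s, C.IsLiftAt f₀ s z := fun z => by
    obtain ⟨x, hx⟩ := C.proj_surjective (f₀ z)
    obtain ⟨s, hs, -⟩ := exists_isLiftAt (hf.holomorphic₀.contMDiffAt (x := z)) hx
    exact ⟨s, hs⟩
  have hlift₁ : ∀ z, ∃ s, C.IsLiftAt f₁ s z := fun z => by
    obtain ⟨x, hx⟩ := C.proj_surjective (f₁ z)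
    obtain ⟨s, hs, -⟩ := exists_isLiftAt (hf.holomorphic₁.contMDiffAt (x := z)) hx
    exact ⟨s, hs⟩
  choose s₀ hs₀ using hlift₀
  choose s₁ hs₁ using hlift₁
  have hzero : ∀ Q, C.IsTensor Q → ∀ b y z, C.transported Q a₀ b y (s₀ z) z = 0 := by
    intro Q hQ b y z
    have hdiff : ∀ (f : ℂ → M) (a : ℂ → GLn d) (s : ℂ → ℂ → C.E), (∀ z, C.IsLiftAt f (s z) z) →
        (∀ z, C.IsFlatAt f a z) → Differentiable ℂ (fun z => C.transported Q a b y (s z) z) := by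
      intro f a s hs ha z
      refine (hQ.differentiableAt_transported (b := b) (y := y) (hs z)
        ((ha z).isParallel hι (hs z))).congr_of_eventuallyEq ?_
      filter_upwards [(hs z).eventually] with w hw
      exact hQ.transported_eq hw (hs w)
    have hd₀ := hdiff f₀ a₀ s₀ hs₀ ha₀
    have hd₁ := hdiff f₁ a₁ s₁ hs₁ ha₁.1
    -- The change of coordinate of a 1-form on ℙ¹; the factor is the derivative of w ↦ w⁻¹.
    have hrel : ∀ w : ℂ, w ≠ 0 → C.transported Q a₁ b y (s₁ w) w
        = (-(w ^ 2)⁻¹) • C.transported Q a₀ b y (s₀ w⁻¹) w⁻¹ := by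
      intro w hw
      have hinv : ContDiffAt ℂ ω (fun v : ℂ => v⁻¹) w := contDiffAt_inv ℂ hw
      have h1 : C.IsLiftAt f₁ (fun v => s₀ w⁻¹ v⁻¹) w := by
        refine ⟨((hs₀ w⁻¹).comp (φ := fun v => v⁻¹) hinv).1, ?_⟩
        filter_upwards [((hs₀ w⁻¹).comp (φ := fun v => v⁻¹) hinv).2, isOpen_ne.mem_nhds hw] with v h1 h2
        rw [h1, hf₁ v h2]
      rw [hQ.transported_eq h1 (hs₁ w), ← deriv_inv, ← transported_comp hinv (hs₀ w⁻¹).1]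
      unfold transported
      simp only [ha₁.2 w hw]
    have htend : Tendsto (fun z => C.transported Q a₀ b y (s₀ z) z) (cocompact ℂ) (𝓝 0) := by
      have hinv : Tendsto (fun z : ℂ => z⁻¹) (cocompact ℂ) (𝓝 0) := by
        rw [← Metric.cobounded_eq_cocompact]
        exact tendsto_inv₀_cobounded
      have h1 : Tendsto (fun z : ℂ => (-(z⁻¹ ^ 2)) • C.transported Q a₁ b y (s₁ z⁻¹) z⁻¹) (cocompact ℂ)
          (𝓝 ((-(0 ^ 2) : ℂ) • C.transported Q a₁ b y (s₁ 0) 0)) :=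
        ((hinv.pow 2).neg).smul ((hd₁.continuous.tendsto 0).comp hinv)
      have h2 : (-(0 ^ 2) : ℂ) • C.transported Q a₁ b y (s₁ 0) 0 = 0 := by simp
      rw [h2] at h1
      refine h1.congr' ?_
      have h3 : ∀ᶠ z : ℂ in cocompact ℂ, z ≠ 0 := by
        have := (isCompact_singleton (x := (0 : ℂ))).compl_mem_cocompact
        filter_upwards [this] with z hz using hz
      filter_upwards [h3] with z hz
      rw [hrel z⁻¹ (inv_ne_zero hz), smul_smul, inv_inv]
      have : -z⁻¹ ^ 2 * -(z⁻¹ ^ 2)⁻¹ = 1 := by field_simp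
      rw [this, one_smul]
    -- An entire function which tends to 0 at infinity vanishes: ℙ¹ has no nonzero holomorphic
    -- 1-forms.
    exact hd₀.apply_eq_of_tendsto_cocompact z htend
  obtain ⟨z, hz⟩ := hf.exists_mder_ne_zero
  refine ⟨s₀ z z, C.coframe.pull (s₀ z) z 1, ?_, ?_⟩
  · intro hX
    obtain ⟨X, hX⟩ := hX
    have h1 := (C.mder_proj_eq_zero_iff (s₀ z z) (mder 𝓘(ℂ, ℂ) (cI d) (s₀ z) z 1)).2 ⟨X, hX⟩
    rw [← mder_comp_apply C.proj_holomorphic.contMDiffAt (hs₀ z).1, mder_congr (hs₀ z).2] at h1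
    refine hz ?_
    ext1
    exact h1
  · intro Q hQ B y
    let p := C.frameAt (a₀ z) (s₀ z z)
    -- The frame is invertible, so its constant vectors reach every B and y at the given point.
    have h1 := hzero Q hQ ((p⁻¹ : GLn d).val B) ((p⁻¹ : GLn d).val y) z
    have h2 : ∀ v, p.val ((p⁻¹ : GLn d).val v) = v := fun v => by
      change (p.val * (p⁻¹ : GLn d).val) v = v
      rw [Units.mul_inv]; rfl
    unfold transported at h1
    change (p⁻¹ : GLn d).val (Q (s₀ z z) (p.val ((p⁻¹ : GLn d).val B)) _ (p.val ((p⁻¹ : GLn d).val y))) = 0 at h1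
    rw [h2, h2] at h1
    have h3 := congrArg p.val h1
    rwa [h2, map_zero] at h3

end CartanGeometry

/-! ### From vanishing Taylor coefficients to vanishing on the total space -/

section Analysis

/-- A family of continuous linear maps on a finite-dimensional space is smooth if its applications
are. -/
lemma contDiffAt_clm_of_apply {D V W : Type*} [NormedAddCommGroup D] [NormedSpace ℂ D]
    [NormedAddCommGroup V] [NormedSpace ℂ V] [FiniteDimensional ℂ V] [NormedAddCommGroup W]
    [NormedSpace ℂ W] {f : D → V →L[ℂ] W} {x : D} (h : ∀ y, ContDiffAt ℂ ω (fun x => f x y) x) :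
    ContDiffAt ℂ ω f x := by
  have hd : Module.finrank ℂ V = Module.finrank ℂ (Fin (Module.finrank ℂ V) → ℂ) :=
    (Module.finrank_fin_fun ℂ).symm
  let e₁ := ContinuousLinearEquiv.ofFinrankEq hd
  let e₂ := (e₁.arrowCongr (1 : W ≃L[ℂ] W)).trans (ContinuousLinearEquiv.piRing _)
  rw [← Function.id_comp f, ← e₂.symm_comp_self]
  exact e₂.symm.contDiff.contDiffAt.comp x (contDiffAt_pi.mpr fun i => h _)

/-- The family F n consists of the successive derivatives of F 0, which is analytic, so it has
infinite order of vanishing at 0. -/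
lemma eventually_eq_zero_of_iterated_derivatives {V : Type*} [NormedAddCommGroup V] [NormedSpace ℂ V]
    [CompleteSpace V] {F : ℕ → ℂ → V} (h : ∀ n, ∀ᶠ t in 𝓝 0, HasDerivAt (F n) (F (n + 1) t) t)
    (h0 : ∀ n, F n 0 = 0) : ∀ᶠ t in 𝓝 0, F 0 t = 0 := by
  have hiter : ∀ n, iteratedDeriv n (F 0) =ᶠ[𝓝 0] F n := by
    intro n
    induction n with
    | zero => rw [iteratedDeriv_zero]
    | succ n ih =>
      rw [iteratedDeriv_succ]
      refine ih.deriv.trans ?_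
      filter_upwards [h n] with t ht using ht.deriv
  have han : AnalyticAt ℂ (F 0) 0 := by
    rw [Complex.analyticAt_iff_eventually_differentiableAt]
    filter_upwards [h 0] with t ht using ht.differentiableAt
  rw [← analyticOrderAt_eq_top, ENat.eq_top_iff_forall_ge]
  intro m
  rw [natCast_le_analyticOrderAt_iff_iteratedDeriv_eq_zero han]
  intro i _
  rw [(hiter i).eq_of_nhds, h0]

variable {n : ℕ} {E : Type*} [TopologicalSpace E] [ChartedSpace (Cn n) E] [IsManifold (cI n) ω E]
  {W : Type*} [NormedAddCommGroup W] [NormedSpace ℂ W]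

/-- The identity theorem on a connected complex manifold. -/
theorem eq_zero_of_eventually_eq_zero [ConnectedSpace E] {f : E → W} (hf : ContMDiff (cI n) 𝓘(ℂ, W) ω f)
    {x₀ : E} (h : ∀ᶠ x in 𝓝 x₀, f x = 0) (x : E) : f x = 0 := by
  let S : Set E := {x | ∀ᶠ y in 𝓝 x, f y = 0}
  have hopen : IsOpen S := isOpen_iff_mem_nhds.2 fun x hx => hx.eventually_nhds
  have hclosed : IsClosed S := by
    refine isClosed_of_closure_subset fun x hx => ?_
    let c := chartAt (Cn n) x
    have hxs : x ∈ c.source := mem_chart_source _ x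
    obtain ⟨r, hr, hball⟩ := Metric.isOpen_iff.1 c.open_target (c x) (c.map_source hxs)
    have hU : c.source ∩ c ⁻¹' Metric.ball (c x) r ∈ 𝓝 x :=
      (c.isOpen_inter_preimage Metric.isOpen_ball).mem_nhds ⟨hxs, Metric.mem_ball_self hr⟩
    obtain ⟨y, ⟨hys, hyb⟩, hyS⟩ := mem_closure_iff_nhds.1 hx _ hU
    have han : AnalyticOnNhd ℂ (fun z => f (c.symm z)) (Metric.ball (c x) r) := fun z hz =>
      (contMDiffAt_iff_contDiffAt.1 (hf.contMDiffAt.comp z (contMDiffAt_chartAt_symm (hball hz)))).analyticAt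
    have hcy : ContinuousAt c.symm (c y) := c.continuousAt_symm (c.map_source hys)
    have hz : (fun z => f (c.symm z)) =ᶠ[𝓝 (c y)] 0 := by
      change ∀ᶠ z in 𝓝 (c y), f (c.symm z) = 0
      refine hcy.eventually (p := fun z => f z = 0) ?_
      rw [c.left_inv hys]
      exact hyS
    have hEq := han.eqOn_zero_of_preconnected_of_eventuallyEq_zero
      (convex_ball (c x) r).isPreconnected hyb hz
    filter_upwards [hU] with w hw
    have := hEq hw.2
    simpa [c.left_inv hw.1] using this
  have := IsClopen.eq_univ ⟨hclosed, hopen⟩ ⟨x₀, h⟩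
  have hx : x ∈ S := this ▸ mem_univ x
  exact hx.self_of_nhds

end Analysis

namespace Coframe

variable {d : ℕ} {E : Type*} [TopologicalSpace E] [ChartedSpace (Cn d) E] [IsManifold (cI d) ω E]
  (C : Coframe d E)

/-- At each point `tors` is computed in the preferred chart of that very point. The structure
equation, applied to the inverse of one fixed chart, replaces this by a formula which is visibly
holomorphic. -/
lemma exists_contDiffAt_tors (x₀ : E) : ∃ T : Cn d → Cn d →L[ℂ] Cn d →L[ℂ] Cn d,
    ContDiffAt ℂ ω T (chartAt (Cn d) x₀ x₀) ∧ ∀ᶠ x in 𝓝 x₀, ∀ A B,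
      C.tors x A B = T (chartAt (Cn d) x₀ x) A B := by
  let c := chartAt (Cn d) x₀
  let Y := fun y => (C.loc x₀ y).inverse
  let D := fderiv ℂ (C.loc x₀)
  let T₀ : Cn d → Cn d →L[ℂ] Cn d →L[ℂ] Cn d := fun y => (D y).bilinearComp (Y y) (Y y)
  have hT : ∀ A B, ContDiffAt ℂ ω (fun y => T₀ y A B) (c x₀) := fun A B => by
    have h1 : ContDiffAt ℂ ω D (c x₀) := (C.holo x₀).fderiv_right le_top
    have h2 := C.contDiffAt_loc_inverse x₀
    exact (h1.clm_apply (h2.clm_apply contDiffAt_const)).clm_apply (h2.clm_apply contDiffAt_const)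
  refine ⟨fun y => (T₀ y).flip - T₀ y, ?_, ?_⟩
  · exact contDiffAt_clm_of_apply fun A => contDiffAt_clm_of_apply fun B => (hT B A).sub (hT A B)
  · have hx₀ : x₀ ∈ c.source := mem_chart_source _ _
    have hc : ContinuousAt c x₀ := c.continuousAt hx₀
    have hloc : ∀ᶠ y in 𝓝 (c x₀), ContDiffAt ℂ ω (C.loc x₀) y := (C.holo x₀).eventually (by simp)
    filter_upwards [hc.eventually (C.eventually_loc_isInvertible x₀), hc.eventually hloc,
      c.open_source.mem_nhds hx₀] with x h1 h2 hx A B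
    have h3 := C.structure_equation (contMDiffAt_chartAt_symm (c.map_source hx)) (Y (c x) A) (Y (c x) B)
    have h4 : ∀ v w, fderiv ℂ (fun y => C.pull c.symm y v) (c x) w = D (c x) w v := fun v w => by
      have h5 := (h2.differentiableAt (by simp)).hasFDerivAt.clm_apply (hasFDerivAt_const v (c x))
      have h6 := DFunLike.congr_fun h5.fderiv w
      simp only [ContinuousLinearMap.comp_zero, zero_add, ContinuousLinearMap.flip_apply] at h6
      exact h6
    have h5 : ∀ A, C.pull c.symm (c x) (Y (c x) A) = A := fun A =>
      DFunLike.congr_fun h1.self_comp_inverse A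
    rw [h4, h4, h5, h5, c.left_inv hx] at h3
    change _ = D (c x) (Y (c x) B) (Y (c x) A) - D (c x) (Y (c x) A) (Y (c x) B)
    rw [← neg_sub, h3, neg_neg]

/-- The bracket of a coframe, as a bilinear map. -/
def torsL (x : E) : Cn d →L[ℂ] Cn d →L[ℂ] Cn d :=
  ((fderiv ℂ (C.loc x) (chartAt (Cn d) x x)).bilinearComp ((C.form x).symm : Cn d →L[ℂ] Cn d)
    ((C.form x).symm : Cn d →L[ℂ] Cn d)).flip
  - (fderiv ℂ (C.loc x) (chartAt (Cn d) x x)).bilinearComp ((C.form x).symm : Cn d →L[ℂ] Cn d)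
    ((C.form x).symm : Cn d →L[ℂ] Cn d)

lemma contMDiff_torsL : ContMDiff (cI d) 𝓘(ℂ, Cn d →L[ℂ] Cn d →L[ℂ] Cn d) ω C.torsL := by
  intro x₀
  obtain ⟨T, hT, hT'⟩ := C.exists_contDiffAt_tors x₀
  have h1 := ContMDiffAt.comp x₀ hT.contMDiffAt (contMDiffAt_chartAt (mem_chart_source (Cn d) x₀))
  refine h1.congr_of_eventuallyEq ?_
  filter_upwards [hT'] with x hx
  ext1 A
  ext1 B
  exact hx A B

/-- Exponential coordinates at a point. -/
lemma exists_exp_at (x₀ : E) : ∃ k : Cn d → E, ContMDiffAt 𝓘(ℂ, Cn d) (cI d) ω k 0 ∧ k 0 = x₀ ∧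
    (∀ᶠ v in 𝓝 0, C.pull k v v = v) ∧
    ∀ B, ∀ᶠ t in 𝓝 (0 : ℂ), C.pull (fun t : ℂ => k (t • B)) t 1 = B := by
  obtain ⟨Φ, hΦ, hΦ0, hΦ1⟩ := C.exists_exp x₀
  let c := chartAt (Cn d) x₀
  let k : Cn d → E := fun v => Φ (v, c x₀)
  have hin : ∀ v, ContDiffAt ℂ ω (fun v : Cn d => (v, c x₀)) v := fun v =>
    contDiffAt_id.prodMk contDiffAt_const
  have hk : ContMDiffAt 𝓘(ℂ, Cn d) (cI d) ω k 0 :=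
    ContMDiffAt.comp (g := Φ) (f := fun v : Cn d => (v, c x₀)) 0 hΦ (hin 0).contMDiffAt
  have hpk : ∀ᶠ v in 𝓝 0, C.pull k v v = v := by
    filter_upwards [(hin 0).continuousAt.eventually hΦ1,
      (hin 0).continuousAt.eventually hΦ.eventually_nhds] with v h1 h2
    have h3 : HasFDerivAt (fun v : Cn d => (v, c x₀)) (ContinuousLinearMap.inl ℂ (Cn d) (Cn d)) v :=
      hasFDerivAt_prodMk_left v (c x₀)
    rw [C.pull_comp (f := Φ) (g := fun v : Cn d => (v, c x₀)) h2 (hin v), h3.fderiv]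
    exact h1
  refine ⟨k, hk, ?_, hpk, fun B => ?_⟩
  · change Φ (0, c x₀) = x₀
    rw [hΦ0.self_of_nhds, c.left_inv (mem_chart_source _ _)]
  have hlin : ∀ t : ℂ, HasFDerivAt (fun t : ℂ => t • B) (ContinuousLinearMap.smulRight (1 : ℂ →L[ℂ] ℂ) B) t :=
    fun t => (hasFDerivAt_id t).smul_const B
  have hlin' : ∀ t : ℂ, ContDiffAt ℂ ω (fun t : ℂ => t • B) t := fun t => contDiffAt_id.smul contDiffAt_const
  have ht : Tendsto (fun t : ℂ => t • B) (𝓝 0) (𝓝 0) := by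
    have := (hlin 0).continuousAt.tendsto
    rwa [zero_smul] at this
  have hγ : ContMDiffAt 𝓘(ℂ, ℂ) (cI d) ω (fun t : ℂ => k (t • B)) 0 :=
    ContMDiffAt.comp (g := k) (f := fun t : ℂ => t • B) 0 (by rwa [zero_smul]) (hlin' 0).contMDiffAt
  -- The radial identity at t • B determines t times the velocity; this divides by t.
  refine eventuallyEq_of_smul_eq (f := fun t => C.pull (fun t : ℂ => k (t • B)) t 1) (g := fun _ => B)
    ((C.contDiffAt_pull hγ).clm_apply contDiffAt_const).continuousAt continuousAt_const ?_
  filter_upwards [ht.eventually hpk, ht.eventually hk.eventually_nhds] with t h1 h2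
  rw [C.pull_comp (g := fun t : ℂ => t • B) h2 (hlin' t), (hlin t).fderiv, ← map_smul]
  simpa using h1

end Coframe

/-- Derivatives along the constant vector fields of a coframe are holomorphic. -/
lemma Coframe.contMDiff_mder_field {d : ℕ} {E : Type*} [TopologicalSpace E] [ChartedSpace (Cn d) E]
    [IsManifold (cI d) ω E] (C : Coframe d E) {W : Type*} [NormedAddCommGroup W] [NormedSpace ℂ W]
    {Q : E → Cn d → W}
    (hQ : ContMDiff ((cI d).prod 𝓘(ℂ, Cn d)) 𝓘(ℂ, W) ω (fun p : E × Cn d => Q p.1 p.2)) :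
    ContMDiff ((cI d).prod 𝓘(ℂ, Cn d)) 𝓘(ℂ, W) ω
      (fun p : E × Cn d => mder (cI d) 𝓘(ℂ, W) (fun y => Q y p.2) p.1 ((C.form p.1).symm p.2)) := by
  rintro ⟨x₀, B₀⟩
  let c := chartAt (Cn d) x₀
  have hx₀ : x₀ ∈ c.source := mem_chart_source _ _
  let R : Cn d × Cn d → W := fun p => Q (c.symm p.1) p.2
  have hR : ∀ y ∈ c.target, ∀ B, ContDiffAt ℂ ω R (y, B) := fun y hy B => by
    rw [← contMDiffAt_iff_contDiffAt]
    have h1 : ContMDiffAt 𝓘(ℂ, Cn d × Cn d) (cI d) ω (fun p : Cn d × Cn d => c.symm p.1) (y, B) :=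
      ContMDiffAt.comp (g := c.symm) (f := Prod.fst) (y, B) (contMDiffAt_chartAt_symm hy)
        contDiffAt_fst.contMDiffAt
    have h2 : ContMDiffAt 𝓘(ℂ, Cn d × Cn d) 𝓘(ℂ, Cn d) ω (fun p : Cn d × Cn d => p.2) (y, B) :=
      contDiffAt_snd.contMDiffAt
    exact ContMDiffAt.comp (g := fun p : E × Cn d => Q p.1 p.2) (y, B) hQ.contMDiffAt (h1.prodMk h2)
  let D : Cn d × Cn d → W := fun p =>
    fderiv ℂ R p ((C.loc x₀ p.1).inverse p.2, 0)
  have hD : ContDiffAt ℂ ω D (c x₀, B₀) := by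
    have h1 : ContDiffAt ℂ ω (fderiv ℂ R) (c x₀, B₀) := (hR _ (c.map_source hx₀) B₀).fderiv_right le_top
    have h2 : ContDiffAt ℂ ω (fun p : Cn d × Cn d => (C.loc x₀ p.1).inverse) (c x₀, B₀) :=
      ContDiffAt.comp (g := fun y => (C.loc x₀ y).inverse) (f := Prod.fst) (c x₀, B₀)
        (C.contDiffAt_loc_inverse x₀) contDiffAt_fst
    exact h1.clm_apply ((h2.clm_apply contDiffAt_snd).prodMk contDiffAt_const)
  have hc : ContMDiffAt ((cI d).prod 𝓘(ℂ, Cn d)) 𝓘(ℂ, Cn d × Cn d) ω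
      (fun p : E × Cn d => (c p.1, p.2)) (x₀, B₀) := by
    refine ContMDiffAt.prodMk_space ?_ contMDiffAt_snd
    exact ContMDiffAt.comp (g := c) (f := Prod.fst) (x₀, B₀) (contMDiffAt_chartAt hx₀) contMDiffAt_fst
  refine (ContMDiffAt.comp (g := D) (x₀, B₀) hD.contMDiffAt hc).congr_of_eventuallyEq ?_
  have hfst : ContinuousAt (Prod.fst : E × Cn d → E) (x₀, B₀) := continuousAt_fst
  filter_upwards [hfst.eventually (c.open_source.mem_nhds hx₀),
    hfst.eventually ((c.continuousAt hx₀).eventually (C.eventually_loc_isInvertible x₀))]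
    with p hp hinv
  obtain ⟨x, B⟩ := p
  change x ∈ c.source at hp
  have h1 : mder (cI d) 𝓘(ℂ, W) (fun y => Q y B) x
      = (fderiv ℂ (fun y => R (y, B)) (c x)).comp (mder (cI d) (cI d) c x) := by
    rw [← mder_eq_fderiv (fun y => R (y, B)) (c x), ← mder_comp (g := fun y => R (y, B)) (f := c)]
    · refine mder_congr ?_
      filter_upwards [c.open_source.mem_nhds hp] with y hy
      simp only [R, c.left_inv hy]
    · exact ((hR _ (c.map_source hp) B).comp (c x) (contDiffAt_id.prodMk contDiffAt_const)).contMDiffAt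
    · exact contMDiffAt_chartAt hp
  have h2 : fderiv ℂ (fun y => R (y, B)) (c x)
      = (fderiv ℂ R (c x, B)).comp (ContinuousLinearMap.inl ℂ (Cn d) (Cn d)) :=
    (HasFDerivAt.comp (g := R) (f := fun y => (y, B)) (c x)
      ((hR _ (c.map_source hp) B).differentiableAt (by simp)).hasFDerivAt
      (hasFDerivAt_prodMk_left (c x) B)).fderiv
  have h3 : mder (cI d) (cI d) c x ((C.form x).symm B) = (C.loc x₀ (c x)).inverse B := by
    have h4 : C.loc x₀ (c x) (mder (cI d) (cI d) c x ((C.form x).symm B)) = B := by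
      change C.form (c.symm (c x)) (mder (cI d) (cI d) c.symm (c x) (mder (cI d) (cI d) c x ((C.form x).symm B))) = B
      have h5 := DFunLike.congr_fun (mder_chartAt_comp_symm (x := x₀) hp) ((C.form x).symm B)
      change mder (cI d) (cI d) c.symm (c x) (mder (cI d) (cI d) c x ((C.form x).symm B)) = _ at h5
      rw [h5, c.left_inv hp]
      exact (C.form x).apply_symm_apply B
    have h5 := DFunLike.congr_fun (hinv.inverse_comp_self) (mder (cI d) (cI d) c x ((C.form x).symm B))
    change (C.loc x₀ (c x)).inverse (C.loc x₀ (c x) _) = _ at h5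
    rw [h4] at h5
    exact h5.symm
  change mder (cI d) 𝓘(ℂ, W) (fun y => Q y B) x ((C.form x).symm B) = D (c x, B)
  rw [h1, ContinuousLinearMap.comp_apply, h3, h2]
  rfl

lemma mder_clm_comp {d : ℕ} {E : Type*} [TopologicalSpace E] [ChartedSpace (Cn d) E]
    {W W' : Type*} [NormedAddCommGroup W] [NormedSpace ℂ W] [NormedAddCommGroup W'] [NormedSpace ℂ W']
    (l : W →L[ℂ] W') {F : E → W} {x : E} (hF : ContMDiffAt (cI d) 𝓘(ℂ, W) ω F x) (v : Cn d) :
    mder (cI d) 𝓘(ℂ, W') (fun x => l (F x)) x v = l (mder (cI d) 𝓘(ℂ, W) F x v) := by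
  have h1 := mder_comp_apply (I₁ := cI d) (g := l) l.contDiff.contMDiff.contMDiffAt hF v
  rw [mder_eq_fderiv, l.fderiv] at h1
  exact h1

namespace CartanGeometry

variable {d e : ℕ} {G H : Type u} [Group G] [TopologicalSpace G] [ChartedSpace (Cn d) G]
  [ComplexLieGroup d G]
  [Group H] [TopologicalSpace H] [ChartedSpace (Cn e) H] [ComplexLieGroup e H]
  {ι : H →* G} {n : ℕ} {M : Type u} [TopologicalSpace M] [ChartedSpace (Cn n) M]
  (C : CartanGeometry d e ι n M)

/-- The derivative of a tensor along the constant vector fields. -/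
def tensorDeriv (Q : C.E → Cn d → Cn d →L[ℂ] Cn d →L[ℂ] Cn d) (x : C.E) (B : Cn d) :
    Cn d →L[ℂ] Cn d →L[ℂ] Cn d :=
  mder (cI d) 𝓘(ℂ, Cn d →L[ℂ] Cn d →L[ℂ] Cn d) (fun y => Q y B) x ((C.frm x).symm B)

variable {C} {Q : C.E → Cn d → Cn d →L[ℂ] Cn d →L[ℂ] Cn d}

lemma IsTensor.contMDiff_left (hQ : C.IsTensor Q) (B : Cn d) :
    ContMDiff (cI d) 𝓘(ℂ, Cn d →L[ℂ] Cn d →L[ℂ] Cn d) ω (fun x => Q x B) :=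
  hQ.holo.comp (contMDiff_id.prodMk contMDiff_const)

lemma mder_apply_apply {F : C.E → Cn d →L[ℂ] Cn d →L[ℂ] Cn d} {x : C.E}
    (hF : ContMDiffAt (cI d) 𝓘(ℂ, Cn d →L[ℂ] Cn d →L[ℂ] Cn d) ω F x) (v A y : Cn d) :
    mder (cI d) 𝓘(ℂ, Cn d) (fun x => F x A y) x v
      = mder (cI d) 𝓘(ℂ, Cn d →L[ℂ] Cn d →L[ℂ] Cn d) F x v A y := by
  let ev : (Cn d →L[ℂ] Cn d →L[ℂ] Cn d) →L[ℂ] Cn d :=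
    (ContinuousLinearMap.apply ℂ (Cn d) y).comp (ContinuousLinearMap.apply ℂ (Cn d →L[ℂ] Cn d) A)
  exact mder_clm_comp ev hF v

/-- Right translation by h carries the constant field B to the constant field Ad(h)⁻¹B, so the
derivative inherits equivariance. For this reason tensors are allowed to depend on the extra vector
B, which serves as direction of differentiation. Vanishing on the constant subspace 𝔥 survives
differentiation. -/
lemma IsTensor.tensorDeriv (hQ : C.IsTensor Q) : C.IsTensor (C.tensorDeriv Q) where
  holo := C.coframe.contMDiff_mder_field hQ.holo
  equivariant := by
    intro h x A B y
    let a := adm d (ι h)⁻¹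
    have h0 : mder (cI d) (cI d) (fun y => C.act y h) x ((C.frm x).symm B)
        = (C.frm (C.act x h)).symm (a B) := by
      rw [ContinuousLinearEquiv.eq_symm_apply, frm_act, ContinuousLinearEquiv.apply_symm_apply]
    have h1 := mder_comp_apply (I₁ := cI d) (g := fun x => Q x (a B)) (f := fun x => C.act x h) (x := x)
      (hQ.contMDiff_left (a B)).contMDiffAt (C.act_left_holomorphic h).contMDiffAt ((C.frm x).symm B)
    have h2 := mder_apply_apply (F := fun x => Q (C.act x h) (a B)) (x := x)
      ((hQ.contMDiff_left (a B)).comp (C.act_left_holomorphic h)).contMDiffAt ((C.frm x).symm B) (a A) (a y)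
    have h3 : (fun x => Q (C.act x h) (a B) (a A) (a y)) = fun x => a (Q x B A y) :=
      funext fun x => hQ.equivariant h x A B y
    have h4 : ContMDiff (cI d) 𝓘(ℂ, Cn d) ω (fun x => Q x B A y) :=
      ((hQ.contMDiff_left B).clm_apply contMDiff_const).clm_apply contMDiff_const
    have h5 := mder_clm_comp a (h4.contMDiffAt (x := x)) ((C.frm x).symm B)
    rw [mder_apply_apply (hQ.contMDiff_left B).contMDiffAt] at h5
    rw [h3, h5, h1, h0] at h2
    exact h2.symm
  vertical := by
    intro x B X
    ext1 y
    change mder (cI d) 𝓘(ℂ, Cn d →L[ℂ] Cn d →L[ℂ] Cn d) (fun y => Q y B) x ((C.frm x).symm B) _ y = 0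
    rw [← mder_apply_apply (hQ.contMDiff_left B).contMDiffAt]
    simp only [hQ.vertical, zero_apply]
    rw [mder_const]
    rfl

/-- The curvature, as a tensor. -/
def curvatureTensor (C : CartanGeometry d e ι n M) (x : C.E) (_ : Cn d) : Cn d →L[ℂ] Cn d →L[ℂ] Cn d :=
  lieBr d G - C.coframe.torsL x

lemma isTensor_curvatureTensor (hι : ContMDiff (cI e) (cI d) ω ι) : C.IsTensor C.curvatureTensor where
  holo := contMDiff_const.sub (C.coframe.contMDiff_torsL.comp contMDiff_fst)
  equivariant := by
    intro h x A B y
    change lieBr d G _ _ - C.coframe.tors _ _ _ = adm d (ι h)⁻¹ (lieBr d G A y - C.coframe.tors x A y)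
    rw [tors_act, map_sub, adm_lieBr]
  vertical := by
    intro x B X
    ext1 y
    change lieBr d G _ _ - C.coframe.tors _ _ _ = 0
    rw [C.tors_vertical hι, sub_self]

/-- On a geometry with a rational curve, the curvature vanishes on some direction which is not
vertical. -/
theorem exists_tors_eq [IsManifold (cI n) ω M] [T2Space M] [ConnectedSpace C.E]
    (hι : ContMDiff (cI e) (cI d) ω ι)
    {f : Projectivization ℂ (Fin 2 → ℂ) → M} (hf : IsRationalCurve (n := n) f) :
    ∃ A : Cn d, (¬ ∃ X, A = lmap d e ι X) ∧ ∀ (x : C.E) y, C.coframe.tors x A y = lieBr d G A y := by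
  obtain ⟨x₀, A, hA, hvan⟩ := exists_tensors_vanish (C := C) hι hf
  refine ⟨A, hA, fun x y => ?_⟩
  -- The n-th derivative of the curvature in the repeated direction B. All of these are tensors, so
  -- all vanish at x₀ when contracted with A.
  let Q : ℕ → C.E → Cn d → Cn d →L[ℂ] Cn d →L[ℂ] Cn d := fun n => (C.tensorDeriv)^[n] C.curvatureTensor
  have hQ : ∀ n, C.IsTensor (Q n) := fun n => by
    induction n with
    | zero => exact isTensor_curvatureTensor hι
    | succ n ih =>
      change C.IsTensor (C.tensorDeriv^[n + 1] _)
      rw [Function.iterate_succ_apply']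
      exact ih.tensorDeriv
  have hQs : ∀ n, Q (n + 1) = C.tensorDeriv (Q n) := fun n => Function.iterate_succ_apply' _ _ _
  obtain ⟨k, hk, hk0, -, hkB⟩ := C.coframe.exists_exp_at x₀
  let F : C.E → Cn d := fun x => C.curvatureTensor x 0 A y
  have hF : ContMDiff (cI d) 𝓘(ℂ, Cn d) ω F :=
    (((isTensor_curvatureTensor hι).contMDiff_left 0).clm_apply contMDiff_const).clm_apply contMDiff_const
  -- The ray has the constant field B as velocity, so its successive derivatives of F are the
  -- contractions of Q n; they vanish at t = 0.
  have hray : ∀ B, ∀ᶠ t in 𝓝 (0 : ℂ), F (k (t • B)) = 0 := by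
    intro B
    have hlin : ∀ t : ℂ, ContDiffAt ℂ ω (fun t : ℂ => t • B) t := fun t => contDiffAt_id.smul contDiffAt_const
    have ht : Tendsto (fun t : ℂ => t • B) (𝓝 0) (𝓝 0) := by
      have := (hlin 0).continuousAt.tendsto
      rwa [zero_smul] at this
    refine eventually_eq_zero_of_iterated_derivatives (F := fun n t => Q n (k (t • B)) B A y)
      (fun n => ?_) (fun n => ?_)
    · filter_upwards [hkB B, ht.eventually hk.eventually_nhds] with t h1 h2
      have h3 : ContMDiffAt 𝓘(ℂ, ℂ) (cI d) ω (fun t : ℂ => k (t • B)) t :=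
        ContMDiffAt.comp (g := k) (f := fun t : ℂ => t • B) t h2 (hlin t).contMDiffAt
      have h4 : ContMDiff (cI d) 𝓘(ℂ, Cn d) ω (fun x => Q n x B A y) :=
        (((hQ n).contMDiff_left B).clm_apply contMDiff_const).clm_apply contMDiff_const
      have h5 := mder_comp_apply h4.contMDiffAt h3 (1 : ℂ)
      have h6 : mder 𝓘(ℂ, ℂ) (cI d) (fun t : ℂ => k (t • B)) t 1 = (C.frm (k (t • B))).symm B := by
        rw [ContinuousLinearEquiv.eq_symm_apply]; exact h1
      rw [h6, mder_apply_apply ((hQ n).contMDiff_left B).contMDiffAt, mder_eq_fderiv] at h5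
      have h7 := contMDiffAt_iff_contDiffAt.1 (h4.contMDiffAt.comp t h3)
      have h8 := (h7.differentiableAt (by simp)).hasFDerivAt.hasDerivAt
      rw [hQs]
      refine HasDerivAt.congr_deriv h8 h5
    · simp only [zero_smul, hk0]
      exact hvan _ (hQ n) B y
  -- The neighbourhood in `hray` depends on the direction. The identity theorem on the convex set of
  -- t with t • v in a fixed ball carries the vanishing to t = 1, uniformly in v.
  have hkA : ∀ᶠ v in 𝓝 (0 : Cn d), F (k v) = 0 := by
    have han : ∀ᶠ v in 𝓝 (0 : Cn d), AnalyticAt ℂ (fun v => F (k v)) v := by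
      filter_upwards [hk.eventually_nhds] with v hv
      exact (contMDiffAt_iff_contDiffAt.1 (hF.contMDiffAt.comp v hv)).analyticAt
    obtain ⟨r, hr, hball⟩ := Metric.eventually_nhds_iff_ball.1 han
    filter_upwards [Metric.ball_mem_nhds (0 : Cn d) hr] with v hv
    let l : ℂ →L[ℂ] Cn d := ContinuousLinearMap.smulRight (1 : ℂ →L[ℂ] ℂ) v
    have hl : ∀ t, l t = t • v := fun t => rfl
    let U : Set ℂ := l ⁻¹' Metric.ball 0 r
    have hU : Convex ℝ U := (convex_ball (0 : Cn d) r).linear_preimage (l.toLinearMap.restrictScalars ℝ)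
    have h1 : AnalyticOnNhd ℂ (fun t => F (k (l t))) U := fun t ht =>
      AnalyticAt.comp (g := fun v => F (k v)) (f := l) (hball _ ht) (l.analyticAt t)
    have h0 : (0 : ℂ) ∈ U := by change l 0 ∈ Metric.ball (0 : Cn d) r; rw [map_zero]; exact Metric.mem_ball_self hr
    have h2 := h1.eqOn_zero_of_preconnected_of_eventuallyEq_zero hU.isPreconnected h0 (hray v)
    have h3 : (1 : ℂ) ∈ U := by change l 1 ∈ Metric.ball (0 : Cn d) r; rw [hl, one_smul]; exact hv
    have h4 := h2 h3
    simpa [hl] using h4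
  -- The exponential map is a local biholomorphism at 0, its derivative being the inverse of the
  -- coframe at x₀.
  have hx₀ : ∀ᶠ x in 𝓝 x₀, F x = 0 := by
    have hp : ∀ B, C.coframe.pull k 0 B = B := fun B => by
      have h1 := (hkB B).self_of_nhds
      have hlin : ContDiffAt ℂ ω (fun t : ℂ => t • B) 0 := contDiffAt_id.smul contDiffAt_const
      have h2 : HasFDerivAt (fun t : ℂ => t • B) (ContinuousLinearMap.smulRight (1 : ℂ →L[ℂ] ℂ) B) 0 :=
        (hasFDerivAt_id (0 : ℂ)).smul_const B
      rw [C.coframe.pull_comp (g := fun t : ℂ => t • B) (by rwa [zero_smul]) hlin, h2.fderiv, zero_smul] at h1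
      simpa using h1
    have hmd : mder 𝓘(ℂ, Cn d) (cI d) k 0 = ((C.frm x₀).symm : Cn d →L[ℂ] Cn d) := by
      ext1 B
      have h1 : C.frm (k 0) (mder 𝓘(ℂ, Cn d) (cI d) k 0 B) = B := hp B
      rw [hk0] at h1
      exact ((C.frm x₀).eq_symm_apply).2 h1
    obtain ⟨e, he0, heq, -, -, -⟩ := exists_openPartialHomeomorph_of_mder hk _ hmd
    have he : e 0 = x₀ := by rw [heq he0, hk0]
    have hx : x₀ ∈ e.target := he ▸ e.map_source he0
    have h1 : Tendsto e.symm (𝓝 x₀) (𝓝 0) := by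
      have h2 := (e.continuousAt_symm hx).tendsto
      rwa [← he, e.left_inv he0, he] at h2
    filter_upwards [h1.eventually hkA, e.open_target.mem_nhds hx] with x h3 h4
    rw [← heq (e.map_target h4), e.right_inv h4] at h3
    exact h3
  have h := eq_zero_of_eventually_eq_zero hF hx₀ x
  change lieBr d G A y - C.coframe.tors x A y = 0 at h
  exact (sub_eq_zero.1 h).symm

end CartanGeometry

/-! ### The subalgebra of flat directions -/

namespace Coframe

variable {d : ℕ} {E : Type*} [TopologicalSpace E] [ChartedSpace (Cn d) E] [IsManifold (cI d) ω E]
  (C : Coframe d E)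

/-- Smoothness as sections of the tangent bundle is what the Jacobi identity for vector fields
requires. -/
lemma contMDiff_field (A : Cn d) :
    ContMDiff (cI d) (cI d).tangent ω (fun x => (⟨x, C.field A x⟩ : TangentBundle (cI d) E)) := by
  intro x₀
  let c := chartAt (Cn d) x₀
  have hx₀ : x₀ ∈ c.source := mem_chart_source _ _
  let Y : Cn d → Cn d := fun y => (C.loc x₀ y).inverse A
  have hY : ContDiffAt ℂ ω Y (c x₀) := (C.contDiffAt_loc_inverse x₀).clm_apply contDiffAt_const
  have hcs : ContMDiffOn (cI d) (cI d) ω c.symm c.target := fun y hy =>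
    (contMDiffAt_chartAt_symm hy).contMDiffWithinAt
  have h1 : ContMDiffAt (cI d) (cI d).tangent ω
      (fun y : Cn d => (⟨y, Y y⟩ : TangentBundle (cI d) (Cn d))) (c x₀) :=
    contMDiffAt_vectorSpace_iff_contDiffAt.2 hY
  have h2 := hcs.contMDiffOn_tangentMapWithin (m := ω) le_rfl c.open_target.uniqueMDiffOn
  have hopen : IsOpen (Bundle.TotalSpace.proj ⁻¹' c.target : Set (TangentBundle (cI d) (Cn d))) :=
    c.open_target.preimage (FiberBundle.continuous_proj _ _)
  have h3 : ContMDiffAt (cI d).tangent (cI d).tangent ω (tangentMapWithin (cI d) (cI d) c.symm c.target)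
      (⟨c x₀, Y (c x₀)⟩ : TangentBundle (cI d) (Cn d)) :=
    h2.contMDiffAt (hopen.mem_nhds (c.map_source hx₀))
  have h4 := ContMDiffAt.comp x₀ (ContMDiffAt.comp (c x₀) h3 h1) (contMDiffAt_chartAt hx₀)
  refine h4.congr_of_eventuallyEq ?_
  filter_upwards [c.open_source.mem_nhds hx₀,
    (c.continuousAt hx₀).eventually (C.eventually_loc_isInvertible x₀)] with x hx hinv
  have h5 : C.field A (c.symm (c x)) = mder (cI d) (cI d) c.symm (c x) (Y (c x)) := by
    rw [field, ContinuousLinearEquiv.symm_apply_eq]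
    exact (DFunLike.congr_fun hinv.self_comp_inverse A).symm
  have h6 : mder (cI d) (cI d) c.symm (c x) = mfderivWithin (cI d) (cI d) c.symm c.target (c x) :=
    (mfderivWithin_of_isOpen c.open_target (c.map_source hx)).symm
  have h7 : ∀ z, z = x → ∀ w : Cn d, C.field A z = w →
      (⟨x, C.field A x⟩ : TangentBundle (cI d) E) = ⟨z, w⟩ := by
    rintro z rfl w rfl; rfl
  exact h7 _ (c.left_inv hx) _ (h5.trans (by rw [h6]; rfl))

/-- If the brackets of constant fields are given by a bilinear map in two directions, then also in
the direction of their bracket. -/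
theorem tors_bracket {br : Cn d →L[ℂ] Cn d →L[ℂ] Cn d}
    (hJ : ∀ A B y, br A (br B y) = br (br A B) y + br B (br A y)) {A B : Cn d}
    (hA : ∀ x y, C.tors x A y = br A y) (hB : ∀ x y, C.tors x B y = br B y) (x : E) (y : Cn d) :
    C.tors x (br A B) y = br (br A B) y := by
  have : IsManifold (cI d) (minSmoothness ℂ 3) E := IsManifold.of_le (n := ω) le_top
  have key : ∀ A B W : Cn d, (∀ x, C.tors x A B = W) →
      VectorField.mlieBracket (cI d) (fun y => (C.field A y : TangentSpace (cI d) y))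
      (fun y => (C.field B y : TangentSpace (cI d) y)) = fun y => (C.field W y : TangentSpace (cI d) y) := by
    intro A B W h
    funext x
    have h1 := C.form_mlieBracket x A B
    rw [h] at h1
    exact (C.form x).eq_symm_apply.2 h1
  have hs : ∀ A, ContMDiff (cI d) (cI d).tangent (minSmoothness ℂ 2)
      (fun x => (⟨x, C.field A x⟩ : TangentBundle (cI d) E)) := fun A => (C.contMDiff_field A).of_le le_top
  -- In the Jacobi identity for the fields of A, B and y, every bracket is a known constant field,
  -- except the one of the field of [A, B] with that of y; the identity determines it.
  have h := VectorField.leibniz_identity_mlieBracket_apply (I := cI d)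
    (U := fun y => (C.field A y : TangentSpace (cI d) y))
    (V := fun y => (C.field B y : TangentSpace (cI d) y))
    (W := fun z => (C.field y z : TangentSpace (cI d) z)) (hs A x) (hs B x) (hs y x)
  rw [key B y _ (fun x => hB x y), key A y _ (fun x => hA x y), key A B _ (fun x => hA x B),
    key A _ _ (fun x => hA x _), key B _ _ (fun x => hB x _)] at h
  have h3 := C.form_mlieBracket x (br A B) y
  generalize VectorField.mlieBracket (cI d) (fun y => (C.field (br A B) y : TangentSpace (cI d) y))
    (fun z => (C.field y z : TangentSpace (cI d) z)) x = b at h h3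
  have h1 : C.field (br A (br B y)) x = (show Cn d from b) + C.field (br B (br A y)) x := h
  have h2 : ∀ W, C.form x (C.field W x) = W := fun W => (C.form x).apply_symm_apply W
  have h4 := congrArg (C.form x) h1
  rw [map_add, h2, h2, hJ] at h4
  exact h3.symm.trans (add_right_cancel h4).symm

end Coframe

namespace CartanGeometry

variable {d e : ℕ} {G H : Type u} [Group G] [TopologicalSpace G] [ChartedSpace (Cn d) G]
  [ComplexLieGroup d G]
  [Group H] [TopologicalSpace H] [ChartedSpace (Cn e) H] [ComplexLieGroup e H]
  {ι : H →* G} {n : ℕ} {M : Type u} [TopologicalSpace M] [ChartedSpace (Cn n) M]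
  (C : CartanGeometry d e ι n M)

lemma lieBr_jacobi (A B y : Cn d) :
    lieBr d G A (lieBr d G B y) = lieBr d G (lieBr d G A B) y + lieBr d G B (lieBr d G A y) :=
  leibniz_lie (L₁ := LieAlg d G) (L₂ := LieAlg d G) (M := LieAlg d G) A B y

/-- The directions in which the curvature vanishes. -/
def flatSubalgebra : LieSubalgebra ℂ (LieAlg d G) where
  carrier := {A | ∀ x (y : Cn d), C.coframe.tors x A y = lieBr d G A y}
  add_mem' := by
    intro A B hA hB x y
    change C.coframe.torsL x ((show Cn d from A) + (show Cn d from B)) y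
      = lieBr d G ((show Cn d from A) + (show Cn d from B)) y
    rw [map_add, map_add]
    exact congrArg₂ (· + ·) (hA x y) (hB x y)
  zero_mem' := by
    intro x y
    change C.coframe.torsL x (0 : Cn d) y = lieBr d G (0 : Cn d) y
    rw [map_zero, map_zero]
  smul_mem' := by
    intro c A hA x y
    change C.coframe.torsL x (c • (show Cn d from A)) y = lieBr d G (c • (show Cn d from A)) y
    rw [map_smul, map_smul]
    exact congrArg (c • ·) (hA x y)
  lie_mem' := by
    intro A B hA hB x y
    exact C.coframe.tors_bracket (br := lieBr d G) lieBr_jacobi hA hB x y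

lemma mem_flatSubalgebra {A : Cn d} : A ∈ C.flatSubalgebra.toSubmodule ↔
    ∀ x (y : Cn d), C.coframe.tors x A y = lieBr d G A y := Iff.rfl

lemma lmap_mem_flatSubalgebra (hι : ContMDiff (cI e) (cI d) ω ι) (X : Cn e) :
    (lmap d e ι X : Cn d) ∈ C.flatSubalgebra.toSubmodule := fun x B => C.tors_vertical hι x X B

/-- Flatness of a direction is required at every point, so equivariance can be used at x·h,
translated back by h⁻¹. -/
lemma adm_mem_flatSubalgebra (h : H) {A : Cn d} (hA : A ∈ C.flatSubalgebra.toSubmodule) :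
    (adm d (ι h) A : Cn d) ∈ C.flatSubalgebra.toSubmodule := by
  intro x y
  have h1 := C.tors_act h⁻¹ (C.act x h) A (adm d (ι h)⁻¹ y)
  rw [map_inv, inv_inv, adm_apply_adm_inv, ← C.act_mul, mul_inv_cancel, C.act_one, hA, adm_lieBr,
    adm_apply_adm_inv] at h1
  exact h1

end CartanGeometry

/-! ### Foliated atlases, the leaf topology and its leaves -/

/-- An integrable holomorphic distribution, given by charts whose plaques are tangent to it. -/
structure FoliatedAtlas (n k q : ℕ) (X : Type u) [TopologicalSpace X] [ChartedSpace (Cn n) X] where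
  dir : X → Cn n → Prop
  chart : X → OpenPartialHomeomorph X (Cn k × Cn q)
  radius : X → ℝ
  mem_source : ∀ x, x ∈ (chart x).source
  target_eq : ∀ x, (chart x).target = Metric.ball 0 (radius x) ×ˢ Metric.ball 0 (radius x)
  holo : ∀ x, ContMDiffOn (cI n) 𝓘(ℂ, Cn k × Cn q) ω (chart x) (chart x).source
  holo_symm : ∀ x, ContMDiffOn 𝓘(ℂ, Cn k × Cn q) (cI n) ω (chart x).symm (chart x).target
  dir_iff : ∀ x, ∀ y ∈ (chart x).source, ∀ v,
    dir y v ↔ (mder (cI n) 𝓘(ℂ, Cn k × Cn q) (chart x) y v).2 = 0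

lemma eventually_eq_of_fderiv_eq_zero {Z V : Type*} [NormedAddCommGroup Z] [NormedSpace ℂ Z]
    [NormedAddCommGroup V] [NormedSpace ℂ V] {F : Z → V}
    {z : Z} (h : ∀ᶠ w in 𝓝 z, DifferentiableAt ℂ F w ∧ fderiv ℂ F w = 0) : ∀ᶠ w in 𝓝 z, F w = F z := by
  obtain ⟨r, hr, hball⟩ := Metric.eventually_nhds_iff_ball.1 h
  have : NormedSpace ℝ Z := NormedSpace.restrictScalars ℝ ℂ Z
  filter_upwards [Metric.ball_mem_nhds z hr] with w hw
  have hd : DifferentiableOn ℂ F (Metric.ball z r) := fun t ht =>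
    (hball t ht).1.differentiableWithinAt
  have hconv : Convex ℝ (Metric.ball z r) := convex_ball z r
  refine hconv.is_const_of_fderivWithin_eq_zero (𝕜 := ℂ) hd (fun t ht => ?_) hw (Metric.mem_ball_self hr)
  rw [fderivWithin_of_isOpen Metric.isOpen_ball ht]
  exact (hball t ht).2

namespace FoliatedAtlas

variable {n k q : ℕ} {X : Type u} [TopologicalSpace X] [ChartedSpace (Cn n) X]
  (F : FoliatedAtlas n k q X)

/-- The plaques of the foliation. -/
def plaque (p : X × Cn q) : PartialEquiv X (Cn k) where
  toFun y := (F.chart p.1 y).1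
  invFun a := (F.chart p.1).symm (a, p.2)
  source := {y | y ∈ (F.chart p.1).source ∧ (F.chart p.1 y).2 = p.2}
  target := {a | (a, p.2) ∈ (F.chart p.1).target}
  map_source' y hy := by
    change ((F.chart p.1 y).1, p.2) ∈ (F.chart p.1).target
    rw [← hy.2]; exact (F.chart p.1).map_source hy.1
  map_target' a ha := by
    refine ⟨(F.chart p.1).map_target ha, ?_⟩
    rw [(F.chart p.1).right_inv ha]
  left_inv' y hy := by rw [← hy.2]; exact (F.chart p.1).left_inv hy.1
  right_inv' a ha := by rw [(F.chart p.1).right_inv ha]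

lemma mem_plaque_target {p : X × Cn q} {a : Cn k} :
    a ∈ (F.plaque p).target ↔ (a, p.2) ∈ (F.chart p.1).target := Iff.rfl

lemma isOpen_plaque_target (p : X × Cn q) : IsOpen (F.plaque p).target :=
  (F.chart p.1).open_target.preimage (f := fun a : Cn k => (a, p.2)) (by fun_prop)

lemma isPreconnected_plaque_target (p : X × Cn q) : IsPreconnected (F.plaque p).target := by
  -- The transverse parameter ranges over all of ℂ^q; outside the ball the plaque is empty.
  by_cases h : p.2 ∈ Metric.ball (0 : Cn q) (F.radius p.1)
  · have : (F.plaque p).target = Metric.ball 0 (F.radius p.1) := by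
      ext a
      rw [mem_plaque_target, F.target_eq]
      simp only [mem_prod, h, and_true]
    rw [this]
    exact (convex_ball _ _).isPreconnected
  · have : (F.plaque p).target = ∅ := by
      ext a
      rw [mem_plaque_target, F.target_eq]
      simp only [mem_prod, h, and_false, mem_empty_iff_false]
    rw [this]
    exact isPreconnected_empty

lemma contMDiffAt_plaque_symm [IsManifold (cI n) ω X] {p : X × Cn q} {a : Cn k} (ha : a ∈ (F.plaque p).target) :
    ContMDiffAt (cI k) (cI n) ω (F.plaque p).symm a := by
  have h1 : ContMDiffAt 𝓘(ℂ, Cn k × Cn q) (cI n) ω (F.chart p.1).symm (a, p.2) :=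
    (F.holo_symm p.1).contMDiffAt ((F.chart p.1).open_target.mem_nhds ha)
  have h2 : ContDiffAt ℂ ω (fun a : Cn k => (a, p.2)) a := contDiffAt_id.prodMk contDiffAt_const
  exact ContMDiffAt.comp (g := (F.chart p.1).symm) a h1 h2.contMDiffAt

variable [IsManifold (cI n) ω X]

lemma contMDiffAt_chart (x : X) {y : X} (hy : y ∈ (F.chart x).source) :
    ContMDiffAt (cI n) 𝓘(ℂ, Cn k × Cn q) ω (F.chart x) y :=
  (F.holo x).contMDiffAt ((F.chart x).open_source.mem_nhds hy)

lemma mder_chart_injective (x : X) {y : X} (hy : y ∈ (F.chart x).source) :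
    Function.Injective (mder (cI n) 𝓘(ℂ, Cn k × Cn q) (F.chart x) y) := by
  have h1 : ContMDiffAt 𝓘(ℂ, Cn k × Cn q) (cI n) ω (F.chart x).symm (F.chart x y) :=
    (F.holo_symm x).contMDiffAt ((F.chart x).open_target.mem_nhds ((F.chart x).map_source hy))
  have h2 := mder_comp (I₁ := cI n) h1 (F.contMDiffAt_chart x hy)
  have h3 : (fun z => (F.chart x).symm (F.chart x z)) =ᶠ[𝓝 y] fun z => z := by
    filter_upwards [(F.chart x).open_source.mem_nhds hy] with z hz using (F.chart x).left_inv hz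
  rw [mder_congr h3, mder_id] at h2
  intro v w hvw
  have h4 := DFunLike.congr_fun h2 v
  have h5 := DFunLike.congr_fun h2 w
  simp only [ContinuousLinearMap.comp_apply, ContinuousLinearMap.id_apply] at h4 h5
  rw [h4, h5, hvw]

variable {Z : Type*} [NormedAddCommGroup Z] [NormedSpace ℂ Z]

/-- A map tangent to the foliation has values in a plaque, locally. -/
lemma eventually_chart_snd_eq {f : Z → X} {z : Z} (hf : ContMDiffAt 𝓘(ℂ, Z) (cI n) ω f z)
    (hdir : ∀ᶠ y in 𝓝 z, ∀ v, F.dir (f y) (mder 𝓘(ℂ, Z) (cI n) f y v)) {x : X}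
    (hx : f z ∈ (F.chart x).source) :
    ∀ᶠ y in 𝓝 z, (F.chart x (f y)).2 = (F.chart x (f z)).2 := by
  refine eventually_eq_of_fderiv_eq_zero (F := fun y => (F.chart x (f y)).2) ?_
  filter_upwards [hf.eventually_nhds, hdir,
    hf.continuousAt.eventually_mem ((F.chart x).open_source.mem_nhds hx)] with y h1 h2 h3
  have h4 : ContDiffAt ℂ ω (fun y => F.chart x (f y)) y :=
    contMDiffAt_iff_contDiffAt.1 ((F.contMDiffAt_chart x h3).comp y h1)
  refine ⟨(contDiffAt_snd.comp y h4).differentiableAt (by simp), ?_⟩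
  ext1 v
  have h5 : HasFDerivAt (fun y => (F.chart x (f y)).2) _ y :=
    (ContinuousLinearMap.snd ℂ (Cn k) (Cn q)).hasFDerivAt.comp y
      (h4.differentiableAt (by simp)).hasFDerivAt
  rw [h5.fderiv, ContinuousLinearMap.comp_apply, ← mder_eq_fderiv,
    mder_comp_apply (F.contMDiffAt_chart x h3) h1]
  exact (F.dir_iff x _ h3 _).1 (h2 v)

lemma dir_mder_plaque_symm {p : X × Cn q} {a : Cn k} (ha : a ∈ (F.plaque p).target) (v : Cn k) :
    F.dir ((F.plaque p).symm a) (mder (cI k) (cI n) (F.plaque p).symm a v) := by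
  have hs : (F.plaque p).symm a ∈ (F.chart p.1).source := ((F.plaque p).map_target ha).1
  rw [F.dir_iff p.1 _ hs, ← mder_comp_apply (F.contMDiffAt_chart p.1 hs) (F.contMDiffAt_plaque_symm ha)]
  have h1 : (fun a => F.chart p.1 ((F.plaque p).symm a)) =ᶠ[𝓝 a] fun a => (a, p.2) := by
    filter_upwards [(F.isOpen_plaque_target p).mem_nhds ha] with b hb
    exact (F.chart p.1).right_inv hb
  rw [mder_congr h1, mder_eq_fderiv, (hasFDerivAt_prodMk_left a p.2).fderiv]
  rfl

/-- A plaque is tangent to the distribution, so the transverse coordinate of any other chart is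
locally constant on it. Hence plaques overlap in open sets and can serve as charts of dimension k.
-/
lemma eventually_plaque_snd_eq {p p' : X × Cn q} {a : Cn k} (ha : a ∈ (F.plaque p).target)
    (hx : (F.plaque p).symm a ∈ (F.plaque p').source) :
    ∀ᶠ b in 𝓝 a, (F.plaque p).symm b ∈ (F.plaque p').source := by
  have h1 := F.contMDiffAt_plaque_symm ha
  have h2 : ∀ᶠ b in 𝓝 a, ∀ v, F.dir ((F.plaque p).symm b) (mder (cI k) (cI n) (F.plaque p).symm b v) := by
    filter_upwards [(F.isOpen_plaque_target p).mem_nhds ha] with b hb v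
    exact F.dir_mder_plaque_symm hb v
  filter_upwards [F.eventually_chart_snd_eq h1 h2 hx.1,
    h1.continuousAt.eventually_mem ((F.chart p'.1).open_source.mem_nhds hx.1)] with b h3 h4
  exact ⟨h4, h3.trans hx.2⟩

/-- The atlas of plaques. -/
def fineCore : ChartedSpaceCore (Cn k) X where
  atlas := range F.plaque
  chartAt y := F.plaque (y, (F.chart y y).2)
  mem_chart_source y := ⟨F.mem_source y, rfl⟩
  chart_mem_atlas y := mem_range_self _
  open_source := by
    rintro _ _ ⟨p, rfl⟩ ⟨p', rfl⟩
    rw [isOpen_iff_mem_nhds]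
    rintro a ⟨ha, ha'⟩
    filter_upwards [(F.isOpen_plaque_target p).mem_nhds ha, F.eventually_plaque_snd_eq ha ha']
      with b h1 h2 using ⟨h1, h2⟩
  continuousOn_toFun := by
    rintro _ _ ⟨p, rfl⟩ ⟨p', rfl⟩
    rintro a ⟨ha, ha'⟩
    refine ContinuousAt.continuousWithinAt ?_
    exact continuous_fst.continuousAt.comp (ContinuousAt.comp (g := F.chart p'.1)
      ((F.chart p'.1).continuousAt ha'.1) (F.contMDiffAt_plaque_symm ha).continuousAt)

end FoliatedAtlas

/-- A manifold with the leaf topology of a foliation. -/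
def FoliatedAtlas.Fine {n k q : ℕ} {X : Type u} [TopologicalSpace X] [ChartedSpace (Cn n) X]
    (_ : FoliatedAtlas n k q X) : Type u := X

namespace FoliatedAtlas

variable {n k q : ℕ} {X : Type u} [TopologicalSpace X] [ChartedSpace (Cn n) X] [IsManifold (cI n) ω X]
  (F : FoliatedAtlas n k q X)

instance : TopologicalSpace F.Fine := F.fineCore.toTopologicalSpace

instance : ChartedSpace (Cn k) F.Fine := F.fineCore.toChartedSpace

/-- The identity map, from the leaf topology. -/
def val (x : F.Fine) : X := x

/-- The identity map, to the leaf topology. -/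
def toFine (x : X) : F.Fine := x

/-- The charts of the leaf topology. -/
def fineChart (p : X × Cn q) : OpenPartialHomeomorph F.Fine (Cn k) :=
  F.fineCore.openPartialHomeomorph (F.plaque p) (mem_range_self p)

lemma fineChart_mem_atlas (p : X × Cn q) : F.fineChart p ∈ atlas (Cn k) F.Fine :=
  mem_iUnion₂.2 ⟨F.plaque p, mem_range_self p, rfl⟩

lemma exists_fineChart_eq {e : OpenPartialHomeomorph F.Fine (Cn k)} (he : e ∈ atlas (Cn k) F.Fine) :
    ∃ p, e = F.fineChart p := by
  obtain ⟨_, ⟨p, rfl⟩, h⟩ := mem_iUnion₂.1 he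
  exact ⟨p, h⟩

instance : IsManifold (cI k) ω F.Fine := by
  refine isManifold_of_contDiffOn _ _ _ fun e e' he he' => ?_
  obtain ⟨p, rfl⟩ := F.exists_fineChart_eq he
  obtain ⟨p', rfl⟩ := F.exists_fineChart_eq he'
  rintro a ⟨⟨ha, ha'⟩, -⟩
  change a ∈ (F.plaque p).target at ha
  change (F.plaque p).symm a ∈ (F.plaque p').source at ha'
  refine ContDiffAt.contDiffWithinAt ?_
  change ContDiffAt ℂ ω (fun a => (F.chart p'.1 ((F.plaque p).symm a)).1) a
  exact contDiffAt_fst.comp a (contMDiffAt_iff_contDiffAt.1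
    (ContMDiffAt.comp (g := F.chart p'.1) a (F.contMDiffAt_chart _ ha'.1) (F.contMDiffAt_plaque_symm ha)))

lemma mem_maximalAtlas_fineChart (p : X × Cn q) :
    F.fineChart p ∈ IsManifold.maximalAtlas (cI k) ω F.Fine :=
  IsManifold.subset_maximalAtlas (F.fineChart_mem_atlas p)

lemma contMDiff_val : ContMDiff (cI k) (cI n) ω F.val := by
  intro x
  let p : X × Cn q := (F.val x, (F.chart (F.val x) (F.val x)).2)
  have hx : x ∈ (F.fineChart p).source := ⟨F.mem_source (F.val x), rfl⟩
  have h1 : ContMDiffAt (cI k) (cI k) ω (F.fineChart p) x :=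
    contMDiffAt_of_mem_maximalAtlas (F.mem_maximalAtlas_fineChart p) hx
  have h2 : ContMDiffAt (cI k) (cI n) ω (F.plaque p).symm (F.fineChart p x) :=
    F.contMDiffAt_plaque_symm ((F.fineChart p).map_source hx)
  refine (ContMDiffAt.comp x h2 h1).congr_of_eventuallyEq ?_
  filter_upwards [(F.fineChart p).open_source.mem_nhds hx] with y hy
  exact ((F.fineChart p).left_inv hy).symm

lemma continuous_val : Continuous F.val := F.contMDiff_val.continuous

instance [T2Space X] : T2Space F.Fine :=
  T2Space.of_injective_continuous (f := F.val) (fun _ _ h => h) F.continuous_val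

instance : LocallyConnectedSpace F.Fine := ChartedSpace.locallyConnectedSpace (Cn k) F.Fine

lemma contMDiffAt_fineChart_symm {p : X × Cn q} {a : Cn k} (ha : a ∈ (F.plaque p).target) :
    ContMDiffAt (cI k) (cI k) ω (F.fineChart p).symm a :=
  contMDiffAt_symm_of_mem_maximalAtlas (F.mem_maximalAtlas_fineChart p) ha

/-- Plaques of one chart with different transverse parameters are disjoint and open for the leaf
topology, so a second countable set meets at most countably many of them. -/
lemma countable_fineChart_inter {S : Set F.Fine} [SecondCountableTopology S] (x : X) :
    {t : Cn q | ((F.fineChart (x, t)).source ∩ S).Nonempty}.Countable := by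
  have h1 : ∀ t, IsOpen (Subtype.val ⁻¹' (F.fineChart (x, t)).source : Set S) := fun t =>
    (F.fineChart (x, t)).open_source.preimage continuous_subtype_val
  refine (Pairwise.countable_of_isOpen_disjoint (s := fun t : {t : Cn q |
    ((F.fineChart (x, t)).source ∩ S).Nonempty} =>
      (Subtype.val ⁻¹' (F.fineChart (x, t.1)).source : Set S)) ?_ (fun t => h1 t.1) ?_)
  · intro t t' htt'
    refine Set.disjoint_left.2 fun y hy hy' => htt' (Subtype.ext ?_)
    exact hy.2.symm.trans hy'.2
  · rintro ⟨t, y, hy, hyS⟩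
    exact ⟨⟨y, hyS⟩, hy⟩

section Maps

variable {E₁ H₁ N : Type*} [NormedAddCommGroup E₁] [NormedSpace ℂ E₁] [TopologicalSpace H₁]
  {I₁ : ModelWithCorners ℂ E₁ H₁} [TopologicalSpace N] [ChartedSpace H₁ N]

/-- A holomorphic map which locally has values in a plaque is holomorphic for the leaf topology. -/
lemma contMDiffAt_toFine_of_eventually {f : N → X} {z : N} (hf : ContMDiffAt I₁ (cI n) ω f z) {x : X}
    (hx : f z ∈ (F.chart x).source) (h : ∀ᶠ y in 𝓝 z, (F.chart x (f y)).2 = (F.chart x (f z)).2) :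
    ContMDiffAt I₁ (cI k) ω (fun y => F.toFine (f y)) z := by
  let p : X × Cn q := (x, (F.chart x (f z)).2)
  have h1 : ContMDiffAt I₁ 𝓘(ℂ, Cn k × Cn q) ω (fun y => F.chart x (f y)) z :=
    (F.contMDiffAt_chart x hx).comp z hf
  have h2 : ContMDiffAt I₁ (cI k) ω (fun y => (F.chart x (f y)).1) z :=
    ContMDiffAt.comp (g := Prod.fst) z contDiffAt_fst.contMDiffAt h1
  have hz : (F.chart x (f z)).1 ∈ (F.plaque p).target := (F.chart x).map_source hx
  refine (ContMDiffAt.comp (g := (F.fineChart p).symm) z (F.contMDiffAt_fineChart_symm hz)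
    h2).congr_of_eventuallyEq ?_
  filter_upwards [h, hf.continuousAt.eventually_mem ((F.chart x).open_source.mem_nhds hx)] with y h3 h4
  change f y = (F.chart x).symm ((F.chart x (f y)).1, (F.chart x (f z)).2)
  rw [← h3]
  exact ((F.chart x).left_inv h4).symm

variable [IsManifold I₁ ω N] [I₁.Boundaryless]

lemma eventually_of_extChartAt {z : N} {p : N → Prop}
    (h : ∀ᶠ a in 𝓝 (extChartAt I₁ z z), p ((extChartAt I₁ z).symm a)) : ∀ᶠ y in 𝓝 z, p y := by
  filter_upwards [(continuousAt_extChartAt (I := I₁) z).eventually h, extChartAt_source_mem_nhds (I := I₁) z]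
    with y h1 h2
  rwa [(extChartAt I₁ z).left_inv h2] at h1

lemma contMDiffAt_extChartAt_symm' (z : N) :
    ContMDiffAt 𝓘(ℂ, E₁) I₁ ω (extChartAt I₁ z).symm (extChartAt I₁ z z) :=
  (contMDiffOn_extChartAt_symm z).contMDiffAt (extChartAt_target_mem_nhds z)

/-- A holomorphic map tangent to the foliation is holomorphic for the leaf topology. -/
theorem contMDiffAt_toFine {f : N → X} {z : N} (hf : ContMDiffAt I₁ (cI n) ω f z)
    (hdir : ∀ᶠ y in 𝓝 z, ∀ v, F.dir (f y) (mder I₁ (cI n) f y v)) :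
    ContMDiffAt I₁ (cI k) ω (fun y => F.toFine (f y)) z := by
  refine F.contMDiffAt_toFine_of_eventually hf (F.mem_source _) (eventually_of_extChartAt (I₁ := I₁) ?_)
  have h1 := contMDiffAt_extChartAt_symm' (I₁ := I₁) z
  have hz : (extChartAt I₁ z).symm (extChartAt I₁ z z) = z := extChartAt_to_inv z
  have hf' : ContMDiffAt I₁ (cI n) ω f ((extChartAt I₁ z).symm (extChartAt I₁ z z)) := by rwa [hz]
  have ht : Tendsto (extChartAt I₁ z).symm (𝓝 (extChartAt I₁ z z)) (𝓝 z) := by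
    have := h1.continuousAt.tendsto
    rwa [hz] at this
  have h2 := F.eventually_chart_snd_eq (f := fun a => f ((extChartAt I₁ z).symm a)) (hf'.comp _ h1)
    (x := f z) ?_ (by rw [hz]; exact F.mem_source _)
  · rwa [hz] at h2
  · filter_upwards [ht.eventually hdir, h1.eventually_nhds, ht.eventually hf.eventually_nhds] with a h3 h4 h5 v
    rw [mder_comp_apply h5 h4]
    exact h3 _

/-- A holomorphic map with values in a second countable subset of the leaf topology is holomorphic
for the leaf topology. -/
theorem contMDiffAt_toFine_of_mem {f : N → X} {z : N} (hf : ContMDiffAt I₁ (cI n) ω f z)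
    {S : Set F.Fine} [SecondCountableTopology S] (hmem : ∀ᶠ y in 𝓝 z, F.toFine (f y) ∈ S) :
    ContMDiffAt I₁ (cI k) ω (fun y => F.toFine (f y)) z := by
  let c := F.chart (f z)
  have hx : f z ∈ c.source := F.mem_source _
  refine F.contMDiffAt_toFine_of_eventually hf hx (eventually_of_extChartAt (I₁ := I₁) ?_)
  have hcount := F.countable_fineChart_inter (S := S) (f z)
  have hs1 := contMDiffAt_extChartAt_symm' (I₁ := I₁) z
  have hz : (extChartAt I₁ z).symm (extChartAt I₁ z z) = z := extChartAt_to_inv z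
  have ht : Tendsto (extChartAt I₁ z).symm (𝓝 (extChartAt I₁ z z)) (𝓝 z) := by
    have := hs1.continuousAt.tendsto
    rwa [hz] at this
  have hgood : ∀ᶠ a in 𝓝 (extChartAt I₁ z z), ContinuousAt (fun a => f ((extChartAt I₁ z).symm a)) a ∧
      f ((extChartAt I₁ z).symm a) ∈ c.source ∧ F.toFine (f ((extChartAt I₁ z).symm a)) ∈ S := by
    filter_upwards [hs1.eventually_nhds, ht.eventually hf.eventually_nhds, ht.eventually hmem,
      ht.eventually (hf.continuousAt.eventually_mem (c.open_source.mem_nhds hx))] with a a1 a2 a3 a4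
    exact ⟨ContinuousAt.comp (g := f) a2.continuousAt a1.continuousAt, a4, a3⟩
  obtain ⟨r, hr, hball⟩ := Metric.eventually_nhds_iff_ball.1 hgood
  have : NormedSpace ℝ E₁ := NormedSpace.restrictScalars ℝ ℂ E₁
  let g : E₁ → Cn q := fun a => (c (f ((extChartAt I₁ z).symm a))).2
  have hg : ContinuousOn g (Metric.ball (extChartAt I₁ z z) r) := fun a ha =>
    (continuous_snd.continuousAt.comp (ContinuousAt.comp (g := c) (f := fun a => f ((extChartAt I₁ z).symm a))
      (c.continuousAt (hball a ha).2.1) (hball a ha).1)).continuousWithinAt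
  have hpre : IsPreconnected (g '' Metric.ball (extChartAt I₁ z z) r) :=
    (convex_ball _ _).isPreconnected.image g hg
  -- The transverse coordinate of the map has connected image, and only countably many values
  -- because S meets countably many plaques; hence it is constant.
  have hsub : (g '' Metric.ball (extChartAt I₁ z z) r).Subsingleton := by
    refine (hcount.mono ?_).isTotallyDisconnected _ Subset.rfl hpre
    rintro _ ⟨a, ha, rfl⟩
    exact ⟨F.toFine (f ((extChartAt I₁ z).symm a)), ⟨(hball a ha).2.1, rfl⟩, (hball a ha).2.2⟩
  filter_upwards [Metric.ball_mem_nhds _ hr] with a ha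
  have h1 := hsub (mem_image_of_mem g ha) (mem_image_of_mem g (Metric.mem_ball_self hr))
  simp only [g, hz] at h1
  exact h1

end Maps

end FoliatedAtlas

section ComponentCountability

/-- From one member of the cover, chains of overlapping members reach only countably many others.
The union of those reached is open and closed, hence contains the component. -/
theorem secondCountableTopology_connectedComponent {Y ι : Type*} [TopologicalSpace Y]
    (U : ι → Set Y) (hU : ∀ i, IsOpen (U i)) (hcov : ∀ y, ∃ i, y ∈ U i)
    (hsc : ∀ i, SecondCountableTopology (U i)) (hcount : ∀ i, {j | (U j ∩ U i).Nonempty}.Countable) (y : Y) :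
    SecondCountableTopology (connectedComponent y) := by
  obtain ⟨i₀, hi₀⟩ := hcov y
  let S : ℕ → Set ι := fun m => Nat.rec {i₀} (fun _ T => ⋃ i ∈ T, {j | (U j ∩ U i).Nonempty}) m
  have hS : ∀ m, (S m).Countable := fun m => by
    induction m with
    | zero => exact countable_singleton _
    | succ m ih => exact ih.biUnion fun i _ => hcount i
  let T : Set ι := ⋃ m, S m
  have hT : T.Countable := countable_iUnion hS
  let W : Set Y := ⋃ i ∈ T, U i
  have hWo : IsOpen W := isOpen_biUnion fun i _ => hU i
  have hWc : IsClosed W := by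
    rw [← isOpen_compl_iff, isOpen_iff_mem_nhds]
    intro z hz
    obtain ⟨j, hj⟩ := hcov z
    filter_upwards [(hU j).mem_nhds hj] with w hw hwW
    obtain ⟨i, hi, hwi⟩ := mem_iUnion₂.1 hwW
    obtain ⟨m, hm⟩ := mem_iUnion.1 hi
    exact hz (mem_iUnion₂.2 ⟨j, mem_iUnion.2 ⟨m + 1, mem_iUnion₂.2 ⟨i, hm, w, hw, hwi⟩⟩, hj⟩)
  have hsub : connectedComponent y ⊆ W :=
    IsClopen.connectedComponent_subset ⟨hWc, hWo⟩
      (mem_iUnion₂.2 ⟨i₀, mem_iUnion.2 ⟨0, mem_singleton _⟩, hi₀⟩)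
  have hW : SecondCountableTopology W := by
    have : Countable T := hT.to_subtype
    have hsc' : ∀ i : T, SecondCountableTopology (Subtype.val ⁻¹' U i : Set W) := fun i => by
      have := hsc i
      have h1 : Topology.IsInducing (fun w : (Subtype.val ⁻¹' U i : Set W) => (w.1.1 : Y)) :=
        Topology.IsInducing.subtypeVal.comp Topology.IsInducing.subtypeVal
      exact (Topology.IsInducing.of_comp (f := fun w : (Subtype.val ⁻¹' U i : Set W) => (⟨w.1.1, w.2⟩ : U i))
        (by fun_prop) continuous_subtype_val h1).secondCountableTopology
    refine TopologicalSpace.secondCountableTopology_of_countable_cover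
      (U := fun i : T => (Subtype.val ⁻¹' U i : Set W))
      (fun i => (hU i).preimage continuous_subtype_val) ?_
    refine eq_univ_of_forall fun w => ?_
    obtain ⟨i, hi, hwi⟩ := mem_iUnion₂.1 w.2
    exact mem_iUnion.2 ⟨⟨i, hi⟩, hwi⟩
  exact (Topology.IsEmbedding.inclusion hsub).isInducing.secondCountableTopology

end ComponentCountability

section OpenSubsets

open TopologicalSpace

variable {E₁ H₁ M : Type*} [NormedAddCommGroup E₁] [NormedSpace ℂ E₁] [TopologicalSpace H₁]
  {I₁ : ModelWithCorners ℂ E₁ H₁} [TopologicalSpace M] [ChartedSpace H₁ M]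
  {E₂ H₂ N : Type*} [NormedAddCommGroup E₂] [NormedSpace ℂ E₂] [TopologicalSpace H₂]
  {I₂ : ModelWithCorners ℂ E₂ H₂} [TopologicalSpace N] [ChartedSpace H₂ N]

/-- The map factors through a retraction of M to U, which takes an arbitrary value outside U and is
holomorphic at the points of U. -/
lemma contMDiffAt_codRestrict {U : Opens M} {f : N → U} {z : N}
    (hf : ContMDiffAt I₂ I₁ ω (fun y => (f y : M)) z) : ContMDiffAt I₂ I₁ ω f z := by
  classical
  let r : M → U := fun y => if h : y ∈ U then ⟨y, h⟩ else f z
  have hr : ∀ y : U, r y = y := fun y => dif_pos y.2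
  have h1 : ContMDiffAt I₁ I₁ ω r (f z) := by
    rw [← contMDiffAt_subtype_iff]
    simp only [hr]
    exact contMDiffAt_id
  refine (h1.comp (g := r) z hf).congr_of_eventuallyEq (Eventually.of_forall fun y => ?_)
  exact (hr _).symm

lemma mder_subtype_val_bijective {U : Opens M} (x : U) :
    Function.Bijective (mder I₁ I₁ (Subtype.val : U → M) x) := by
  classical
  let r : M → U := fun y => if h : y ∈ U then ⟨y, h⟩ else x
  have hr : ∀ y : U, r y = y := fun y => dif_pos y.2
  have h1 : ContMDiffAt I₁ I₁ ω r x := by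
    rw [← contMDiffAt_subtype_iff]
    simp only [hr]
    exact contMDiffAt_id
  have h2 : ContMDiffAt I₁ I₁ ω (Subtype.val : U → M) x := contMDiff_subtype_val.contMDiffAt
  have h3 := mder_comp (g := r) h1 h2
  simp only [hr, mder_id] at h3
  have h4 := mder_comp (g := (Subtype.val : U → M)) (f := r) (x := x.1) (by rw [hr]; exact h2) h1
  have h5 : (fun y => (r y : M)) =ᶠ[𝓝 x.1] fun y => y := by
    filter_upwards [U.isOpen.mem_nhds x.2] with y hy
    exact congrArg Subtype.val (hr ⟨y, hy⟩)
  rw [mder_congr h5, mder_id, hr] at h4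
  refine ⟨fun v w hvw => ?_, fun v => ⟨mder I₁ I₁ r x v, (DFunLike.congr_fun h4 v).symm⟩⟩
  have h6 := DFunLike.congr_fun h3 v
  have h7 := DFunLike.congr_fun h3 w
  simp only [ContinuousLinearMap.comp_apply, ContinuousLinearMap.id_apply] at h6 h7
  rw [h6, h7, hvw]

end OpenSubsets

namespace FoliatedAtlas

variable {n k q : ℕ} {X : Type u} [TopologicalSpace X] [ChartedSpace (Cn n) X] [IsManifold (cI n) ω X]
  (F : FoliatedAtlas n k q X)

/-- Near x the leaf chart is the first component of the foliated chart, and the second component is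
constant along the plaque. -/
lemma mder_chart_mder_val (x : F.Fine) (v : Cn k) :
    mder (cI n) 𝓘(ℂ, Cn k × Cn q) (F.chart (F.val x)) (F.val x) (mder (cI k) (cI n) F.val x v) = (v, 0) := by
  let c := F.chart (F.val x)
  have hc := F.contMDiffAt_chart (F.val x) (F.mem_source (F.val x))
  have h1 : (fun y => c (F.val y)) =ᶠ[𝓝 x] fun y => (chartAt (Cn k) x y, (c (F.val x)).2) := by
    filter_upwards [(chartAt (Cn k) x).open_source.mem_nhds (mem_chart_source _ x)] with y hy
    exact Prod.ext rfl hy.2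
  have h2 := contMDiffAt_chartAt (mem_chart_source (Cn k) x)
  have h3 : ContDiffAt ℂ ω (fun a : Cn k => (a, (c (F.val x)).2)) (chartAt (Cn k) x x) :=
    contDiffAt_id.prodMk contDiffAt_const
  rw [← mder_comp_apply hc (F.contMDiff_val x), mder_congr h1,
    mder_comp_apply (g := fun a : Cn k => (a, (c (F.val x)).2)) h3.contMDiffAt h2, mder_chartAt_self,
    mder_eq_fderiv, (hasFDerivAt_prodMk_left _ _).fderiv]
  rfl

lemma mder_val_injective (x : F.Fine) : Function.Injective (mder (cI k) (cI n) F.val x) := fun v w h => by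
  have h1 := F.mder_chart_mder_val x v
  rw [h, F.mder_chart_mder_val x w] at h1
  exact (Prod.ext_iff.1 h1).1.symm

lemma dir_val_iff (x : F.Fine) (v : Cn n) :
    F.dir (F.val x) v ↔ ∃ w, mder (cI k) (cI n) F.val x w = v := by
  rw [F.dir_iff (F.val x) _ (F.mem_source _)]
  constructor
  · intro h
    refine ⟨_, F.mder_chart_injective (F.val x) (F.mem_source _)
      ((F.mder_chart_mder_val x _).trans (Prod.ext rfl h.symm))⟩
  · rintro ⟨w, rfl⟩
    rw [F.mder_chart_mder_val]

theorem secondCountableTopology_component [SecondCountableTopology X] (x : F.Fine) :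
    SecondCountableTopology (connectedComponent x) := by
  obtain ⟨s, hs, hcov⟩ := TopologicalSpace.countable_cover_nhds
    (f := fun x : X => (F.chart x).source) fun x => (F.chart x).open_source.mem_nhds (F.mem_source x)
  refine secondCountableTopology_connectedComponent
    (fun p : s × Cn q => (F.fineChart (p.1.1, p.2)).source) (fun p => (F.fineChart _).open_source)
    (fun y => ?_) (fun p => (F.fineChart _).secondCountableTopology_source) (fun p => ?_) x
  · obtain ⟨z, hz, hy⟩ := mem_iUnion₂.1 (hcov.symm ▸ mem_univ (F.val y))
    exact ⟨(⟨z, hz⟩, (F.chart z (F.val y)).2), hy, rfl⟩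
  · have := (F.fineChart (p.1.1, p.2)).secondCountableTopology_source
    have : Countable s := hs.to_subtype
    refine (countable_iUnion fun z : s => (F.countable_fineChart_inter
      (S := (F.fineChart (p.1.1, p.2)).source) z.1).image fun t => (z, t)).mono ?_
    rintro ⟨z, t⟩ h
    exact mem_iUnion.2 ⟨z, t, h, rfl⟩

/-- The leaves, as open sets for the leaf topology. -/
def leaf (a : ConnectedComponents F.Fine) : TopologicalSpace.Opens F.Fine :=
  ⟨(↑) ⁻¹' {a}, by
    obtain ⟨x, rfl⟩ := ConnectedComponents.surjective_coe a
    rw [connectedComponents_preimage_singleton]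
    exact isOpen_connectedComponent⟩

lemma coe_leaf (x : F.Fine) : (F.leaf x : Set F.Fine) = connectedComponent x :=
  connectedComponents_preimage_singleton

lemma mem_leaf {a : ConnectedComponents F.Fine} {x : F.Fine} : x ∈ F.leaf a ↔ (x : ConnectedComponents F.Fine) = a :=
  Iff.rfl

instance (a : ConnectedComponents F.Fine) : ConnectedSpace (F.leaf a) := by
  obtain ⟨x, rfl⟩ := ConnectedComponents.surjective_coe a
  refine isConnected_iff_connectedSpace.1 ?_
  rw [coe_leaf]
  exact isConnected_connectedComponent

instance [SecondCountableTopology X] (a : ConnectedComponents F.Fine) :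
    SecondCountableTopology (F.leaf a) := by
  obtain ⟨x, rfl⟩ := ConnectedComponents.surjective_coe a
  change SecondCountableTopology (F.leaf x : Set F.Fine)
  rw [coe_leaf]
  exact F.secondCountableTopology_component x

instance [T2Space X] [SecondCountableTopology X] (a : ConnectedComponents F.Fine) :
    ComplexManifold k (F.leaf a) where

/-- The foliation by the maximal connected integral manifolds. -/
def foliation [T2Space X] [SecondCountableTopology X] : HolomorphicFoliation n X k where
  Index := ConnectedComponents F.Fine
  Leaf a := F.leaf a
  incl _ x := F.val x.1
  incl_holomorphic _ := F.contMDiff_val.comp contMDiff_subtype_val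
  incl_injective _ _ _ h := Subtype.ext h
  incl_immersion a p := by
    change Function.Injective (mder (cI k) (cI n) (fun x : F.leaf a => F.val x.1) p)
    intro v w h
    have h1 := mder_comp (g := F.val) (F.contMDiff_val p.1)
      (contMDiff_subtype_val (I := cI k) (U := F.leaf a) (n := ω)).contMDiffAt
    rw [h1] at h
    exact (mder_subtype_val_bijective p).1 (F.mder_val_injective p.1 h)
  partition m := by
    refine ⟨(F.toFine m : ConnectedComponents F.Fine), ⟨⟨F.toFine m, rfl⟩, rfl⟩, ?_⟩
    rintro a ⟨⟨x, hx⟩, rfl⟩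
    exact hx.symm
  foliated_chart m := by
    refine ⟨q, F.chart m, Metric.ball 0 (F.radius m), Metric.ball 0 (F.radius m), F.mem_source m,
      F.target_eq m, ?_, F.holo m, F.holo_symm m, ?_⟩
    · have := (F.chart m).map_source (F.mem_source m)
      rw [F.target_eq] at this
      exact Metric.isConnected_ball (Metric.pos_of_mem_ball this.1)
    · intro y hy
      have hpos := Metric.pos_of_mem_ball hy
      have himg : (F.chart m).symm '' (Metric.ball 0 (F.radius m) ×ˢ {y}) = (F.plaque (m, y)).source := by
        ext x
        constructor
        · rintro ⟨⟨a, b⟩, ⟨ha, rfl⟩, rfl⟩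
          exact (F.plaque (m, b)).map_target
            (show (a, b) ∈ (F.chart m).target from F.target_eq m ▸ ⟨ha, hy⟩)
        · intro hx
          have h1 := (F.chart m).map_source hx.1
          rw [F.target_eq] at h1
          exact ⟨F.chart m x, ⟨h1.1, hx.2⟩, (F.chart m).left_inv hx.1⟩
      have hconn : IsPreconnected (F.fineChart (m, y)).source := by
        have h1 : (F.fineChart (m, y)).symm '' (F.fineChart (m, y)).target = (F.fineChart (m, y)).source :=
          (F.fineChart (m, y)).symm_image_target_eq_source
        rw [← h1]
        exact (F.isPreconnected_plaque_target (m, y)).image _ (F.fineChart (m, y)).continuousOn_symm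
      have h0 : (F.plaque (m, y)).symm 0 ∈ (F.fineChart (m, y)).source :=
        (F.plaque (m, y)).map_target
          (show (0, y) ∈ (F.chart m).target from F.target_eq m ▸ ⟨Metric.mem_ball_self hpos, hy⟩)
      refine ⟨(F.toFine ((F.plaque (m, y)).symm 0) : ConnectedComponents F.Fine), ?_, ?_⟩
      · rw [himg]
        intro x hx
        refine ⟨⟨F.toFine x, ?_⟩, rfl⟩
        rw [mem_leaf, ConnectedComponents.coe_eq_coe]
        exact (connectedComponent_eq (hconn.subset_connectedComponent h0 hx)).symm
      · rw [himg]
        exact (F.fineChart (m, y)).open_source.preimage continuous_subtype_val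

end FoliatedAtlas

/-! ### Frobenius charts from exponential coordinates -/

section FlatCharts

variable {n k q : ℕ} {X : Type u} [TopologicalSpace X] [ChartedSpace (Cn n) X] [IsManifold (cI n) ω X]

/-- The chart is the local inverse of a parametrization Θ whose slices are tangent to D, shrunk to a
product of balls; such a product of equal radii is a ball for the supremum norm. -/
lemma exists_foliated_chart {D : X → Submodule ℂ (Cn n)} (hD : ∀ x, Module.finrank ℂ (D x) = k) {x : X}
    {Θ : Cn k × Cn q → X} (hΘ : ContMDiffAt 𝓘(ℂ, Cn k × Cn q) (cI n) ω Θ 0) (h0 : Θ 0 = x)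
    (hinj : Function.Injective (mder 𝓘(ℂ, Cn k × Cn q) (cI n) Θ 0)) (hkq : k + q = n)
    (h : ∀ᶠ p in 𝓝 0, ∀ a, mder 𝓘(ℂ, Cn k × Cn q) (cI n) Θ p (a, 0) ∈ D (Θ p)) :
    ∃ (c : OpenPartialHomeomorph X (Cn k × Cn q)) (r : ℝ), x ∈ c.source ∧
      c.target = Metric.ball 0 r ×ˢ Metric.ball 0 r ∧
      ContMDiffOn (cI n) 𝓘(ℂ, Cn k × Cn q) ω c c.source ∧
      ContMDiffOn 𝓘(ℂ, Cn k × Cn q) (cI n) ω c.symm c.target ∧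
      ∀ y ∈ c.source, ∀ v, v ∈ D y ↔ (mder (cI n) 𝓘(ℂ, Cn k × Cn q) c y v).2 = 0 := by
  have hfr : Module.finrank ℂ (Cn k × Cn q) = Module.finrank ℂ (Cn n) := by simp [hkq]
  obtain ⟨e, he0, heq, heh, he1, he2⟩ := exists_openPartialHomeomorph_of_mder hΘ
    (LinearEquiv.ofInjectiveOfFinrankEq _ hinj hfr).toContinuousLinearEquiv
    (ContinuousLinearMap.ext fun v => rfl)
  obtain ⟨r, hr, hball⟩ := Metric.eventually_nhds_iff_ball.1
    ((e.open_source.eventually_mem he0).and h)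
  have hs : IsOpen (Metric.ball (0 : Cn k) r ×ˢ Metric.ball (0 : Cn q) r) :=
    Metric.isOpen_ball.prod Metric.isOpen_ball
  have hsub : Metric.ball (0 : Cn k) r ×ˢ Metric.ball (0 : Cn q) r = Metric.ball 0 r := by
    rw [ball_prod_same]; rfl
  have hsrc : (e.restrOpen _ hs).source = Metric.ball 0 r ×ˢ Metric.ball 0 r := by
    rw [OpenPartialHomeomorph.restrOpen_source, inter_eq_right, hsub]
    exact fun p hp => (hball p hp).1
  refine ⟨(e.restrOpen _ hs).symm, r, ?_, hsrc, ?_, ?_, ?_⟩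
  · have h1 : (0 : Cn k × Cn q) ∈ (e.restrOpen _ hs).source := by
      rw [hsrc, hsub]; exact Metric.mem_ball_self hr
    have h2 := (e.restrOpen _ hs).map_source h1
    have h3 : e.restrOpen _ hs 0 = x := (heq he0).trans h0
    rwa [h3] at h2
  · exact he2.mono fun y hy => hy.1
  · exact he1.mono fun y hy => hy.1
  · intro y hy v
    have hp : e.symm y ∈ Metric.ball (0 : Cn k × Cn q) r := by
      rw [← hsub, ← hsrc]
      exact (e.restrOpen _ hs).map_target hy
    have hy' : y ∈ e.target := hy.1
    obtain ⟨h1, h2⟩ := hball _ hp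
    have hΘy : Θ (e.symm y) = y := (heq h1).symm.trans (e.right_inv hy')
    have h3 : ContMDiffAt (cI n) 𝓘(ℂ, Cn k × Cn q) ω e.symm y :=
      he2.contMDiffAt (e.open_target.mem_nhds hy')
    have h4 := mder_comp (g := Θ) (heh _ h1) h3
    have h5 : (fun z => Θ (e.symm z)) =ᶠ[𝓝 y] fun z => z := by
      filter_upwards [e.open_target.mem_nhds hy'] with z hz
      exact (heq (e.map_target hz)).symm.trans (e.right_inv hz)
    rw [mder_congr h5, mder_id] at h4
    have h6 : Function.Injective (mder 𝓘(ℂ, Cn k × Cn q) (cI n) Θ (e.symm y)) := by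
      refine (LinearMap.injective_iff_surjective_of_finrank_eq_finrank hfr
        (f := (mder 𝓘(ℂ, Cn k × Cn q) (cI n) Θ (e.symm y)).toLinearMap)).2 fun w => ?_
      exact ⟨_, (DFunLike.congr_fun h4 w).symm⟩
    -- The hypothesis gives only that the slices are tangent to D; equality of dimensions turns the
    -- inclusion into an equality.
    have h7 : Submodule.map (mder 𝓘(ℂ, Cn k × Cn q) (cI n) Θ (e.symm y)).toLinearMap
        (LinearMap.range (LinearMap.inl ℂ (Cn k) (Cn q))) = D y := by
      refine Submodule.eq_of_le_of_finrank_eq ?_ ?_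
      · rintro _ ⟨_, ⟨a, rfl⟩, rfl⟩
        have := h2 a
        rw [hΘy] at this
        exact this
      · rw [hD, (Submodule.equivMapOfInjective _ h6 _).finrank_eq.symm, LinearMap.finrank_range_of_inj LinearMap.inl_injective]
        simp
    change v ∈ D y ↔ (mder (cI n) 𝓘(ℂ, Cn k × Cn q) e.symm y v).2 = 0
    have h8 : v = mder 𝓘(ℂ, Cn k × Cn q) (cI n) Θ (e.symm y) (mder (cI n) 𝓘(ℂ, Cn k × Cn q) e.symm y v) :=
      DFunLike.congr_fun h4 v
    rw [← h7]
    constructor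
    · rintro ⟨_, ⟨a, rfl⟩, ha⟩
      rw [h8] at ha
      rw [← h6 ha]
      rfl
    · intro hv
      refine ⟨_, ⟨(mder (cI n) 𝓘(ℂ, Cn k × Cn q) e.symm y v).1, rfl⟩, ?_⟩
      refine Eq.trans ?_ h8.symm
      exact congrArg _ (Prod.ext rfl hv.symm)

theorem exists_foliatedAtlas {D : X → Submodule ℂ (Cn n)} (hD : ∀ x, Module.finrank ℂ (D x) = k)
    (hkq : k + q = n)
    (h : ∀ x, ∃ Θ : Cn k × Cn q → X, ContMDiffAt 𝓘(ℂ, Cn k × Cn q) (cI n) ω Θ 0 ∧ Θ 0 = x ∧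
      Function.Injective (mder 𝓘(ℂ, Cn k × Cn q) (cI n) Θ 0) ∧
      ∀ᶠ p in 𝓝 0, ∀ a, mder 𝓘(ℂ, Cn k × Cn q) (cI n) Θ p (a, 0) ∈ D (Θ p)) :
    ∃ F : FoliatedAtlas n k q X, F.dir = fun x v => v ∈ D x := by
  choose Θ h1 h2 h3 h4 using h
  choose c r h5 h6 h7 h8 h9 using fun x => exists_foliated_chart hD (h1 x) (h2 x) (h3 x) hkq (h4 x)
  exact ⟨⟨fun x v => v ∈ D x, c, r, h5, h6, h7, h8, h9⟩, rfl⟩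

end FlatCharts

/-- For A = 0 the equation is y' = x, solved by y + t x. It computes the derivative of exponential
coordinates at the origin. -/
lemma exp_expGen_zero {V : Type*} [NormedAddCommGroup V] [NormedSpace ℂ V] [CompleteSpace V]
    (br : V →L[ℂ] V →L[ℂ] V) (x y : V) : (NormedSpace.exp (expGen br 0) (x, y)).2 = x + y := by
  have h := eq_exp_of_hasDerivAt (M := expGen br 0) (z := fun t : ℝ => (x, y + t • x)) fun t _ => by
    have h1 : HasDerivAt (fun t : ℝ => y + t • x) x t := by
      simpa using ((hasDerivAt_id t).smul_const x).const_add y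
    refine ((hasDerivAt_const t x).prodMk h1).congr_deriv ?_
    simp [expGen]
  simp only [zero_smul, add_zero, one_smul] at h
  rw [← h, add_comm]

lemma exists_equiv_extending {k d : ℕ} (l : Cn k →L[ℂ] Cn d) (hl : Function.Injective l) :
    ∃ (q : ℕ) (L : (Cn k × Cn q) ≃L[ℂ] Cn d), (∀ a, L (a, 0) = l a) ∧ k + q = d := by
  obtain ⟨S, hS⟩ := (LinearMap.range l.toLinearMap).exists_isCompl
  have h1 : Module.finrank ℂ (LinearMap.range l.toLinearMap) = k := by
    rw [LinearMap.finrank_range_of_inj hl]; simp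
  have h2 : k + Module.finrank ℂ S = d := by
    rw [← h1, Submodule.finrank_add_eq_of_isCompl hS]; simp
  let eS : Cn (Module.finrank ℂ S) ≃ₗ[ℂ] S := LinearEquiv.ofFinrankEq _ _ (by simp)
  refine ⟨_, ((LinearEquiv.prodCongr (LinearEquiv.ofInjective l.toLinearMap hl) eS).trans
    (Submodule.prodEquivOfIsCompl _ _ hS)).toContinuousLinearEquiv, fun a => ?_, h2⟩
  change ((LinearEquiv.ofInjective l.toLinearMap hl a : LinearMap.range l.toLinearMap) : Cn d)
    + ((eS 0 : S) : Cn d) = l a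
  rw [map_zero]
  simp

namespace Coframe

variable {d k q : ℕ} {E : Type u} [TopologicalSpace E] [ChartedSpace (Cn d) E] [IsManifold (cI d) ω E]
  (C : Coframe d E)

/-- Coordinates on a manifold with a coframe, exponential in the first variables. -/
theorem exists_exp_param (L : (Cn k × Cn q) ≃L[ℂ] Cn d) (br : Cn d →L[ℂ] Cn d →L[ℂ] Cn d)
    (hbr : ∀ y a B, C.tors y (L (a, 0)) B = br (L (a, 0)) B) (x₀ : E) :
    ∃ Θ : Cn k × Cn q → E, ContMDiffAt 𝓘(ℂ, Cn k × Cn q) (cI d) ω Θ 0 ∧ Θ 0 = x₀ ∧ C.pull Θ 0 = L ∧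
      ∀ᶠ p in 𝓝 (0 : Cn k × Cn q), ∀ b v, C.pull Θ p (b, v) =
        (NormedSpace.exp (expGen br (L (p.1, 0))) (L (b, 0), C.pull Θ (0, p.2) (0, v))).2 := by
  obtain ⟨Φ, hΦ, hΦ0, hΦ1⟩ := C.exists_exp x₀
  let c := chartAt (Cn d) x₀
  let l : Cn k →L[ℂ] Cn d := (L : Cn k × Cn q →L[ℂ] Cn d).comp (ContinuousLinearMap.inl ℂ _ _)
  -- The slice is affine in the chart, with velocity chosen so that the coframe at x₀ gives it the
  -- value L(0, v); then the whole derivative of Θ at 0 is L.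
  let m : Cn q →L[ℂ] Cn d := ((C.form x₀).symm : Cn d →L[ℂ] Cn d).comp
    ((L : Cn k × Cn q →L[ℂ] Cn d).comp (ContinuousLinearMap.inr ℂ _ _))
  let g : Cn k × Cn q → Cn d × Cn d := fun p => (l p.1, c x₀ + m p.2)
  have hg' : ∀ p, HasFDerivAt g ((l.comp (ContinuousLinearMap.fst ℂ _ _)).prod
      (m.comp (ContinuousLinearMap.snd ℂ _ _))) p := fun p =>
    (l.hasFDerivAt.comp p hasFDerivAt_fst).prodMk ((m.hasFDerivAt.comp p hasFDerivAt_snd).const_add _)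
  have hg : ∀ p, ContDiffAt ℂ ω g p := fun p =>
    (l.contDiff.contDiffAt.comp p contDiffAt_fst).prodMk
      (contDiffAt_const.add (m.contDiff.contDiffAt.comp p contDiffAt_snd))
  have hg0 : g 0 = (0, c x₀) := by simp [g]
  let Θ : Cn k × Cn q → E := fun p => Φ (g p)
  have hΘ : ContMDiffAt 𝓘(ℂ, Cn k × Cn q) (cI d) ω Θ 0 :=
    ContMDiffAt.comp (g := Φ) (f := g) 0 (by rwa [hg0]) (hg 0).contMDiffAt
  have ht : Tendsto g (𝓝 0) (𝓝 (0, c x₀)) := hg0 ▸ (hg 0).continuousAt.tendsto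
  have h1 : ∀ᶠ p in 𝓝 (0 : Cn k × Cn q), C.pull Θ p (p.1, 0) = l p.1 := by
    filter_upwards [ht.eventually hΦ1, ht.eventually hΦ.eventually_nhds] with p h1 h2
    rw [C.pull_comp h2 (hg p), (hg' p).fderiv]
    change C.pull Φ (g p) (l p.1, m 0) = l p.1
    rw [map_zero]
    exact h1
  have h2 := C.pull_eq_exp (Θ := Θ) (z₀ := 0) hΘ l h1 br fun y a B => hbr y a B
  have hΘ0 : Θ 0 = x₀ := by
    change Φ (g 0) = x₀
    rw [hg0, hΦ0.self_of_nhds, c.left_inv (mem_chart_source _ _)]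
  have h3 : ∀ v, C.pull Θ 0 (0, v) = L (0, v) := fun v => by
    have h4 : (fun t : Cn q => Θ (0, t)) =ᶠ[𝓝 0] fun t => c.symm (c x₀ + m t) := by
      have h5 : Tendsto (fun t : Cn q => c x₀ + m t) (𝓝 0) (𝓝 (c x₀)) := by
        have : ContinuousAt (fun t : Cn q => c x₀ + m t) 0 := by fun_prop
        simpa [ContinuousAt] using this
      filter_upwards [h5.eventually hΦ0] with t h6
      rw [← h6]
      change Φ (l 0, _) = _
      rw [map_zero]
    have h5 := C.pull_comp (f := Θ) (g := fun t : Cn q => ((0 : Cn k), t)) (y := 0) hΘ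
      (contDiffAt_const.prodMk contDiffAt_id)
    rw [(hasFDerivAt_prodMk_right (0 : Cn k) (0 : Cn q)).fderiv] at h5
    have h6 : C.pull Θ 0 (0, v) = C.pull (fun t : Cn q => Θ (0, t)) 0 v := (DFunLike.congr_fun h5 v).symm
    have hm : HasFDerivAt (fun t : Cn q => c x₀ + m t) m 0 := m.hasFDerivAt.const_add _
    have hm0 : c x₀ + m 0 = c x₀ := by simp
    rw [h6, C.pull_congr h4, C.pull_comp (f := c.symm) (g := fun t : Cn q => c x₀ + m t)
      (by rw [hm0]; exact contMDiffAt_chartAt_symm (mem_chart_target _ _))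
      (contDiffAt_const.add m.contDiff.contDiffAt), hm.fderiv, hm0]
    change C.form (c.symm (c x₀)) (mder (cI d) (cI d) c.symm (c x₀) (m v)) = _
    rw [mder_chartAt_symm_self, c.left_inv (mem_chart_source _ _)]
    exact (C.form x₀).apply_symm_apply _
  refine ⟨Θ, hΘ, hΘ0, ?_, h2⟩
  refine ContinuousLinearMap.ext fun ⟨b, v⟩ => ?_
  have h4 := h2.self_of_nhds b v
  simp only [map_zero, exp_expGen_zero] at h4
  rw [show (((0 : Cn k), (0 : Cn q)) : Cn k × Cn q) = 0 from rfl, h3 v] at h4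
  rw [h4]
  change L (b, 0) + L (0, v) = L (b, v)
  rw [← map_add]
  simp

/-- The distribution on which a coframe has values in a given subspace. -/
def distribution (S : Submodule ℂ (Cn d)) (x : E) : Submodule ℂ (Cn d) :=
  S.comap (C.form x).toLinearEquiv.toLinearMap

lemma finrank_distribution (S : Submodule ℂ (Cn d)) (x : E) :
    Module.finrank ℂ (C.distribution S x) = Module.finrank ℂ S := by
  have h := LinearEquiv.finrank_map_eq (C.form x).toLinearEquiv (C.distribution S x)
  rw [← h]
  exact congrArg (fun T : Submodule ℂ (Cn d) => Module.finrank ℂ T)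
    (Submodule.map_comap_eq_of_surjective (C.form x).surjective S)

/-- As S is closed under the bracket, the generator of the linear equation preserves S × S. The
initial value (L(a, 0), 0) lies in it, so the solution stays in it and the slices are tangent to the
distribution. -/
lemma eventually_mder_mem_distribution {L : (Cn k × Cn q) ≃L[ℂ] Cn d} {br : Cn d →L[ℂ] Cn d →L[ℂ] Cn d}
    {S : Submodule ℂ (Cn d)} (hS : ∀ B, B ∈ S ↔ ∃ a, L (a, 0) = B)
    (hSbr : ∀ A ∈ S, ∀ B ∈ S, br A B ∈ S) {Θ : Cn k × Cn q → E}
    (h : ∀ᶠ p in 𝓝 (0 : Cn k × Cn q), ∀ b v, C.pull Θ p (b, v) =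
        (NormedSpace.exp (expGen br (L (p.1, 0))) (L (b, 0), C.pull Θ (0, p.2) (0, v))).2) :
    ∀ᶠ p in 𝓝 0, ∀ a, mder 𝓘(ℂ, Cn k × Cn q) (cI d) Θ p (a, 0) ∈ C.distribution S (Θ p) := by
  filter_upwards [h] with p hp a
  change C.pull Θ p (a, 0) ∈ S
  rw [hp a 0]
  have h1 : NormedSpace.exp (expGen br (L (p.1, 0))) (L (a, 0), C.pull Θ (0, p.2) (0, 0)) ∈ S.prod S := by
    refine exp_mem_of_invariant ?_ ⟨(hS _).2 ⟨a, rfl⟩, ?_⟩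
    · rintro ⟨x, y⟩ ⟨hx, hy⟩
      exact ⟨S.zero_mem, S.sub_mem hx (hSbr _ ((hS _).2 ⟨_, rfl⟩) _ hy)⟩
    · rw [show (((0 : Cn k), (0 : Cn q)) : Cn k × Cn q) = 0 from rfl, map_zero]
      exact S.zero_mem
  exact h1.2

lemma mder_injective_of_pull_eq {Θ : Cn k × Cn q → E} {L : (Cn k × Cn q) ≃L[ℂ] Cn d} {p : Cn k × Cn q}
    (h : C.pull Θ p = L) : Function.Injective (mder 𝓘(ℂ, Cn k × Cn q) (cI d) Θ p) := fun v w hvw => by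
  have h1 : ∀ v, L v = C.form (Θ p) (mder 𝓘(ℂ, Cn k × Cn q) (cI d) Θ p v) := fun v =>
    (DFunLike.congr_fun h v).symm
  exact L.injective (by rw [h1, h1, hvw])

/-- Frobenius for the distribution on which the coframe is S-valued. Brackets are prescribed on S
against all directions, not only within S, so exponential coordinates along S are themselves
foliated charts. -/
theorem exists_foliatedAtlas (L : (Cn k × Cn q) ≃L[ℂ] Cn d) (hkq : k + q = d)
    (br : Cn d →L[ℂ] Cn d →L[ℂ] Cn d) {S : Submodule ℂ (Cn d)} (hS : ∀ B, B ∈ S ↔ ∃ a, L (a, 0) = B)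
    (hSbr : ∀ A ∈ S, ∀ B ∈ S, br A B ∈ S) (hbr : ∀ y, ∀ A ∈ S, ∀ B, C.tors y A B = br A B) :
    ∃ F : FoliatedAtlas d k q E, F.dir = fun x v => C.form x v ∈ S := by
  have hfr : Module.finrank ℂ S = k := by
    have h1 : S = LinearMap.range ((L.toLinearEquiv.toLinearMap).comp (LinearMap.inl ℂ (Cn k) (Cn q))) := by
      ext B
      exact hS B
    have h2 : Function.Injective ((L.toLinearEquiv.toLinearMap).comp (LinearMap.inl ℂ (Cn k) (Cn q))) :=
      L.injective.comp (g := L) (LinearMap.inl_injective (R := ℂ) (M := Cn k) (M₂ := Cn q))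
    rw [h1, LinearMap.finrank_range_of_inj h2]
    simp
  refine _root_.exists_foliatedAtlas (D := C.distribution S)
    (fun x => (C.finrank_distribution S x).trans hfr) hkq fun x => ?_
  obtain ⟨Θ, h1, h2, h3, h4⟩ := C.exists_exp_param L br (fun y a B => hbr y _ ((hS _).2 ⟨a, rfl⟩) B) x
  exact ⟨Θ, h1, h2, C.mder_injective_of_pull_eq h3, C.eventually_mder_mem_distribution hS hSbr h4⟩

end Coframe

lemma exists_equiv_of_submodule {d k : ℕ} {S : Submodule ℂ (Cn d)} (hk : Module.finrank ℂ S = k) :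
    ∃ (q : ℕ) (L : (Cn k × Cn q) ≃L[ℂ] Cn d), (∀ B, B ∈ S ↔ ∃ a, L (a, 0) = B) ∧ k + q = d := by
  let e : Cn k ≃ₗ[ℂ] S := LinearEquiv.ofFinrankEq _ _ (by simp [hk])
  obtain ⟨q, L, hL, hkq⟩ := exists_equiv_extending (LinearMap.toContinuousLinearMap (S.subtype.comp e.toLinearMap))
    (S.injective_subtype.comp e.injective)
  refine ⟨q, L, fun B => ⟨fun hB => ⟨e.symm ⟨B, hB⟩, ?_⟩, ?_⟩, hkq⟩
  · rw [hL]
    change ((e (e.symm ⟨B, hB⟩) : S) : Cn d) = B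
    rw [e.apply_symm_apply]
  · rintro ⟨a, rfl⟩
    rw [hL]
    exact (e a).2

/-! ### Integral subgroups and the construction of the overgroup -/

section IntegralSubgroup

variable {d : ℕ} {G : Type u} [Group G] [TopologicalSpace G] [ChartedSpace (Cn d) G] [ComplexLieGroup d G]

lemma mcForm_one : mcForm d (1 : G) = ContinuousLinearEquiv.refl ℂ (Cn d) := by
  ext1
  funext v
  rw [mcForm_apply, inv_one, mder_one_mul]
  rfl

lemma exists_foliatedAtlas_group {S : Submodule ℂ (Cn d)} {k : ℕ} (hk : Module.finrank ℂ S = k)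
    (hS : ∀ A ∈ S, ∀ B ∈ S, lieBr d G A B ∈ S) :
    ∃ (q : ℕ) (F : FoliatedAtlas d k q G), F.dir = fun g v => mcForm d g v ∈ S := by
  obtain ⟨q, L, hL, hkq⟩ := exists_equiv_of_submodule hk
  exact ⟨q, (mc d G).exists_foliatedAtlas L hkq (lieBr d G) hL hS fun y A _ B => tors_mc y A B⟩

variable {S : Submodule ℂ (Cn d)} {k q : ℕ} {F : FoliatedAtlas d k q G}

lemma FoliatedAtlas.mcForm_val_mem (hF : F.dir = fun g v => mcForm d g v ∈ S) (x : F.Fine) (v : Cn k) :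
    mcForm d (F.val x) (mder (cI k) (cI d) F.val x v) ∈ S := by
  have h := (F.dir_val_iff x (mder (cI k) (cI d) F.val x v)).2 ⟨v, rfl⟩
  rwa [hF] at h

/-- The Maurer-Cartan form is left invariant, so left translations preserve the distribution. -/
lemma FoliatedAtlas.contMDiff_mul_left (hF : F.dir = fun g v => mcForm d g v ∈ S) (g : G) :
    ContMDiff (cI k) (cI k) ω (fun x : F.Fine => F.toFine (g * F.val x)) := fun x => by
  have h1 : ∀ y, ContMDiffAt (cI k) (cI d) ω (fun _ : F.Fine => g) y := fun y => contMDiffAt_const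
  refine F.contMDiffAt_toFine ((contMDiffAt_mul_left' g _).comp x (F.contMDiff_val x))
    (Eventually.of_forall fun y v => ?_)
  rw [hF]
  change mcForm d (g * F.val y) (mder (cI k) (cI d) (fun x : F.Fine => g * F.val x) y v) ∈ S
  rw [mc_mul (h1 y) (F.contMDiff_val y), mder_const]
  simpa using F.mcForm_val_mem hF y v

/-- Right translation by g composes the Maurer-Cartan form with Ad(g)⁻¹, so it preserves the
distribution once S is stable under this operator. -/
lemma FoliatedAtlas.contMDiff_mul_right (hF : F.dir = fun g v => mcForm d g v ∈ S) {g : G}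
    (hg : ∀ A ∈ S, adm d g⁻¹ A ∈ S) :
    ContMDiff (cI k) (cI k) ω (fun x : F.Fine => F.toFine (F.val x * g)) := fun x => by
  have h1 : ∀ y, ContMDiffAt (cI k) (cI d) ω (fun _ : F.Fine => g) y := fun y => contMDiffAt_const
  refine F.contMDiffAt_toFine ((contMDiffAt_mul_right' g _).comp x (F.contMDiff_val x))
    (Eventually.of_forall fun y v => ?_)
  rw [hF]
  change mcForm d (F.val y * g) (mder (cI k) (cI d) (fun x : F.Fine => F.val x * g) y v) ∈ S
  rw [mc_mul (F.contMDiff_val y) (h1 y), mder_const]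
  simpa using hg _ (F.mcForm_val_mem hF y v)

lemma FoliatedAtlas.contMDiff_hom (hF : F.dir = fun g v => mcForm d g v ∈ S) {e : ℕ} {H : Type u} [Group H]
    [TopologicalSpace H] [ChartedSpace (Cn e) H] [ComplexLieGroup e H] {ι : H →* G}
    (hι : ContMDiff (cI e) (cI d) ω ι) (h : ∀ X, lmap d e ι X ∈ S) :
    ContMDiff (cI e) (cI k) ω (fun h => F.toFine (ι h)) := fun x => by
  refine F.contMDiffAt_toFine (hι x) (Eventually.of_forall fun y v => ?_)
  rw [hF]
  change mcForm d (ι y) (mder (cI e) (cI d) ι y v) ∈ S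
  rw [mc_hom hι]
  exact h _

/-- The integral subgroup of a left invariant distribution. -/
def FoliatedAtlas.identityLeaf (hF : F.dir = fun g v => mcForm d g v ∈ S) : Subgroup G where
  carrier := {g | F.toFine g ∈ connectedComponent (F.toFine 1)}
  one_mem' := mem_connectedComponent (x := F.toFine (1 : G))
  mul_mem' {a b} ha hb := by
    have h1 := (isPreconnected_connectedComponent (x := F.toFine (1 : G))).image
      (fun x => F.toFine (a * F.val x)) (F.contMDiff_mul_left hF a).continuous.continuousOn
    have h2 : F.toFine a ∈ (fun x => F.toFine (a * F.val x)) '' connectedComponent (F.toFine (1 : G)) :=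
      ⟨F.toFine 1, mem_connectedComponent, mul_one a⟩
    have h3 := h1.subset_connectedComponent h2
    have h4 : connectedComponent (F.toFine (1 : G)) = connectedComponent (F.toFine a) :=
      connectedComponent_eq (x := F.toFine (1 : G)) ha
    rw [← h4] at h3
    exact h3 ⟨F.toFine b, hb, rfl⟩
  inv_mem' {a} ha := by
    have h1 := (isPreconnected_connectedComponent (x := F.toFine (1 : G))).image
      (fun x => F.toFine (a⁻¹ * F.val x)) (F.contMDiff_mul_left hF a⁻¹).continuous.continuousOn
    have h2 : F.toFine (1 : G) ∈ (fun x => F.toFine (a⁻¹ * F.val x)) '' connectedComponent (F.toFine (1 : G)) :=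
      ⟨F.toFine a, ha, inv_mul_cancel a⟩
    exact h1.subset_connectedComponent h2 ⟨F.toFine (1 : G), mem_connectedComponent, show F.toFine (a⁻¹ * 1) = F.toFine a⁻¹ by rw [mul_one]⟩

/-- The conjugation is a left translation followed by an admissible right translation; it is
continuous for the leaf topology and fixes 1, so it maps the leaf of 1 to itself. -/
lemma FoliatedAtlas.conj_mem_identityLeaf (hF : F.dir = fun g v => mcForm d g v ∈ S) {g : G}
    (hg : ∀ A ∈ S, adm d g⁻¹ A ∈ S) {a : G} (ha : a ∈ F.identityLeaf hF) :
    g⁻¹ * a * g ∈ F.identityLeaf hF := by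
  have h1 := (isPreconnected_connectedComponent (x := F.toFine (1 : G))).image _
    ((F.contMDiff_mul_right hF hg).comp (F.contMDiff_mul_left hF g⁻¹)).continuous.continuousOn
  have h2 : F.toFine (1 : G) ∈ ((fun x : F.Fine => F.toFine (F.val x * g)) ∘
      fun x => F.toFine (g⁻¹ * F.val x)) '' connectedComponent (F.toFine (1 : G)) :=
    ⟨F.toFine 1, mem_connectedComponent, (by simp : g⁻¹ * 1 * g = 1)⟩
  exact h1.subset_connectedComponent h2 ⟨F.toFine a, ha, rfl⟩

variable {e : ℕ} {H : Type u} [Group H] [TopologicalSpace H] [ChartedSpace (Cn e) H] [ComplexLieGroup e H]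
  {ι : H →* G}

/-- The subgroup generated by the integral subgroup of a left invariant distribution and a subgroup
which preserves the distribution. -/
def FoliatedAtlas.extendedLeaf (hF : F.dir = fun g v => mcForm d g v ∈ S)
    (hS : ∀ h : H, ∀ A ∈ S, adm d (ι h) A ∈ S) : Subgroup G where
  carrier := {g | ∃ h, (ι h)⁻¹ * g ∈ F.identityLeaf hF}
  one_mem' := ⟨1, by simp⟩
  mul_mem' {a b} := by
    rintro ⟨h, ha⟩ ⟨h', hb⟩
    refine ⟨h * h', ?_⟩
    have h1 := F.conj_mem_identityLeaf hF (g := ι h')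
      (fun A hA => by rw [← map_inv]; exact hS h'⁻¹ A hA) ha
    have h2 := mul_mem h1 hb
    rw [map_mul]
    convert h2 using 1
    group
  inv_mem' {a} := by
    rintro ⟨h, ha⟩
    refine ⟨h⁻¹, ?_⟩
    have h1 := F.conj_mem_identityLeaf hF (g := (ι h)⁻¹)
      (fun A hA => by rw [inv_inv]; exact hS h A hA) (inv_mem ha)
    rw [map_inv]
    convert h1 using 1
    group

lemma FoliatedAtlas.hom_mem_extendedLeaf (hF : F.dir = fun g v => mcForm d g v ∈ S)
    (hS : ∀ h : H, ∀ A ∈ S, adm d (ι h) A ∈ S) (h : H) : ι h ∈ F.extendedLeaf hF hS :=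
  ⟨h, by simp⟩

/-- The extended integral subgroup, as an open set for the leaf topology. -/
def FoliatedAtlas.extendedLeafOpens (hF : F.dir = fun g v => mcForm d g v ∈ S)
    (hS : ∀ h : H, ∀ A ∈ S, adm d (ι h) A ∈ S) : TopologicalSpace.Opens F.Fine where
  carrier := {x | F.val x ∈ F.extendedLeaf hF hS}
  is_open' := by
    have h1 : {x : F.Fine | F.val x ∈ F.extendedLeaf hF hS} =
        ⋃ h : H, (fun x => F.toFine ((ι h)⁻¹ * F.val x)) ⁻¹' connectedComponent (F.toFine (1 : G)) := by
      ext x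
      exact (mem_iUnion (s := fun h : H => (fun x => F.toFine ((ι h)⁻¹ * F.val x)) ⁻¹'
        connectedComponent (F.toFine (1 : G)))).symm
    rw [h1]
    exact isOpen_iUnion fun h => isOpen_connectedComponent.preimage (F.contMDiff_mul_left hF _).continuous

instance (hF : F.dir = fun g v => mcForm d g v ∈ S) (hS : ∀ h : H, ∀ A ∈ S, adm d (ι h) A ∈ S) :
    Group (F.extendedLeafOpens hF hS) := inferInstanceAs (Group (F.extendedLeaf hF hS))

/-- The inclusion of the extended integral subgroup. -/
def FoliatedAtlas.extendedLeafIncl (hF : F.dir = fun g v => mcForm d g v ∈ S)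
    (hS : ∀ h : H, ∀ A ∈ S, adm d (ι h) A ∈ S) : F.extendedLeafOpens hF hS →* G :=
  (F.extendedLeaf hF hS).subtype

lemma FoliatedAtlas.secondCountableTopology_extendedLeaf (hF : F.dir = fun g v => mcForm d g v ∈ S)
    (hS : ∀ h : H, ∀ A ∈ S, adm d (ι h) A ∈ S) (hι : ContMDiff (cI e) (cI d) ω ι) (h : ∀ X, lmap d e ι X ∈ S) :
    SecondCountableTopology (F.extendedLeafOpens hF hS) := by
  let U : H → Set (F.extendedLeafOpens hF hS) := fun h =>
    {x | F.toFine ((ι h)⁻¹ * F.val x.1) ∈ connectedComponent (F.toFine (1 : G))}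
  have hU : ∀ h, IsOpen (U h) := fun h => isOpen_connectedComponent.preimage
    ((F.contMDiff_mul_left hF (ι h)⁻¹).continuous.comp continuous_subtype_val)
  have hUs : ∀ h, SecondCountableTopology (U h) := fun h => by
    have h0 := F.secondCountableTopology_component (F.toFine (1 : G))
    let f : U h → connectedComponent (F.toFine (1 : G)) := fun x => ⟨_, x.2⟩
    have hf : Continuous f := ((F.contMDiff_mul_left hF (ι h)⁻¹).continuous.comp
      (continuous_subtype_val.comp continuous_subtype_val)).subtype_mk _
    have h1 : (fun x : F.Fine => F.toFine (ι h * F.val x)) ∘ Subtype.val ∘ f = Subtype.val ∘ Subtype.val := by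
      funext x
      exact mul_inv_cancel_left (ι h) _
    have h2 : Topology.IsInducing ((fun x : F.Fine => F.toFine (ι h * F.val x)) ∘ Subtype.val ∘ f) := by
      rw [h1]
      exact Topology.IsInducing.subtypeVal.comp Topology.IsInducing.subtypeVal
    exact (Topology.IsInducing.of_comp (f := f)
      (g := (fun x : F.Fine => F.toFine (ι h * F.val x)) ∘ Subtype.val) hf
      ((F.contMDiff_mul_left hF (ι h)).continuous.comp continuous_subtype_val) h2).secondCountableTopology
  -- The open sets U h are cosets of the identity leaf. The morphism ι is continuous into the leaf
  -- topology, so nearby h give the same coset, and a dense sequence in H meets every one.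
  let s := TopologicalSpace.denseSeq H
  refine TopologicalSpace.secondCountableTopology_of_countable_cover (U := fun m => U (s m)) (fun m => hU _)
    (eq_univ_of_forall fun x => ?_)
  obtain ⟨h₀, hx⟩ := x.2
  have h1 : IsOpen {h' : H | (ι h₀)⁻¹ * ι h' ∈ F.identityLeaf hF} := isOpen_connectedComponent.preimage
    ((F.contMDiff_mul_left hF (ι h₀)⁻¹).continuous.comp (F.contMDiff_hom hF hι h).continuous)
  obtain ⟨m, hm⟩ := (TopologicalSpace.denseRange_denseSeq H).exists_mem_open h1
    ⟨h₀, show (ι h₀)⁻¹ * ι h₀ ∈ F.identityLeaf hF by rw [inv_mul_cancel]; exact one_mem _⟩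
  refine mem_iUnion.2 ⟨m, ?_⟩
  have h2 := mul_mem (inv_mem hm) hx
  change (ι (s m))⁻¹ * F.val x.1 ∈ F.identityLeaf hF
  convert h2 using 1
  group
  rfl

/-- Multiplication and inversion are holomorphic into G, with values in a set which is second
countable for the leaf topology; such maps are holomorphic for the leaf topology. -/
lemma FoliatedAtlas.complexLieGroup_extendedLeaf (hF : F.dir = fun g v => mcForm d g v ∈ S)
    (hS : ∀ h : H, ∀ A ∈ S, adm d (ι h) A ∈ S) (hι : ContMDiff (cI e) (cI d) ω ι) (h : ∀ X, lmap d e ι X ∈ S) :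
    ComplexLieGroup k (F.extendedLeafOpens hF hS) := by
  have hsc := F.secondCountableTopology_extendedLeaf hF hS hι h
  have hv : ContMDiff (cI k) (cI d) ω (fun x : F.extendedLeafOpens hF hS => F.val x.1) :=
    F.contMDiff_val.comp contMDiff_subtype_val
  have hsc' : SecondCountableTopology (F.extendedLeafOpens hF hS : Set F.Fine) := hsc
  exact
    { contMDiff_mul := fun p => by
        refine contMDiffAt_codRestrict (F.contMDiffAt_toFine_of_mem
          (S := (F.extendedLeafOpens hF hS : Set F.Fine))
          (f := fun p : F.extendedLeafOpens hF hS × F.extendedLeafOpens hF hS =>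
            F.val p.1.1 * F.val p.2.1) ?_ (Eventually.of_forall fun p => (p.1 * p.2).2))
        exact (hv.comp contMDiff_fst).contMDiffAt.mul (hv.comp contMDiff_snd).contMDiffAt
      contMDiff_inv := fun x => by
        refine contMDiffAt_codRestrict (F.contMDiffAt_toFine_of_mem
          (S := (F.extendedLeafOpens hF hS : Set F.Fine))
          (f := fun x : F.extendedLeafOpens hF hS => (F.val x.1)⁻¹) ?_ (Eventually.of_forall fun x => (x⁻¹).2))
        exact hv.contMDiffAt.inv
      toT2Space := inferInstance
      toSecondCountableTopology := hsc }

end IntegralSubgroup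

/-- The overgroup is the product of H with the integral subgroup N of 𝔥'. Stability of 𝔥' under
Ad(H) makes H normalize N, so the product is a group; containing 𝔥 makes H → HN holomorphic for the
leaf topology. The Lie algebra is the tangent space at 1 of the leaf. -/
theorem exists_lieOvergroup {d : ℕ} {G : Type u} [Group G] [TopologicalSpace G] [ChartedSpace (Cn d) G]
    [ComplexLieGroup d G] (H : ComplexLieSubgroup d G) (𝔥' : LieSubalgebra ℂ (LieAlg d G))
    (h1 : ∀ X, (lmap d H.dim H.incl X : Cn d) ∈ 𝔥'.toSubmodule)
    (h2 : ∀ h, ∀ A : Cn d, A ∈ 𝔥'.toSubmodule → (adm d (H.incl h) A : Cn d) ∈ 𝔥'.toSubmodule) :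
    Nonempty (LieOvergroup H 𝔥') := by
  let S : Submodule ℂ (Cn d) := 𝔥'.toSubmodule
  obtain ⟨q, F, hF⟩ := exists_foliatedAtlas_group (G := G) (S := S) rfl
    fun A hA B hB => 𝔥'.lie_mem (x := (A : LieAlg d G)) (y := (B : LieAlg d G)) hA hB
  have h2' : ∀ h, ∀ A ∈ S, adm d (H.incl h) A ∈ S := h2
  have hG := F.complexLieGroup_extendedLeaf hF h2' H.holomorphic h1
  let κ := F.extendedLeafIncl hF h2'
  have hκ : ContMDiff (cI (Module.finrank ℂ S)) (cI d) ω κ := F.contMDiff_val.comp contMDiff_subtype_val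
  have hder : mder (cI (Module.finrank ℂ S)) (cI d) κ 1 = (mder (cI (Module.finrank ℂ S)) (cI d) F.val
      (1 : F.extendedLeafOpens hF h2').1).comp (mder (cI _) (cI _) Subtype.val 1) :=
    mder_comp (g := F.val) (F.contMDiff_val _) contMDiff_subtype_val.contMDiffAt
  refine ⟨{
    dim := Module.finrank ℂ S
    carrier := F.extendedLeafOpens hF h2'
    complexLieGroup := hG
    incl := κ
    injective := (F.extendedLeaf hF h2').subtype_injective
    holomorphic := hκ
    immersion := ?_
    sub := H.incl.codRestrict (F.extendedLeaf hF h2') (F.hom_mem_extendedLeaf hF h2')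
    sub_holomorphic := fun x => contMDiffAt_codRestrict (F.contMDiff_hom hF H.holomorphic h1 x)
    incl_comp_sub := rfl
    lieAlgebra_eq := ?_ }⟩
  · change Function.Injective (mder (cI _) (cI d) κ 1)
    rw [hder]
    exact (F.mder_val_injective _).comp (mder_subtype_val_bijective _).1
  · have h3 : ∀ v : Cn d, (∃ w, mder (cI (Module.finrank ℂ S)) (cI d) κ 1 w = v) ↔ v ∈ S := fun v => by
      have h4 := F.dir_val_iff (1 : F.extendedLeafOpens hF h2').1 v
      rw [hF] at h4
      change mcForm d (1 : G) v ∈ S ↔ _ at h4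
      rw [mcForm_one] at h4
      refine Iff.trans ?_ h4.symm
      rw [hder]
      constructor
      · rintro ⟨w, rfl⟩
        exact ⟨_, rfl⟩
      · rintro ⟨w, rfl⟩
        obtain ⟨w', rfl⟩ := (mder_subtype_val_bijective (I₁ := cI (Module.finrank ℂ S))
          (1 : F.extendedLeafOpens hF h2')).2 w
        exact ⟨w', rfl⟩
    ext v
    exact h3 v

/-! ### Geometries flat along an overgroup; the foliation of the base -/

section LieAlgebraImage

variable {d e e' : ℕ} {G H H' : Type u} [Group G] [TopologicalSpace G] [ChartedSpace (Cn d) G]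
  [ComplexLieGroup d G]
  [Group H] [TopologicalSpace H] [ChartedSpace (Cn e) H] [ComplexLieGroup e H]
  [Group H'] [TopologicalSpace H'] [ChartedSpace (Cn e') H'] [ComplexLieGroup e' H']

/-- The image of the Lie algebra under a morphism of Lie groups. -/
def lieImage (d e : ℕ) {G H : Type u} [Group G] [TopologicalSpace G] [ChartedSpace (Cn d) G]
    [Group H] [TopologicalSpace H] [ChartedSpace (Cn e) H] (ι : H →* G) : Submodule ℂ (Cn d) :=
  LinearMap.range (lmap d e ι).toLinearMap

lemma lmap_mem_lieImage (ι : H →* G) (X : Cn e) : lmap d e ι X ∈ lieImage d e ι := ⟨X, rfl⟩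

lemma lmap_comp_apply {ι : H →* G} {ι' : H' →* G} {j : H →* H'} (hι' : ContMDiff (cI e') (cI d) ω ι')
    (hj : ContMDiff (cI e) (cI e') ω j) (h : ∀ x, ι' (j x) = ι x) (X : Cn e) :
    lmap d e' ι' (lmap e' e j X) = lmap d e ι X := by
  have h1 := mder_comp_apply (g := ι') (hι' (j 1)) (hj 1) X
  rw [mder_congr (g := ι) (Eventually.of_forall h), map_one] at h1
  exact h1.symm

lemma lieBr_mem_lieImage {ι : H →* G} (hι : ContMDiff (cI e) (cI d) ω ι) {A B : Cn d}
    (hA : A ∈ lieImage d e ι) (hB : B ∈ lieImage d e ι) : lieBr d G A B ∈ lieImage d e ι := by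
  obtain ⟨X, rfl⟩ := hA
  obtain ⟨Y, rfl⟩ := hB
  exact ⟨lieBr e H X Y, lmap_lieBr hι X Y⟩

end LieAlgebraImage

namespace CartanGeometry

variable {d e : ℕ} {G H : Type u} [Group G] [TopologicalSpace G] [ChartedSpace (Cn d) G]
  [ComplexLieGroup d G]
  [Group H] [TopologicalSpace H] [ChartedSpace (Cn e) H] [ComplexLieGroup e H]
  {ι : H →* G} {n : ℕ} {M : Type u} [TopologicalSpace M] [ChartedSpace (Cn n) M]
  (C : CartanGeometry d e ι n M)
  (e' : ℕ) {H' : Type u} [Group H'] [TopologicalSpace H'] [ChartedSpace (Cn e') H'] [ComplexLieGroup e' H']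
  (ι' : H' →* G) (j : H →* H')

/-- The curvature of a geometry vanishes along the Lie algebra of an immersed subgroup, which contains
the structure group. -/
structure FlatAlong : Prop where
  hol : ContMDiff (cI e') (cI d) ω ι'
  inj : Function.Injective (lmap d e' ι')
  hol_sub : ContMDiff (cI e) (cI e') ω j
  comp : ∀ h, ι' (j h) = ι h
  inj_sub : Function.Injective (lmap d e ι)
  tors_eq : ∀ a y B, C.coframe.tors y (lmap d e' ι' a) B = lieBr d G (lmap d e' ι' a) B

variable {C e' ι' j}

namespace FlatAlong

lemma lmap_sub (hC : C.FlatAlong e' ι' j) (X : Cn e) : lmap d e' ι' (lmap e' e j X) = lmap d e ι X :=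
  lmap_comp_apply hC.hol hC.hol_sub hC.comp X

lemma lmap_mem (hC : C.FlatAlong e' ι' j) (X : Cn e) : lmap d e ι X ∈ lieImage d e' ι' := ⟨_, hC.lmap_sub X⟩

lemma adm_inv_mem (hC : C.FlatAlong e' ι' j) (h : H) {A : Cn d} (hA : A ∈ lieImage d e' ι') : adm d (ι h)⁻¹ A ∈ lieImage d e' ι' := by
  obtain ⟨X, rfl⟩ := hA
  refine ⟨adm e' (j h)⁻¹ X, ?_⟩
  have := lmap_adm hC.hol (j h)⁻¹ X
  rw [map_inv, hC.comp] at this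
  exact this

lemma exists_foliatedAtlas (hC : C.FlatAlong e' ι' j) {q : ℕ} {L : (Cn e' × Cn q) ≃L[ℂ] Cn d}
    (hL : ∀ a, L (a, 0) = lmap d e' ι' a)
    (hq : e' + q = d) :
    ∃ F : FoliatedAtlas d e' q C.E, F.dir = fun x v => C.frm x v ∈ lieImage d e' ι' := by
  refine C.coframe.exists_foliatedAtlas L hq (lieBr d G) (S := lieImage d e' ι')
    (fun B => ⟨fun ⟨a, ha⟩ => ⟨a, (hL a).trans ha⟩, fun ⟨a, ha⟩ => ⟨a, (hL a).symm.trans ha⟩⟩)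
    (fun A hA B hB => lieBr_mem_lieImage hC.hol hA hB) ?_
  rintro y _ ⟨a, rfl⟩ B
  exact hC.tors_eq a y B

lemma mder_proj_surjective (x : C.E) : Function.Surjective (mder (cI d) (cI n) C.proj x) := fun v => by
  let σ := C.localSection x
  have hs : ContMDiffAt (cI n) (cI d) ω σ.s (C.proj x) :=
    σ.s_holomorphic.contMDiffAt (σ.isOpen.mem_nhds σ.mem)
  have h1 := mder_comp_apply (g := C.proj) (C.proj_holomorphic _) hs v
  have h2 : (fun y => C.proj (σ.s y)) =ᶠ[𝓝 (C.proj x)] fun y => y := by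
    filter_upwards [σ.isOpen.mem_nhds σ.mem] with y hy using σ.proj_s y hy
  rw [mder_congr h2, mder_id, σ.s_proj] at h1
  exact ⟨_, h1.symm⟩

/-- Rank and nullity of dπ at one point: dπ is surjective, and ω identifies its kernel with 𝔥. -/
lemma dim_add_eq [Nonempty C.E] (hC : C.FlatAlong e' ι' j) : n + e = d := by
  obtain ⟨x⟩ := ‹Nonempty C.E›
  have h1 := LinearMap.finrank_range_add_finrank_ker (mder (cI d) (cI n) C.proj x).toLinearMap
  rw [LinearMap.range_eq_top.2 (mder_proj_surjective x)] at h1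
  have h2 : LinearMap.ker (mder (cI d) (cI n) C.proj x).toLinearMap
      = C.coframe.distribution (lieImage d e ι) x := by
    ext v
    refine (C.mder_proj_eq_zero_iff x v).trans ?_
    exact ⟨fun ⟨X, hX⟩ => ⟨X, hX.symm⟩, fun ⟨X, hX⟩ => ⟨X, hX.symm⟩⟩
  rw [h2, C.coframe.finrank_distribution, lieImage, LinearMap.finrank_range_of_inj hC.inj_sub] at h1
  simpa using h1

/-- The distribution ω⁻¹(𝔥') on E is H-invariant and contains the vertical vectors, so it is the
preimage of a distribution on M. Foliated charts of M come from projecting exponential coordinates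
of E restricted to a complement of 𝔥. -/
theorem exists_foliatedAtlas_base [IsManifold (cI n) ω M] [Nonempty C.E] (hC : C.FlatAlong e' ι' j) {q k : ℕ}
    {L : (Cn e' × Cn q) ≃L[ℂ] Cn d}
    (hL : ∀ a, L (a, 0) = lmap d e' ι' a) (hq : e' + q = d) (hk : e + k = e') :
    ∃ F : FoliatedAtlas n k q M, ∀ (x : C.E) w,
      F.dir (C.proj x) (mder (cI d) (cI n) C.proj x w) ↔ C.frm x w ∈ lieImage d e' ι' := by
  have hinj : Function.Injective (lmap e' e j) := fun X Y hXY => hC.inj_sub <| by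
    rw [← hC.lmap_sub, hXY, hC.lmap_sub]
  obtain ⟨k', N, hN, hk'⟩ := exists_equiv_extending (lmap e' e j) hinj
  obtain rfl : k' = k := by omega
  choose b hb using C.proj_surjective
  -- The distribution is defined at an arbitrarily chosen point of each fibre; `hD` shows that the
  -- choice does not matter.
  let D : M → Submodule ℂ (Cn n) := fun m =>
    (C.coframe.distribution (lieImage d e' ι') (b m)).map (mder (cI d) (cI n) C.proj (b m)).toLinearMap
  have hD : ∀ x w, mder (cI d) (cI n) C.proj x w ∈ D (C.proj x) ↔ C.frm x w ∈ lieImage d e' ι' := by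
    intro x w
    obtain ⟨h, hh⟩ := C.exists_act_eq (hb (C.proj x))
    obtain ⟨h', hh'⟩ := C.exists_act_eq (hb (C.proj x)).symm
    have key : ∀ (x y : C.E) (h : H), C.act x h = y → ∀ w, mder (cI d) (cI n) C.proj y
        (mder (cI d) (cI d) (fun z => C.act z h) x w) = mder (cI d) (cI n) C.proj x w := by
      rintro x _ h rfl w
      rw [← mder_comp_apply (g := C.proj) (C.proj_holomorphic _) (C.act_left_holomorphic h x)]
      simp only [C.proj_act]
    have key' : ∀ (x y : C.E) (h : H), C.act x h = y → ∀ w, C.frm x w ∈ lieImage d e' ι' →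
        C.frm y (mder (cI d) (cI d) (fun z => C.act z h) x w) ∈ lieImage d e' ι' := by
      rintro x _ h rfl w hw
      rw [C.frm_act]
      exact hC.adm_inv_mem h hw
    constructor
    · rintro ⟨w', hw', hw⟩
      change mder (cI d) (cI n) C.proj (b (C.proj x)) w' = mder (cI d) (cI n) C.proj x w at hw
      rw [← key _ _ h hh] at hw
      have h1 : mder (cI d) (cI n) C.proj x
          (w - mder (cI d) (cI d) (fun z => C.act z h) (b (C.proj x)) w') = 0 := by
        rw [map_sub, hw, sub_self]
      obtain ⟨X, hX⟩ := (C.mder_proj_eq_zero_iff x _).1 h1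
      rw [map_sub, sub_eq_iff_eq_add] at hX
      rw [hX]
      exact Submodule.add_mem _ (hC.lmap_mem X) (key' _ _ h hh w' hw')
    · intro hw
      exact ⟨_, key' _ _ h' hh' w hw, key _ _ h' hh' w⟩
  -- Under L and N the subspace 𝔥 is the first of three summands, and it is the kernel of dπ; so dπ
  -- is injective on the sum of the other two.
  have hproj0 : ∀ x a t, mder (cI d) (cI n) C.proj x ((C.frm x).symm (L (N (0, a), t))) = 0 → a = 0 ∧ t = 0 := by
    intro x a t h
    obtain ⟨X, hX⟩ := (C.mder_proj_eq_zero_iff x _).1 h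
    rw [ContinuousLinearEquiv.apply_symm_apply, ← hC.lmap_sub, ← hL, ← hN] at hX
    have h1 := L.injective hX
    have h2 := N.injective (Prod.ext_iff.1 h1).1
    exact ⟨(Prod.ext_iff.1 h2).2, (Prod.ext_iff.1 h1).2⟩
  have hfr : ∀ m, Module.finrank ℂ (D m) = k' := by
    intro m
    let f : Cn k' →ₗ[ℂ] Cn n := (mder (cI d) (cI n) C.proj (b m)).toLinearMap ∘ₗ
      (C.frm (b m)).symm.toLinearEquiv.toLinearMap ∘ₗ (lmap d e' ι').toLinearMap ∘ₗ
        N.toLinearEquiv.toLinearMap ∘ₗ LinearMap.inr ℂ (Cn e) (Cn k')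
    have hf : ∀ a, f a = mder (cI d) (cI n) C.proj (b m) ((C.frm (b m)).symm (L (N (0, a), 0))) := fun a => by
      rw [hL]; rfl
    have hfi : Function.Injective f := (injective_iff_map_eq_zero f).2 fun a ha => by
      rw [hf] at ha
      exact (hproj0 _ a 0 ha).1
    have hr : D m = LinearMap.range f := by
      ext v
      constructor
      · rintro ⟨w, ⟨A, hA⟩, rfl⟩
        refine ⟨(N.symm A).2, ?_⟩
        rw [hf]
        change _ = mder (cI d) (cI n) C.proj (b m) w
        rw [← sub_eq_zero, ← map_sub, C.mder_proj_eq_zero_iff]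
        refine ⟨-(N.symm A).1, ?_⟩
        rw [map_sub, ContinuousLinearEquiv.apply_symm_apply, ← hC.lmap_sub, ← hL, ← hN]
        have h1 : C.frm (b m) w = L (N (N.symm A), 0) := by
          rw [N.apply_symm_apply, hL]
          exact hA.symm
        rw [h1, ← map_sub]
        congr 1
        rw [Prod.mk_sub_mk, ← map_sub, sub_self]
        congr 2
        exact Prod.ext (by simp) (by simp)
      · rintro ⟨a, rfl⟩
        rw [hf]
        refine ⟨_, ?_, rfl⟩
        change C.frm (b m) ((C.frm (b m)).symm (L (N (0, a), 0))) ∈ lieImage d e' ι'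
        rw [ContinuousLinearEquiv.apply_symm_apply, hL]
        exact lmap_mem_lieImage ι' _
    rw [hr, LinearMap.finrank_range_of_inj hfi]
    simp
  obtain ⟨F, hF⟩ := _root_.exists_foliatedAtlas (X := M) hfr (by have := hC.dim_add_eq; omega) (q := q) fun m => by
    obtain ⟨Θ, h1, h2, h3, h4⟩ := C.coframe.exists_exp_param L (lieBr d G)
      (fun y a B => by rw [hL]; exact hC.tors_eq a y B) (b m)
    have h5 := C.coframe.eventually_mder_mem_distribution (S := lieImage d e' ι')
      (fun B => ⟨fun ⟨a, ha⟩ => ⟨a, (hL a).trans ha⟩, fun ⟨a, ha⟩ => ⟨a, (hL a).symm.trans ha⟩⟩)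
      (fun A hA B hB => lieBr_mem_lieImage hC.hol hA hB) h4
    -- Drops the coordinates along 𝔥, in whose directions π ∘ Θ is degenerate at the origin.
    let g : Cn k' × Cn q →L[ℂ] Cn e' × Cn q :=
      (((N : Cn e × Cn k' →L[ℂ] Cn e').comp (ContinuousLinearMap.inr ℂ _ _)).comp
        (ContinuousLinearMap.fst ℂ _ _)).prod (ContinuousLinearMap.snd ℂ _ _)
    have hg : ∀ p, ContMDiffAt 𝓘(ℂ, Cn k' × Cn q) 𝓘(ℂ, Cn e' × Cn q) ω g p := fun p =>
      g.contDiff.contDiffAt.contMDiffAt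
    have ht : Tendsto g (𝓝 0) (𝓝 0) := by simpa using g.continuous.tendsto 0
    have hder : ∀ p, ContMDiffAt 𝓘(ℂ, Cn e' × Cn q) (cI d) ω Θ (g p) → ∀ v,
        mder 𝓘(ℂ, Cn k' × Cn q) (cI n) (fun p => C.proj (Θ (g p))) p v =
          mder (cI d) (cI n) C.proj (Θ (g p)) (mder 𝓘(ℂ, Cn e' × Cn q) (cI d) Θ (g p) (g v)) := by
      intro p hp v
      rw [mder_comp_apply (g := C.proj) (f := fun p => Θ (g p)) (C.proj_holomorphic _) (hp.comp p (hg p)),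
        mder_comp_apply (g := Θ) hp (hg p), mder_eq_fderiv, g.fderiv]
    have h1' : ContMDiffAt 𝓘(ℂ, Cn e' × Cn q) (cI d) ω Θ (g 0) := by rwa [map_zero]
    refine ⟨fun p => C.proj (Θ (g p)), (C.proj_holomorphic _).comp 0 (h1'.comp (f := g) 0 (hg 0)), ?_, ?_, ?_⟩
    · simp only [map_zero, h2, hb]
    · refine (injective_iff_map_eq_zero _).2 fun v hv => ?_
      rw [hder 0 h1'] at hv
      have h6 : mder 𝓘(ℂ, Cn e' × Cn q) (cI d) Θ (g 0) (g v) = (C.frm (Θ (g 0))).symm (L (N (0, v.1), v.2)) := by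
        rw [ContinuousLinearEquiv.eq_symm_apply, map_zero]
        exact DFunLike.congr_fun h3 (g v)
      rw [h6] at hv
      exact Prod.ext (hproj0 _ _ _ hv).1 (hproj0 _ _ _ hv).2
    · filter_upwards [ht.eventually h5, ht.eventually h1.eventually_nhds] with p h7 h8 a
      rw [hder p h8, hD]
      exact h7 _
  exact ⟨F, fun x w => by rw [hF]; exact hD x w⟩

end FlatAlong

end CartanGeometry

/-! ### The flat geometry on each leaf -/

namespace CartanGeometry.FlatAlong

variable {d e : ℕ} {G H : Type u} [Group G] [TopologicalSpace G] [ChartedSpace (Cn d) G]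
  [ComplexLieGroup d G]
  [Group H] [TopologicalSpace H] [ChartedSpace (Cn e) H] [ComplexLieGroup e H]
  {ι : H →* G} {n : ℕ} {M : Type u} [TopologicalSpace M] [ChartedSpace (Cn n) M] [ComplexManifold n M]
  {C : CartanGeometry d e ι n M}
  {e' : ℕ} {H' : Type u} [Group H'] [TopologicalSpace H'] [ChartedSpace (Cn e') H'] [ComplexLieGroup e' H']
  {ι' : H' →* G} {j : H →* H'} (hC : C.FlatAlong e' ι' j)
  {k q : ℕ} {FE : FoliatedAtlas d e' q C.E} (hE : FE.dir = fun x v => C.frm x v ∈ lieImage d e' ι')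
  {FM : FoliatedAtlas n k q M}
  (hM : ∀ (x : C.E) w, FM.dir (C.proj x) (mder (cI d) (cI n) C.proj x w) ↔ C.frm x w ∈ lieImage d e' ι')

lemma frm_mder_val_mem (hE : FE.dir = fun x v => C.frm x v ∈ lieImage d e' ι') (y : FE.Fine) (v : Cn e') :
    C.frm (FE.val y) (mder (cI e') (cI d) FE.val y v) ∈ lieImage d e' ι' := by
  have h := (FE.dir_val_iff y (mder (cI e') (cI d) FE.val y v)).2 ⟨v, rfl⟩
  rwa [hE] at h

/-- The bundle projection, for the leaf topologies. -/
def fineProj (FE : FoliatedAtlas d e' q C.E) (FM : FoliatedAtlas n k q M) (y : FE.Fine) : FM.Fine :=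
  FM.toFine (C.proj (FE.val y))

lemma contMDiff_fineProj (hE : FE.dir = fun x v => C.frm x v ∈ lieImage d e' ι')
    (hM : ∀ (x : C.E) w, FM.dir (C.proj x) (mder (cI d) (cI n) C.proj x w) ↔ C.frm x w ∈ lieImage d e' ι') :
    ContMDiff (cI e') (cI k) ω (fineProj FE FM) := fun y => by
  refine FM.contMDiffAt_toFine ((C.proj_holomorphic _).comp y (FE.contMDiff_val y))
    (Eventually.of_forall fun y v => ?_)
  rw [mder_comp_apply (g := C.proj) (C.proj_holomorphic _) (FE.contMDiff_val y), hM]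
  exact frm_mder_val_mem hE y v

variable (a : ConnectedComponents FM.Fine)

/-- The total space above a leaf. -/
def total : TopologicalSpace.Opens FE.Fine :=
  ⟨fineProj FE FM ⁻¹' FM.leaf a, (FM.leaf a).isOpen.preimage (contMDiff_fineProj hE hM).continuous⟩

variable {a} {hE} {hM}

/-- The inclusion of the total space above a leaf. -/
def totalVal (y : total hE hM a) : C.E := FE.val y.1

/-- The inclusion of a leaf. -/
def leafVal (u : FM.leaf a) : M := FM.val u.1

/-- The bundle projection above a leaf. -/
def leafProj (y : total hE hM a) : FM.leaf a := ⟨fineProj FE FM y.1, y.2⟩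

/-- The action on the total space above a leaf. -/
def leafAct (y : total hE hM a) (h : H) : total hE hM a :=
  ⟨FE.toFine (C.act (totalVal y) h), by
    change FM.toFine (C.proj (C.act (totalVal y) h)) ∈ FM.leaf a
    rw [C.proj_act]
    exact y.2⟩

open Classical in
/-- A retraction to the total space above a leaf. -/
def toTotal (y₀ : total hE hM a) (x : C.E) : total hE hM a :=
  if h : FM.toFine (C.proj x) ∈ FM.leaf a then ⟨FE.toFine x, h⟩ else y₀

lemma totalVal_toTotal (y₀ : total hE hM a) {x : C.E} (h : FM.toFine (C.proj x) ∈ FM.leaf a) :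
    totalVal (toTotal y₀ x) = x := by
  rw [toTotal, dif_pos h]
  rfl

lemma totalVal_injective : Function.Injective (totalVal : total hE hM a → C.E) := fun _ _ h => Subtype.ext h

lemma leafVal_injective : Function.Injective (leafVal : FM.leaf a → M) := fun _ _ h => Subtype.ext h

lemma leafVal_leafProj (y : total hE hM a) : leafVal (leafProj y) = C.proj (totalVal y) := rfl

lemma contMDiff_totalVal : ContMDiff (cI e') (cI d) ω (totalVal : total hE hM a → C.E) :=
  FE.contMDiff_val.comp contMDiff_subtype_val

lemma contMDiff_leafVal : ContMDiff (cI k) (cI n) ω (leafVal : FM.leaf a → M) :=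
  FM.contMDiff_val.comp contMDiff_subtype_val

lemma mder_totalVal (y : total hE hM a) : mder (cI e') (cI d) totalVal y =
    (mder (cI e') (cI d) FE.val y.1).comp (mder (cI e') (cI e') Subtype.val y) :=
  mder_comp (g := FE.val) (FE.contMDiff_val _) contMDiff_subtype_val.contMDiffAt

lemma mder_totalVal_injective (y : total hE hM a) : Function.Injective (mder (cI e') (cI d) totalVal y) := by
  rw [mder_totalVal]
  exact (FE.mder_val_injective _).comp (mder_subtype_val_bijective _).1

lemma frm_mder_totalVal_mem (y : total hE hM a) (v : Cn e') :
    C.frm (totalVal y) (mder (cI e') (cI d) totalVal y v) ∈ lieImage d e' ι' := by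
  rw [mder_totalVal]
  exact frm_mder_val_mem hE _ _

lemma dir_mder_leafVal (u : FM.leaf a) (v : Cn k) :
    FM.dir (leafVal u) (mder (cI k) (cI n) leafVal u v) := by
  have h : mder (cI k) (cI n) leafVal u =
      (mder (cI k) (cI n) FM.val u.1).comp (mder (cI k) (cI k) Subtype.val u) :=
    mder_comp (g := FM.val) (FM.contMDiff_val _) contMDiff_subtype_val.contMDiffAt
  rw [h]
  exact (FM.dir_val_iff _ _).2 ⟨_, rfl⟩

section Maps

variable {E₁ H₁ N : Type*} [NormedAddCommGroup E₁] [NormedSpace ℂ E₁] [TopologicalSpace H₁]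
  {I₁ : ModelWithCorners ℂ E₁ H₁} [TopologicalSpace N] [ChartedSpace H₁ N] [IsManifold I₁ ω N]
  [I₁.Boundaryless]

lemma contMDiffAt_total {f : N → total hE hM a} {z : N}
    (hf : ContMDiffAt I₁ (cI d) ω (fun y => totalVal (f y)) z)
    (h : ∀ᶠ y in 𝓝 z, ∀ v, C.frm (totalVal (f y)) (mder I₁ (cI d) (fun y => totalVal (f y)) y v)
      ∈ lieImage d e' ι') : ContMDiffAt I₁ (cI e') ω f z := by
  refine contMDiffAt_codRestrict (FE.contMDiffAt_toFine hf ?_)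
  rwa [hE]

/-- By the product rule, moving along the fibres applies Ad(h)⁻¹ and adds an element of 𝔥; both
preserve 𝔥'. -/
lemma frm_act_mem (hC : C.FlatAlong e' ι' j) {s : N → C.E} {g : N → H} {x : N} (hs : ContMDiffAt I₁ (cI d) ω s x)
    (hg : ContMDiffAt I₁ (cI e) ω g x) {v : E₁} (h : C.frm (s x) (mder I₁ (cI d) s x v) ∈ lieImage d e' ι') :
    C.frm (C.act (s x) (g x)) (mder I₁ (cI d) (fun y => C.act (s y) (g y)) x v) ∈ lieImage d e' ι' := by
  rw [C.frm_act_mul hs hg]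
  exact Submodule.add_mem _ (hC.adm_inv_mem _ h) (hC.lmap_mem _)

end Maps

lemma contMDiff_leafProj : ContMDiff (cI e') (cI k) ω (leafProj : total hE hM a → FM.leaf a) := fun _ =>
  contMDiffAt_codRestrict ((contMDiff_fineProj hE hM).comp contMDiff_subtype_val _)

lemma contMDiff_leafAct (hC : C.FlatAlong e' ι' j) :
    ContMDiff ((cI e').prod (cI e)) (cI e') ω (fun p : total hE hM a × H => leafAct p.1 p.2) := fun p => by
  have h1 : ContMDiff ((cI e').prod (cI e)) (cI d) ω (fun p : total hE hM a × H => totalVal p.1) :=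
    contMDiff_totalVal.comp contMDiff_fst
  have h2 : ContMDiff ((cI e').prod (cI e)) (cI e) ω (fun p : total hE hM a × H => p.2) := contMDiff_snd
  refine contMDiffAt_total ?_ (Eventually.of_forall fun p v => hC.frm_act_mem (h1 p) (h2 p) ?_)
  · exact C.act_holomorphic.comp (h1.prodMk h2) p
  · rw [mder_comp_apply (g := totalVal) (contMDiff_totalVal _) (f := fun p : total hE hM a × H => p.1)
      contMDiff_fst.contMDiffAt]
    exact frm_mder_totalVal_mem _ _

/-- A local section of E, restricted to a leaf, is tangent to ω⁻¹(𝔥') because its projection is the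
inclusion of the leaf. So trivializations of E restrict to trivializations which are holomorphic for
the leaf topology. -/
lemma exists_trivialization (hC : C.FlatAlong e' ι' j) (m : FM.leaf a) :
    ∃ (V : Set (FM.leaf a)) (ψ : OpenPartialHomeomorph (FM.leaf a × H) (total hE hM a)),
    IsOpen V ∧ m ∈ V ∧ ψ.source = V ×ˢ Set.univ ∧ ψ.target = leafProj ⁻¹' V ∧
    ContMDiffOn ((cI k).prod (cI e)) (cI e') ω ψ ψ.source ∧
    ContMDiffOn (cI e') ((cI k).prod (cI e)) ω ψ.symm ψ.target ∧
    ∀ x ∈ V, ∀ h g : H, leafProj (ψ (x, h)) = x ∧ ψ (x, h * g) = leafAct (ψ (x, h)) g := by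
  obtain ⟨x, hx⟩ := C.proj_surjective (leafVal m)
  let σ := C.localSection x
  let y₀ : total hE hM a := ⟨FE.toFine x, by
    change FM.toFine (C.proj x) ∈ FM.leaf a
    rw [hx]
    exact m.2⟩
  let V : Set (FM.leaf a) := leafVal ⁻¹' σ.U
  have hV : IsOpen V := σ.isOpen.preimage contMDiff_leafVal.continuous
  let f : FM.leaf a × H → total hE hM a := fun p => toTotal y₀ (C.act (σ.s (leafVal p.1)) p.2)
  have hproj : ∀ p : FM.leaf a × H, p.1 ∈ V → C.proj (C.act (σ.s (leafVal p.1)) p.2) = leafVal p.1 :=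
    fun p hp => by rw [C.proj_act, σ.proj_s _ hp]
  have hf : ∀ p : FM.leaf a × H, p.1 ∈ V → totalVal (f p) = C.act (σ.s (leafVal p.1)) p.2 := fun p hp => by
    refine totalVal_toTotal _ ?_
    rw [hproj p hp]
    exact p.1.2
  have hfV : IsOpen (V ×ˢ (Set.univ : Set H)) := hV.prod isOpen_univ
  have hfc : ContMDiffOn ((cI k).prod (cI e)) (cI e') ω f (V ×ˢ Set.univ) := fun p hp => by
    refine ContMDiffAt.contMDiffWithinAt ?_
    have hs : ∀ p : FM.leaf a × H, p.1 ∈ V →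
        ContMDiffAt ((cI k).prod (cI e)) (cI d) ω (fun p : FM.leaf a × H => σ.s (leafVal p.1)) p := fun p hp =>
      (σ.s_holomorphic.contMDiffAt (σ.isOpen.mem_nhds hp)).comp p
        ((contMDiff_leafVal.comp contMDiff_fst) p)
    have hsnd : ∀ p, ContMDiffAt ((cI k).prod (cI e)) (cI e) ω (fun p : FM.leaf a × H => p.2) p := fun p =>
      contMDiff_snd.contMDiffAt
    have heq : ∀ p ∈ V ×ˢ (Set.univ : Set H),
        (fun p => totalVal (f p)) =ᶠ[𝓝 p] fun p => C.act (σ.s (leafVal p.1)) p.2 := fun p hp => by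
      filter_upwards [hfV.mem_nhds hp] with p hp using hf p hp.1
    refine contMDiffAt_total ((C.act_holomorphic.contMDiffAt.comp p
      ((hs p hp.1).prodMk (hsnd p))).congr_of_eventuallyEq (heq p hp)) ?_
    filter_upwards [hfV.mem_nhds hp] with p hp v
    rw [mder_congr (heq p hp), hf p hp.1]
    refine hC.frm_act_mem (hs p hp.1) (hsnd p) ?_
    have h1 := σ.s_holomorphic.contMDiffAt (σ.isOpen.mem_nhds hp.1)
    have h2 : (fun p : FM.leaf a × H => C.proj (σ.s (leafVal p.1))) =ᶠ[𝓝 p] fun p => leafVal p.1 := by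
      filter_upwards [hfV.mem_nhds hp] with p hp using σ.proj_s _ hp.1
    rw [← hM, ← mder_comp_apply (g := C.proj) (C.proj_holomorphic _) (hs p hp.1), mder_congr h2,
      mder_comp_apply (g := leafVal) (contMDiff_leafVal _) (f := fun p : FM.leaf a × H => p.1)
      contMDiff_fst.contMDiffAt, σ.proj_s _ hp.1]
    exact dir_mder_leafVal _ _
  have hkc : ContMDiffOn (cI e') (cI e) ω (fun y : total hE hM a => σ.k (totalVal y)) (leafProj ⁻¹' V) :=
    σ.k_holomorphic.comp contMDiff_totalVal.contMDiffOn fun y hy => hy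
  have hgc : ContMDiffOn (cI e') ((cI k).prod (cI e)) ω
      (fun y : total hE hM a => (leafProj y, σ.k (totalVal y))) (leafProj ⁻¹' V) :=
    contMDiff_leafProj.contMDiffOn.prodMk hkc
  have hlp : ∀ p : FM.leaf a × H, p.1 ∈ V → leafProj (f p) = p.1 := fun p hp => by
    refine leafVal_injective ?_
    rw [leafVal_leafProj, hf p hp, hproj p hp]
  refine ⟨V, {
    toFun := f
    invFun := fun y => (leafProj y, σ.k (totalVal y))
    source := V ×ˢ Set.univ
    target := leafProj ⁻¹' V
    map_source' := fun p hp => by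
      change leafProj (f p) ∈ V
      rw [hlp p hp.1]
      exact hp.1
    map_target' := fun y hy => ⟨hy, mem_univ _⟩
    left_inv' := fun p hp => by
      refine Prod.ext (hlp p hp.1) ?_
      change σ.k (totalVal (f p)) = p.2
      rw [hf p hp.1, σ.k_act _ (by rw [σ.proj_s _ hp.1]; exact hp.1), σ.k_s _ hp.1, one_mul]
    right_inv' := fun y hy => by
      refine totalVal_injective ?_
      rw [hf (leafProj y, σ.k (totalVal y)) hy]
      exact σ.act_s_k _ hy
    open_source := hfV
    open_target := hV.preimage contMDiff_leafProj.continuous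
    continuousOn_toFun := hfc.continuousOn
    continuousOn_invFun := hgc.continuousOn }, hV, ?_, rfl, rfl, hfc, hgc, fun x hx h g => ⟨hlp (x, h) hx, ?_⟩⟩
  · change leafVal m ∈ σ.U
    rw [← hx]
    exact σ.mem
  · refine totalVal_injective ?_
    change totalVal (f (x, h * g)) = C.act (totalVal (f (x, h))) g
    rw [hf _ hx, hf _ hx, C.act_mul]

/-- The total space above a leaf may have several components, so countability of single leaves of E
does not suffice; it follows from countably many trivializations over the leaf of M. -/
lemma complexManifold_total (hC : C.FlatAlong e' ι' j) : ComplexManifold e' (total hE hM a) := by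
  choose V ψ h1 h2 h3 h4 h5 using hC.exists_trivialization (hE := hE) (hM := hM) (a := a)
  obtain ⟨s, hs, hcov⟩ := TopologicalSpace.countable_cover_nhds fun m => (h1 m).mem_nhds (h2 m)
  have : Countable s := hs.to_subtype
  have hsc : ∀ m, SecondCountableTopology (ψ m).target := fun m =>
    (ψ m).symm.secondCountableTopology_source
  have hsc' : SecondCountableTopology (total hE hM a) := by
    have : ∀ m : s, SecondCountableTopology (ψ m.1).target := fun m => hsc m.1
    refine TopologicalSpace.secondCountableTopology_of_countable_cover
      (fun m : s => (ψ m.1).open_target) (eq_univ_of_forall fun y => ?_)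
    obtain ⟨m, hm, hy⟩ := mem_iUnion₂.1 (hcov.symm ▸ mem_univ (leafProj y))
    refine mem_iUnion.2 ⟨⟨m, hm⟩, ?_⟩
    rw [h4]
    exact hy
  exact {}

/-- The Cartan connection on the total space above a leaf. -/
def leafForm {L : (Cn e' × Cn q) ≃L[ℂ] Cn d} (hL : ∀ a, L (a, 0) = lmap d e' ι' a) (y : total hE hM a) :
    Cn e' ≃L[ℂ] Cn e' :=
  (LinearEquiv.ofInjectiveEndo ((ContinuousLinearMap.fst ℂ (Cn e') (Cn q)).toLinearMap ∘ₗ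
    L.symm.toLinearEquiv.toLinearMap ∘ₗ (C.frm (totalVal y)).toLinearEquiv.toLinearMap ∘ₗ
      (mder (cI e') (cI d) totalVal y).toLinearMap) (by
    intro v w hvw
    obtain ⟨X, hX⟩ := frm_mder_totalVal_mem y v
    obtain ⟨Y, hY⟩ := frm_mder_totalVal_mem y w
    change (L.symm (C.frm (totalVal y) (mder (cI e') (cI d) totalVal y v))).1
      = (L.symm (C.frm (totalVal y) (mder (cI e') (cI d) totalVal y w))).1 at hvw
    refine mder_totalVal_injective y ((C.frm (totalVal y)).injective ?_)
    rw [← hX, ← hY] at hvw ⊢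
    change (L.symm (lmap d e' ι' X)).1 = (L.symm (lmap d e' ι' Y)).1 at hvw
    rw [← hL, ← hL, L.symm_apply_apply, L.symm_apply_apply] at hvw
    exact congrArg _ hvw)).toContinuousLinearEquiv

lemma leafForm_apply {L : (Cn e' × Cn q) ≃L[ℂ] Cn d} (hL : ∀ a, L (a, 0) = lmap d e' ι' a)
    (y : total hE hM a) (v : Cn e') :
    leafForm hL y v = (L.symm (C.frm (totalVal y) (mder (cI e') (cI d) totalVal y v))).1 := rfl

/-- The first component of L⁻¹ω loses no information, since above a leaf ω has values in 𝔥', which L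
identifies with the first factor. -/
lemma lmap_leafForm {L : (Cn e' × Cn q) ≃L[ℂ] Cn d} (hL : ∀ a, L (a, 0) = lmap d e' ι' a)
    (y : total hE hM a) (v : Cn e') :
    lmap d e' ι' (leafForm hL y v) = C.frm (totalVal y) (mder (cI e') (cI d) totalVal y v) := by
  obtain ⟨X, hX⟩ := frm_mder_totalVal_mem y v
  rw [leafForm_apply, ← hX]
  change lmap d e' ι' (L.symm (lmap d e' ι' X)).1 = lmap d e' ι' X
  rw [← hL X, L.symm_apply_apply]
  exact (hL X).symm

variable (a hE hM)

/-- The restriction of a Cartan geometry to a leaf. -/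
def leafGeometry {L : (Cn e' × Cn q) ≃L[ℂ] Cn d} (hL : ∀ a, L (a, 0) = lmap d e' ι' a) :
    CartanGeometry e' e j k (FM.leaf a) where
  E := total hE hM a
  complexManifold := hC.complexManifold_total
  proj := leafProj
  act := leafAct
  act_one y := totalVal_injective (C.act_one _)
  act_mul y h g := totalVal_injective (C.act_mul _ h g)
  act_holomorphic := hC.contMDiff_leafAct
  locally_trivial := hC.exists_trivialization
  form := leafForm hL
  form_holomorphic := by
    have h1 : ContMDiff (cI e').tangent (cI d).tangent ω
        (tangentMap (cI e') (cI d) (totalVal : total hE hM a → C.E)) :=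
      contMDiff_totalVal.contMDiff_tangentMap le_top
    have h2 := C.form_holomorphic.comp h1
    exact ((ContinuousLinearMap.fst ℂ (Cn e') (Cn q)).comp (L.symm : Cn d →L[ℂ] Cn e' × Cn q)).contMDiff.comp h2
  form_equivariant h y v := by
    refine hC.inj ((lmap_leafForm hL _ _).trans ?_)
    have h1 := lmap_adm hC.hol (j h)⁻¹ (leafForm hL y v)
    rw [lmap_leafForm hL y v, map_inv, hC.comp] at h1
    refine Eq.trans ?_ h1.symm
    have h2 : ContMDiffAt (cI e') (cI e') ω (fun y : total hE hM a => leafAct y h) y :=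
      hC.contMDiff_leafAct.comp (contMDiff_id.prodMk contMDiff_const) y
    refine (congrArg (C.frm (totalVal (leafAct y h)))
      (mder_comp_apply (g := totalVal) (contMDiff_totalVal _) h2 v).symm).trans ?_
    have h3 := mder_comp_apply (g := fun x => C.act x h) (f := (totalVal : total hE hM a → C.E))
      (C.act_left_holomorphic h _) (contMDiff_totalVal y) v
    exact (congrArg (C.frm (C.act (totalVal y) h)) h3).trans (C.frm_act h _ _)
  form_vertical y X := by
    refine hC.inj ((lmap_leafForm hL _ _).trans ?_)
    refine Eq.trans ?_ (hC.lmap_sub X).symm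
    have h2 : ContMDiffAt (cI e) (cI e') ω (fun h => leafAct y h) 1 :=
      hC.contMDiff_leafAct.comp (contMDiff_const.prodMk contMDiff_id) 1
    refine (congrArg (C.frm (totalVal (leafAct y 1)))
      (mder_comp_apply (g := totalVal) (contMDiff_totalVal _) h2 X).symm).trans ?_
    refine (C.frm_vertical (totalVal y) 1 X).trans ?_
    rw [mcForm_one]
    rfl

/-- The inclusion into E relates the two coframes, so the brackets correspond; in E the brackets of
directions in 𝔥' are those of the Lie algebra. -/
lemma leafGeometry_flat {L : (Cn e' × Cn q) ≃L[ℂ] Cn d} (hL : ∀ a, L (a, 0) = lmap d e' ι' a) :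
    (hC.leafGeometry hE hM a hL).Flat := fun y A B => by
  refine ((hC.leafGeometry hE hM a hL).curvature_eq y A B).trans (sub_eq_zero.2 (hC.inj ?_))
  refine ((lmap_lieBr hC.hol A B).trans (hC.tors_eq A (totalVal y) _).symm).trans ?_
  refine ((hC.leafGeometry hE hM a hL).coframe.tors_of_related C.coframe totalVal (lmap d e' ι')
    (contMDiff_totalVal y) (Eventually.of_forall fun z v => ?_) A B).symm
  exact (lmap_leafForm hL z v).symm

lemma restrictsAlong_leafGeometry {L : (Cn e' × Cn q) ≃L[ℂ] Cn d}
    (hL : ∀ a, L (a, 0) = lmap d e' ι' a) :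
    C.RestrictsAlong (leafVal (a := a)) (hC.leafGeometry hE hM a hL) ι' :=
  ⟨totalVal, contMDiff_totalVal, fun _ => rfl, fun _ _ => rfl, fun y v => (lmap_leafForm hL y v).symm⟩

theorem exists_foliation [Nonempty C.E] (hC : C.FlatAlong e' ι' j) (hee' : e < e') :
    ∃ k : ℕ, 0 < k ∧ ∃ ℱ : HolomorphicFoliation n M k, ∀ a : ℱ.Index,
      ∃ D : CartanGeometry e' e j k (ℱ.Leaf a), D.Flat ∧ C.RestrictsAlong (ℱ.incl a) D ι' := by
  obtain ⟨q, L, hL, hq⟩ := exists_equiv_extending (lmap d e' ι') hC.inj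
  obtain ⟨FE, hE⟩ := hC.exists_foliatedAtlas hL hq
  obtain ⟨FM, hM⟩ := hC.exists_foliatedAtlas_base (k := e' - e) hL hq (by omega)
  -- The leaves have the dimension of 𝔥'/𝔥, positive because 𝔥' is strictly larger.
  exact ⟨e' - e, by omega, FM.foliation, fun a => ⟨hC.leafGeometry hE hM a hL,
    hC.leafGeometry_flat hE hM a hL, hC.restrictsAlong_leafGeometry hE hM a hL⟩⟩

end CartanGeometry.FlatAlong

/-! ### Change of model space and universe; global inverses -/

section TransportedManifold

universe v

variable {d : ℕ} {E₁ : Type*} {H₁ : Type*} [NormedAddCommGroup E₁] [NormedSpace ℂ E₁] [TopologicalSpace H₁]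

/-- A manifold, considered as a manifold modelled on `ℂᵈ`, in a given universe. -/
def Transported (_ : ModelWithCorners ℂ E₁ H₁) (_ : E₁ ≃L[ℂ] Cn d) (X : Type v) : Type (max u v) :=
  ULift.{u, v} X

namespace Transported

variable {I₁ : ModelWithCorners ℂ E₁ H₁} {L : E₁ ≃L[ℂ] Cn d} {X : Type v}

instance [TopologicalSpace X] : TopologicalSpace (Transported.{u, v} I₁ L X) :=
  inferInstanceAs (TopologicalSpace (ULift.{u, v} X))

instance [TopologicalSpace X] [T2Space X] : T2Space (Transported.{u, v} I₁ L X) :=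
  inferInstanceAs (T2Space (ULift.{u, v} X))

instance [TopologicalSpace X] [SecondCountableTopology X] :
    SecondCountableTopology (Transported.{u, v} I₁ L X) :=
  (Homeomorph.ulift : ULift.{u, v} X ≃ₜ X).secondCountableTopology

/-- The identity map, to the transported manifold. -/
def mk (x : X) : Transported.{u, v} I₁ L X := ULift.up x

/-- The identity map, from the transported manifold. -/
def out (x : Transported.{u, v} I₁ L X) : X := ULift.down x

variable [TopologicalSpace X] [ChartedSpace H₁ X] [I₁.Boundaryless]

/-- The charts of a transported manifold. -/
def chart (x : X) : OpenPartialHomeomorph (Transported.{u, v} I₁ L X) (Cn d) :=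
  (Homeomorph.ulift.toOpenPartialHomeomorph.trans (chartAt H₁ x)).trans
    (I₁.toHomeomorph.trans L.toHomeomorph).toOpenPartialHomeomorph

lemma mem_chart_source_iff {x : X} {y : Transported.{u, v} I₁ L X} :
    y ∈ (chart x : OpenPartialHomeomorph (Transported.{u, v} I₁ L X) _).source ↔
      out y ∈ (chartAt H₁ x).source := by
  simp only [chart, OpenPartialHomeomorph.trans_source]
  simp only [Homeomorph.toOpenPartialHomeomorph_source, preimage_univ, univ_inter, inter_univ]
  exact Iff.rfl

lemma mem_chart_target_iff {x : X} {z : Cn d} :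
    z ∈ (chart x : OpenPartialHomeomorph (Transported.{u, v} I₁ L X) _).target ↔
      L.symm z ∈ (extChartAt I₁ x).target := by
  rw [extChartAt_target, I₁.range_eq_univ]
  simp [chart]

instance : ChartedSpace (Cn d) (Transported.{u, v} I₁ L X) where
  atlas := range chart
  chartAt x := chart (out x)
  mem_chart_source x := mem_chart_source_iff.2 (mem_chart_source H₁ (out x))
  chart_mem_atlas _ := mem_range_self _

variable [IsManifold I₁ ω X]

lemma contMDiffAt_extChartAt_symm_of_mem {x : X} {z : E₁} (hz : z ∈ (extChartAt I₁ x).target) :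
    ContMDiffAt 𝓘(ℂ, E₁) I₁ ω (extChartAt I₁ x).symm z :=
  (contMDiffOn_extChartAt_symm x).contMDiffAt (extChartAt_target_mem_nhds' hz)

instance : IsManifold (cI d) ω (Transported.{u, v} I₁ L X) := by
  refine isManifold_of_contDiffOn _ _ _ ?_
  rintro _ _ ⟨x, rfl⟩ ⟨x', rfl⟩ z ⟨⟨hz, hz'⟩, -⟩
  have h1 : L.symm z ∈ (extChartAt I₁ x).target := mem_chart_target_iff.1 hz
  have h2 : (extChartAt I₁ x).symm (L.symm z) ∈ (chartAt H₁ x').source := mem_chart_source_iff.1 hz'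
  refine ContDiffAt.contDiffWithinAt ?_
  have h3 : ContMDiffAt 𝓘(ℂ, E₁) 𝓘(ℂ, E₁) ω (fun w => extChartAt I₁ x' ((extChartAt I₁ x).symm w)) (L.symm z) :=
    (contMDiffAt_extChartAt' (n := ω) h2).comp _ (contMDiffAt_extChartAt_symm_of_mem h1)
  exact L.contDiff.contDiffAt.comp z (h3.contDiffAt.comp z L.symm.contDiff.contDiffAt)

lemma contMDiff_out : ContMDiff (cI d) I₁ ω (out : Transported.{u, v} I₁ L X → X) := fun x => by
  let c : OpenPartialHomeomorph (Transported.{u, v} I₁ L X) (Cn d) := chartAt (Cn d) x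
  have hx : x ∈ c.source := mem_chart_source _ x
  have h1 : ContMDiffAt (cI d) (cI d) ω c x := contMDiffAt_chartAt hx
  have h2 : ContMDiffAt (cI d) 𝓘(ℂ, E₁) ω (fun y => L.symm (c y)) x :=
    ContMDiffAt.comp (g := L.symm) x L.symm.contDiff.contMDiff.contMDiffAt h1
  have h3 : L.symm (c x) ∈ (extChartAt I₁ (out x)).target := mem_chart_target_iff.1 (c.map_source hx)
  refine (ContMDiffAt.comp (g := (extChartAt I₁ (out x)).symm) x (contMDiffAt_extChartAt_symm_of_mem h3)
    h2).congr_of_eventuallyEq ?_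
  filter_upwards [c.open_source.mem_nhds hx] with y hy
  exact congrArg out (c.left_inv hy).symm

lemma contMDiff_mk : ContMDiff I₁ (cI d) ω (mk : X → Transported.{u, v} I₁ L X) := fun x => by
  let c : OpenPartialHomeomorph (Transported.{u, v} I₁ L X) (Cn d) := chartAt (Cn d) (mk x)
  have hx : mk x ∈ c.source := mem_chart_source _ _
  have h1 : ContMDiffAt I₁ (cI d) ω (fun y => L (extChartAt I₁ x y)) x :=
    ContMDiffAt.comp (g := L) x L.contDiff.contMDiff.contMDiffAt contMDiffAt_extChartAt
  refine (ContMDiffAt.comp (g := c.symm) x (contMDiffAt_chartAt_symm (c.map_source hx))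
    h1).congr_of_eventuallyEq ?_
  filter_upwards [(chartAt H₁ x).open_source.mem_nhds (mem_chart_source _ x)] with y hy
  exact (c.left_inv (x := mk y) (mem_chart_source_iff.2 hy)).symm

lemma mder_out_injective (x : Transported.{u, v} I₁ L X) : Function.Injective (mder (cI d) I₁ out x) := by
  have h1 := mder_comp (g := (mk : X → Transported.{u, v} I₁ L X)) (contMDiff_mk _) (contMDiff_out x)
  have h2 : mder (cI d) (cI d) (fun y : Transported.{u, v} I₁ L X => mk (out y)) x = ContinuousLinearMap.id ℂ _ :=
    mder_id x
  rw [h2] at h1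
  intro v w hvw
  have h3 := DFunLike.congr_fun h1 v
  have h4 := DFunLike.congr_fun h1 w
  simp only [ContinuousLinearMap.comp_apply, ContinuousLinearMap.id_apply] at h3 h4
  rw [h3, h4, hvw]

end Transported

end TransportedManifold

/-- Passes from holomorphy in charts, which defines a coframe, to holomorphy on the tangent bundle,
which a Cartan geometry demands. -/
lemma Coframe.form_holomorphic {d : ℕ} {E : Type*} [TopologicalSpace E] [ChartedSpace (Cn d) E]
    [IsManifold (cI d) ω E] (C : Coframe d E) :
    ContMDiff (cI d).tangent 𝓘(ℂ, Cn d) ω (fun v : TangentBundle (cI d) E => C.form v.proj v.snd) := by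
  intro v₀
  let c := chartAt (Cn d) v₀.proj
  have hx₀ : v₀.proj ∈ c.source := mem_chart_source _ _
  have hc : ContMDiffOn (cI d) (cI d) ω c c.source := fun y hy => (contMDiffAt_chartAt hy).contMDiffWithinAt
  have hopen : IsOpen (Bundle.TotalSpace.proj ⁻¹' c.source : Set (TangentBundle (cI d) E)) :=
    c.open_source.preimage (FiberBundle.continuous_proj _ _)
  have h1 := (hc.contMDiffOn_tangentMapWithin (m := ω) le_rfl c.open_source.uniqueMDiffOn).contMDiffAt
    (hopen.mem_nhds hx₀)
  have h2 : ContMDiffAt (cI d).tangent 𝓘(ℂ, Cn d) ω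
      (fun v : TangentBundle (cI d) E => mder (cI d) (cI d) c v.proj v.snd) v₀ := by
    refine ((contMDiff_snd_tangentBundle_modelSpace (Cn d) (cI d)).contMDiffAt.comp v₀ h1).congr_of_eventuallyEq ?_
    filter_upwards [hopen.mem_nhds hx₀] with v hv
    have h3 : mder (cI d) (cI d) c v.proj = mfderivWithin (cI d) (cI d) c c.source v.proj :=
      (mfderivWithin_of_isOpen c.open_source hv).symm
    rw [h3]
    rfl
  have h3 : ContMDiffAt (cI d).tangent 𝓘(ℂ, Cn d →L[ℂ] Cn d) ω
      (fun v : TangentBundle (cI d) E => C.loc v₀.proj (c v.proj)) v₀ := by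
    have h4 : ContMDiffAt (cI d) 𝓘(ℂ, Cn d →L[ℂ] Cn d) ω (C.loc v₀.proj) (c v₀.proj) :=
      (C.holo v₀.proj).contMDiffAt
    exact ContMDiffAt.comp v₀ h4 (ContMDiffAt.comp v₀ (contMDiffAt_chartAt hx₀)
      (Bundle.contMDiff_proj (TangentSpace (cI d) (M := E))).contMDiffAt)
  refine (h3.clm_apply h2).congr_of_eventuallyEq ?_
  filter_upwards [hopen.mem_nhds hx₀] with v hv
  have h5 := DFunLike.congr_fun (mder_chartAt_comp_symm (x := v₀.proj) hv) v.snd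
  change _ = C.form (c.symm (c v.proj)) (mder (cI d) (cI d) c.symm (c v.proj) (mder (cI d) (cI d) c v.proj v.snd))
  rw [c.left_inv hv]
  exact congrArg _ h5.symm

section InjectiveLocalDiffeo

variable {E₁ M₁ E₂ M₂ : Type*}
  [NormedAddCommGroup E₁] [NormedSpace ℂ E₁] [CompleteSpace E₁] [TopologicalSpace M₁]
  [ChartedSpace E₁ M₁] [IsManifold 𝓘(ℂ, E₁) ω M₁]
  [NormedAddCommGroup E₂] [NormedSpace ℂ E₂] [TopologicalSpace M₂]
  [ChartedSpace E₂ M₂] [IsManifold 𝓘(ℂ, E₂) ω M₂]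

/-- Local inverses show that f is open on s; by injectivity the global inverse agrees with them
locally, hence is holomorphic. -/
theorem exists_openPartialHomeomorph_of_injOn [Nonempty M₁] {f : M₁ → M₂} {s : Set M₁} (hs : IsOpen s)
    (hinj : InjOn f s) (hf : ∀ x ∈ s, ContMDiffAt 𝓘(ℂ, E₁) 𝓘(ℂ, E₂) ω f x)
    (hf' : ∀ x ∈ s, ∃ f' : E₁ ≃L[ℂ] E₂, mder 𝓘(ℂ, E₁) 𝓘(ℂ, E₂) f x = f') :
    ∃ e : OpenPartialHomeomorph M₁ M₂, e.source = s ∧ ⇑e = f ∧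
      ContMDiffOn 𝓘(ℂ, E₁) 𝓘(ℂ, E₂) ω e e.source ∧
      ContMDiffOn 𝓘(ℂ, E₂) 𝓘(ℂ, E₁) ω e.symm e.target := by
  have hloc : ∀ x ∈ s, ∃ e : OpenPartialHomeomorph M₁ M₂, x ∈ e.source ∧ EqOn e f e.source ∧
      ContMDiffOn 𝓘(ℂ, E₂) 𝓘(ℂ, E₁) ω e.symm e.target := fun x hx => by
    obtain ⟨f', h'⟩ := hf' x hx
    obtain ⟨e, h1, h2, -, -, h5⟩ := exists_openPartialHomeomorph_of_mder (hf x hx) f' h'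
    exact ⟨e, h1, h2, h5⟩
  choose e h1 h2 h5 using hloc
  have hopen : ∀ t ⊆ s, IsOpen t → IsOpen (f '' t) := fun t hts ht => by
    rw [isOpen_iff_mem_nhds]
    rintro _ ⟨x, hx, rfl⟩
    have hxs := hts hx
    have h6 : IsOpen (e x hxs '' ((e x hxs).source ∩ t)) :=
      (e x hxs).isOpen_image_of_subset_source ((e x hxs).open_source.inter ht) inter_subset_left
    have h7 : e x hxs '' ((e x hxs).source ∩ t) ⊆ f '' t := by
      rintro _ ⟨y, ⟨hy, hyt⟩, rfl⟩
      exact ⟨y, hyt, (h2 x hxs hy).symm⟩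
    refine mem_of_superset (h6.mem_nhds ⟨x, ⟨h1 x hxs, hx⟩, h2 x hxs (h1 x hxs)⟩) h7
  let P : PartialEquiv M₁ M₂ := hinj.toPartialEquiv f s
  have hcont : ContinuousOn f s := fun x hx => (hf x hx).continuousAt.continuousWithinAt
  have hmap : IsOpenMap (s.domRestrict f) := fun t ht => by
    have h6 : s.domRestrict f '' t = f '' (Subtype.val '' t) := by
      rw [image_image]; rfl
    rw [h6]
    exact hopen _ (by rintro _ ⟨y, -, rfl⟩; exact y.2) (hs.isOpenMap_subtype_val t ht)
  let Q : OpenPartialHomeomorph M₁ M₂ := OpenPartialHomeomorph.ofContinuousOpenRestrict P hcont hmap hs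
  refine ⟨Q, rfl, rfl, fun x hx => (hf x hx).contMDiffWithinAt, ?_⟩
  intro y hy
  have hx : Q.symm y ∈ s := Q.map_target hy
  set x := Q.symm y with hxdef
  have hxy : f x = y := Q.right_inv hy
  have hey : e x hx x = y := (h2 x hx (h1 x hx)).trans hxy
  have hyt : y ∈ (e x hx).target := hey ▸ (e x hx).map_source (h1 x hx)
  refine ContMDiffAt.contMDiffWithinAt (((h5 x hx).contMDiffAt
    ((e x hx).open_target.mem_nhds hyt)).congr_of_eventuallyEq ?_)
  have hsy : (e x hx).symm y = x := by rw [← hey]; exact (e x hx).left_inv (h1 x hx)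
  have h8 : ∀ᶠ z in 𝓝 y, (e x hx).symm z ∈ s := by
    refine ((e x hx).symm.continuousAt hyt).eventually_mem (hs.mem_nhds ?_)
    rw [hsy]; exact hx
  filter_upwards [h8, (e x hx).open_target.mem_nhds hyt, Q.open_target.mem_nhds hy] with z hz hz' hz''
  refine hinj (Q.map_target hz'') hz ?_
  have h9 : f (Q.symm z) = z := Q.right_inv hz''
  rw [h9, ← h2 x hx ((e x hx).map_target hz'), (e x hx).right_inv hz']

end InjectiveLocalDiffeo

lemma mder_prodMk {E₁ H₁ M₁ E₂ H₂ M₂ E₃ H₃ M₃ : Type*}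
    [NormedAddCommGroup E₁] [NormedSpace ℂ E₁] [TopologicalSpace H₁] [TopologicalSpace M₁] [ChartedSpace H₁ M₁]
    [NormedAddCommGroup E₂] [NormedSpace ℂ E₂] [TopologicalSpace H₂] [TopologicalSpace M₂] [ChartedSpace H₂ M₂]
    [NormedAddCommGroup E₃] [NormedSpace ℂ E₃] [TopologicalSpace H₃] [TopologicalSpace M₃] [ChartedSpace H₃ M₃]
    {I₁ : ModelWithCorners ℂ E₁ H₁} {I₂ : ModelWithCorners ℂ E₂ H₂} {I₃ : ModelWithCorners ℂ E₃ H₃}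
    {f : M₁ → M₂} {g : M₁ → M₃} {x : M₁} (hf : ContMDiffAt I₁ I₂ ω f x) (hg : ContMDiffAt I₁ I₃ ω g x) :
    mder I₁ (I₂.prod I₃) (fun y => (f y, g y)) x = (mder I₁ I₂ f x).prod (mder I₁ I₃ g x) :=
  mfderiv_prodMk (hf.mdifferentiableAt (by simp)) (hg.mdifferentiableAt (by simp))

/-! ### The product of a transversal and a group as a Cartan geometry -/

/-- A holomorphic one-form on a ball, with values in a complement of the Lie algebra of a subgroup. -/
structure TransversalForm (d e q : ℕ) {G H : Type u} [Group G] [TopologicalSpace G] [ChartedSpace (Cn d) G]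
    [Group H] [TopologicalSpace H] [ChartedSpace (Cn e) H] (ι : H →* G) where
  r : ℝ
  pos : 0 < r
  form : Cn q → Cn q →L[ℂ] Cn d
  holo : ∀ t ∈ Metric.ball (0 : Cn q) r, ContDiffAt ℂ ω form t
  inj : ∀ t ∈ Metric.ball (0 : Cn q) r, ∀ b v, form t v + lmap d e ι b = 0 → v = 0 ∧ b = 0
  -- Any isomorphism serves: it only makes the product a manifold modelled on ℂᵈ.
  model : (Cn q × Cn e) ≃L[ℂ] Cn d

namespace TransversalForm

variable {d e q : ℕ} {G H : Type u} [Group G] [TopologicalSpace G] [ChartedSpace (Cn d) G]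
  [ComplexLieGroup d G] [Group H] [TopologicalSpace H] [ChartedSpace (Cn e) H] [ComplexLieGroup e H]
  {ι : H →* G} (η : TransversalForm d e q ι)

/-- The ball, as an open set. -/
def opens : TopologicalSpace.Opens (Cn q) := ⟨Metric.ball 0 η.r, Metric.isOpen_ball⟩

/-- The ball, as a manifold in the given universe. -/
abbrev Base : Type u := Transported.{u, 0} (cI q) (ContinuousLinearEquiv.refl ℂ (Cn q)) η.opens

/-- The product of the ball and the group. -/
abbrev Total : Type u := Transported.{u, u} ((cI q).prod (cI e)) η.model (η.Base × H)

instance : ComplexManifold q η.Base where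
instance : ComplexManifold d η.Total where

instance : ConnectedSpace η.Base := by
  have h1 : ConnectedSpace η.opens := isConnected_iff_connectedSpace.1 (Metric.isConnected_ball η.pos)
  exact (Homeomorph.ulift : ULift.{u} η.opens ≃ₜ η.opens).symm.surjective.connectedSpace
    (Homeomorph.ulift : ULift.{u} η.opens ≃ₜ η.opens).symm.continuous

/-- The coordinates on the base. -/
def baseVal (m : η.Base) : Cn q := m.out.1

/-- The coordinates on the base, on the total space. -/
def τ (p : η.Total) : Cn q := η.baseVal p.out.1

/-- The fibre coordinate. -/
def γ (p : η.Total) : H := p.out.2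

lemma τ_mem (p : η.Total) : η.τ p ∈ Metric.ball (0 : Cn q) η.r := p.out.1.out.2

open Classical in
/-- The point with given coordinates. -/
def pt (t : Cn q) (g : H) : η.Total :=
  .mk (.mk (if h : t ∈ η.opens then ⟨t, h⟩ else ⟨0, Metric.mem_ball_self η.pos⟩), g)

open Classical in
lemma τ_pt {t : Cn q} (ht : t ∈ Metric.ball (0 : Cn q) η.r) (g : H) : η.τ (η.pt t g) = t := by
  change ((if h : t ∈ η.opens then (⟨t, h⟩ : η.opens) else ⟨0, Metric.mem_ball_self η.pos⟩) : η.opens).1 = t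
  rw [dif_pos (show t ∈ η.opens from ht)]

lemma γ_pt (t : Cn q) (g : H) : η.γ (η.pt t g) = g := rfl

lemma ext {p p' : η.Total} (h : η.τ p = η.τ p') (h' : η.γ p = η.γ p') : p = p' := by
  have h1 : p.out.1.out = p'.out.1.out := Subtype.ext h
  have h2 : p.out.1 = p'.out.1 := ULift.down_injective h1
  exact ULift.down_injective (Prod.ext h2 h')

lemma contMDiff_baseVal : ContMDiff (cI q) (cI q) ω η.baseVal :=
  contMDiff_subtype_val.comp Transported.contMDiff_out

lemma contMDiff_proj : ContMDiff (cI d) (cI q) ω (fun p : η.Total => p.out.1) :=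
  contMDiff_fst.comp Transported.contMDiff_out

lemma contMDiff_τ : ContMDiff (cI d) (cI q) ω η.τ := η.contMDiff_baseVal.comp η.contMDiff_proj

lemma contMDiff_γ : ContMDiff (cI d) (cI e) ω η.γ := contMDiff_snd.comp Transported.contMDiff_out

section Maps

variable {E₁ H₁ N : Type*} [NormedAddCommGroup E₁] [NormedSpace ℂ E₁] [TopologicalSpace H₁]
  {I₁ : ModelWithCorners ℂ E₁ H₁} [TopologicalSpace N] [ChartedSpace H₁ N]

lemma contMDiffAt_pt {t : N → Cn q} {g : N → H} {z : N} (ht : ContMDiffAt I₁ (cI q) ω t z)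
    (hg : ContMDiffAt I₁ (cI e) ω g z) (hz : t z ∈ Metric.ball (0 : Cn q) η.r) :
    ContMDiffAt I₁ (cI d) ω (fun y => η.pt (t y) (g y)) z := by
  classical
  let ρ : Cn q → η.opens := fun t => if h : t ∈ η.opens then ⟨t, h⟩ else ⟨0, Metric.mem_ball_self η.pos⟩
  have hρ : ∀ y : η.opens, ρ y = y := fun y => dif_pos y.2
  have h1 : ContMDiffAt (cI q) (cI q) ω ρ (⟨t z, hz⟩ : η.opens).1 := by
    rw [← contMDiffAt_subtype_iff]
    simp only [hρ]
    exact contMDiffAt_id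
  exact (Transported.contMDiff_mk _).comp z
    (((Transported.contMDiff_mk _).comp z (h1.comp z ht)).prodMk hg)

end Maps

lemma eq_zero_of_mder {p : η.Total} {u : Cn d} (h1 : mder (cI d) (cI q) η.τ p u = 0)
    (h2 : mder (cI d) (cI e) η.γ p u = 0) : u = 0 := by
  have h3 := mder_prodMk (η.contMDiff_proj p) (η.contMDiff_γ p)
  have h4 : mder (cI d) (cI q) (fun p : η.Total => p.out.1) p u = 0 := by
    have h5 := mder_comp_apply (g := (Transported.out : η.Base → η.opens)) (Transported.contMDiff_out _)
      (η.contMDiff_proj p) u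
    have h6 := mder_comp_apply (g := (Subtype.val : η.opens → Cn q)) (f := fun p : η.Total => p.out.1.out)
      (contMDiff_subtype_val.contMDiffAt) ((Transported.contMDiff_out _).comp p (η.contMDiff_proj p)) u
    rw [h5] at h6
    have h7 := (mder_subtype_val_bijective (I₁ := cI q) p.out.1.out).1
      ((h6.symm.trans h1).trans (map_zero _).symm)
    exact Transported.mder_out_injective _ (h7.trans (map_zero _).symm)
  have h8 : mder (cI d) ((cI q).prod (cI e)) Transported.out p u = 0 :=
    (DFunLike.congr_fun h3 u).trans (Prod.ext h4 h2)
  exact Transported.mder_out_injective p (h8.trans (map_zero _).symm)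

/-- The Cartan connection on the product, as a linear map. -/
def lin (p : η.Total) : Cn d →L[ℂ] Cn d :=
  (adm d (ι (η.γ p))⁻¹).comp ((η.form (η.τ p)).comp (mder (cI d) (cI q) η.τ p))
    + (lmap d e ι).comp ((mcForm e (η.γ p) : Cn e →L[ℂ] Cn e).comp (mder (cI d) (cI e) η.γ p))

variable (hι : ContMDiff (cI e) (cI d) ω ι)

/-- Applying Ad of the fibre coordinate moves a kernel vector to the unit of the group, where
transversality of η applies. -/
lemma lin_injective (hι : ContMDiff (cI e) (cI d) ω ι) (p : η.Total) : Function.Injective (η.lin p) :=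
  (injective_iff_map_eq_zero _).2 fun u hu => by
    set v := mder (cI d) (cI q) η.τ p u with hv
    set b := mcForm e (η.γ p) (mder (cI d) (cI e) η.γ p u) with hb
    have h1 : adm d (ι (η.γ p))⁻¹ (η.form (η.τ p) v) + lmap d e ι b = 0 := hu
    have h2 := congrArg (adm d (ι (η.γ p))) h1
    rw [map_add, map_zero, adm_apply_adm_inv, ← lmap_adm hι] at h2
    obtain ⟨h3, h4⟩ := η.inj _ (η.τ_mem p) _ _ h2
    have h5 : b = 0 := by rw [← adm_inv_apply_adm (η.γ p) b, h4, map_zero]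
    refine η.eq_zero_of_mder h3 ?_
    exact (mcForm e (η.γ p)).injective (h5.trans (map_zero _).symm)

/-- The Cartan connection on the product. -/
def frm (p : η.Total) : Cn d ≃L[ℂ] Cn d :=
  (LinearEquiv.ofInjectiveEndo (η.lin p).toLinearMap (η.lin_injective hι p)).toContinuousLinearEquiv

section Maps

variable {E₁ H₁ N : Type*} [NormedAddCommGroup E₁] [NormedSpace ℂ E₁] [TopologicalSpace H₁]
  {I₁ : ModelWithCorners ℂ E₁ H₁} [TopologicalSpace N] [ChartedSpace H₁ N]

lemma frm_mder {f : N → η.Total} {z : N} (hf : ContMDiffAt I₁ (cI d) ω f z) (v : E₁) :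
    η.frm hι (f z) (mder I₁ (cI d) f z v) =
      adm d (ι (η.γ (f z)))⁻¹ (η.form (η.τ (f z)) (mder I₁ (cI q) (fun y => η.τ (f y)) z v))
        + lmap d e ι (mcForm e (η.γ (f z)) (mder I₁ (cI e) (fun y => η.γ (f y)) z v)) := by
  rw [mder_comp_apply (g := η.τ) (η.contMDiff_τ _) hf, mder_comp_apply (g := η.γ) (η.contMDiff_γ _) hf]
  rfl

end Maps

/-- The coframe of the product. -/
def coframe : Coframe d η.Total where
  form := η.frm hι
  holo x₀ := by
    let c := chartAt (Cn d) x₀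
    have hx₀ : c x₀ ∈ c.target := mem_chart_target _ _
    have hc : ∀ {z}, z ∈ c.target → ContMDiffAt (cI d) (cI d) ω c.symm z := fun hz => contMDiffAt_chartAt_symm hz
    have hτ : ContMDiffAt (cI d) (cI q) ω (fun z => η.τ (c.symm z)) (c x₀) :=
      (η.contMDiff_τ _).comp _ (hc hx₀)
    have hτ' : ContDiffAt ℂ ω (fun z => η.τ (c.symm z)) (c x₀) := hτ.contDiffAt
    have hγ : ContMDiffAt (cI d) (cI e) ω (fun z => η.γ (c.symm z)) (c x₀) :=
      (η.contMDiff_γ _).comp _ (hc hx₀)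
    have hιγ : ContMDiffAt (cI d) (cI d) ω (fun z => ι (η.γ (c.symm z))) (c x₀) := (hι _).comp _ hγ
    have h1 : ContDiffAt ℂ ω (fun z => (adm d (ι (η.γ (c.symm z)))⁻¹).comp
        ((η.form (η.τ (c.symm z))).comp (fderiv ℂ (fun z => η.τ (c.symm z)) z))
        + (lmap d e ι).comp ((mc e H).pull (fun z => η.γ (c.symm z)) z)) (c x₀) := by
      refine ContDiffAt.add ((contDiffAt_adm_inv hιγ).clm_comp (ContDiffAt.clm_comp ?_ ?_))
        (contDiffAt_const.clm_comp ((mc e H).contDiffAt_pull hγ))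
      · exact ContDiffAt.comp (g := η.form) (c x₀) (η.holo _ (η.τ_mem _)) hτ'
      · exact hτ'.fderiv_right (m := ω) (by simp)
    refine h1.congr_of_eventuallyEq ?_
    filter_upwards [c.open_target.mem_nhds hx₀] with z hz
    refine ContinuousLinearMap.ext fun v => ?_
    refine (η.frm_mder hι (hc hz) v).trans ?_
    rw [mder_eq_fderiv]
    rfl

/-- The action on the product. -/
def act (p : η.Total) (g : H) : η.Total := .mk (p.out.1, p.out.2 * g)

lemma τ_act (p : η.Total) (g : H) : η.τ (η.act p g) = η.τ p := rfl

lemma γ_act (p : η.Total) (g : H) : η.γ (η.act p g) = η.γ p * g := rfl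

lemma contMDiff_act : ContMDiff ((cI d).prod (cI e)) (cI d) ω (fun p : η.Total × H => η.act p.1 p.2) :=
  Transported.contMDiff_mk.comp ((η.contMDiff_proj.comp contMDiff_fst).prodMk
    ((η.contMDiff_γ.comp contMDiff_fst).mul contMDiff_snd))

lemma frm_act (p : η.Total) (h : H) (v : Cn d) :
    η.frm hι (η.act p h) (mder (cI d) (cI d) (fun y => η.act y h) p v) = adm d (ι h)⁻¹ (η.frm hι p v) := by
  have h1 : ContMDiffAt (cI d) (cI d) ω (fun y => η.act y h) p :=
    η.contMDiff_act.comp (contMDiff_id.prodMk contMDiff_const) p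
  have h2 : mcForm e (η.γ p * h) (mder (cI d) (cI e) (fun y => η.γ y * h) p v)
      = adm e h⁻¹ (mcForm e (η.γ p) (mder (cI d) (cI e) η.γ p v)) := by
    rw [mc_mul (η.contMDiff_γ p) (k := fun _ => h) contMDiffAt_const, mder_const]
    simp
  rw [η.frm_mder hι h1 v]
  simp only [τ_act, γ_act]
  rw [h2, lmap_adm hι, map_mul, mul_inv_rev, adm_mul, map_inv]
  exact (map_add (adm d (ι h)⁻¹) _ _).symm

lemma frm_vertical (p : η.Total) (X : Cn e) :
    η.frm hι (η.act p 1) (mder (cI e) (cI d) (fun h => η.act p h) 1 X) = lmap d e ι X := by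
  have h1 : ContMDiffAt (cI e) (cI d) ω (fun h => η.act p h) 1 :=
    η.contMDiff_act.comp (contMDiff_const.prodMk contMDiff_id) 1
  have h2 : mcForm e (η.γ p * 1) (mder (cI e) (cI e) (fun h => η.γ p * h) 1 X) = X := by
    rw [mc_mul (f := fun _ => η.γ p) (k := fun h : H => h) contMDiffAt_const contMDiffAt_id, mder_const, mder_id]
    simp [mcForm_one]
  rw [η.frm_mder hι h1 X]
  simp only [τ_act, γ_act]
  rw [h2, mder_const]
  simp

/-- The product geometry. -/
def geometry : CartanGeometry d e ι q η.Base where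
  E := η.Total
  proj p := p.out.1
  act := η.act
  act_one p := η.ext rfl (mul_one _)
  act_mul p h k := η.ext rfl (mul_assoc _ _ _).symm
  act_holomorphic := η.contMDiff_act
  locally_trivial m := by
    refine ⟨univ, (Homeomorph.ulift : ULift.{u} (η.Base × H) ≃ₜ η.Base × H).symm.toOpenPartialHomeomorph,
      isOpen_univ, mem_univ _, univ_prod_univ.symm, rfl, Transported.contMDiff_mk.contMDiffOn,
      Transported.contMDiff_out.contMDiffOn, fun x _ h k => ⟨rfl, rfl⟩⟩
  form := η.frm hι
  form_holomorphic := (η.coframe hι).form_holomorphic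
  form_equivariant h p v := η.frm_act hι p h v
  form_vertical p X := η.frm_vertical hι p X

end TransversalForm

/-! ### Local isomorphism with the lift of a geometry with structure group H' -/

namespace CartanGeometry.FlatAlong

variable {d e : ℕ} {G H : Type u} [Group G] [TopologicalSpace G] [ChartedSpace (Cn d) G]
  [ComplexLieGroup d G]
  [Group H] [TopologicalSpace H] [ChartedSpace (Cn e) H] [ComplexLieGroup e H]
  {ι : H →* G} {n : ℕ} {M : Type u} [TopologicalSpace M] [ChartedSpace (Cn n) M] [ComplexManifold n M]
  {C : CartanGeometry d e ι n M}
  {e' : ℕ} {H' : Type u} [Group H'] [TopologicalSpace H'] [ChartedSpace (Cn e') H'] [ComplexLieGroup e' H']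
  {ι' : H' →* G} {j : H →* H'}
  {n' : ℕ} {M' : Type u} [TopologicalSpace M'] [ChartedSpace (Cn n') M'] [ComplexManifold n' M']
  {C' : CartanGeometry d e' ι' n' M'}

/-- A local equivalence of Cartan geometries extends equivariantly. -/
theorem exists_restrictionIsoToLift_of_germ (hC : C.FlatAlong e' ι' j) (hind : Topology.IsInducing ι)
    {x₀ : C.E} {F₀ : C.E → C'.E} (hF₀ : ContMDiffAt (cI d) (cI d) ω F₀ x₀)
    (hrel : ∀ᶠ x in 𝓝 x₀, ∀ v, C'.frm (F₀ x) (mder (cI d) (cI d) F₀ x v) = C.frm x v) :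
    ∃ U : Set M, IsOpen U ∧ C.proj x₀ ∈ U ∧ C.RestrictionIsoToLift U C' j := by
  let σ := C.localSection x₀
  let σ' := C'.localSection (F₀ x₀)
  let m := C.proj x₀
  obtain ⟨W, hW, hWo, hxW⟩ := eventually_nhds_iff.1 ((hF₀.eventually_nhds.and hrel).and
    ((C'.proj_holomorphic.continuous.continuousAt.comp hF₀.continuousAt).eventually_mem
      (σ'.isOpen.mem_nhds σ'.mem)))
  let f : M → C'.E := fun u => F₀ (σ.s u)
  -- The germ is kept along the local section only, and extended along whole fibres by equivariance:
  -- s(u)·k ↦ F₀(s(u))·j(k).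
  let F : C.E → C'.E := fun x => C'.act (f (C.proj x)) (j (σ.k x))
  have hs : ∀ u ∈ σ.U, ContMDiffAt (cI n) (cI d) ω σ.s u := fun u hu =>
    σ.s_holomorphic.contMDiffAt (σ.isOpen.mem_nhds hu)
  have hk : ∀ x, C.proj x ∈ σ.U → ContMDiffAt (cI d) (cI e) ω σ.k x := fun x hx =>
    σ.k_holomorphic.contMDiffAt (σ.isOpen_preimage.mem_nhds hx)
  have hsp : ∀ x, C.proj x ∈ σ.U → ContMDiffAt (cI d) (cI d) ω (fun x => σ.s (C.proj x)) x := fun x hx =>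
    (hs _ hx).comp x (C.proj_holomorphic x)
  have hf : ∀ x, C.proj x ∈ σ.U → σ.s (C.proj x) ∈ W →
      ContMDiffAt (cI d) (cI d) ω (fun x => f (C.proj x)) x := fun x hx hx' =>
    (hW _ hx').1.1.comp x (hsp x hx)
  have hjk : ∀ x, C.proj x ∈ σ.U → ContMDiffAt (cI d) (cI e') ω (fun x => j (σ.k x)) x := fun x hx =>
    (hC.hol_sub _).comp x (hk x hx)
  have hF : ∀ x, C.proj x ∈ σ.U → σ.s (C.proj x) ∈ W → ContMDiffAt (cI d) (cI d) ω F x := fun x hx hx' =>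
    C'.act_holomorphic.contMDiffAt.comp x ((hf x hx hx').prodMk (hjk x hx))
  -- On both sides the product rule splits the connection into Ad(k)⁻¹ of its value along the
  -- section and a term from k. The germ matches the first, the factorization of ι through j the
  -- second.
  have hFrel : ∀ x, C.proj x ∈ σ.U → σ.s (C.proj x) ∈ W →
      ∀ v, C'.frm (F x) (mder (cI d) (cI d) F x v) = C.frm x v := by
    intro x hx hx' v
    have h1 := C'.frm_act_mul (hf x hx hx') (hjk x hx) v
    have h2 := C.frm_act_mul (hsp x hx) (hk x hx) v
    have h3 : (fun y => C.act (σ.s (C.proj y)) (σ.k y)) =ᶠ[𝓝 x] fun y => y := by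
      filter_upwards [σ.isOpen_preimage.mem_nhds hx] with y hy using σ.act_s_k y hy
    rw [mder_congr h3, mder_id, σ.act_s_k x hx] at h2
    refine h1.trans (Eq.trans ?_ h2.symm)
    have h4 : mder (cI d) (cI d) (fun x => f (C.proj x)) x v = mder (cI d) (cI d) F₀ (σ.s (C.proj x))
        (mder (cI d) (cI d) (fun x => σ.s (C.proj x)) x v) :=
      mder_comp_apply (g := F₀) (f := fun x => σ.s (C.proj x)) (hW _ hx').1.1 (hsp x hx) v
    have h5 : ∀ w, C'.frm (f (C.proj x)) (mder (cI d) (cI d) F₀ (σ.s (C.proj x)) w) =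
        C.frm (σ.s (C.proj x)) w := (hW _ hx').1.2
    rw [hC.comp, h4, h5, mder_comp_apply (g := j) (hC.hol_sub _) (hk x hx), mc_hom hC.hol_sub, hC.lmap_sub]
  have hx₀ : C.proj x₀ ∈ σ.U := σ.mem
  have hsx₀ : σ.s (C.proj x₀) ∈ W := by rw [σ.s_proj]; exact hxW
  have hder : ∀ x, C.proj x ∈ σ.U → σ.s (C.proj x) ∈ W → ∃ f' : Cn d ≃L[ℂ] Cn d,
      mder (cI d) (cI d) F x = f' := fun x hx hx' => by
    refine ⟨(C.frm x).trans (C'.frm (F x)).symm, ContinuousLinearMap.ext fun v => ?_⟩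
    exact ((C'.frm (F x)).eq_symm_apply).2 (hFrel x hx hx' v)
  obtain ⟨f', hf'⟩ := hder x₀ hx₀ hsx₀
  obtain ⟨E₀, hE₀, hE₀F, -, -, -⟩ := exists_openPartialHomeomorph_of_mder (hF x₀ hx₀ hsx₀) f' hf'
  have hinjF : InjOn F E₀.source := E₀.injOn.congr hE₀F
  have hcont : ContinuousAt (fun p : M × H => C.act (σ.s p.1) p.2) (m, 1) := by
    have h1 : ContinuousAt (fun p : M × H => (σ.s p.1, p.2)) (m, 1) :=
      (ContinuousAt.comp (g := σ.s) (f := Prod.fst) (x := ((m, 1) : M × H)) (hs m hx₀).continuousAt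
        continuousAt_fst).prodMk continuousAt_snd
    exact ContinuousAt.comp (g := fun p : C.E × H => C.act p.1 p.2)
      C.act_holomorphic.continuous.continuousAt h1
  have hval : C.act (σ.s m) 1 = x₀ := by rw [C.act_one]; exact σ.s_proj
  have hmemV : ∀ᶠ p in 𝓝 ((m, 1) : M × H), C.act (σ.s p.1) p.2 ∈ E₀.source :=
    hcont.eventually_mem (E₀.open_source.mem_nhds (by change C.act (σ.s m) 1 ∈ _; rwa [hval]))
  rw [nhds_prod_eq] at hmemV
  obtain ⟨pa, hpa, pb, hpb, hV⟩ := eventually_prod_iff.1 hmemV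
  -- Here the topology induced from G is essential: an element of H close to 1 in G is close to 1 in
  -- H. Otherwise H could return near 1 in H', and F would not be injective on whole fibres.
  rw [hind.nhds_eq_comap, map_one, eventually_comap] at hpb
  have hκ : ContinuousAt (fun u => σ'.k (f u)) m := by
    have h1 : ContinuousAt f m := by
      refine ContinuousAt.comp (g := F₀) ?_ (hs m hx₀).continuousAt
      exact (hW _ hsx₀).1.1.continuousAt
    refine ContinuousAt.comp (g := σ'.k) ?_ h1
    refine (σ'.k_holomorphic.contMDiffAt (σ'.isOpen_preimage.mem_nhds ?_)).continuousAt
    exact (hW _ hsx₀).2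
  -- If F identifies points above u and u', this is the image in G of the element of H by which
  -- their fibre coordinates differ. It is close to 1 for u and u' close to m.
  have hδ : ContinuousAt (fun p : M × M => ι' ((σ'.k (f p.1))⁻¹ * σ'.k (f p.2))) (m, m) := by
    have htg : IsTopologicalGroup H' := topologicalGroup_of_lieGroup (cI e') ω
    refine ContinuousAt.comp (g := ι') hC.hol.continuous.continuousAt ?_
    exact (ContinuousAt.comp (g := fun u => σ'.k (f u)) (x := ((m, m) : M × M)) hκ continuousAt_fst).inv.mul
      (ContinuousAt.comp (g := fun u => σ'.k (f u)) (x := ((m, m) : M × M)) hκ continuousAt_snd)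
  have hδ1 : ι' ((σ'.k (f m))⁻¹ * σ'.k (f m)) = 1 := by rw [inv_mul_cancel, map_one]
  have hpb' : ∀ᶠ p in 𝓝 ((m, m) : M × M), ∀ h, ι h = ι' ((σ'.k (f p.1))⁻¹ * σ'.k (f p.2)) → pb h := by
    refine hδ.eventually (p := fun b => ∀ h, ι h = b → pb h) ?_
    change ∀ᶠ b in 𝓝 (ι' ((σ'.k (f m))⁻¹ * σ'.k (f m))), _
    rw [hδ1]
    exact hpb
  rw [nhds_prod_eq] at hpb'
  obtain ⟨pc, hpc, pd, hpd, hδ'⟩ := eventually_prod_iff.1 hpb'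
  obtain ⟨U, hU, hUo, hmU⟩ := eventually_nhds_iff.1 ((hpa.and (hpc.and hpd)).and
    ((σ.isOpen.eventually_mem hx₀).and ((hs m hx₀).continuousAt.eventually_mem (hWo.mem_nhds hsx₀))))
  have hpb1 : pb 1 := hδ' hpc.self_of_nhds hpd.self_of_nhds 1 (by rw [map_one]; exact hδ1.symm)
  have hks : ∀ u ∈ U, F (σ.s u) = f u := fun u hu => by
    change C'.act (f (C.proj (σ.s u))) (j (σ.k (σ.s u))) = f u
    rw [σ.proj_s u (hU u hu).2.1, σ.k_s u (hU u hu).2.1, map_one, C'.act_one]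
  -- Two points with the same image are translated along the fibres by the inverse of the fibre
  -- coordinate of the second. They then lie in the domain where the inverse function theorem makes
  -- F injective, hence coincide.
  have hinj : InjOn F (C.proj ⁻¹' U) := by
    intro x hx y hy hxy
    have hu := hU _ hx
    have hu' := hU _ hy
    set u := C.proj x with hudef
    set u' := C.proj y with hudef'
    have h1 : C'.act (f u) (j (σ.k x * (σ.k y)⁻¹)) = f u' := by
      have h2 : C'.act (f u) (j (σ.k x)) = C'.act (f u') (j (σ.k y)) := hxy
      rw [map_mul, C'.act_mul, h2, ← C'.act_mul, ← map_mul, mul_inv_cancel, map_one, C'.act_one]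
    have h3 : σ'.k (f u') = σ'.k (f u) * j (σ.k x * (σ.k y)⁻¹) := by
      rw [← h1]
      exact σ'.k_act _ (hW _ hu.2.2).2 _
    have h4 : pb (σ.k x * (σ.k y)⁻¹) := hδ' hu.1.2.1 hu'.1.2.2 _ (by
      rw [h3, inv_mul_cancel_left, hC.comp])
    have h5 : C.act (σ.s u) (σ.k x * (σ.k y)⁻¹) = C.act (σ.s u') 1 := by
      refine hinjF (hV hu.1.1 h4) (hV hu'.1.1 hpb1) ?_
      rw [C.act_one, hks u' hy, ← h1]
      change C'.act (f (C.proj _)) (j (σ.k _)) = _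
      rw [C.proj_act, σ.proj_s u hu.2.1, σ.k_act _ (by rw [σ.proj_s u hu.2.1]; exact hu.2.1),
        σ.k_s u hu.2.1, one_mul]
    rw [C.act_one] at h5
    have h6 : u = u' := by
      have := congrArg C.proj h5
      rwa [C.proj_act, σ.proj_s u hu.2.1, σ.proj_s u' hu'.2.1] at this
    have h7 : σ.k x = σ.k y := by
      have := congrArg σ.k h5
      rw [σ.k_act _ (by rw [σ.proj_s u hu.2.1]; exact hu.2.1), σ.k_s u hu.2.1, σ.k_s u' hu'.2.1, one_mul] at this
      exact mul_inv_eq_one.1 this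
    rw [← σ.act_s_k x hu.2.1, ← σ.act_s_k y hu'.2.1, h7, ← hudef, ← hudef', h6]
  have : Nonempty C.E := ⟨x₀⟩
  obtain ⟨Q, hQ1, hQ2, hQ3, hQ4⟩ := exists_openPartialHomeomorph_of_injOn
    (hUo.preimage C.proj_holomorphic.continuous) hinj
    (fun x hx => hF x (hU _ hx).2.1 (hU _ hx).2.2) (fun x hx => hder x (hU _ hx).2.1 (hU _ hx).2.2)
  refine ⟨U, hUo, hmU, Q, hQ1, hQ3, hQ4, fun x hx h => ?_, fun x hx v => ?_⟩
  · rw [hQ1] at hx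
    rw [hQ2]
    change C'.act (f (C.proj (C.act x h))) (j (σ.k (C.act x h))) = C'.act (C'.act (f (C.proj x)) (j (σ.k x))) (j h)
    rw [C.proj_act, σ.k_act x (hU _ hx).2.1, map_mul, C'.act_mul]
  · rw [hQ1] at hx
    rw [hQ2]
    exact hFrel x (hU _ hx).2.1 (hU _ hx).2.2 v

/-- The restriction of ω to the slice. It is transversal to 𝔥' at 0, where the derivative of Θ
corresponds to L, and transversality is an open condition. -/
lemma exists_transversalForm {q : ℕ} {L : (Cn e' × Cn q) ≃L[ℂ] Cn d} (hL : ∀ a, L (a, 0) = lmap d e' ι' a)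
    {Θ : Cn e' × Cn q → C.E} (hΘ : ContMDiffAt 𝓘(ℂ, Cn e' × Cn q) (cI d) ω Θ 0) (hΘ' : C.coframe.pull Θ 0 = L) :
    ∃ η : TransversalForm d e' q ι', ∀ t v, η.form t v = C.coframe.pull Θ (0, t) (0, v) := by
  let η : Cn q → Cn q →L[ℂ] Cn d := fun t =>
    (C.coframe.pull Θ (0, t)).comp (ContinuousLinearMap.inr ℂ (Cn e') (Cn q))
  let g : Cn q → Cn e' × Cn q := fun t => (0, t)
  have hg : ∀ t, ContDiffAt ℂ ω g t := fun t => contDiffAt_const.prodMk contDiffAt_id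
  have hη : ContDiffAt ℂ ω η 0 :=
    (ContDiffAt.comp (g := C.coframe.pull Θ) (f := g) 0 (C.coframe.contDiffAt_pull hΘ) (hg 0)).clm_comp
      contDiffAt_const
  let T : Cn q → (Cn e' × Cn q) →L[ℂ] Cn d := fun t =>
    (lmap d e' ι').comp (ContinuousLinearMap.fst ℂ _ _) + (η t).comp (ContinuousLinearMap.snd ℂ _ _)
  have hT : ContinuousAt T 0 :=
    (contDiffAt_const.add (hη.clm_comp contDiffAt_const)).continuousAt
  have hT0 : T 0 = L := by
    refine ContinuousLinearMap.ext fun p => ?_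
    change lmap d e' ι' p.1 + C.coframe.pull Θ 0 (0, p.2) = L p
    rw [hΘ', ← hL]
    change L (p.1, 0) + L (0, p.2) = L p
    rw [← map_add]
    simp
  have hinj : ∀ᶠ t in 𝓝 0, ∃ e : (Cn e' × Cn q) ≃L[ℂ] Cn d, (e : (Cn e' × Cn q) →L[ℂ] Cn d) = T t :=
    hT.eventually_mem (by rw [hT0]; exact L.nhds)
  obtain ⟨r, hr, hball⟩ := Metric.eventually_nhds_iff_ball.1 ((hη.eventually (by simp)).and hinj)
  refine ⟨⟨r, hr, η, fun t ht => (hball t ht).1, fun t ht b v h => ?_,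
    (ContinuousLinearEquiv.prodComm ℂ (Cn q) (Cn e')).trans L⟩, fun t v => rfl⟩
  obtain ⟨e, he⟩ := (hball t ht).2
  have h1 : e (b, v) = 0 := by
    refine (DFunLike.congr_fun he (b, v)).trans ?_
    rw [← h, add_comm]
    rfl
  have h2 : (b, v) = 0 := e.injective (h1.trans (map_zero e).symm)
  exact ⟨(Prod.ext_iff.1 h2).2, (Prod.ext_iff.1 h2).1⟩

/-- A geometry which is flat along an immersed subgroup is locally isomorphic to the lift of a geometry
with that structure group. -/
theorem exists_restrictionIsoToLift (hC : C.FlatAlong e' ι' j) (hind : Topology.IsInducing ι) (m : M) :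
    ∃ U : Set M, IsOpen U ∧ m ∈ U ∧ ∃ (n' : ℕ) (M' : Type u) (_ : TopologicalSpace M')
      (_ : ChartedSpace (Cn n') M') (_ : ComplexManifold n' M') (_ : ConnectedSpace M')
      (C' : CartanGeometry d e' ι' n' M'), C.RestrictionIsoToLift U C' j := by
  obtain ⟨x₀, rfl⟩ := C.proj_surjective m
  obtain ⟨q, L, hL, hq⟩ := exists_equiv_extending (lmap d e' ι') hC.inj
  obtain ⟨Θ, hΘ, hΘ0, hΘL, hΘe⟩ := C.coframe.exists_exp_param L (lieBr d G)
    (fun y a B => by rw [hL]; exact hC.tors_eq a y B) x₀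
  obtain ⟨η, hη⟩ := exists_transversalForm hL hΘ hΘL
  let C' := η.geometry hC.hol
  obtain ⟨ε, hε, hε0, hε1, -⟩ := (mc e' H').exists_exp_at 1
  -- The counterpart of Θ in the product: exponential along H', starting from the slice at the unit.
  let Θ' : Cn e' × Cn q → C'.E := fun p => η.pt p.2 (ε p.1)
  have hfst : ∀ p : Cn e' × Cn q, ContMDiffAt 𝓘(ℂ, Cn e' × Cn q) (cI e') ω Prod.fst p := fun p =>
    contDiffAt_fst.contMDiffAt
  have hsnd : ∀ p : Cn e' × Cn q, ContMDiffAt 𝓘(ℂ, Cn e' × Cn q) (cI q) ω Prod.snd p := fun p =>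
    contDiffAt_snd.contMDiffAt
  have h0ball : (0 : Cn q) ∈ Metric.ball (0 : Cn q) η.r := Metric.mem_ball_self η.pos
  have hΘ' : ∀ p, p.2 ∈ Metric.ball (0 : Cn q) η.r → ContMDiffAt 𝓘(ℂ, Cn e') (cI e') ω ε p.1 →
      ContMDiffAt 𝓘(ℂ, Cn e' × Cn q) (cI d) ω Θ' p := fun p hp hp' =>
    η.contMDiffAt_pt (hsnd p) (hp'.comp p (hfst p)) hp
  have hpull : ∀ p, p.2 ∈ Metric.ball (0 : Cn q) η.r → ContMDiffAt 𝓘(ℂ, Cn e') (cI e') ω ε p.1 → ∀ b v,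
      C'.coframe.pull Θ' p (b, v) = adm d (ι' (ε p.1))⁻¹ (η.form p.2 v)
        + lmap d e' ι' ((mc e' H').pull ε p.1 b) := by
    intro p hp hp' b v
    refine (η.frm_mder hC.hol (hΘ' p hp hp') (b, v)).trans ?_
    have h1 : (fun y => η.τ (Θ' y)) =ᶠ[𝓝 p] Prod.snd := by
      filter_upwards [continuousAt_snd.eventually_mem (Metric.isOpen_ball.mem_nhds hp)] with y hy
      exact η.τ_pt hy _
    have h2 : η.τ (Θ' p) = p.2 := η.τ_pt hp _
    have h3 : mder 𝓘(ℂ, Cn e' × Cn q) (cI e') (fun y : Cn e' × Cn q => ε y.1) p (b, v)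
        = mder (cI e') (cI e') ε p.1 b := by
      rw [mder_comp_apply (g := ε) hp' (hfst p), mder_eq_fderiv, fderiv_fst]
      rfl
    rw [h2, mder_congr h1, mder_eq_fderiv, fderiv_snd]
    exact congrArg (fun w => adm d (ι' (ε p.1))⁻¹ (η.form p.2 v) + lmap d e' ι' (mcForm e' (ε p.1) w)) h3
  have hev : ∀ᶠ p in 𝓝 (0 : Cn e' × Cn q), p.2 ∈ Metric.ball (0 : Cn q) η.r ∧
      ContMDiffAt 𝓘(ℂ, Cn e') (cI e') ω ε p.1 ∧ (mc e' H').pull ε p.1 p.1 = p.1 := by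
    have h1 : Tendsto (Prod.fst : Cn e' × Cn q → Cn e') (𝓝 0) (𝓝 0) := continuous_fst.tendsto 0
    have h2 : Tendsto (Prod.snd : Cn e' × Cn q → Cn q) (𝓝 0) (𝓝 0) := continuous_snd.tendsto 0
    filter_upwards [h2.eventually (Metric.isOpen_ball.eventually_mem h0ball), h1.eventually hε.eventually_nhds,
      h1.eventually hε1] with p a b c using ⟨a, b, c⟩
  -- In the product the directions of 𝔥' are vertical, so the condition on brackets is that its
  -- curvature is semibasic.
  have hexp := C'.coframe.pull_eq_exp (Θ := Θ') (z₀ := 0) (hΘ' 0 h0ball hε) (lmap d e' ι')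
    (by
      filter_upwards [hev] with p hp
      rw [hpull p hp.1 hp.2.1, hp.2.2]
      simp) (lieBr d G) (fun y a B => C'.tors_vertical hC.hol y a B)
  -- Both pullbacks solve the same linear equation along rays, with the same initial value η on the
  -- slice. So Θ' ∘ Θ⁻¹ matches the connections.
  have heq : ∀ᶠ p in 𝓝 (0 : Cn e' × Cn q), C'.coframe.pull Θ' p = C.coframe.pull Θ p := by
    filter_upwards [hexp, hΘe, hev] with p h1 h2 h3
    refine ContinuousLinearMap.ext fun ⟨b, v⟩ => ?_
    rw [h1, h2, hpull (0, p.2) h3.1 hε, hL, hL, hη]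
    simp [hε0, adm_one]
  let f' : (Cn e' × Cn q) ≃L[ℂ] Cn d := L.trans (C.frm (Θ 0)).symm
  obtain ⟨Q, hQ0, hQΘ, hQh, -, hQs⟩ := exists_openPartialHomeomorph_of_mder hΘ f' (by
    refine ContinuousLinearMap.ext fun v => ?_
    exact ((C.frm (Θ 0)).eq_symm_apply).2 (DFunLike.congr_fun hΘL v))
  have hx₀ : Q 0 = x₀ := (hQΘ hQ0).trans hΘ0
  have hx₀t : x₀ ∈ Q.target := hx₀ ▸ Q.map_source hQ0
  have hQx₀ : Q.symm x₀ = 0 := by rw [← hx₀]; exact Q.left_inv hQ0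
  have hQa : ∀ x ∈ Q.target, ContMDiffAt (cI d) 𝓘(ℂ, Cn e' × Cn q) ω Q.symm x := fun x hx =>
    hQs.contMDiffAt (Q.open_target.mem_nhds hx)
  let F₀ : C.E → C'.E := fun x => Θ' (Q.symm x)
  have ht : Tendsto Q.symm (𝓝 x₀) (𝓝 0) := hQx₀ ▸ (hQa x₀ hx₀t).continuousAt.tendsto
  have hF₀ : ContMDiffAt (cI d) (cI d) ω F₀ x₀ :=
    ContMDiffAt.comp (g := Θ') x₀ (by rw [hQx₀]; exact hΘ' 0 h0ball hε) (hQa x₀ hx₀t)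
  obtain ⟨U, hU, hmU, hiso⟩ := hC.exists_restrictionIsoToLift_of_germ (C' := C') hind hF₀ (by
    filter_upwards [ht.eventually heq, ht.eventually hev, Q.open_target.mem_nhds hx₀t] with x h1 h2 h3 v
    have h4 : mder (cI d) (cI d) F₀ x v = mder 𝓘(ℂ, Cn e' × Cn q) (cI d) Θ' (Q.symm x)
        (mder (cI d) 𝓘(ℂ, Cn e' × Cn q) Q.symm x v) :=
      mder_comp_apply (g := Θ') (hΘ' _ h2.1 h2.2.1) (hQa x h3) v
    have h5 := mder_comp_apply (g := Θ) (hQh _ (Q.map_target h3)) (hQa x h3) v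
    have h6 : (fun y => Θ (Q.symm y)) =ᶠ[𝓝 x] fun y => y := by
      filter_upwards [Q.open_target.mem_nhds h3] with y hy
      exact (hQΘ (Q.map_target hy)).symm.trans (Q.right_inv hy)
    rw [mder_congr h6, mder_id] at h5
    rw [h4]
    refine (DFunLike.congr_fun h1 (mder (cI d) 𝓘(ℂ, Cn e' × Cn q) Q.symm x v)).trans ?_
    change C.frm (Θ (Q.symm x)) _ = _
    refine (congrArg (C.frm (Θ (Q.symm x))) h5.symm).trans ?_
    have h7 : Θ (Q.symm x) = x := h6.self_of_nhds
    rw [h7]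
    rfl)
  exact ⟨U, hU, hmU, q, η.Base, inferInstance, inferInstance, inferInstance, inferInstance, C', hiso⟩

end CartanGeometry.FlatAlong

/-! ### Conclusion -/

lemma ComplexLieSubgroup.finrank_lieAlgebra {d : ℕ} {G : Type u} [Group G] [TopologicalSpace G]
    [ChartedSpace (Cn d) G] (H : ComplexLieSubgroup d G) :
    Module.finrank ℂ H.lieAlgebra = H.dim :=
  (LinearMap.finrank_range_of_inj H.immersion).trans (by
    change Module.finrank ℂ (Cn H.dim) = _
    simp)

end

theorem mainTheorem7 {d n : ℕ} {G : Type u} [Group G] [TopologicalSpace G] [ChartedSpace (Cn d) G]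
    [ComplexLieGroup d G] (H : ComplexLieSubgroup d G)
    (hH : Topology.IsClosedEmbedding H.incl)
    {M : Type u} [TopologicalSpace M] [ChartedSpace (Cn n) M] [ComplexManifold n M]
    [ConnectedSpace M]
    (C : CartanGeometry d H.dim H.incl n M) [ConnectedSpace C.E]
    (hM : ∃ f : Projectivization ℂ (Fin 2 → ℂ) → M, IsRationalCurve (n := n) f) :
    ∃ 𝔥' : LieSubalgebra ℂ (LieAlg d G),
      H.lieAlgebra < 𝔥'.toSubmodule ∧
      Nonempty (LieOvergroup H 𝔥') ∧
      ∀ H' : LieOvergroup H 𝔥',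
        (∀ m : M, ∃ U : Set M, IsOpen U ∧ m ∈ U ∧
          ∃ (n' : ℕ) (M' : Type u) (_ : TopologicalSpace M') (_ : ChartedSpace (Cn n') M')
            (_ : ComplexManifold n' M') (_ : ConnectedSpace M')
            (C' : CartanGeometry d H'.dim H'.incl n' M'), C.RestrictionIsoToLift U C' H'.sub) ∧
        (∃ k : ℕ, 0 < k ∧ ∃ ℱ : HolomorphicFoliation n M k, ∀ a : ℱ.Index,
          ∃ D : CartanGeometry H'.dim H.dim H'.sub k (ℱ.Leaf a),
            D.Flat ∧ C.RestrictsAlong (ℱ.incl a) D H'.incl) := by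
  obtain ⟨f, hf⟩ := hM
  have hι : ContMDiff (cI H.dim) (cI d) ω H.incl := H.holomorphic
  have hle : H.lieAlgebra ≤ C.flatSubalgebra.toSubmodule := by
    rintro _ ⟨X, rfl⟩
    exact C.lmap_mem_flatSubalgebra hι X
  have hlt : H.lieAlgebra < C.flatSubalgebra.toSubmodule := by
    obtain ⟨A, hA, hA'⟩ := C.exists_tors_eq hι hf
    refine lt_of_le_of_ne hle fun h => ?_
    have h1 : A ∈ H.lieAlgebra := h ▸ (C.mem_flatSubalgebra).2 hA'
    obtain ⟨X, hX⟩ := h1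
    exact hA ⟨X, hX.symm⟩
  refine ⟨C.flatSubalgebra, hlt, exists_lieOvergroup H _ (fun X => C.lmap_mem_flatSubalgebra hι X)
    (fun h A hA => C.adm_mem_flatSubalgebra h hA), fun H' => ?_⟩
  -- Flatness along H' depends only on its Lie algebra, which consists of flat directions; hence
  -- both conclusions hold for every overgroup with this Lie algebra.
  have hC : C.FlatAlong H'.dim H'.incl H'.sub :=
    { hol := H'.holomorphic
      inj := H'.immersion
      hol_sub := H'.sub_holomorphic
      comp := fun h => DFunLike.congr_fun H'.incl_comp_sub h
      inj_sub := H.immersion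
      tors_eq := fun a y B => by
        have h1 : lmap d H'.dim H'.incl a ∈ C.flatSubalgebra.toSubmodule := H'.lieAlgebra_eq ▸ ⟨a, rfl⟩
        exact (C.mem_flatSubalgebra).1 h1 y B }
  have hdim : H.dim < H'.dim := by
    have h1 : H.lieAlgebra < H'.lieAlgebra := H'.lieAlgebra_eq.symm ▸ hlt
    have : FiniteDimensional ℂ (LieAlg d G) := inferInstanceAs (FiniteDimensional ℂ (Cn d))
    have h2 := Submodule.finrank_lt_finrank_of_lt h1
    rwa [H.finrank_lieAlgebra, H'.finrank_lieAlgebra] at h2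
  exact ⟨hC.exists_restrictionIsoToLift hH.toIsEmbedding.toIsInducing, hC.exists_foliation hdim⟩
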